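/- Let $G$ be a connected real semisimple Lie group with finite center and Lie algebra $\mathfrak g$, let $T\subset G$ be a compact Cartan subgroup with Lie algebra $\mathfrak t$, and identify $\mathfrak t^*$ with the linear forms on $\mathfrak g$ vanishing on the Killing-orthogonal of $\mathfrak t$. Let $\Lambda\subset\mathfrak t^*$ be the weight lattice, i.e. the set of $\mu$ such that $e^X\mapsto e^{i\langle\mu,X\rangle}$ ($X\in\mathfrak t$) is a character of $T$; let $\mathfrak R\subset\Lambda$ be the set of real roots of $T$ in $\mathfrak g\otimes\mathbb C$, let $(\cdot,\cdot)$ be the scalar product on $\mathfrak t^*$ induced by minus the Killing form, and put $\rho(\lambda)=\frac12\sum_{\alpha\in\mathfrak R,\,(\alpha,\lambda)>0}\alpha$ for $\lambda\in\mathfrak t^*$. A Hamiltonian $G$-manifold $(M,\Omega,\Phi)$, with $\Phi:M\to\mathfrak g^*$ and $\iota(X_M)\Omega=-d\langle\Phi,X\rangle$, where $X_M(m)=\frac{d}{dt}|_{t=0}e^{-tX}m$, is called $\mathrm{spin}^c$-prequantized if for some $G$-invariant Riemannian metric on $M$ there is a $G$-equivariant $\mathrm{spin}^c$-bundle $\mathcal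 S\to M$ (a complex $\mathrm{Cl}(M)$-module bundle with $\mathrm{Cl}(M)\otimes_{\mathbb R}\mathbb C\cong\mathrm{End}(\mathcal S)$) whose determinant line bundle $\det(\mathcal S)=\mathrm{Hom}_{\mathrm{Cl}(M)}(\overline{\mathcal S},\mathcal S)$ is a prequantum line bundle over $(M,2\Omega,2\Phi)$, that is, carries an invariant Hermitian metric and an invariant Hermitian connection $\nabla$ with $\mathcal L(X)-\nabla_{X_M}=i\langle 2\Phi,X\rangle$ for all $X\in\mathfrak g$ and $\nabla^2=-2i\,\Omega$. Let $\lambda\in\mathfrak t^*$ be regular, i.e. $(\lambda,\alpha)\neq0$ for all $\alpha\in\mathfrak R$, and let $\mathcal O=G\lambda\subset\mathfrak g^*$ be its coadjoint orbit, with its Kirillov–Kostant–Souriau symplectic form and the inclusion $\mathcal O\hookrightarrow\mathfrak g^*$ as moment map. Then $\mathcal O$ is $\mathrm{spin}^c$-prequantized if and only if $\lambda-\rho(\lambda)\in\Lambda$. Moreover, $\mathcal O$ is admissible, i.e. $\mu-\rho(\mu)\in\Lambda$ for every $\mu\in\mathcal O\cap\mathfrak t^*$, if and only if $\mathcal O$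 is $\mathrm{spin}^c$-prequantized. -/

import Mathlib

open scoped Manifold ContDiff Topology
open Bundle Set

set_option linter.unusedSectionVars false

/-- A constant rank map has, near a point, a smooth local section over the projection of its values
to the range of its derivative. -/
theorem exists_slice_aux {E W : Type*} [NormedAddCommGroup E] [NormedSpace ℝ E]
    [FiniteDimensional ℝ E] [NormedAddCommGroup W] [NormedSpace ℝ W] [FiniteDimensional ℝ W]
    (f : E → W) (x₀ : E) (T : Submodule ℝ W) (p : W →L[ℝ] T)
    (hp : ∀ v : T, p v = v) (hT : T = LinearMap.range (fderiv ℝ f x₀ : E →ₗ[ℝ] W))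
    (hf : ∀ᶠ x in 𝓝 x₀, ContDiffAt ℝ ∞ f x)
    (hrk : ∀ᶠ x in 𝓝 x₀, Module.finrank ℝ (LinearMap.range (fderiv ℝ f x : E →ₗ[ℝ] W)) ≤
      Module.finrank ℝ T) (N : Set E) (hN : N ∈ 𝓝 x₀) :
    ∃ (B : Set T) (s : T → E) (U : Set E), IsOpen B ∧ IsOpen U ∧ x₀ ∈ U ∧ U ⊆ N ∧
      ContDiffOn ℝ ∞ s B ∧ (∀ v ∈ B, s v ∈ U) ∧ (∀ x ∈ U, p (f x) ∈ B) ∧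
      (∀ v ∈ B, p (f (s v)) = v) ∧ (∀ x ∈ U, f (s (p (f x))) = f x) := by
  classical
  set D := fderiv ℝ f x₀ with hD
  set A : E →L[ℝ] T := p.comp D with hA
  have hDT : ∀ x, D x ∈ T := fun x => by rw [hT]; exact ⟨x, rfl⟩
  have hAD : ∀ x, (A x : W) = D x := fun x => by
    have := hp ⟨D x, hDT x⟩
    simpa [hA] using congrArg Subtype.val this
  have hAsurj : Function.Surjective A := by
    rintro ⟨y, hy⟩
    rw [hT] at hy
    obtain ⟨x, rfl⟩ := hy
    exact ⟨x, Subtype.ext (hAD x)⟩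
  set K := LinearMap.ker (A : E →ₗ[ℝ] T) with hK
  -- projection onto the kernel
  obtain ⟨κ, hκ⟩ := (Submodule.ClosedComplemented.of_finiteDimensional K)
  let Θ : E → T × K := fun x => (p (f x), κ x)
  let Θ' : E → (E →L[ℝ] T × K) := fun x => (p.comp (fderiv ℝ f x)).prod κ
  have hΘd : ∀ x, ContDiffAt ℝ ∞ f x → HasFDerivAt Θ (Θ' x) x := fun x hx =>
    (p.hasFDerivAt.comp x (hx.differentiableAt (by simp)).hasFDerivAt).prodMk κ.hasFDerivAt
  have hΘs : ∀ x, ContDiffAt ℝ ∞ f x → ContDiffAt ℝ ∞ Θ x := fun x hx =>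
    (p.contDiff.contDiffAt.comp x hx).prodMk κ.contDiff.contDiffAt
  -- invertibility at `x₀`
  have hinj : Function.Injective (Θ' x₀) := by
    rw [injective_iff_map_eq_zero]
    intro x hx
    have h1 : A x = 0 := congrArg Prod.fst hx
    have h2 : κ x = 0 := congrArg Prod.snd hx
    have h3 := hκ ⟨x, h1⟩
    rw [show κ ((⟨x, h1⟩ : K) : E) = κ x from rfl, h2] at h3
    exact (congrArg Subtype.val h3).symm
  have hsurj : Function.Surjective (Θ' x₀) := by
    rintro ⟨a, b⟩
    obtain ⟨x, rfl⟩ := hAsurj a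
    refine ⟨x - κ x + b, ?_⟩
    have hb : A (b : E) = 0 := b.2
    have hkx : A (κ x : E) = 0 := (κ x).2
    refine Prod.ext ?_ ?_
    · change A (x - κ x + b) = A x
      simp [hb, hkx]
    · change κ (x - κ x + b) = b
      simp [hκ]
  let e : E ≃L[ℝ] T × K := (LinearEquiv.ofBijective (Θ' x₀ : E →ₗ[ℝ] T × K)
    ⟨hinj, hsurj⟩).toContinuousLinearEquiv
  have he : (e : E →L[ℝ] T × K) = Θ' x₀ := by ext x <;> rfl
  have hf0 : ContDiffAt ℝ ∞ f x₀ := hf.self_of_nhds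
  have hΘ0 : HasFDerivAt Θ (e : E →L[ℝ] T × K) x₀ := by rw [he]; exact hΘd x₀ hf0
  let P := (hΘs x₀ hf0).toOpenPartialHomeomorph Θ hΘ0 (by simp)
  have hP : ∀ x, P x = Θ x := fun x => rfl
  have hx₀P : x₀ ∈ P.source := (hΘs x₀ hf0).mem_toOpenPartialHomeomorph_source hΘ0 (by simp)
  -- good points
  have hcont : ContinuousAt Θ' x₀ := by
    have h1 : ContinuousAt (fderiv ℝ f) x₀ :=
      (hf0.fderiv_right (m := 0) (by simp)).continuousAt
    have h2 : ContinuousAt (fun x => p.comp (fderiv ℝ f x)) x₀ :=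
      (continuous_const.clm_comp continuous_id).continuousAt.comp h1
    exact ((ContinuousLinearMap.prodₗᵢ ℝ).continuous.comp
      (Continuous.prodMk_left κ)).continuousAt.comp h2
  have hev : ∀ᶠ x in 𝓝 x₀, ∃ e' : E ≃L[ℝ] T × K, (e' : E →L[ℝ] T × K) = Θ' x :=
    hcont.eventually (by rw [← he]; exact ContinuousLinearEquiv.nhds e)
  have hgood : ∀ᶠ x in 𝓝 x₀, x ∈ P.source ∧ x ∈ N ∧ ContDiffAt ℝ ∞ f x ∧
      (Module.finrank ℝ (LinearMap.range (fderiv ℝ f x : E →ₗ[ℝ] W)) ≤ Module.finrank ℝ T) ∧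
      ∃ e' : E ≃L[ℝ] T × K, (e' : E →L[ℝ] T × K) = Θ' x := by
    filter_upwards [P.open_source.mem_nhds hx₀P, hN, hf, hrk, hev] with x a b c d e
      using ⟨a, b, c, d, e⟩
  have hy₀ : P x₀ ∈ P.target := P.map_source hx₀P
  have hgood' : ∀ᶠ y in 𝓝 (P x₀), y ∈ P.target ∧ (P.symm y ∈ P.source ∧ P.symm y ∈ N ∧
      ContDiffAt ℝ ∞ f (P.symm y) ∧
      (Module.finrank ℝ (LinearMap.range (fderiv ℝ f (P.symm y) : E →ₗ[ℝ] W)) ≤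
        Module.finrank ℝ T) ∧
      ∃ e' : E ≃L[ℝ] T × K, (e' : E →L[ℝ] T × K) = Θ' (P.symm y)) := by
    refine Filter.Eventually.and (P.open_target.mem_nhds hy₀) ?_
    have := P.continuousAt_symm hy₀
    rw [ContinuousAt, P.left_inv hx₀P] at this
    exact this.eventually hgood
  obtain ⟨r, hr, hball⟩ := Metric.eventually_nhds_iff_ball.1 hgood'
  set v₀ : T := (P x₀).1
  set k₀ : K := (P x₀).2
  have hprod : ∀ v ∈ Metric.ball v₀ r, ∀ k ∈ Metric.ball k₀ r, (v, k) ∈ Metric.ball (P x₀) r := by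
    intro v hv k hk
    have : P x₀ = (v₀, k₀) := rfl
    rw [this, ← ball_prod_same]
    exact ⟨hv, hk⟩
  have hPs : ∀ y ∈ Metric.ball (P x₀) r, ContDiffAt ℝ ∞ P.symm y := by
    intro y hy
    obtain ⟨h1, -, -, h2, -, e', he'⟩ := hball y hy
    refine P.contDiffAt_symm (f₀' := e') h1 ?_ (hΘs _ h2)
    rw [he']
    exact hΘd _ h2
  have hfst : ∀ y ∈ Metric.ball (P x₀) r, p (f (P.symm y)) = y.1 := by
    intro y hy
    have := P.right_inv (hball y hy).1
    exact congrArg Prod.fst this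
  -- constancy along the fibres
  have hconst : ∀ v ∈ Metric.ball v₀ r, ∀ k ∈ Metric.ball k₀ r,
      f (P.symm (v, k)) = f (P.symm (v, k₀)) := by
    intro v hv k hk
    have hd : ∀ k ∈ Metric.ball k₀ r, HasFDerivAt (fun k => f (P.symm (v, k)))
        (0 : K →L[ℝ] W) k := by
      intro k hk
      have hy := hprod v hv k hk
      obtain ⟨h1, -, -, h2, h3, -⟩ := hball _ hy
      have d1 : HasFDerivAt P.symm (fderiv ℝ P.symm (v, k)) (v, k) :=
        ((hPs _ hy).differentiableAt (by simp)).hasFDerivAt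
      have d2 : HasFDerivAt (fun k : K => (v, k)) (ContinuousLinearMap.inr ℝ T K) k :=
        hasFDerivAt_prodMk_right v k
      have d3 : HasFDerivAt f (fderiv ℝ f (P.symm (v, k))) (P.symm (v, k)) :=
        (h2.differentiableAt (by simp)).hasFDerivAt
      have d4 := (d3.comp (v, k) d1)
      have d5 := d4.comp k d2
      refine d5.congr_fderiv ?_
      set F := fderiv ℝ f (P.symm (v, k)) with hF
      set Q := fderiv ℝ P.symm (v, k) with hQ
      -- `p ∘ F ∘ Q = fst`
      have hfq : (p.comp (F.comp Q)) = ContinuousLinearMap.fst ℝ T K := by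
        have a1 : HasFDerivAt (fun y => p (f (P.symm y))) (p.comp (F.comp Q)) (v, k) :=
          p.hasFDerivAt.comp _ d4
        have a2 : (fun y => p (f (P.symm y))) =ᶠ[𝓝 (v, k)] Prod.fst := by
          filter_upwards [Metric.isOpen_ball.mem_nhds hy] with y hy using hfst y hy
        exact (a1.congr_of_eventuallyEq a2.symm).unique hasFDerivAt_fst
      let R := LinearMap.range (F : E →ₗ[ℝ] W)
      let pR : R →ₗ[ℝ] T := (p : W →ₗ[ℝ] T).comp R.subtype
      have hpRs : Function.Surjective pR := by
        intro t
        refine ⟨⟨F (Q (t, 0)), ⟨_, rfl⟩⟩, ?_⟩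
        exact DFunLike.congr_fun hfq (t, 0)
      have hfin : Module.finrank ℝ R = Module.finrank ℝ T :=
        le_antisymm h3 (LinearMap.finrank_le_finrank_of_surjective hpRs)
      have hpRi : Function.Injective pR :=
        (LinearMap.injective_iff_surjective_of_finrank_eq_finrank hfin).2 hpRs
      ext u
      have h0 : pR ⟨F (Q (0, u)), ⟨_, rfl⟩⟩ = pR 0 := by
        rw [map_zero]
        exact DFunLike.congr_fun hfq (0, u)
      exact congrArg Subtype.val (hpRi h0)
    refine Metric.isOpen_ball.is_const_of_fderiv_eq_zero (𝕜 := ℝ)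
      (convex_ball k₀ r).isPreconnected
      (f := fun k => f (P.symm (v, k))) (fun k hk => (hd k hk).differentiableAt.differentiableWithinAt)
      (fun k hk => (hd k hk).fderiv) hk (Metric.mem_ball_self hr)
  refine ⟨Metric.ball v₀ r, fun v => P.symm (v, k₀),
    P.source ∩ P ⁻¹' Metric.ball (P x₀) r, Metric.isOpen_ball,
    P.isOpen_inter_preimage Metric.isOpen_ball, ⟨hx₀P, Metric.mem_ball_self hr⟩, ?_, ?_, ?_, ?_,
    ?_, ?_⟩
  · rintro x ⟨h1, h2⟩
    have := (hball _ h2).2.2.1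
    rwa [P.left_inv h1] at this
  · intro v hv
    refine ContDiffAt.contDiffWithinAt ?_
    exact (hPs _ (hprod v hv k₀ (Metric.mem_ball_self hr))).comp v
      (contDiffAt_id.prodMk contDiffAt_const)
  · intro v hv
    have hy := hprod v hv k₀ (Metric.mem_ball_self hr)
    obtain ⟨h1, h2, -⟩ := hball _ hy
    exact ⟨h2, by rw [mem_preimage, P.right_inv h1]; exact hy⟩
  · rintro x ⟨h1, h2⟩
    rw [mem_preimage, show P x₀ = (v₀, k₀) from rfl, ← ball_prod_same] at h2
    exact h2.1
  · intro v hv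
    exact hfst _ (hprod v hv k₀ (Metric.mem_ball_self hr))
  · rintro x ⟨h1, h2⟩
    have h2' := h2
    rw [mem_preimage, show P x₀ = (v₀, k₀) from rfl, ← ball_prod_same] at h2
    have := hconst _ h2.1 _ h2.2
    rw [Prod.mk.eta, P.left_inv h1] at this
    exact this.symm

section LinearOrbit

variable {E G W : Type*} [NormedAddCommGroup E] [NormedSpace ℝ E]
  [TopologicalSpace G] [ChartedSpace E G] [Group G]
  [NormedAddCommGroup W] [NormedSpace ℝ W]

variable (E) in
/-- The derivative at `1` of the orbit map `g ↦ ρ g w`. -/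
noncomputable def orbitDeriv (ρ : G →* (W →L[ℝ] W)) (w : W) : E →L[ℝ] W :=
  mfderiv 𝓘(ℝ, E) 𝓘(ℝ, W) (fun g : G => ρ g w) 1

variable (E) in
/-- The tangent space at `w` of the orbit of `w`, as a subspace of `W`: the range of the derivative
at `1` of `g ↦ ρ g w`. It is the model space of the orbit. -/
noncomputable abbrev OrbitModel (ρ : G →* (W →L[ℝ] W)) (w : W) : Submodule ℝ W :=
  LinearMap.range (orbitDeriv E ρ w : E →ₗ[ℝ] W)

/-- Data of a local smooth section of the orbit map `g ↦ ρ g w` near `w`. -/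
structure OrbitSlice (E : Type*) {G W : Type*} [NormedAddCommGroup E] [NormedSpace ℝ E]
    [TopologicalSpace G] [ChartedSpace E G] [Group G] [NormedAddCommGroup W] [NormedSpace ℝ W]
    (ρ : G →* (W →L[ℝ] W)) (w : W) where
  proj : W →L[ℝ] OrbitModel E ρ w
  proj_apply : ∀ v : OrbitModel E ρ w, proj v = v
  base : Set (OrbitModel E ρ w)
  sec : OrbitModel E ρ w → G
  nhd : Set G
  isOpen_base : IsOpen base
  isOpen_nhd : IsOpen nhd
  one_mem : (1 : G) ∈ nhd
  contMDiffOn_sec : ContMDiffOn 𝓘(ℝ, OrbitModel E ρ w) 𝓘(ℝ, E) ∞ sec base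
  sec_mem : ∀ v ∈ base, sec v ∈ nhd
  proj_mem : ∀ g ∈ nhd, proj (ρ g w) ∈ base
  proj_sec : ∀ v ∈ base, proj (ρ (sec v) w) = v
  sec_proj : ∀ g ∈ nhd, ρ (sec (proj (ρ g w))) w = ρ g w

theorem nonempty_orbitSlice [FiniteDimensional ℝ E] [FiniteDimensional ℝ W]
    [LieGroup 𝓘(ℝ, E) ∞ G] (ρ : G →* (W →L[ℝ] W))
    (hρ : ContMDiff 𝓘(ℝ, E) 𝓘(ℝ, W →L[ℝ] W) ∞ ρ) (w : W) :
    Nonempty (OrbitSlice E ρ w) := by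
  classical
  have : IsManifold 𝓘(ℝ, E) 1 G := IsManifold.of_le (n := ∞) (by simp)
  set φ : G → W := fun g => ρ g w with hφdef
  have hφ : ContMDiff 𝓘(ℝ, E) 𝓘(ℝ, W) ∞ φ := hρ.clm_apply contMDiff_const
  set c := chartAt E (1 : G) with hc
  set x₀ : E := c 1 with hx₀
  have h1c : (1 : G) ∈ c.source := mem_chart_source E 1
  have hx₀t : x₀ ∈ c.target := c.map_source h1c
  set f : E → W := φ ∘ c.symm with hfdef
  have hcs : ContMDiffOn 𝓘(ℝ, E) 𝓘(ℝ, E) ∞ c.symm c.target := contMDiffOn_chart_symm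
  have hcc : ContMDiffOn 𝓘(ℝ, E) 𝓘(ℝ, E) ∞ c c.source := contMDiffOn_chart
  have hfC : ∀ x ∈ c.target, ContDiffAt ℝ ∞ f x := fun x hx =>
    (hφ.contMDiffAt.comp x (hcs.contMDiffAt (c.open_target.mem_nhds hx))).contDiffAt
  obtain ⟨p, hp⟩ := Submodule.ClosedComplemented.of_finiteDimensional (OrbitModel E ρ w)
  have hD : orbitDeriv E ρ w = fderiv ℝ f x₀ := by
    have h1 : orbitDeriv E ρ w = _ :=
      (hφ.mdifferentiableAt (x := 1) (by simp)).mfderiv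
    refine h1.trans ?_
    simp [writtenInExtChartAt, hfdef, hx₀, hc, fderivWithin_univ]
    rfl
  have hT : OrbitModel E ρ w = LinearMap.range (fderiv ℝ f x₀ : E →ₗ[ℝ] W) := by
    rw [← hD]
  have hrk : ∀ x ∈ c.target,
      Module.finrank ℝ (LinearMap.range (fderiv ℝ f x : E →ₗ[ℝ] W)) ≤
      Module.finrank ℝ (OrbitModel E ρ w) := by
    intro x hx
    set h := c.symm x with hh
    set τ : E → E := fun y => c (h⁻¹ * c.symm y) with hτ
    have hτx : τ x = x₀ := by simp [hτ, hx₀, ← hh]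
    have hτd : ContDiffAt ℝ ∞ τ x := by
      have a1 := hcs.contMDiffAt (c.open_target.mem_nhds hx)
      have a2 : ContMDiffAt 𝓘(ℝ, E) 𝓘(ℝ, E) ∞ (fun y => h⁻¹ * c.symm y) x :=
        (contMDiff_mul_left (a := h⁻¹)).contMDiffAt.comp x a1
      have a3 : ContMDiffAt 𝓘(ℝ, E) 𝓘(ℝ, E) ∞ c (h⁻¹ * c.symm x) := by
        rw [← hh, inv_mul_cancel]
        exact hcc.contMDiffAt (c.open_source.mem_nhds h1c)
      exact (a3.comp x a2).contDiffAt
    have hev : f =ᶠ[𝓝 x] fun y => ρ h (f (τ y)) := by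
      have a1 := (hcs.contMDiffAt (c.open_target.mem_nhds hx)).continuousAt
      have a2 : ContinuousAt (fun y => h⁻¹ * c.symm y) x :=
        ((contMDiff_mul_left (I := 𝓘(ℝ, E)) (n := ∞) (a := h⁻¹)).continuous.continuousAt).comp a1
      have a3 : c.source ∈ 𝓝 (h⁻¹ * c.symm x) := by
        rw [← hh, inv_mul_cancel]
        exact c.open_source.mem_nhds h1c
      filter_upwards [a2 a3] with y hy
      simp only [hfdef, hτ, Function.comp, hφdef]
      rw [c.left_inv hy, ← mul_apply_eq_comp, ← map_mul, mul_inv_cancel_left]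
    have hd : HasFDerivAt f ((ρ h).comp ((fderiv ℝ f x₀).comp (fderiv ℝ τ x))) x := by
      have b1 : HasFDerivAt τ (fderiv ℝ τ x) x := (hτd.differentiableAt (by simp)).hasFDerivAt
      have b2 : HasFDerivAt f (fderiv ℝ f x₀) (τ x) := by
        rw [hτx]; exact ((hfC x₀ hx₀t).differentiableAt (by simp)).hasFDerivAt
      exact (((ρ h).hasFDerivAt).comp x (b2.comp x b1)).congr_of_eventuallyEq hev
    rw [hd.fderiv, hT]
    have hle : LinearMap.range (((ρ h).comp ((fderiv ℝ f x₀).comp (fderiv ℝ τ x)) :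
        E →L[ℝ] W) : E →ₗ[ℝ] W) ≤
        (LinearMap.range (fderiv ℝ f x₀ : E →ₗ[ℝ] W)).map (ρ h : W →ₗ[ℝ] W) := by
      rintro _ ⟨u, rfl⟩
      exact ⟨fderiv ℝ f x₀ (fderiv ℝ τ x u), ⟨_, rfl⟩, rfl⟩
    exact (Submodule.finrank_mono hle).trans (Submodule.finrank_map_le _ _)
  obtain ⟨B, s, U, hB, hU, hxU, hUN, hs, hsU, hpB, hps, hsp⟩ :=
    exists_slice_aux f x₀ (OrbitModel E ρ w) p hp hT
      (by filter_upwards [c.open_target.mem_nhds hx₀t] with x hx using hfC x hx)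
      (by filter_upwards [c.open_target.mem_nhds hx₀t] with x hx using hrk x hx)
      c.target (c.open_target.mem_nhds hx₀t)
  refine ⟨⟨p, hp, B, fun v => c.symm (s v), c.source ∩ c ⁻¹' U, hB,
    c.isOpen_inter_preimage hU, ⟨h1c, hxU⟩, ?_, ?_, ?_, ?_, ?_⟩⟩
  · exact hcs.comp hs.contMDiffOn fun v hv => hUN (hsU v hv)
  · intro v hv
    have := hUN (hsU v hv)
    exact ⟨c.map_target this, by rw [mem_preimage, c.right_inv this]; exact hsU v hv⟩
  · rintro g ⟨hg, hgU⟩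
    have := hpB _ hgU
    simpa [hfdef, hφdef, c.left_inv hg] using this
  · exact hps
  · rintro g ⟨hg, hgU⟩
    have := hsp _ hgU
    simpa [hfdef, hφdef, c.left_inv hg] using this

/-- The orbit of `w` under a representation `ρ` of a Lie group modelled on `E`. It is a type of its
own, as its topology is not a priori the one induced by `W`. -/
def LinearOrbit (_E : Type*) {G W : Type*} [Group G] [NormedAddCommGroup W] [NormedSpace ℝ W]
    (ρ : G →* (W →L[ℝ] W)) (w : W) : Type _ := {y : W // ∃ g : G, ρ g w = y}

/-- Smoothness of a finite-dimensional representation of a Lie group. -/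
class SmoothRep (E : Type*) {G W : Type*} [NormedAddCommGroup E] [NormedSpace ℝ E]
    [TopologicalSpace G] [ChartedSpace E G] [Group G] [NormedAddCommGroup W] [NormedSpace ℝ W]
    (ρ : G →* (W →L[ℝ] W)) : Prop where
  contMDiff : ContMDiff 𝓘(ℝ, E) 𝓘(ℝ, W →L[ℝ] W) ∞ ρ

namespace LinearOrbit

variable {ρ : G →* (W →L[ℝ] W)} {w : W}

variable (E ρ w) in
/-- The orbit map. -/
def mk (g : G) : LinearOrbit E ρ w := ⟨ρ g w, g, rfl⟩

theorem mk_surjective : Function.Surjective (mk E ρ w) := by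
  rintro ⟨_, g, rfl⟩
  exact ⟨g, rfl⟩

instance : MulAction G (LinearOrbit E ρ w) where
  smul g y := ⟨ρ g y.1, by
    obtain ⟨h, hh⟩ := y.2
    exact ⟨g * h, by rw [map_mul, mul_apply_eq_comp, hh]⟩⟩
  one_smul y := Subtype.ext (by change ρ 1 y.1 = y.1; simp)
  mul_smul g h y := Subtype.ext (by change ρ (g * h) y.1 = ρ g (ρ h y.1); simp)

@[simp] theorem val_smul (g : G) (y : LinearOrbit E ρ w) : (g • y).1 = ρ g y.1 := rfl

@[simp] theorem val_mk (g : G) : (mk E ρ w g).1 = ρ g w := rfl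

theorem smul_mk (g h : G) : g • mk E ρ w h = mk E ρ w (g * h) := Subtype.ext (by simp)

theorem mk_eq_mk {a b : G} : mk E ρ w a = mk E ρ w b ↔ ρ a w = ρ b w := Subtype.ext_iff

variable (σ : OrbitSlice E ρ w)

/-- Group elements mapping `w` into the domain of the slice. -/
def sat : Set G := {a | ∃ k ∈ σ.nhd, ρ k w = ρ a w}

theorem isOpen_sat [LieGroup 𝓘(ℝ, E) ∞ G] : IsOpen (sat σ) := by
  have : IsTopologicalGroup G := topologicalGroup_of_lieGroup 𝓘(ℝ, E) ∞
  have h : sat σ = ⋃ t ∈ {t : G | ρ t w = w}, (fun a => a * t⁻¹) ⁻¹' σ.nhd := by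
    ext a
    simp only [sat, mem_ofPred_eq, mem_iUnion, mem_preimage, exists_prop]
    constructor
    · rintro ⟨k, hk, hka⟩
      refine ⟨k⁻¹ * a, ?_, by simpa using hk⟩
      rw [map_mul, mul_apply_eq_comp, ← hka, ← mul_apply_eq_comp, ← map_mul]
      simp
    · rintro ⟨t, ht, hk⟩
      refine ⟨_, hk, ?_⟩
      have : ρ t⁻¹ w = w := by
        nth_rewrite 1 [← ht]
        rw [← mul_apply_eq_comp, ← map_mul]
        simp
      rw [map_mul, mul_apply_eq_comp, this]
  rw [h]
  exact isOpen_biUnion fun t _ => σ.isOpen_nhd.preimage (continuous_mul_const _)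

theorem proj_mem_of_sat {a : G} (ha : a ∈ sat σ) : σ.proj (ρ a w) ∈ σ.base := by
  obtain ⟨k, hk, h⟩ := ha
  rw [← h]
  exact σ.proj_mem k hk

theorem sec_proj_of_sat {a : G} (ha : a ∈ sat σ) : ρ (σ.sec (σ.proj (ρ a w))) w = ρ a w := by
  obtain ⟨k, hk, h⟩ := ha
  rw [← h]
  exact σ.sec_proj k hk

/-- The chart of the orbit around `ρ g w`, given by a linear projection onto the tangent space. -/
noncomputable def chart (g : G) : PartialEquiv (LinearOrbit E ρ w) (OrbitModel E ρ w) where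
  toFun y := σ.proj (g⁻¹ • y).1
  invFun v := mk E ρ w (g * σ.sec v)
  source := {y | ∃ k ∈ σ.nhd, y = mk E ρ w (g * k)}
  target := σ.base
  map_source' := by
    rintro _ ⟨k, hk, rfl⟩
    rw [smul_mk, inv_mul_cancel_left]
    exact σ.proj_mem k hk
  map_target' v hv := ⟨σ.sec v, σ.sec_mem v hv, rfl⟩
  left_inv' := by
    rintro _ ⟨k, hk, rfl⟩
    rw [smul_mk, inv_mul_cancel_left, val_mk, mk_eq_mk, map_mul, mul_apply_eq_comp,
      σ.sec_proj k hk, map_mul, mul_apply_eq_comp]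
  right_inv' v hv := by
    rw [smul_mk, inv_mul_cancel_left]
    exact σ.proj_sec v hv

theorem mk_mem_chart_source {g a : G} : mk E ρ w a ∈ (chart σ g).source ↔ g⁻¹ * a ∈ sat σ := by
  change (∃ k ∈ σ.nhd, mk E ρ w a = mk E ρ w (g * k)) ↔ ∃ k ∈ σ.nhd, ρ k w = ρ (g⁻¹ * a) w
  refine exists_congr fun k => and_congr_right fun _ => ?_
  rw [← smul_mk, ← inv_smul_eq_iff, smul_mk, mk_eq_mk, eq_comm]

theorem chart_mk (g a : G) : chart σ g (mk E ρ w a) = σ.proj (ρ (g⁻¹ * a) w) := by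
  change σ.proj (g⁻¹ • mk E ρ w a).1 = _
  rw [smul_mk, val_mk]

theorem chart_symm (g : G) (v : OrbitModel E ρ w) :
    (chart σ g).symm v = mk E ρ w (g * σ.sec v) := rfl

theorem trans_source (g h : G) : ((chart σ g).symm.trans (chart σ h)).source =
    σ.base ∩ (fun v => h⁻¹ * (g * σ.sec v)) ⁻¹' sat σ := by
  ext v
  rw [PartialEquiv.trans_source]
  refine and_congr_right fun _ => ?_
  rw [mem_preimage, chart_symm, mk_mem_chart_source, mem_preimage]

theorem trans_apply (g h : G) (v : OrbitModel E ρ w) : (chart σ g).symm.trans (chart σ h) v =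
    σ.proj (ρ (h⁻¹ * (g * σ.sec v)) w) := by
  rw [PartialEquiv.trans_apply, chart_symm, chart_mk]

theorem contMDiffOn_mul_sec [LieGroup 𝓘(ℝ, E) ∞ G] (g : G) :
    ContMDiffOn 𝓘(ℝ, OrbitModel E ρ w) 𝓘(ℝ, E) ∞ (fun v => g * σ.sec v) σ.base :=
  (contMDiff_mul_left (a := g)).comp_contMDiffOn σ.contMDiffOn_sec

theorem contDiffOn_trans [LieGroup 𝓘(ℝ, E) ∞ G]
    (hρ : ContMDiff 𝓘(ℝ, E) 𝓘(ℝ, W →L[ℝ] W) ∞ ρ) (g h : G) :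
    ContDiffOn ℝ ∞ ((chart σ g).symm.trans (chart σ h))
      ((chart σ g).symm.trans (chart σ h)).source := by
  have h1 : ContMDiffOn 𝓘(ℝ, OrbitModel E ρ w) 𝓘(ℝ, E) ∞ (fun v => h⁻¹ * (g * σ.sec v))
      σ.base := (contMDiff_mul_left (a := h⁻¹)).comp_contMDiffOn (contMDiffOn_mul_sec σ g)
  have h2 : ContMDiff 𝓘(ℝ, E) 𝓘(ℝ, OrbitModel E ρ w) ∞ (fun a : G => σ.proj (ρ a w)) :=
    σ.proj.contMDiff.comp (hρ.clm_apply contMDiff_const)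
  refine ((h2.comp_contMDiffOn h1).contDiffOn.congr fun v _ => ?_).mono ?_
  · exact trans_apply σ g h v
  · rw [trans_source]
    exact inter_subset_left

/-- The atlas of the orbit. -/
noncomputable def chartedSpaceCore [LieGroup 𝓘(ℝ, E) ∞ G]
    (hρ : ContMDiff 𝓘(ℝ, E) 𝓘(ℝ, W →L[ℝ] W) ∞ ρ) :
    ChartedSpaceCore (OrbitModel E ρ w) (LinearOrbit E ρ w) where
  atlas := range (chart σ)
  chartAt y := chart σ y.2.choose
  mem_chart_source y := by
    obtain ⟨a, rfl⟩ := mk_surjective y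
    rw [mk_mem_chart_source]
    refine ⟨1, σ.one_mem, ?_⟩
    have h := (mk E ρ w a).2.choose_spec
    have h' : ρ a w = ρ (mk E ρ w a).2.choose w := h.symm
    rw [map_mul, mul_apply_eq_comp, h', ← mul_apply_eq_comp, ← map_mul, inv_mul_cancel]
  chart_mem_atlas y := ⟨_, rfl⟩
  open_source := by
    rintro _ _ ⟨g, rfl⟩ ⟨h, rfl⟩
    rw [trans_source]
    have := ((contMDiff_mul_left (I := 𝓘(ℝ, E)) (n := ∞) (a := h⁻¹)).comp_contMDiffOn
      (contMDiffOn_mul_sec σ g)).continuousOn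
    exact this.isOpen_inter_preimage σ.isOpen_base (isOpen_sat σ)
  continuousOn_toFun := by
    rintro _ _ ⟨g, rfl⟩ ⟨h, rfl⟩
    exact (contDiffOn_trans σ hρ g h).continuousOn

section Manifold

variable [FiniteDimensional ℝ E] [FiniteDimensional ℝ W] [LieGroup 𝓘(ℝ, E) ∞ G]
  [hρ : SmoothRep E ρ]

variable (E ρ w) in
/-- A chosen slice. -/
noncomputable def slice : OrbitSlice E ρ w := (nonempty_orbitSlice ρ hρ.contMDiff w).some

noncomputable instance : TopologicalSpace (LinearOrbit E ρ w) :=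
  (chartedSpaceCore (slice E ρ w) hρ.contMDiff).toTopologicalSpace

noncomputable instance : ChartedSpace (OrbitModel E ρ w) (LinearOrbit E ρ w) :=
  (chartedSpaceCore (slice E ρ w) hρ.contMDiff).toChartedSpace

theorem mem_atlas {e : OpenPartialHomeomorph (LinearOrbit E ρ w) (OrbitModel E ρ w)}
    (he : e ∈ atlas (OrbitModel E ρ w) (LinearOrbit E ρ w)) :
    ∃ g : G, e.toPartialEquiv = chart (slice E ρ w) g := by
  obtain ⟨_, ⟨e', rfl⟩, _, ⟨⟨g, rfl⟩, rfl⟩, rfl⟩ := he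
  exact ⟨g, rfl⟩

instance : IsManifold 𝓘(ℝ, OrbitModel E ρ w) ∞ (LinearOrbit E ρ w) := by
  refine isManifold_of_contDiffOn _ _ _ fun e e' he he' => ?_
  obtain ⟨g, hg⟩ := mem_atlas he
  obtain ⟨h, hh⟩ := mem_atlas he'
  have := contDiffOn_trans (slice E ρ w) hρ.contMDiff g h
  rw [← hg, ← hh] at this
  simpa using this

theorem continuous_mk : Continuous (mk E ρ w) := by
  refine continuous_generateFrom_iff.2 fun u hu => ?_
  simp only [mem_iUnion, exists_prop] at hu
  obtain ⟨_, ⟨g, rfl⟩, s, hs, rfl⟩ := hu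
  have : IsTopologicalGroup G := topologicalGroup_of_lieGroup 𝓘(ℝ, E) ∞
  have h2 : Continuous (fun a : G => (slice E ρ w).proj (ρ (g⁻¹ * a) w)) :=
    ((slice E ρ w).proj.contMDiff.comp
      (hρ.contMDiff.clm_apply contMDiff_const)).continuous.comp (continuous_const_mul g⁻¹)
  convert (hs.preimage h2).inter
    ((isOpen_sat (slice E ρ w)).preimage (continuous_const_mul g⁻¹)) using 1
  ext a
  simp only [mem_preimage, mem_inter_iff]
  rw [chart_mk, mk_mem_chart_source]

/-- The orbit map is smooth. -/
theorem contMDiff_mk :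
    ContMDiff 𝓘(ℝ, E) 𝓘(ℝ, OrbitModel E ρ w) ∞ (mk E ρ w) := by
  intro a
  rw [contMDiffAt_iff_target]
  refine ⟨continuous_mk.continuousAt, ?_⟩
  obtain ⟨g, hg⟩ := mem_atlas (chart_mem_atlas (OrbitModel E ρ w) (mk E ρ w a))
  have h2 : ContMDiff 𝓘(ℝ, E) 𝓘(ℝ, OrbitModel E ρ w) ∞
      (fun a : G => (slice E ρ w).proj (ρ (g⁻¹ * a) w)) :=
    (slice E ρ w).proj.contMDiff.comp
      ((hρ.contMDiff.clm_apply contMDiff_const).comp contMDiff_mul_left)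
  refine h2.contMDiffAt.congr_of_eventuallyEq (Filter.Eventually.of_forall fun b => ?_)
  have := chart_mk (slice E ρ w) g b
  rw [← hg] at this
  simpa using this

/-- Near every point, the orbit map has a smooth local section. -/
theorem exists_section (y : LinearOrbit E ρ w) : ∃ s : LinearOrbit E ρ w → G,
    ContMDiffAt 𝓘(ℝ, OrbitModel E ρ w) 𝓘(ℝ, E) ∞ s y ∧ ∀ᶠ z in 𝓝 y, mk E ρ w (s z) = z := by
  obtain ⟨g, hg⟩ := mem_atlas (chart_mem_atlas (OrbitModel E ρ w) y)
  set c := chartAt (OrbitModel E ρ w) y with hc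
  have hcs : c.source ∈ 𝓝 y := chart_source_mem_nhds _ y
  have hct : c.target = (slice E ρ w).base := by
    rw [hg]; rfl
  refine ⟨fun z => g * (slice E ρ w).sec (c z), ?_, ?_⟩
  · have h1 : ContMDiffAt 𝓘(ℝ, OrbitModel E ρ w) 𝓘(ℝ, OrbitModel E ρ w) ∞ c y :=
      contMDiffOn_chart.contMDiffAt hcs
    have h2 := (contMDiffOn_mul_sec (slice E ρ w) g).contMDiffAt
      ((slice E ρ w).isOpen_base.mem_nhds (hct ▸ c.map_source (mem_chart_source _ y)))
    exact h2.comp y h1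
  · filter_upwards [hcs] with z hz
    have h1 : c.symm (c z) = z := c.left_inv hz
    have h2 : ∀ v, c.symm v = mk E ρ w (g * (slice E ρ w).sec v) := fun v => by
      change c.toPartialEquiv.symm v = _
      rw [hg]; rfl
    rw [← h2, h1]

instance : ContMDiffSMul 𝓘(ℝ, E) 𝓘(ℝ, OrbitModel E ρ w) ∞ G (LinearOrbit E ρ w) where
  contMDiff_smul := by
    rintro ⟨g, y⟩
    obtain ⟨s, hs, hsy⟩ := exists_section y
    have h1 : ContMDiffAt (𝓘(ℝ, E).prod 𝓘(ℝ, OrbitModel E ρ w)) 𝓘(ℝ, E) ∞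
        (fun q : G × LinearOrbit E ρ w => q.1 * s q.2) (g, y) :=
      contMDiffAt_fst.mul (hs.comp (g, y) contMDiffAt_snd)
    refine (contMDiff_mk.contMDiffAt.comp (g, y) h1).congr_of_eventuallyEq ?_
    have := (continuous_snd.tendsto (g, y)).eventually hsy
    filter_upwards [this] with q hq
    change q.1 • q.2 = mk E ρ w (q.1 * s q.2)
    rw [← smul_mk, hq]

/-- The infinitesimal action on the orbit is onto the tangent spaces. -/
theorem surjective_mfderiv_smul (y : LinearOrbit E ρ w) : Function.Surjective
    (mfderiv 𝓘(ℝ, E) 𝓘(ℝ, OrbitModel E ρ w) (fun g : G => g • y) 1) := by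
  obtain ⟨s, hs, hsy⟩ := exists_section y
  have hy : mk E ρ w (s y) = y := hsy.self_of_nhds
  set t : LinearOrbit E ρ w → G := fun z => s z * (s y)⁻¹ with ht
  have hty : t y = 1 := mul_inv_cancel _
  have htC : ContMDiffAt 𝓘(ℝ, OrbitModel E ρ w) 𝓘(ℝ, E) ∞ t y := hs.mul contMDiffAt_const
  have hev : (fun z => t z • y) =ᶠ[𝓝 y] id := by
    filter_upwards [hsy] with z hz
    change t z • y = z
    nth_rewrite 1 [← hy]
    rw [smul_mk]
    simpa [ht] using hz
  have hsm : ContMDiff 𝓘(ℝ, E) 𝓘(ℝ, OrbitModel E ρ w) ∞ (fun g : G => g • y) :=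
    (contMDiff_smul (I := 𝓘(ℝ, E)) (I' := 𝓘(ℝ, OrbitModel E ρ w)) (n := ∞) (G := G)
      (M := LinearOrbit E ρ w)).comp (contMDiff_id.prodMk contMDiff_const)
  have h1 : HasMFDerivAt 𝓘(ℝ, OrbitModel E ρ w) 𝓘(ℝ, E) t y
      (mfderiv 𝓘(ℝ, OrbitModel E ρ w) 𝓘(ℝ, E) t y) :=
    (htC.mdifferentiableAt (by simp)).hasMFDerivAt
  have h2 : HasMFDerivAt 𝓘(ℝ, E) 𝓘(ℝ, OrbitModel E ρ w) (fun g : G => g • y) (t y)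
      (mfderiv 𝓘(ℝ, E) 𝓘(ℝ, OrbitModel E ρ w) (fun g : G => g • y) (t y)) :=
    (hsm.mdifferentiableAt (by simp)).hasMFDerivAt
  have h3 := (h2.comp y h1).congr_of_eventuallyEq (f₁ := id) hev.symm
  have h4 := hasMFDerivAt_unique h3 (hasMFDerivAt_id y)
  rw [← hty]
  intro u
  exact ⟨mfderiv 𝓘(ℝ, OrbitModel E ρ w) 𝓘(ℝ, E) t y u, DFunLike.congr_fun h4 u⟩

end Manifold

end LinearOrbit

end LinearOrbit

section Adjoint

variable (E G : Type*) [NormedAddCommGroup E] [NormedSpace ℝ E]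
  [TopologicalSpace G] [ChartedSpace E G] [Group G]

/-- The Lie algebra `𝔤 = T₁G` of `G`, with the Lie bracket of left-invariant vector fields. -/
abbrev LieAlg : Type _ := GroupLieAlgebra 𝓘(ℝ, E) G

/-- The dual `𝔤*` of the Lie algebra. -/
abbrev LieDual : Type _ := LieAlg E G →L[ℝ] ℝ

variable {E G}

/-- A linear form on `𝔤`, read on the normed space `E` which underlies `𝔤 = T₁G`. -/
def LieDual.toModel (lam : LieDual E G) : E →L[ℝ] ℝ := lam

variable (E)

/-- The adjoint action `Ad g : 𝔤 → 𝔤`, the derivative at `1` of `h ↦ g h g⁻¹`. -/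
noncomputable def Ad (g : G) : LieAlg E G →L[ℝ] LieAlg E G :=
  mfderiv 𝓘(ℝ, E) 𝓘(ℝ, E) (fun h : G => g * h * g⁻¹) 1

/-- `Ad g`, read in the model space `E` (which underlies `T₁G`). -/
noncomputable def AdModel (g : G) : E →L[ℝ] E := Ad E g

variable [LieGroup 𝓘(ℝ, E) ∞ G]

theorem Ad_one : Ad E (1 : G) = ContinuousLinearMap.id ℝ _ := by
  have h : (fun h : G => 1 * h * 1⁻¹) = id := by ext; simp
  change (mfderiv 𝓘(ℝ, E) 𝓘(ℝ, E) (fun h : G => 1 * h * 1⁻¹) 1 : E →L[ℝ] E) = _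
  rw [h]
  exact mfderiv_id

theorem Ad_mul (a b : G) : Ad E (a * b) = (Ad E a).comp (Ad E b) := by
  have hs : ∀ a : G, ContMDiff 𝓘(ℝ, E) 𝓘(ℝ, E) ∞ (fun h : G => a * h * a⁻¹) := fun a =>
    contMDiff_mul_right.comp contMDiff_mul_left
  have hd : ∀ a x : G, HasMFDerivAt 𝓘(ℝ, E) 𝓘(ℝ, E) (fun h : G => a * h * a⁻¹) x
      (mfderiv 𝓘(ℝ, E) 𝓘(ℝ, E) (fun h : G => a * h * a⁻¹) x) := fun a x =>
    ((hs a).mdifferentiableAt (by simp)).hasMFDerivAt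
  have h : (fun h : G => a * b * h * (a * b)⁻¹) =
      (fun h : G => a * h * a⁻¹) ∘ (fun h : G => b * h * b⁻¹) := by
    ext h; simp [mul_assoc]
  have h1 := (hd a (b * 1 * b⁻¹)).comp 1 (hd b 1)
  rw [← h] at h1
  refine h1.mfderiv.trans ?_
  have key : ∀ x : G, x = 1 → ((mfderiv 𝓘(ℝ, E) 𝓘(ℝ, E) (fun h : G => a * h * a⁻¹) x :
      E →L[ℝ] E)) = (mfderiv 𝓘(ℝ, E) 𝓘(ℝ, E) (fun h : G => a * h * a⁻¹) 1 : E →L[ℝ] E) := by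
    rintro x rfl; rfl
  exact congrArg (fun L : E →L[ℝ] E => L.comp (Ad E b : E →L[ℝ] E)) (key _ (by simp))

theorem contMDiff_Ad : ContMDiff 𝓘(ℝ, E) 𝓘(ℝ, E →L[ℝ] E) ∞
    (AdModel E : G → E →L[ℝ] E) := by
  have : IsManifold 𝓘(ℝ, E) 1 G := IsManifold.of_le (n := ∞) (by simp)
  intro g₀
  have h1 : ContMDiff (𝓘(ℝ, E).prod 𝓘(ℝ, E)) 𝓘(ℝ, E) ∞
      (Function.uncurry fun (g h : G) => g * h * g⁻¹) :=
    (contMDiff_fst.mul contMDiff_snd).mul contMDiff_fst.inv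
  have h2 := ContMDiffAt.mfderiv (m := ∞) (x₀ := g₀) (fun (g h : G) => g * h * g⁻¹)
    (fun _ => 1) h1.contMDiffAt contMDiffAt_const (by simp)
  refine h2.congr_of_eventuallyEq (Filter.Eventually.of_forall fun g => ?_)
  have e1 : ∀ g : G, g * 1 * g⁻¹ = 1 := fun g => by simp
  have hh : ∀ (a b : G) (L : E →L[ℝ] E), a = 1 → b = 1 →
      inTangentCoordinates 𝓘(ℝ, E) 𝓘(ℝ, E) (fun _ : G => (1 : G)) (fun g : G => g * 1 * g⁻¹)
        (fun _ => L) g₀ g = L := by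
    intro a b L _ _
    rw [inTangentCoordinates_eq]
    · ext v
      simp only [ContinuousLinearMap.comp_apply]
      rw [(tangentBundleCore 𝓘(ℝ, E) G).coordChange_self _ _ (mem_chart_source E (1 : G))]
      simp only [e1]
      exact (tangentBundleCore 𝓘(ℝ, E) G).coordChange_self _ _ (mem_chart_source E (1 : G)) _
    · exact mem_chart_source E (1 : G)
    · simp only [e1]; exact mem_chart_source E (1 : G)
  exact (hh 1 1 (AdModel E g) rfl rfl).symm

variable (G) in
/-- The coadjoint representation `⟨Ad* g ξ, X⟩ = ⟨ξ, Ad g⁻¹ X⟩`. -/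
noncomputable def coAd : G →* ((E →L[ℝ] ℝ) →L[ℝ] (E →L[ℝ] ℝ)) where
  toFun g := (AdModel E g⁻¹).precomp ℝ
  map_one' := by
    have h : AdModel E (1 : G)⁻¹ = ContinuousLinearMap.id ℝ E := by
      rw [inv_one]; exact Ad_one E
    rw [h]
    rfl
  map_mul' a b := by
    have h : AdModel E (a * b)⁻¹ = (AdModel E b⁻¹).comp (AdModel E a⁻¹) := by
      rw [mul_inv_rev]; exact Ad_mul E b⁻¹ a⁻¹
    rw [h]
    rfl

instance : SmoothRep E (coAd E G) where
  contMDiff :=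
    ((contMDiff_Ad E).comp (contMDiff_inv 𝓘(ℝ, E) ∞)).clm_precomp (F₃ := ℝ)

/-- The coadjoint orbit of `lam ∈ 𝔤*`. -/
abbrev CoadjointOrbit (lam : LieDual E G) : Type _ := LinearOrbit E (coAd E G) lam.toModel

/-- The model space of the coadjoint orbit: its tangent space at `lam`. -/
noncomputable abbrev CoadjointModel (lam : LieDual E G) : Submodule ℝ (E →L[ℝ] ℝ) :=
  OrbitModel E (coAd E G) lam.toModel

end Adjoint

section HamiltonianManifolds

variable {E F G M : Type*} [NormedAddCommGroup E] [NormedSpace ℝ E]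
  [TopologicalSpace G] [ChartedSpace E G] [Group G]
  [NormedAddCommGroup F] [NormedSpace ℝ F] [TopologicalSpace M] [ChartedSpace F M] [MulAction G M]

variable (F) in
/-- The vector field `X_M` generated by `X ∈ 𝔤`: `X_M(m) = d/dt|₀ exp(-tX)·m`. -/
noncomputable def fundamentalField (X : LieAlg E G) (m : M) : TangentSpace 𝓘(ℝ, F) m :=
  -(mfderiv 𝓘(ℝ, E) 𝓘(ℝ, F) (fun g : G => g • m) 1 X)

variable (F) in
/-- The derivative `T_m M → T_{gm} M` of the action of `g`. -/
noncomputable def smulDeriv (g : G) (m : M) :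
    TangentSpace 𝓘(ℝ, F) m →L[ℝ] TangentSpace 𝓘(ℝ, F) (g • m) :=
  mfderiv 𝓘(ℝ, F) 𝓘(ℝ, F) (fun x : M => g • x) m

variable (F M) in
/-- Smooth Riemannian metrics on `M`. -/
abbrev RiemannianMetricOn [IsManifold 𝓘(ℝ, F) 1 M] : Type _ :=
  ContMDiffRiemannianMetric 𝓘(ℝ, F) ∞ F (fun m : M => TangentSpace 𝓘(ℝ, F) m)

variable (G) in
/-- `G`-invariance of a Riemannian metric. -/
def InvariantMetric [IsManifold 𝓘(ℝ, F) 1 M] (h : RiemannianMetricOn F M) : Prop :=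
  ∀ (g : G) (m : M) (u v : TangentSpace 𝓘(ℝ, F) m),
    h.inner (g • m) (smulDeriv F g m u) (smulDeriv F g m v) = h.inner m u v

/-- The quadratic form `v ↦ -h(v, v)` on `T_m M`, so that `v² = -‖v‖²` in `Cl(T_m M)`. -/
noncomputable def cliffordForm [IsManifold 𝓘(ℝ, F) 1 M] (h : RiemannianMetricOn F M) (m : M) :
    QuadraticForm ℝ (TangentSpace 𝓘(ℝ, F) m) :=
  -LinearMap.BilinMap.toQuadraticMap (LinearMap.mk₂ ℝ (fun u v => h.inner m u v)
    (by simp) (by simp) (by simp) (by simp))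

/-- Smoothness at `m₀` of a section of a vector bundle over `M`. -/
abbrev SmoothSectionAt (F : Type*) {M : Type*} [NormedAddCommGroup F] [NormedSpace ℝ F]
    [TopologicalSpace M] [ChartedSpace F M] (V₀ : Type*) [NormedAddCommGroup V₀] [NormedSpace ℝ V₀]
    {V : M → Type*} [TopologicalSpace (TotalSpace V₀ V)] [∀ m, TopologicalSpace (V m)]
    [FiberBundle V₀ V] (s : ∀ m, V m) (m₀ : M) : Prop :=
  ContMDiffAt 𝓘(ℝ, F) (𝓘(ℝ, F).prod 𝓘(ℝ, V₀)) ∞ (fun m => TotalSpace.mk' V₀ m (s m)) m₀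

/-- Differentiability at `m₀` of a section of a vector bundle over `M`. -/
abbrev DifferentiableSectionAt (F : Type*) {M : Type*} [NormedAddCommGroup F] [NormedSpace ℝ F]
    [TopologicalSpace M] [ChartedSpace F M] (V₀ : Type*) [NormedAddCommGroup V₀] [NormedSpace ℝ V₀]
    {V : M → Type*} [TopologicalSpace (TotalSpace V₀ V)] [∀ m, TopologicalSpace (V m)]
    [FiberBundle V₀ V] (s : ∀ m, V m) (m₀ : M) : Prop :=
  MDifferentiableAt 𝓘(ℝ, F) (𝓘(ℝ, F).prod 𝓘(ℝ, V₀)) (fun m => TotalSpace.mk' V₀ m (s m)) m₀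

/-- A smooth action of `G` on the total space of a complex vector bundle `V → M`, covering the
action on `M` and complex linear on the fibres. -/
structure BundleAction (E F G : Type*) {M : Type*} [NormedAddCommGroup E] [NormedSpace ℝ E]
    [TopologicalSpace G] [ChartedSpace E G] [Group G] [NormedAddCommGroup F] [NormedSpace ℝ F]
    [TopologicalSpace M] [ChartedSpace F M] [MulAction G M]
    (V₀ : Type*) [NormedAddCommGroup V₀] [NormedSpace ℂ V₀]
    (V : M → Type*) [∀ m, AddCommGroup (V m)] [∀ m, Module ℂ (V m)]
    [TopologicalSpace (TotalSpace V₀ V)] [∀ m, TopologicalSpace (V m)] [FiberBundle V₀ V] where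
  act : ∀ (g : G) (m : M), V m ≃ₗ[ℂ] V (g • m)
  act_one : ∀ (m : M) (v : V m),
    TotalSpace.mk' V₀ ((1 : G) • m) (act 1 m v) = TotalSpace.mk' V₀ m v
  act_mul : ∀ (a b : G) (m : M) (v : V m),
    TotalSpace.mk' V₀ ((a * b) • m) (act (a * b) m v) =
      TotalSpace.mk' V₀ (a • b • m) (act a (b • m) (act b m v))
  contMDiff_act : ContMDiff (𝓘(ℝ, E).prod (𝓘(ℝ, F).prod 𝓘(ℝ, V₀))) (𝓘(ℝ, F).prod 𝓘(ℝ, V₀)) ∞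
    (fun q : G × TotalSpace V₀ V => TotalSpace.mk' V₀ (q.1 • q.2.proj) (act q.1 q.2.proj q.2.2))

/-- A `G`-equivariant `spin^c`-bundle on `M` for the Riemannian metric `h`: a smooth `G`-equivariant
complex vector bundle `S` with a smooth equivariant action of the Clifford bundle which induces
isomorphisms `Cl(T_m M) ⊗ ℂ ≅ End(S_m)`. -/
structure EquivariantSpincBundle (E G : Type*) {F M : Type*} [NormedAddCommGroup E]
    [NormedSpace ℝ E] [TopologicalSpace G] [ChartedSpace E G] [Group G] [NormedAddCommGroup F]
    [NormedSpace ℝ F] [TopologicalSpace M] [ChartedSpace F M] [MulAction G M]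
    [IsManifold 𝓘(ℝ, F) 1 M] (h : RiemannianMetricOn F M) where
  rank : ℕ
  Fiber : M → Type
  [addCommGroup : ∀ m, AddCommGroup (Fiber m)]
  [module : ∀ m, Module ℂ (Fiber m)]
  [topTotal : TopologicalSpace (TotalSpace (EuclideanSpace ℂ (Fin rank)) Fiber)]
  [topFiber : ∀ m, TopologicalSpace (Fiber m)]
  [fiberBundle : FiberBundle (EuclideanSpace ℂ (Fin rank)) Fiber]
  [vectorBundle : VectorBundle ℂ (EuclideanSpace ℂ (Fin rank)) Fiber]
  [vectorBundleReal : VectorBundle ℝ (EuclideanSpace ℂ (Fin rank)) Fiber]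
  [contMDiffVectorBundle :
    ContMDiffVectorBundle ∞ (EuclideanSpace ℂ (Fin rank)) Fiber 𝓘(ℝ, F)]
  action : BundleAction E F G (EuclideanSpace ℂ (Fin rank)) Fiber
  clifford : ∀ m, CliffordAlgebra (cliffordForm h m) →ₐ[ℝ] Module.End ℂ (Fiber m)
  bijective_clifford : ∀ m, Function.Bijective
    (LinearMap.liftBaseChange ℂ (clifford m).toLinearMap :
      TensorProduct ℝ ℂ (CliffordAlgebra (cliffordForm h m)) →ₗ[ℂ] Module.End ℂ (Fiber m))
  smooth_clifford : ∀ (X : ∀ m : M, TangentSpace 𝓘(ℝ, F) m) (s : ∀ m, Fiber m) (m₀ : M),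
    SmoothSectionAt F F X m₀ → SmoothSectionAt F (EuclideanSpace ℂ (Fin rank)) s m₀ →
    SmoothSectionAt F (EuclideanSpace ℂ (Fin rank))
      (fun m => clifford m (CliffordAlgebra.ι _ (X m)) (s m)) m₀
  equivariant_clifford : ∀ (g : G) (m : M) (v : TangentSpace 𝓘(ℝ, F) m) (s : Fiber m),
    action.act g m (clifford m (CliffordAlgebra.ι _ v) s) =
      clifford (g • m) (CliffordAlgebra.ι _ (smulDeriv F g m v)) (action.act g m s)

attribute [instance] EquivariantSpincBundle.addCommGroup EquivariantSpincBundle.module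
  EquivariantSpincBundle.topTotal EquivariantSpincBundle.topFiber
  EquivariantSpincBundle.fiberBundle EquivariantSpincBundle.vectorBundle
  EquivariantSpincBundle.vectorBundleReal EquivariantSpincBundle.contMDiffVectorBundle

/-- The fibre at `m` of the determinant line bundle `Hom_{Cl}(S̄, S)`: the conjugate linear maps
`S_m → S_m` which commute with the Clifford action. -/
def EquivariantSpincBundle.detFiber [IsManifold 𝓘(ℝ, F) 1 M] {h : RiemannianMetricOn F M}
    (S : EquivariantSpincBundle E G h) (m : M) :
    Submodule ℂ (S.Fiber m →ₛₗ[starRingEnd ℂ] S.Fiber m) where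
  carrier := {A | ∀ (a : CliffordAlgebra (cliffordForm h m)) (s : S.Fiber m),
    A (S.clifford m a s) = S.clifford m a (A s)}
  add_mem' hA hB a s := by simp [hA a s, hB a s]
  zero_mem' a s := by simp
  smul_mem' c A hA a s := by simp [hA a s]

/-- A `G`-equivariant Hermitian line bundle on `M`: a smooth `G`-equivariant complex line bundle
with a smooth `G`-invariant Hermitian metric. -/
structure EquivariantHermitianLineBundle (E F G M : Type*) [NormedAddCommGroup E]
    [NormedSpace ℝ E] [TopologicalSpace G] [ChartedSpace E G] [Group G] [NormedAddCommGroup F]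
    [NormedSpace ℝ F] [TopologicalSpace M] [ChartedSpace F M] [MulAction G M] where
  Fiber : M → Type
  [normedAddCommGroup : ∀ m, NormedAddCommGroup (Fiber m)]
  [innerProductSpace : ∀ m, InnerProductSpace ℂ (Fiber m)]
  [topTotal : TopologicalSpace (TotalSpace ℂ Fiber)]
  [fiberBundle : FiberBundle ℂ Fiber]
  [vectorBundle : VectorBundle ℂ ℂ Fiber]
  [vectorBundleReal : VectorBundle ℝ ℂ Fiber]
  [contMDiffVectorBundle : ContMDiffVectorBundle ∞ ℂ Fiber 𝓘(ℝ, F)]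
  smooth_inner : ∀ (s t : ∀ m, Fiber m) (m₀ : M), SmoothSectionAt F ℂ s m₀ →
    SmoothSectionAt F ℂ t m₀ →
    ContMDiffAt 𝓘(ℝ, F) 𝓘(ℝ, ℂ) ∞ (fun m => inner ℂ (s m) (t m)) m₀
  action : BundleAction E F G ℂ Fiber
  inner_act : ∀ (g : G) (m : M) (s t : Fiber m),
    inner ℂ (action.act g m s) (action.act g m t) = inner ℂ s t

attribute [instance] EquivariantHermitianLineBundle.normedAddCommGroup
  EquivariantHermitianLineBundle.innerProductSpace EquivariantHermitianLineBundle.topTotal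
  EquivariantHermitianLineBundle.fiberBundle EquivariantHermitianLineBundle.vectorBundle
  EquivariantHermitianLineBundle.vectorBundleReal
  EquivariantHermitianLineBundle.contMDiffVectorBundle

/-- The section `g⁻¹·s : m ↦ g⁻¹ · s(g m)`. -/
def EquivariantHermitianLineBundle.translate (L : EquivariantHermitianLineBundle E F G M) (g : G)
    (s : ∀ m, L.Fiber m) (m : M) : L.Fiber m :=
  (L.action.act g m).symm (s (g • m))

/-- The infinitesimal action of `X ∈ 𝔤` on sections,
`(𝓛(X) s)(m) = d/dt|₀ exp(tX) · s(exp(-tX) m)`. -/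
noncomputable def EquivariantHermitianLineBundle.lieDerivative
    (L : EquivariantHermitianLineBundle E F G M) (X : LieAlg E G) (s : ∀ m, L.Fiber m) (m : M) :
    L.Fiber m :=
  -(mfderiv 𝓘(ℝ, E) 𝓘(ℝ, L.Fiber m) (fun g : G => L.translate g s m) 1 X)

/-- A `G`-invariant Hermitian connection `∇` on `L` satisfying the Kostant relations
`𝓛(X) - ∇_{X_M} = i⟨Φ, X⟩` and `∇² = -iΩ`. Thus `(L, ∇)` is a prequantum line bundle over
`(M, Ω, Φ)`. -/
structure PrequantumConnection [IsManifold 𝓘(ℝ, F) 1 M]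
    (L : EquivariantHermitianLineBundle E F G M)
    (Ω : ∀ m : M, TangentSpace 𝓘(ℝ, F) m →ₗ[ℝ] TangentSpace 𝓘(ℝ, F) m →ₗ[ℝ] ℝ)
    (Φ : M → LieDual E G) where
  cov : CovariantDerivative 𝓘(ℝ, F) ℂ L.Fiber
  [smooth : CovariantDerivative.ContMDiffCovariantDerivative cov ∞]
  complex_linear : ∀ (s : ∀ m, L.Fiber m) (m : M) (v : TangentSpace 𝓘(ℝ, F) m),
    DifferentiableSectionAt F ℂ s m →
    cov (fun m => Complex.I • s m) m v = Complex.I • cov s m v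
  hermitian : ∀ (s t : ∀ m, L.Fiber m) (m : M) (v : TangentSpace 𝓘(ℝ, F) m),
    DifferentiableSectionAt F ℂ s m → DifferentiableSectionAt F ℂ t m →
    (mfderiv 𝓘(ℝ, F) 𝓘(ℝ, ℂ) (fun m => (inner ℂ (s m) (t m) : ℂ)) m v : ℂ) =
      inner ℂ (cov s m v) (t m) + inner ℂ (s m) (cov t m v)
  invariant : ∀ (g : G) (s : ∀ m, L.Fiber m) (m : M) (v : TangentSpace 𝓘(ℝ, F) m),
    DifferentiableSectionAt F ℂ s (g • m) →
    cov (L.translate g s) m v = (L.action.act g m).symm (cov s (g • m) (smulDeriv F g m v))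
  kostant : ∀ (X : LieAlg E G) (s : ∀ m, L.Fiber m) (m : M),
    DifferentiableSectionAt F ℂ s m →
    L.lieDerivative X s m - cov s m (fundamentalField F X m) =
      (Complex.I * (Φ m X : ℂ)) • s m
  curvature : ∀ (V W : ∀ m : M, TangentSpace 𝓘(ℝ, F) m) (s : ∀ m, L.Fiber m),
    (∀ m, SmoothSectionAt F F V m) → (∀ m, SmoothSectionAt F F W m) →
    (∀ m, SmoothSectionAt F ℂ s m) → ∀ m,
    cov (fun x => cov s x (W x)) m (V m) - cov (fun x => cov s x (V x)) m (W m) -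
      cov s m (VectorField.mlieBracket 𝓘(ℝ, F) V W m) =
      (-Complex.I * (Ω m (V m) (W m) : ℂ)) • s m

/-- An isomorphism of smooth `G`-equivariant complex line bundles between `L` and the determinant
line bundle `det(S) = Hom_{Cl}(S̄, S)` of `S`, whose smooth structure is the one of a subbundle
of `Hom(S̄, S)` and on which `G` acts by conjugation. -/
structure DetLineIso [IsManifold 𝓘(ℝ, F) 1 M] {h : RiemannianMetricOn F M}
    (S : EquivariantSpincBundle E G h) (L : EquivariantHermitianLineBundle E F G M) where
  iso : ∀ m, L.Fiber m ≃ₗ[ℂ] S.detFiber m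
  smooth_iso : ∀ (l : ∀ m, L.Fiber m) (s : ∀ m, S.Fiber m) (m₀ : M), SmoothSectionAt F ℂ l m₀ →
    SmoothSectionAt F (EuclideanSpace ℂ (Fin S.rank)) s m₀ →
    SmoothSectionAt F (EuclideanSpace ℂ (Fin S.rank))
      (fun m => (iso m (l m)).1 (s m)) m₀
  equivariant_iso : ∀ (g : G) (m : M) (l : L.Fiber m) (s : S.Fiber m),
    (iso (g • m) (L.action.act g m l)).1 (S.action.act g m s) =
      S.action.act g m ((iso m l).1 s)

/-- The Hamiltonian `G`-manifold `(M, Ω, Φ)` is `spin^c`-prequantized: for some invariant Riemannian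
metric there is an equivariant `spin^c`-bundle `S` whose determinant line bundle is a
prequantum line bundle over `(M, 2Ω, 2Φ)`. -/
def IsSpincPrequantized [IsManifold 𝓘(ℝ, F) 1 M]
    (Ω : ∀ m : M, TangentSpace 𝓘(ℝ, F) m →ₗ[ℝ] TangentSpace 𝓘(ℝ, F) m →ₗ[ℝ] ℝ)
    (Φ : M → LieDual E G) : Prop :=
  ∃ h : RiemannianMetricOn F M, InvariantMetric G h ∧
    ∃ (S : EquivariantSpincBundle E G h) (L : EquivariantHermitianLineBundle E F G M),
      Nonempty (DetLineIso S L) ∧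
      Nonempty (PrequantumConnection L (fun m => (2 : ℝ) • Ω m) (fun m => (2 : ℝ) • Φ m))

end HamiltonianManifolds

section CoadjointOrbits

variable {E G : Type*} [NormedAddCommGroup E] [NormedSpace ℝ E] [FiniteDimensional ℝ E]
  [TopologicalSpace G] [ChartedSpace E G] [Group G] [LieGroup 𝓘(ℝ, E) ∞ G]

instance : LieGroup 𝓘(ℝ, E) (minSmoothness ℝ 3) G := by
  rw [minSmoothness_of_isRCLikeNormedField]; infer_instance

instance : FiniteDimensional ℝ (LieAlg E G) := inferInstanceAs (FiniteDimensional ℝ E)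

theorem exists_rightInverse_fundamentalField {lam : LieDual E G} (y : CoadjointOrbit E lam) :
    ∃ r : TangentSpace 𝓘(ℝ, CoadjointModel E lam) y →ₗ[ℝ] LieAlg E G,
      ∀ u, fundamentalField (CoadjointModel E lam) (r u) y = u := by
  let D : E →L[ℝ] CoadjointModel E lam :=
    mfderiv 𝓘(ℝ, E) 𝓘(ℝ, CoadjointModel E lam) (fun g : G => g • y) 1
  have hD : LinearMap.range (D : E →ₗ[ℝ] CoadjointModel E lam) = ⊤ :=
    LinearMap.range_eq_top.2 (LinearOrbit.surjective_mfderiv_smul y)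
  obtain ⟨r, hr⟩ := LinearMap.exists_rightInverse_of_surjective _ hD
  refine ⟨-r, fun u => ?_⟩
  change -(D (-(r u))) = u
  rw [map_neg, neg_neg]
  exact LinearMap.congr_fun hr u

/-- The moment map of a coadjoint orbit is the inclusion into `𝔤*`. -/
def momentMap (lam : LieDual E G) (y : CoadjointOrbit E lam) : LieDual E G := y.1

/-- The Kirillov-Kostant-Souriau symplectic form of a coadjoint orbit,
`Ω_ξ(X_O(ξ), Y_O(ξ)) = ⟨ξ, [X, Y]⟩`; elements `X`, `Y` of `𝔤` generating given tangent
vectors are chosen; they are unique up to the stabilizer algebra `{Z | ξ([Z, ·]) = 0}` of `ξ`, so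
that the value does not depend on the choice. -/
noncomputable def kksForm (lam : LieDual E G) (y : CoadjointOrbit E lam) :
    TangentSpace 𝓘(ℝ, CoadjointModel E lam) y →ₗ[ℝ]
      TangentSpace 𝓘(ℝ, CoadjointModel E lam) y →ₗ[ℝ] ℝ :=
  let r := (exists_rightInverse_fundamentalField y).choose
  LinearMap.mk₂ ℝ (fun u v => momentMap lam y ⁅r u, r v⁆)
    (by simp) (by simp) (by simp) (by simp)

/-- The Cartan subgroup of `G` associated with a Cartan subalgebra `𝔱`: its centralizer in `G`. -/
def cartanSubgroup (t : LieSubalgebra ℝ (LieAlg E G)) : Subgroup G where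
  carrier := {g | ∀ X ∈ t, Ad E g X = X}
  one_mem' X _ := by rw [Ad_one]; rfl
  mul_mem' {a b} ha hb X hX := by
    rw [Ad_mul, ContinuousLinearMap.comp_apply, hb X hX, ha X hX]
  inv_mem' {a} ha X hX := by
    have h : Ad E (a⁻¹ * a) X = Ad E a⁻¹ (Ad E a X) := by
      rw [Ad_mul]; rfl
    rw [inv_mul_cancel, Ad_one, ha X hX] at h
    exact h.symm

/-- The subspace `𝔱*` of `𝔤*`: the linear forms which vanish on the orthogonal of `𝔱` for the
Killing form. -/
def IsInCartanDual (t : LieSubalgebra ℝ (LieAlg E G)) (lam : LieDual E G) : Prop :=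
  ∀ X : LieAlg E G, (∀ Y ∈ t, killingForm ℝ (LieAlg E G) X Y = 0) → lam X = 0

/-- The restriction to `𝔱` of a linear form on `𝔤`. -/
noncomputable def restrictCartan (t : LieSubalgebra ℝ (LieAlg E G)) (lam : LieDual E G) : Module.Dual ℝ t :=
  (lam : LieAlg E G →ₗ[ℝ] ℝ).comp t.toSubmodule.subtype

open TensorProduct in
/-- The (real) roots of `𝔱` in `𝔤 ⊗ ℂ`: the nonzero `α ∈ 𝔱*` such that `𝔱` acts by `i α` on
some nonzero vector of `𝔤 ⊗ ℂ`. -/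
def realRoots (t : LieSubalgebra ℝ (LieAlg E G)) : Set (Module.Dual ℝ t) :=
  {α | α ≠ 0 ∧ ∃ Z : ℂ ⊗[ℝ] LieAlg E G, Z ≠ 0 ∧
    ∀ X : t, ⁅(1 : ℂ) ⊗ₜ[ℝ] (X : LieAlg E G), Z⁆ = (Complex.I * (α X : ℂ)) • Z}

/-- `γ` is the one-parameter subgroup `s ↦ exp(sX)`. -/
def IsOneParameterSubgroup (X : LieAlg E G) (γ : ℝ → G) : Prop :=
  ContMDiff 𝓘(ℝ, ℝ) 𝓘(ℝ, E) ∞ γ ∧ (∀ a b, γ (a + b) = γ a * γ b) ∧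
    (mfderiv 𝓘(ℝ, ℝ) 𝓘(ℝ, E) γ 0 (1 : ℝ) : E) = X

/-- The weight lattice `Λ ⊆ 𝔱*`: the `μ` for which there is a (unitary) character `χ` of the torus
`T` with `χ(exp X) = exp(i⟨μ, X⟩)` for `X ∈ 𝔱`. -/
def weightLattice (t : LieSubalgebra ℝ (LieAlg E G)) : Set (Module.Dual ℝ t) :=
  {μ | ∃ χ : cartanSubgroup t →* Circle, Continuous χ ∧
    ∀ (X : t) (γ : ℝ → cartanSubgroup t),
      IsOneParameterSubgroup (X : LieAlg E G) (fun s => (γ s : G)) →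
      ∀ s : ℝ, (χ (γ s) : ℂ) = Complex.exp (Complex.I * (s * μ X : ℝ))}

variable [LieAlgebra.IsSemisimple ℝ (LieAlg E G)]

/-- The bilinear form on `𝔱*` induced by the form `-B` on `𝔱`, where `B` is the Killing form
of `𝔤` (which is negative definite on `𝔱` when `𝔱` is the Lie algebra of a compact torus). -/
noncomputable def dualForm (t : LieSubalgebra ℝ (LieAlg E G)) [t.IsCartanSubalgebra]
    (μ ν : Module.Dual ℝ t) : ℝ :=
  -killingForm ℝ (LieAlg E G) ((LieAlgebra.IsKilling.cartanEquivDual t).symm μ)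
    ((LieAlgebra.IsKilling.cartanEquivDual t).symm ν)

/-- `lam ∈ 𝔱*` is regular: `(lam, α) ≠ 0` for every root `α`. -/
def IsRegularElement (t : LieSubalgebra ℝ (LieAlg E G)) [t.IsCartanSubalgebra]
    (lam : LieDual E G) : Prop :=
  ∀ α ∈ realRoots t, dualForm t (restrictCartan t lam) α ≠ 0

/-- `ρ(μ)`: half the sum of the roots `α` with `(α, μ) > 0`. -/
noncomputable def rhoShift (t : LieSubalgebra ℝ (LieAlg E G)) [t.IsCartanSubalgebra]
    (μ : Module.Dual ℝ t) : Module.Dual ℝ t :=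
  (1 / 2 : ℝ) • ∑ᶠ α ∈ {α | α ∈ realRoots t ∧ 0 < dualForm t α μ}, α

/-- The orbit of `lam` is admissible: `μ - ρ(μ) ∈ Λ` for all `μ` in the intersection of the orbit
with `𝔱*`. -/
def IsAdmissibleOrbit (t : LieSubalgebra ℝ (LieAlg E G)) [t.IsCartanSubalgebra]
    (lam : LieDual E G) : Prop :=
  ∀ y : CoadjointOrbit E lam, IsInCartanDual t (momentMap lam y) →
    restrictCartan t (momentMap lam y) - rhoShift t (restrictCartan t (momentMap lam y)) ∈
      weightLattice t

end CoadjointOrbits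

section Charts

variable {E M : Type*} [NormedAddCommGroup E] [NormedSpace ℝ E] [TopologicalSpace M]
  [ChartedSpace E M]

theorem hasMFDerivAt_chartAt_self [IsManifold 𝓘(ℝ, E) 1 M] (m : M) :
    HasMFDerivAt 𝓘(ℝ, E) 𝓘(ℝ, E) (chartAt E m) m (ContinuousLinearMap.id ℝ E) := by
  have h1 : m ∈ (chartAt E m).source := mem_chart_source E m
  refine ⟨((chartAt E m).continuousAt h1), ?_⟩
  refine HasFDerivAt.hasFDerivWithinAt (𝕜 := ℝ) (E := E) (F := E) ?_
  refine (hasFDerivAt_id (𝕜 := ℝ) (E := E) _).congr_of_eventuallyEq ?_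
  filter_upwards [(chartAt E m).open_target.mem_nhds ((chartAt E m).map_source h1)] with y hy
  exact (chartAt E m).right_inv hy

theorem hasMFDerivAt_chartAt_symm_self [IsManifold 𝓘(ℝ, E) 1 M] (m : M) :
    HasMFDerivAt 𝓘(ℝ, E) 𝓘(ℝ, E) (chartAt E m).symm (chartAt E m m)
      (ContinuousLinearMap.id ℝ E) := by
  have h1 : m ∈ (chartAt E m).source := mem_chart_source E m
  have h2 := (chartAt E m).map_source h1
  refine ⟨((chartAt E m).symm.continuousAt h2), ?_⟩
  refine HasFDerivAt.hasFDerivWithinAt (𝕜 := ℝ) (E := E) (F := E) ?_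
  refine (hasFDerivAt_id (𝕜 := ℝ) (E := E) _).congr_of_eventuallyEq ?_
  filter_upwards [(chartAt E m).open_target.mem_nhds ((chartAt E m).map_source h1)] with y hy
  change chartAt E ((chartAt E m).symm (chartAt E m m)) ((chartAt E m).symm y) = y
  rw [(chartAt E m).left_inv h1]
  exact (chartAt E m).right_inv hy

theorem mdifferentiableAt_chartAt_symm [IsManifold 𝓘(ℝ, E) 1 M] (m : M) {x : E}
    (hx : x ∈ (chartAt E m).target) :
    MDifferentiableAt 𝓘(ℝ, E) 𝓘(ℝ, E) (chartAt E m).symm x :=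
  (contMDiffOn_chart_symm.contMDiffAt (n := 1)
    ((chartAt E m).open_target.mem_nhds hx)).mdifferentiableAt (by simp)

theorem mdifferentiableAt_chartAt [IsManifold 𝓘(ℝ, E) 1 M] (m : M) {x : M}
    (hx : x ∈ (chartAt E m).source) :
    MDifferentiableAt 𝓘(ℝ, E) 𝓘(ℝ, E) (chartAt E m) x :=
  (contMDiffOn_chart.contMDiffAt (n := 1)
    ((chartAt E m).open_source.mem_nhds hx)).mdifferentiableAt (by simp)

theorem mfderiv_chartAt_comp_symm [IsManifold 𝓘(ℝ, E) 1 M] (m : M) {x : E}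
    (hx : x ∈ (chartAt E m).target) :
    (mfderiv 𝓘(ℝ, E) 𝓘(ℝ, E) (chartAt E m) ((chartAt E m).symm x)).comp
      (mfderiv 𝓘(ℝ, E) 𝓘(ℝ, E) (chartAt E m).symm x) = ContinuousLinearMap.id ℝ E := by
  have h := ((mdifferentiableAt_chartAt m ((chartAt E m).map_target hx)).hasMFDerivAt).comp x
    (mdifferentiableAt_chartAt_symm m hx).hasMFDerivAt
  refine hasMFDerivAt_unique (h.congr_of_eventuallyEq (f₁ := id) ?_) (hasMFDerivAt_id x)
  filter_upwards [(chartAt E m).open_target.mem_nhds hx] with y hy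
  exact ((chartAt E m).right_inv hy).symm

theorem mfderiv_chartAt_symm_comp [IsManifold 𝓘(ℝ, E) 1 M] (m : M) {x : E}
    (hx : x ∈ (chartAt E m).target) :
    (mfderiv 𝓘(ℝ, E) 𝓘(ℝ, E) (chartAt E m).symm x).comp
      (mfderiv 𝓘(ℝ, E) 𝓘(ℝ, E) (chartAt E m) ((chartAt E m).symm x)) =
      ContinuousLinearMap.id ℝ _ := by
  have hs := (chartAt E m).map_target hx
  have h0 := (mdifferentiableAt_chartAt_symm m hx).hasMFDerivAt
  nth_rewrite 1 [← (chartAt E m).right_inv hx] at h0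
  have h := h0.comp ((chartAt E m).symm x) (mdifferentiableAt_chartAt m hs).hasMFDerivAt
  refine hasMFDerivAt_unique (h.congr_of_eventuallyEq (f₁ := id) ?_) (hasMFDerivAt_id _)
  filter_upwards [(chartAt E m).open_source.mem_nhds hs] with y hy
  exact ((chartAt E m).left_inv hy).symm

/-- The Lie bracket of vector fields, computed from their expressions in the preferred chart. -/
theorem mlieBracket_eq_fderiv [IsManifold 𝓘(ℝ, E) 1 M] {m : M}
    {V W : ∀ x : M, TangentSpace 𝓘(ℝ, E) x} {V' W' : E → E}
    (hV : ∀ᶠ x in 𝓝 (chartAt E m m),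
      mfderiv 𝓘(ℝ, E) 𝓘(ℝ, E) (chartAt E m).symm x (V' x) = V ((chartAt E m).symm x))
    (hW : ∀ᶠ x in 𝓝 (chartAt E m m),
      mfderiv 𝓘(ℝ, E) 𝓘(ℝ, E) (chartAt E m).symm x (W' x) = W ((chartAt E m).symm x)) :
    VectorField.mlieBracket 𝓘(ℝ, E) V W m =
      (fderiv ℝ W' (chartAt E m m) (V' (chartAt E m m)) -
        fderiv ℝ V' (chartAt E m m) (W' (chartAt E m m)) : E) := by
  have ht := (chartAt E m).open_target.mem_nhds
    ((chartAt E m).map_source (mem_chart_source E m))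
  have key : ∀ {V : ∀ x : M, TangentSpace 𝓘(ℝ, E) x} {V' : E → E},
      (∀ᶠ x in 𝓝 (chartAt E m m),
        mfderiv 𝓘(ℝ, E) 𝓘(ℝ, E) (chartAt E m).symm x (V' x) = V ((chartAt E m).symm x)) →
      (VectorField.mpullbackWithin 𝓘(ℝ, E) 𝓘(ℝ, E) (chartAt E m).symm V univ : E → E)
        =ᶠ[𝓝 (chartAt E m m)] V' := by
    intro V V' hV
    filter_upwards [hV, ht] with x hx hxt
    rw [VectorField.mpullbackWithin_apply, mfderivWithin_univ, ← hx,
      ContinuousLinearMap.inverse_eq (mfderiv_chartAt_symm_comp m hxt)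
        (mfderiv_chartAt_comp_symm m hxt)]
    exact DFunLike.congr_fun (mfderiv_chartAt_comp_symm m hxt) (V' x)
  rw [← VectorField.mlieBracketWithin_univ, VectorField.mlieBracketWithin_apply]
  have e0 : mfderiv 𝓘(ℝ, E) 𝓘(ℝ, E) (extChartAt 𝓘(ℝ, E) m) m = ContinuousLinearMap.id ℝ E :=
    (hasMFDerivAt_chartAt_self m).mfderiv
  have e1 : ∀ v : E, (mfderiv 𝓘(ℝ, E) 𝓘(ℝ, E) (extChartAt 𝓘(ℝ, E) m) m).inverse v = v := by
    intro v
    rw [e0]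
    exact DFunLike.congr_fun (ContinuousLinearMap.inverse_id (R := ℝ) (M := E)) v
  refine (e1 _).trans ?_
  have e2 : ∀ (s : Set E) (x : E) (V W : E → E), s = univ →
      VectorField.lieBracketWithin ℝ V W s x = fderiv ℝ W x (V x) - fderiv ℝ V x (W x) := by
    rintro s x V W rfl
    rw [VectorField.lieBracketWithin_univ]
    rfl
  have e3 : (range 𝓘(ℝ, E) : Set E) = univ := by simp
  rw [e3]
  refine (e2 _ _ _ _ (by simp)).trans ?_
  have e4 : ∀ (x : E) (V W V' W' : E → E), V =ᶠ[𝓝 x] V' → W =ᶠ[𝓝 x] W' →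
      fderiv ℝ W x (V x) - fderiv ℝ V x (W x) = fderiv ℝ W' x (V' x) - fderiv ℝ V' x (W' x) := by
    intro x V W V' W' h1 h2
    rw [h1.fderiv_eq, h2.fderiv_eq, h1.eq_of_nhds, h2.eq_of_nhds]
  exact e4 _ _ _ _ _ (key hV) (key hW)

end Charts

section LieGroupChart

variable {E G : Type*} [NormedAddCommGroup E] [NormedSpace ℝ E]
  [TopologicalSpace G] [ChartedSpace E G] [Group G]

variable (E G) in
/-- The multiplication of `G`, read in the chart at `1`. -/
noncomputable def chartMul (p : E × E) : E :=
  chartAt E (1 : G) ((chartAt E (1 : G)).symm p.1 * (chartAt E (1 : G)).symm p.2)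

variable (E G) in
/-- The derivative at `1` of the left translations, read in the chart at `1`. -/
noncomputable def chartLeft (x : E) : E →L[ℝ] E :=
  (fderiv ℝ (chartMul E G) (x, chartAt E (1 : G) 1)).comp (ContinuousLinearMap.inr ℝ E E)

variable [LieGroup 𝓘(ℝ, E) ∞ G]

theorem contDiffAt_chartMul {x y : E} (hx : x ∈ (chartAt E (1 : G)).target)
    (hy : y ∈ (chartAt E (1 : G)).target)
    (h : (chartAt E (1 : G)).symm x * (chartAt E (1 : G)).symm y ∈ (chartAt E (1 : G)).source) :
    ContDiffAt ℝ ∞ (chartMul E G) (x, y) := by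
  set c := chartAt E (1 : G)
  have hcs : ContMDiffOn 𝓘(ℝ, E) 𝓘(ℝ, E) ∞ c.symm c.target := contMDiffOn_chart_symm
  have hcc : ContMDiffOn 𝓘(ℝ, E) 𝓘(ℝ, E) ∞ c c.source := contMDiffOn_chart
  have h1 := (hcs.contMDiffAt (c.open_target.mem_nhds hx)).comp (x, y)
    (contDiff_fst (𝕜 := ℝ) (E := E) (F := E)).contMDiff.contMDiffAt
  have h2 := (hcs.contMDiffAt (c.open_target.mem_nhds hy)).comp (x, y)
    (contDiff_snd (𝕜 := ℝ) (E := E) (F := E)).contMDiff.contMDiffAt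
  exact ((hcc.contMDiffAt (c.open_source.mem_nhds h)).comp (x, y) (h1.mul h2)).contDiffAt

theorem contDiffAt_chartMul_right_one {x : E} (hx : x ∈ (chartAt E (1 : G)).target) :
    ContDiffAt ℝ ∞ (chartMul E G) (x, chartAt E (1 : G) 1) := by
  have h1 : (1 : G) ∈ (chartAt E (1 : G)).source := mem_chart_source E 1
  refine contDiffAt_chartMul hx ((chartAt E (1 : G)).map_source h1) ?_
  rw [(chartAt E (1 : G)).left_inv h1, mul_one]
  exact (chartAt E (1 : G)).map_target hx

theorem contDiffAt_chartLeft {x : E} (hx : x ∈ (chartAt E (1 : G)).target) :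
    ContDiffAt ℝ ∞ (chartLeft E G) x := by
  have h1 : ContDiffAt ℝ ∞ (fderiv ℝ (chartMul E G)) (x, chartAt E (1 : G) 1) :=
    (contDiffAt_chartMul_right_one hx).fderiv_right (by simp)
  exact (h1.comp x (contDiffAt_id.prodMk contDiffAt_const)).clm_comp contDiffAt_const

theorem hasFDerivAt_chartMul_right {x : E} (hx : x ∈ (chartAt E (1 : G)).target) :
    HasFDerivAt (fun y => chartMul E G (x, y)) (chartLeft E G x) (chartAt E (1 : G) 1) :=
  ((contDiffAt_chartMul_right_one hx).differentiableAt (by simp)).hasFDerivAt.comp _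
    (hasFDerivAt_prodMk_right x _)

theorem chartLeft_one : chartLeft E G (chartAt E (1 : G) 1) = ContinuousLinearMap.id ℝ E := by
  set c := chartAt E (1 : G)
  have h1 : (1 : G) ∈ c.source := mem_chart_source E 1
  refine (hasFDerivAt_chartMul_right (c.map_source h1)).unique ?_
  refine (hasFDerivAt_id _).congr_of_eventuallyEq ?_
  filter_upwards [c.open_target.mem_nhds (c.map_source h1)] with y hy
  simp [chartMul, c, c.right_inv hy]

/-- Left invariant vector fields in the chart at `1`. -/
theorem mfderiv_chart_symm_chartLeft {x : E} (hx : x ∈ (chartAt E (1 : G)).target) (Y : E) :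
    mfderiv 𝓘(ℝ, E) 𝓘(ℝ, E) (chartAt E (1 : G)).symm x (chartLeft E G x Y) =
      mulInvariantVectorField (I := 𝓘(ℝ, E)) (G := G) (Y : GroupLieAlgebra 𝓘(ℝ, E) G)
        ((chartAt E (1 : G)).symm x) := by
  have : IsManifold 𝓘(ℝ, E) 1 G := IsManifold.of_le (n := ∞) (by simp)
  set c := chartAt E (1 : G) with hc
  have h1 : (1 : G) ∈ c.source := mem_chart_source E 1
  have hm : chartMul E G (x, c 1) = x := by
    simp [chartMul, ← hc, c.left_inv h1, c.right_inv hx]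
  have a1 := (mdifferentiableAt_chartAt_symm (1 : G) hx).hasMFDerivAt
  rw [← hm] at a1
  have a2 := a1.comp (c 1) (hasFDerivAt_chartMul_right hx).hasMFDerivAt
  have b1 := hasMFDerivAt_chartAt_symm_self (E := E) (1 : G)
  have b2 : HasMFDerivAt 𝓘(ℝ, E) 𝓘(ℝ, E) (fun h => c.symm x * h) (1 : G)
      (mfderiv 𝓘(ℝ, E) 𝓘(ℝ, E) (fun h => c.symm x * h) (1 : G)) :=
    ((contMDiff_mul_left (I := 𝓘(ℝ, E)) (n := ∞) (a := c.symm x)).mdifferentiableAt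
      (by simp)).hasMFDerivAt
  have b2' := b2
  rw [← c.left_inv h1] at b2
  have b3 := b2.comp (c 1) b1
  have e : (fun h => c.symm x * h) ∘ c.symm =ᶠ[𝓝 (c 1)]
      (c.symm ∘ fun y => chartMul E G (x, y)) := by
    have a1 : ContinuousAt (fun y => c.symm x * c.symm y) (c 1) := b3.continuousAt
    have a3 : c.source ∈ 𝓝 (c.symm x * c.symm (c 1)) := by
      rw [c.left_inv h1, mul_one]
      exact c.open_source.mem_nhds (c.map_target hx)
    filter_upwards [a1 a3] with y hy
    exact (c.left_inv hy).symm
  have h3 := hasMFDerivAt_unique (a2.congr_of_eventuallyEq e) b3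
  have h4 := DFunLike.congr_fun h3 Y
  rw [hm, c.left_inv h1] at h4
  exact h4

theorem lie_eq_chartLeft (X Y : LieAlg E G) :
    (⁅X, Y⁆ : LieAlg E G) = (fderiv ℝ (chartLeft E G) (chartAt E (1 : G) 1) (X : E) (Y : E) -
      fderiv ℝ (chartLeft E G) (chartAt E (1 : G) 1) (Y : E) (X : E) : E) := by
  have : IsManifold 𝓘(ℝ, E) 1 G := IsManifold.of_le (n := ∞) (by simp)
  have ht := (chartAt E (1 : G)).map_source (mem_chart_source E (1 : G))
  have key : ∀ Z : E, HasFDerivAt (fun x => chartLeft E G x Z)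
      ((fderiv ℝ (chartLeft E G) (chartAt E (1 : G) 1)).flip Z) (chartAt E (1 : G) 1) := by
    intro Z
    have := ((contDiffAt_chartLeft ht).differentiableAt (by simp)).hasFDerivAt.clm_apply
      (hasFDerivAt_const Z (chartAt E (1 : G) 1))
    refine this.congr_fderiv ?_
    ext; simp
  rw [GroupLieAlgebra.bracket_def]
  have h := fun Z : E => (Filter.eventually_of_mem ((chartAt E (1 : G)).open_target.mem_nhds ht)
    fun x hx => mfderiv_chart_symm_chartLeft (G := G) hx Z)
  rw [mlieBracket_eq_fderiv (h X) (h Y), (key X).fderiv, (key Y).fderiv]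
  simp only [chartLeft_one]
  rfl

variable (G) in
/-- The Lie bracket of `𝔤`, read in the model space. -/
noncomputable def bracketModel (X Y : E) : E :=
  (fun X' Y' : LieAlg E G => (⁅X', Y'⁆ : LieAlg E G)) X Y

theorem bracketModel_eq (X Y : E) : bracketModel G X Y =
    fderiv ℝ (chartLeft E G) (chartAt E (1 : G) 1) X Y -
      fderiv ℝ (chartLeft E G) (chartAt E (1 : G) 1) Y X :=
  lie_eq_chartLeft (E := E) (G := G) X Y

theorem HasMFDerivAt.toModel {F : Type*} [NormedAddCommGroup F] [NormedSpace ℝ F] {f : F → E}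
    {f' : F →L[ℝ] E} {y : F} (h : HasMFDerivAt 𝓘(ℝ, F) 𝓘(ℝ, E) f y f') : HasFDerivAt f f' y :=
  hasMFDerivAt_iff_hasFDerivAt.1 h

section LeftLogDeriv

variable {F N : Type*} [NormedAddCommGroup F] [NormedSpace ℝ F]
    [TopologicalSpace N] [ChartedSpace F N]

variable (E) in
/-- The Maurer-Cartan form of a map into `G`. -/
noncomputable def leftLogDeriv (σ : N → G) (z : N) : F →L[ℝ] E :=
  mfderiv 𝓘(ℝ, F) 𝓘(ℝ, E) (fun y => (σ z)⁻¹ * σ y) z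

theorem leftLogDeriv_const_mul (g : G) (σ : N → G) :
    leftLogDeriv E (fun y => g * σ y) = leftLogDeriv E (F := F) σ := by
  funext z
  have h : ∀ f h : N → G, f = h → (mfderiv 𝓘(ℝ, F) 𝓘(ℝ, E) f z : F →L[ℝ] E) =
      mfderiv 𝓘(ℝ, F) 𝓘(ℝ, E) h z := by
    rintro f _ rfl; rfl
  exact h _ _ (by ext y; group)

theorem chartLeft_leftLogDeriv {σ : F → G} {y : F}
    (hσ : ContMDiffAt 𝓘(ℝ, F) 𝓘(ℝ, E) ∞ σ y) (hys : σ y ∈ (chartAt E (1 : G)).source) (w : F) :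
    chartLeft E G (chartAt E (1 : G) (σ y)) (leftLogDeriv E σ y w) =
      fderiv ℝ (fun x => chartAt E (1 : G) (σ x)) y w := by
  have : IsManifold 𝓘(ℝ, E) 1 G := IsManifold.of_le (n := ∞) (by simp)
  set c := chartAt E (1 : G) with hc
  have h1c : (1 : G) ∈ c.source := mem_chart_source E 1
  set s : F → E := fun y => c (σ y) with hs
  have hsd : ContDiffAt ℝ ∞ s y :=
    ((contMDiffOn_chart.contMDiffAt (c.open_source.mem_nhds hys)).comp y hσ).contDiffAt
  have a1 : HasMFDerivAt 𝓘(ℝ, F) 𝓘(ℝ, E) (fun x => (σ y)⁻¹ * σ x) y (leftLogDeriv E (F := F) σ y) :=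
    (((contMDiff_mul_left (I := 𝓘(ℝ, E)) (n := ∞) (a := (σ y)⁻¹)).contMDiffAt.comp y
      hσ).mdifferentiableAt (by simp)).hasMFDerivAt
  have a2 := hasMFDerivAt_chartAt_self (E := E) (1 : G)
  have e1 : (σ y)⁻¹ * σ y = 1 := by simp
  have a3 : HasFDerivAt (fun x : F => c ((σ y)⁻¹ * σ x)) (leftLogDeriv E σ y : F →L[ℝ] E) y := by
    have e2 : ∀ g : G, g = 1 → HasMFDerivAt 𝓘(ℝ, E) 𝓘(ℝ, E) c g (ContinuousLinearMap.id ℝ E) := by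
      rintro g rfl; exact a2
    exact HasMFDerivAt.toModel ((e2 _ e1).comp y a1)
  have a4 := hasFDerivAt_chartMul_right (G := G) (c.map_source hys)
  have e2 : c 1 = c ((σ y)⁻¹ * σ y) := by simp
  rw [← hc, e2] at a4
  have a5 := a4.comp y a3
  have a6 : HasFDerivAt s (fderiv ℝ s y) y :=
    (hsd.differentiableAt (by simp)).hasFDerivAt
  have hev' : (fun x => chartMul E G (s y, c ((σ y)⁻¹ * σ x))) =ᶠ[𝓝 y] s := by
    have b1 : ContinuousAt (fun x => (σ y)⁻¹ * σ x) y := a1.continuousAt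
    have b2 : c.source ∈ 𝓝 ((σ y)⁻¹ * σ y) := by rw [e1]; exact c.open_source.mem_nhds h1c
    filter_upwards [b1 b2] with x hx
    simp only [chartMul, ← hc, hs]
    rw [c.left_inv hys, c.left_inv hx, mul_inv_cancel_left]
  exact DFunLike.congr_fun ((a5.congr_of_eventuallyEq hev'.symm).unique a6) w

theorem eventually_chartLeft_leftLogDeriv {σ : F → G} {U : Set F} (hU : IsOpen U)
    (hσ : ContMDiffOn 𝓘(ℝ, F) 𝓘(ℝ, E) ∞ σ U) {z : F} (hz : z ∈ U) (h1 : σ z = 1) :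
    (∀ᶠ y in 𝓝 z, (chartLeft E G (chartAt E (1 : G) (σ y))).comp (leftLogDeriv E σ y) =
      fderiv ℝ (fun x => chartAt E (1 : G) (σ x)) y) ∧
    ContDiffAt ℝ ∞ (fun x => chartAt E (1 : G) (σ x)) z := by
  have : IsManifold 𝓘(ℝ, E) 1 G := IsManifold.of_le (n := ∞) (by simp)
  set c := chartAt E (1 : G) with hc
  have h1c : (1 : G) ∈ c.source := mem_chart_source E 1
  have hσz : ContMDiffAt 𝓘(ℝ, F) 𝓘(ℝ, E) ∞ σ z := hσ.contMDiffAt (hU.mem_nhds hz)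
  constructor
  · have hev : ∀ᶠ y in 𝓝 z, σ y ∈ c.source := by
      apply hσz.continuousAt
      rw [h1]; exact c.open_source.mem_nhds h1c
    filter_upwards [hev, hU.mem_nhds hz] with y hy hyU
    ext w
    exact chartLeft_leftLogDeriv (hσ.contMDiffAt (hU.mem_nhds hyU)) hy w
  · refine ((contMDiffOn_chart.contMDiffAt (c.open_source.mem_nhds ?_)).comp z hσz).contDiffAt
    rw [h1]; exact h1c

theorem contDiffAt_leftLogDeriv [CompleteSpace E] {σ : F → G} {U : Set F} (hU : IsOpen U)
    (hσ : ContMDiffOn 𝓘(ℝ, F) 𝓘(ℝ, E) ∞ σ U) {z : F} (hz : z ∈ U) :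
    ContDiffAt ℝ ∞ (leftLogDeriv E σ : F → F →L[ℝ] E) z := by
  have : IsManifold 𝓘(ℝ, E) 1 G := IsManifold.of_le (n := ∞) (by simp)
  wlog h1 : σ z = 1 generalizing σ
  · rw [← leftLogDeriv_const_mul (σ z)⁻¹ σ]
    exact this (contMDiff_mul_left.comp_contMDiffOn hσ) (by simp)
  obtain ⟨h2, h3⟩ := eventually_chartLeft_leftLogDeriv hU hσ hz h1
  set c := chartAt E (1 : G) with hc
  have hL : ContDiffAt ℝ ∞ (fun y => chartLeft E G (c (σ y))) z := by
    refine ContDiffAt.comp (g := chartLeft E G) z ?_ h3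
    rw [h1]
    exact contDiffAt_chartLeft (c.map_source (mem_chart_source E 1))
  have hL1 : chartLeft E G (c (σ z)) = ContinuousLinearMap.id ℝ E := by
    rw [h1]; exact chartLeft_one
  have hinv : ContDiffAt ℝ ∞ (fun y : F => (chartLeft E G (c (σ y))).inverse) z := by
    have := contDiffAt_map_inverse (𝕜 := ℝ) (n := ∞) (E := E) (F := E)
      (ContinuousLinearEquiv.refl ℝ E)
    exact ContDiffAt.comp (g := fun A : E →L[ℝ] E => A.inverse) z (by rw [hL1]; exact this) hL
  refine (ContDiffAt.clm_comp (E := F) (F := E) (G := E) (X := F) hinv (h3.fderiv_right (m := ∞) (by simp))).congr_of_eventuallyEq ?_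
  have hev : ∀ᶠ y in 𝓝 z, ∃ e : E ≃L[ℝ] E, (e : E →L[ℝ] E) = chartLeft E G (c (σ y)) :=
    hL.continuousAt.eventually (p := fun A => ∃ e : E ≃L[ℝ] E, (e : E →L[ℝ] E) = A) (by
      simp only [hL1]; exact ContinuousLinearEquiv.nhds (ContinuousLinearEquiv.refl ℝ E))
  filter_upwards [h2, hev] with y hy ⟨e, he⟩
  rw [← hy, ← he, ContinuousLinearMap.inverse_equiv]
  ext; simp

/-- The Maurer-Cartan equation. -/
theorem fderiv_leftLogDeriv [CompleteSpace E] {σ : F → G} {U : Set F} (hU : IsOpen U)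
    (hσ : ContMDiffOn 𝓘(ℝ, F) 𝓘(ℝ, E) ∞ σ U) {z : F} (hz : z ∈ U) (u w : F) :
    fderiv ℝ (leftLogDeriv E σ : F → F →L[ℝ] E) z u w -
      fderiv ℝ (leftLogDeriv E σ : F → F →L[ℝ] E) z w u =
      - bracketModel G (leftLogDeriv E σ z u) (leftLogDeriv E σ z w) := by
  wlog h1 : σ z = 1 generalizing σ
  · have := this (σ := fun y => (σ z)⁻¹ * σ y) (contMDiff_mul_left.comp_contMDiffOn hσ) (by simp)
    rwa [leftLogDeriv_const_mul (σ z)⁻¹ σ] at this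
  obtain ⟨h2, h3⟩ := eventually_chartLeft_leftLogDeriv hU hσ hz h1
  set c := chartAt E (1 : G) with hc
  have hs : HasFDerivAt (fun x => c (σ x)) (fderiv ℝ (fun x => c (σ x)) z) z :=
    (h3.differentiableAt (by simp)).hasFDerivAt
  have hL : HasFDerivAt (chartLeft E G) (fderiv ℝ (chartLeft E G) (c 1)) (c (σ z)) := by
    rw [h1]
    exact ((contDiffAt_chartLeft (c.map_source (mem_chart_source E 1))).differentiableAt
      (by simp)).hasFDerivAt
  have hω := ((contDiffAt_leftLogDeriv hU hσ hz).differentiableAt (by simp)).hasFDerivAt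
  have h4 := (hL.comp z hs).clm_comp hω
  have h5 := ((h3.fderiv_right (m := ∞) (by simp)).differentiableAt (by simp)).hasFDerivAt
  have h6 := (h5.congr_of_eventuallyEq h2).unique h4
  have hz2 := h2.self_of_nhds
  have hL1 : chartLeft E G (c (σ z)) = ContinuousLinearMap.id ℝ E := by
    rw [h1]; exact chartLeft_one
  rw [hL1, ContinuousLinearMap.id_comp] at hz2
  have hsym : IsSymmSndFDerivAt ℝ (fun x => c (σ x)) z :=
    h3.isSymmSndFDerivAt (by simpa using ENat.LEInfty.out)
  have key : ∀ u w : F, fderiv ℝ (fderiv ℝ (fun x => c (σ x))) z u w =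
      fderiv ℝ (chartLeft E G) (c 1) (leftLogDeriv E σ z u) (leftLogDeriv E σ z w) +
        fderiv ℝ (leftLogDeriv E σ : F → F →L[ℝ] E) z u w := by
    intro u w
    rw [h6, hz2]
    simp [hL1]
    rw [add_comm]
  have k1 := key u w
  have k2 := key w u
  rw [bracketModel_eq]
  have k3 := hsym u w
  rw [k1, k2] at k3
  rw [← hc, neg_sub, sub_eq_sub_iff_add_eq_add, add_comm, k3, add_comm]

end LeftLogDeriv

end LieGroupChart

section AdDerivative

variable {E G : Type*} [NormedAddCommGroup E] [NormedSpace ℝ E]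
  [TopologicalSpace G] [ChartedSpace E G] [Group G] [LieGroup 𝓘(ℝ, E) ∞ G]

variable (E G) in
/-- The derivative at `1` of the right translations, read in the chart at `1`. -/
noncomputable def chartRight (x : E) : E →L[ℝ] E :=
  (fderiv ℝ (chartMul E G) (chartAt E (1 : G) 1, x)).comp (ContinuousLinearMap.inl ℝ E E)

theorem contDiffAt_chartMul_left_one {x : E} (hx : x ∈ (chartAt E (1 : G)).target) :
    ContDiffAt ℝ ∞ (chartMul E G) (chartAt E (1 : G) 1, x) := by
  have h1 : (1 : G) ∈ (chartAt E (1 : G)).source := mem_chart_source E 1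
  refine contDiffAt_chartMul ((chartAt E (1 : G)).map_source h1) hx ?_
  rw [(chartAt E (1 : G)).left_inv h1, one_mul]
  exact (chartAt E (1 : G)).map_target hx

theorem contDiffAt_chartRight {x : E} (hx : x ∈ (chartAt E (1 : G)).target) :
    ContDiffAt ℝ ∞ (chartRight E G) x := by
  have h1 : ContDiffAt ℝ ∞ (fderiv ℝ (chartMul E G)) (chartAt E (1 : G) 1, x) :=
    (contDiffAt_chartMul_left_one hx).fderiv_right (by simp)
  exact (h1.comp x (contDiffAt_const.prodMk contDiffAt_id)).clm_comp contDiffAt_const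

theorem hasFDerivAt_chartMul_left {x : E} (hx : x ∈ (chartAt E (1 : G)).target) :
    HasFDerivAt (fun y => chartMul E G (y, x)) (chartRight E G x) (chartAt E (1 : G) 1) :=
  HasFDerivAt.comp (f := fun y : E => (y, x)) (g := chartMul E G) (chartAt E (1 : G) 1)
    ((contDiffAt_chartMul_left_one hx).differentiableAt (by simp)).hasFDerivAt
    (hasFDerivAt_prodMk_left _ x)

theorem chartRight_one : chartRight E G (chartAt E (1 : G) 1) = ContinuousLinearMap.id ℝ E := by
  set c := chartAt E (1 : G)
  have h1 : (1 : G) ∈ c.source := mem_chart_source E 1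
  refine (hasFDerivAt_chartMul_left (c.map_source h1)).unique ?_
  refine (hasFDerivAt_id _).congr_of_eventuallyEq ?_
  filter_upwards [c.open_target.mem_nhds (c.map_source h1)] with y hy
  simp [chartMul, c, c.right_inv hy]

theorem fderiv_chartRight_one (X Y : E) :
    fderiv ℝ (chartRight E G) (chartAt E (1 : G) 1) X Y =
      fderiv ℝ (chartLeft E G) (chartAt E (1 : G) 1) Y X := by
  set c := chartAt E (1 : G) with hc
  have h1 : c 1 ∈ c.target := c.map_source (mem_chart_source E 1)
  have h2 : ContDiffAt ℝ ∞ (chartMul E G) (c 1, c 1) := contDiffAt_chartMul_left_one h1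
  have h3 : HasFDerivAt (fderiv ℝ (chartMul E G)) (fderiv ℝ (fderiv ℝ (chartMul E G)) (c 1, c 1))
      (c 1, c 1) :=
    ((h2.fderiv_right (m := ∞) (by simp)).differentiableAt (by simp)).hasFDerivAt
  have hsym : IsSymmSndFDerivAt ℝ (chartMul E G) (c 1, c 1) :=
    h2.isSymmSndFDerivAt (by simpa using ENat.LEInfty.out)
  have hR : HasFDerivAt (chartRight E G) _ (c 1) :=
    (HasFDerivAt.comp (f := fun y : E => (c 1, y)) (c 1) h3
      (hasFDerivAt_prodMk_right (c 1) (c 1))).clm_comp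
      (hasFDerivAt_const (ContinuousLinearMap.inl ℝ E E) (c 1))
  have hL : HasFDerivAt (chartLeft E G) _ (c 1) :=
    (HasFDerivAt.comp (f := fun y : E => (y, c 1)) (c 1) h3
      (hasFDerivAt_prodMk_left (c 1) (c 1))).clm_comp
      (hasFDerivAt_const (ContinuousLinearMap.inr ℝ E E) (c 1))
  rw [hR.fderiv, hL.fderiv]
  simpa using hsym (0, X) (Y, 0)

theorem hasMFDerivAt_conj (g : G) :
    HasMFDerivAt 𝓘(ℝ, E) 𝓘(ℝ, E) (fun h : G => g * h * g⁻¹) 1 (AdModel E g) :=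
  ((contMDiff_mul_right.comp (contMDiff_mul_left (I := 𝓘(ℝ, E)) (n := ∞) (a := g)) :
    ContMDiff 𝓘(ℝ, E) 𝓘(ℝ, E) ∞ (fun h : G => g * h * g⁻¹)).mdifferentiableAt
      (by simp)).hasMFDerivAt

theorem chartRight_comp_Ad {g : G} (hg : g ∈ (chartAt E (1 : G)).source) :
    (chartRight E G (chartAt E (1 : G) g)).comp (AdModel E g) =
      chartLeft E G (chartAt E (1 : G) g) := by
  have : IsManifold 𝓘(ℝ, E) 1 G := IsManifold.of_le (n := ∞) (by simp)
  set c := chartAt E (1 : G) with hc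
  have h1c : (1 : G) ∈ c.source := mem_chart_source E 1
  have e1 : g * 1 * g⁻¹ = 1 := by simp
  have a1 := hasMFDerivAt_conj (E := E) g
  have a2 : HasMFDerivAt 𝓘(ℝ, E) 𝓘(ℝ, E) c (g * 1 * g⁻¹) (ContinuousLinearMap.id ℝ E) := by
    have e2 : ∀ g : G, g = 1 → HasMFDerivAt 𝓘(ℝ, E) 𝓘(ℝ, E) c g (ContinuousLinearMap.id ℝ E) := by
      rintro g rfl; exact hasMFDerivAt_chartAt_self (E := E) (1 : G)
    exact e2 _ e1
  have a3 := a2.comp (1 : G) a1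
  have a4 := hasMFDerivAt_chartAt_symm_self (E := E) (1 : G)
  rw [← c.left_inv h1c] at a3
  have a5 : HasFDerivAt (fun y : E => c (g * c.symm y * g⁻¹)) (AdModel E g) (c 1) :=
    HasMFDerivAt.toModel (a3.comp (c 1) a4)
  have b1 := hasFDerivAt_chartMul_left (G := G) (c.map_source hg)
  have e3 : c 1 = c (g * c.symm (c 1) * g⁻¹) := by simp [c.left_inv h1c]
  rw [← hc, e3] at b1
  have b2 := b1.comp (c 1) a5
  refine (b2.congr_of_eventuallyEq ?_).unique (hasFDerivAt_chartMul_right (c.map_source hg)) 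
  have hcont : ContinuousAt (fun y : E => g * c.symm y * g⁻¹) (c 1) := by
    have : IsTopologicalGroup G := topologicalGroup_of_lieGroup 𝓘(ℝ, E) ∞
    have := c.continuousAt_symm (c.map_source h1c)
    fun_prop
  have hs : c.source ∈ 𝓝 (g * c.symm (c 1) * g⁻¹) := by
    rw [c.left_inv h1c, e1]; exact c.open_source.mem_nhds h1c
  filter_upwards [hcont hs] with y hy
  simp only [chartMul, ← hc, Function.comp]
  rw [c.left_inv hg, c.left_inv hy, inv_mul_cancel_right]

variable (E G) in
/-- The derivative at `1` of the adjoint representation. -/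
noncomputable def AdDeriv : E →L[ℝ] E →L[ℝ] E :=
  mfderiv 𝓘(ℝ, E) 𝓘(ℝ, E →L[ℝ] E) (AdModel E : G → E →L[ℝ] E) 1

theorem AdDeriv_apply (X Y : E) : AdDeriv E G X Y = bracketModel G X Y := by
  have : IsManifold 𝓘(ℝ, E) 1 G := IsManifold.of_le (n := ∞) (by simp)
  set c := chartAt E (1 : G) with hc
  have h1c : (1 : G) ∈ c.source := mem_chart_source E 1
  have hct := c.map_source h1c
  set D : E →L[ℝ] E →L[ℝ] E := AdDeriv E G with hD
  have a1 : HasMFDerivAt 𝓘(ℝ, E) 𝓘(ℝ, E →L[ℝ] E) (AdModel E : G → E →L[ℝ] E) (c.symm (c 1)) D := by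
    have h0 : HasMFDerivAt 𝓘(ℝ, E) 𝓘(ℝ, E →L[ℝ] E) (AdModel E : G → E →L[ℝ] E) 1 D :=
      (((contMDiff_Ad E) (1 : G)).mdifferentiableAt (by simp)).hasMFDerivAt
    have e2 : ∀ g : G, g = 1 →
        HasMFDerivAt 𝓘(ℝ, E) 𝓘(ℝ, E →L[ℝ] E) (AdModel E : G → E →L[ℝ] E) g D := by
      rintro g rfl; exact h0
    exact e2 _ (c.left_inv h1c)
  have a2 : HasFDerivAt (fun x : E => (AdModel E (c.symm x) : E →L[ℝ] E)) D (c 1) :=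
    hasMFDerivAt_iff_hasFDerivAt (E := E) (E' := E →L[ℝ] E) (f' := D) |>.1
      (a1.comp (c 1) (hasMFDerivAt_chartAt_symm_self (E := E) (1 : G)))
  have a3 := ((contDiffAt_chartRight hct).differentiableAt (by simp)).hasFDerivAt.clm_comp a2
  have a4 := ((contDiffAt_chartLeft hct).differentiableAt (by simp)).hasFDerivAt
  have e : (fun x : E => (chartRight E G x).comp (AdModel E (c.symm x) : E →L[ℝ] E)) =ᶠ[𝓝 (c 1)]
      chartLeft E G := by
    filter_upwards [c.open_target.mem_nhds hct] with x hx
    have := chartRight_comp_Ad (E := E) (c.map_target hx)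
    rwa [← hc, c.right_inv hx] at this
  have h5 := DFunLike.congr_fun (DFunLike.congr_fun
    ((a3.congr_of_eventuallyEq e.symm).unique a4) X) Y
  have hA1 : (AdModel E (c.symm (c 1)) : E →L[ℝ] E) = ContinuousLinearMap.id ℝ E := by
    rw [c.left_inv h1c]; exact Ad_one E
  rw [hA1, hc, chartRight_one] at h5
  simp only [_root_.add_apply, ContinuousLinearMap.comp_apply,
    ContinuousLinearMap.compL_apply, ContinuousLinearMap.flip_apply,
    ContinuousLinearMap.id_apply] at h5
  rw [fderiv_chartRight_one] at h5
  rw [bracketModel_eq, ← h5, add_sub_cancel_right]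

theorem hasMFDerivAt_AdModel_one :
    HasMFDerivAt 𝓘(ℝ, E) 𝓘(ℝ, E →L[ℝ] E) (AdModel E : G → E →L[ℝ] E) 1 (AdDeriv E G) :=
  (((contMDiff_Ad E) (1 : G)).mdifferentiableAt (by simp)).hasMFDerivAt

theorem AdModel_mul (a b : G) : AdModel E (a * b) = (AdModel E a).comp (AdModel E b) := Ad_mul E a b

theorem AdModel_one : AdModel E (1 : G) = ContinuousLinearMap.id ℝ E := Ad_one E

theorem AdModel_inv_apply (a : G) (X : E) : AdModel E a⁻¹ (AdModel E a X) = X := by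
  have h := AdModel_mul (E := E) a⁻¹ a
  rw [inv_mul_cancel, AdModel_one] at h
  exact (DFunLike.congr_fun h X).symm

theorem AdModel_apply_inv (a : G) (X : E) : AdModel E a (AdModel E a⁻¹ X) = X := by
  simpa using AdModel_inv_apply (E := E) a⁻¹ X

/-- `Ad g` is an automorphism of the Lie algebra. -/
theorem AdModel_bracketModel (g : G) (X Y : E) :
    AdModel E g (bracketModel G X Y) = bracketModel G (AdModel E g X) (AdModel E g Y) := by
  -- differentiate `Ad (g h g⁻¹) Ad g = Ad g Ad h` in `h`
  have h1 : HasMFDerivAt 𝓘(ℝ, E) 𝓘(ℝ, E →L[ℝ] E)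
      (fun h : G => (AdModel E (g * h * g⁻¹) : E →L[ℝ] E)) 1 ((AdDeriv E G).comp (AdModel E g)) := by
    have e2 : ∀ k : G, k = 1 →
        HasMFDerivAt 𝓘(ℝ, E) 𝓘(ℝ, E →L[ℝ] E) (AdModel E : G → E →L[ℝ] E) k (AdDeriv E G) := by
      rintro k rfl; exact hasMFDerivAt_AdModel_one
    exact (e2 (g * 1 * g⁻¹) (by simp)).comp (1 : G) (hasMFDerivAt_conj g)
  have h2 : HasMFDerivAt 𝓘(ℝ, E) 𝓘(ℝ, E →L[ℝ] E)
      (fun h : G => (AdModel E (g * h * g⁻¹) : E →L[ℝ] E).comp (AdModel E g)) 1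
      ((((ContinuousLinearMap.compL ℝ E E E).flip (AdModel E g))).comp
        ((AdDeriv E G).comp (AdModel E g))) :=
    (((ContinuousLinearMap.compL ℝ E E E).flip (AdModel E g)).hasMFDerivAt).comp (1 : G) h1
  have h3 : HasMFDerivAt 𝓘(ℝ, E) 𝓘(ℝ, E →L[ℝ] E)
      (fun h : G => (AdModel E g : E →L[ℝ] E).comp (AdModel E h)) 1
      (((ContinuousLinearMap.compL ℝ E E E) (AdModel E g)).comp (AdDeriv E G)) :=
    (((ContinuousLinearMap.compL ℝ E E E) (AdModel E g)).hasMFDerivAt).comp (1 : G)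
      hasMFDerivAt_AdModel_one
  have e : (fun h : G => (AdModel E (g * h * g⁻¹) : E →L[ℝ] E).comp (AdModel E g)) =
      (fun h : G => (AdModel E g : E →L[ℝ] E).comp (AdModel E h)) := by
    funext h
    rw [← AdModel_mul, ← AdModel_mul, inv_mul_cancel_right]
  rw [e] at h2
  have h4 : (((ContinuousLinearMap.compL ℝ E E E).flip (AdModel E g))).comp
      ((AdDeriv E G).comp (AdModel E g)) =
      ((ContinuousLinearMap.compL ℝ E E E) (AdModel E g)).comp (AdDeriv E G) :=
    hasMFDerivAt_unique h2 h3
  have h5 : AdDeriv E G (AdModel E g X) (AdModel E g Y) = AdModel E g (AdDeriv E G X Y) :=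
    DFunLike.congr_fun (DFunLike.congr_fun h4 X) Y
  rw [← AdDeriv_apply, ← AdDeriv_apply, h5]

end AdDerivative

section OneParameter

variable {E G : Type*} [NormedAddCommGroup E] [NormedSpace ℝ E] [FiniteDimensional ℝ E]
  [TopologicalSpace G] [ChartedSpace E G] [Group G] [LieGroup 𝓘(ℝ, E) ∞ G]

theorem t2Space_of_lieGroup (E G : Type*) [NormedAddCommGroup E] [NormedSpace ℝ E]
    [TopologicalSpace G] [ChartedSpace E G] [Group G] [LieGroup 𝓘(ℝ, E) ∞ G] : T2Space G := by
  have : IsTopologicalGroup G := topologicalGroup_of_lieGroup 𝓘(ℝ, E) ∞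
  have : T0Space G := by
    refine ⟨fun x y hxy => ?_⟩
    have hx := mem_chart_source E x
    have hy : y ∈ (chartAt E x).source := (hxy.mem_open_iff (chartAt E x).open_source).1 hx
    have h : Inseparable (chartAt E x x) (chartAt E x y) := by
      have h2 := Topology.IsInducing.inseparable_iff
        (f := ((↑) : (chartAt E x).source → G)) Topology.IsInducing.subtypeVal
        (x := ⟨x, hx⟩) (y := ⟨y, hy⟩)
      exact (h2.1 hxy).map ((chartAt E x).continuousOn.domRestrict)
    exact (chartAt E x).injOn hx hy h.eq
  infer_instance

theorem hasMFDerivAt_mul_left_one (g : G) : HasMFDerivAt 𝓘(ℝ, E) 𝓘(ℝ, E) (fun h : G => g * h) 1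
    (mfderiv 𝓘(ℝ, E) 𝓘(ℝ, E) (fun h : G => g * h) 1) :=
  ((contMDiff_mul_left (I := 𝓘(ℝ, E)) (n := ∞) (a := g)).mdifferentiableAt (by simp)).hasMFDerivAt

/-- Left translates of integral curves of left invariant vector fields are integral curves. -/
theorem hasMFDerivAt_mul_integralCurve (X : LieAlg E G) {γ : ℝ → G} {s : Set ℝ} {t : ℝ}
    (h : HasMFDerivWithinAt 𝓘(ℝ, ℝ) 𝓘(ℝ, E) γ s t
      ((1 : ℝ →L[ℝ] ℝ).smulRight (mulInvariantVectorField X (γ t)))) (g : G) :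
    HasMFDerivWithinAt 𝓘(ℝ, ℝ) 𝓘(ℝ, E) (fun r => g * γ r) s t
      ((1 : ℝ →L[ℝ] ℝ).smulRight (mulInvariantVectorField X (g * γ t))) := by
  have h1 : HasMFDerivAt 𝓘(ℝ, E) 𝓘(ℝ, E) (fun h : G => g * h) (γ t)
      (mfderiv 𝓘(ℝ, E) 𝓘(ℝ, E) (fun h : G => g * h) (γ t)) :=
    ((contMDiff_mul_left (I := 𝓘(ℝ, E)) (n := ∞) (a := g)).mdifferentiableAt
      (by simp)).hasMFDerivAt
  have h2 := h1.comp_hasMFDerivWithinAt t h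
  refine h2.congr_mfderiv ?_
  have h3 : HasMFDerivAt 𝓘(ℝ, E) 𝓘(ℝ, E) (fun h : G => g * h) (γ t * 1)
      (mfderiv 𝓘(ℝ, E) 𝓘(ℝ, E) (fun h : G => g * h) (γ t)) := by
    have : ∀ k, k = γ t → HasMFDerivAt 𝓘(ℝ, E) 𝓘(ℝ, E) (fun h : G => g * h) k
      (mfderiv 𝓘(ℝ, E) 𝓘(ℝ, E) (fun h : G => g * h) (γ t) : E →L[ℝ] E) := by
      rintro k rfl; exact h1
    exact this _ (mul_one _)
  have h4 := h3.comp (1 : G) (hasMFDerivAt_mul_left_one (E := E) (γ t))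
  have e : (fun h : G => g * h) ∘ (fun h => γ t * h) = fun h => g * γ t * h := by
    ext h; simp [mul_assoc]
  rw [e] at h4
  have h5 := hasMFDerivAt_unique h4 (hasMFDerivAt_mul_left_one (E := E) (g * γ t))
  have h6 := DFunLike.congr_fun h5 X
  refine ContinuousLinearMap.ext_ring ?_
  have h7 : ∀ v : E, ((1 : ℝ →L[ℝ] ℝ).smulRight v) 1 = v := fun v => by simp
  refine (congrArg (mfderiv 𝓘(ℝ, E) 𝓘(ℝ, E) (fun h : G => g * h) (γ t) : E → E) (h7 _)).trans ?_
  exact h6.trans (h7 _).symm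

theorem exists_oneParameterSubgroup_aux (X : LieAlg E G) : ∃ γ : ℝ → G, γ 0 = 1 ∧
    IsMIntegralCurve (I := 𝓘(ℝ, E)) γ (mulInvariantVectorField X) := by
  have : T2Space G := t2Space_of_lieGroup E G
  have : IsManifold 𝓘(ℝ, E) 1 G := IsManifold.of_le (n := ∞) (by simp)
  have hv : ContMDiff 𝓘(ℝ, E) 𝓘(ℝ, E).tangent 1 (fun g : G =>
      (⟨g, mulInvariantVectorField X g⟩ : TangentBundle 𝓘(ℝ, E) G)) :=
    (contMDiff_mulInvariantVectorField X).of_le (by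
      rw [minSmoothness_of_isRCLikeNormedField]; norm_num)
  obtain ⟨γ, h0, hγ⟩ := exists_isMIntegralCurveAt_of_contMDiffAt_boundaryless (t₀ := 0)
    (hv.contMDiffAt (x := (1 : G)))
  obtain ⟨ε, hε, h⟩ := isMIntegralCurveAt_iff'.1 hγ
  refine exists_isMIntegralCurve_of_isMIntegralCurveOn hv hε (fun g => ⟨fun t => g * γ t, ?_, ?_⟩) 1
  · simp [h0]
  · intro t ht
    rw [Real.ball_eq_Ioo, zero_sub, zero_add] at h
    exact hasMFDerivAt_mul_integralCurve X (h t ht) g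

theorem integralCurve_add {X : LieAlg E G} {γ : ℝ → G} (h0 : γ 0 = 1)
    (hγ : IsMIntegralCurve (I := 𝓘(ℝ, E)) γ (mulInvariantVectorField X)) (a b : ℝ) :
    γ (a + b) = γ a * γ b := by
  have : T2Space G := t2Space_of_lieGroup E G
  have : IsManifold 𝓘(ℝ, E) 1 G := IsManifold.of_le (n := ∞) (by simp)
  have hv : ContMDiff 𝓘(ℝ, E) 𝓘(ℝ, E).tangent 1 (fun g : G =>
      (⟨g, mulInvariantVectorField X g⟩ : TangentBundle 𝓘(ℝ, E) G)) :=
    (contMDiff_mulInvariantVectorField X).of_le (by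
      rw [minSmoothness_of_isRCLikeNormedField]; norm_num)
  have h1 : IsMIntegralCurve (I := 𝓘(ℝ, E)) (fun t => γ a * γ t) (mulInvariantVectorField X) := by
    intro t
    have := hasMFDerivAt_mul_integralCurve X (s := univ) (hγ t).hasMFDerivWithinAt (γ a)
    exact this.hasMFDerivAt Filter.univ_mem
  have h2 := hγ.comp_add a
  have h3 := isMIntegralCurve_Ioo_eq_of_contMDiff_boundaryless (t₀ := 0) hv h2 h1
    (by simp [h0])
  have := congrFun h3 b
  simpa [add_comm] using this

end OneParameter

section OneParameterSmooth

variable {E G : Type*} [NormedAddCommGroup E] [NormedSpace ℝ E] [FiniteDimensional ℝ E]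
  [TopologicalSpace G] [ChartedSpace E G] [Group G] [LieGroup 𝓘(ℝ, E) ∞ G]

theorem hasDerivAt_chart_integralCurve {X : LieAlg E G} {γ : ℝ → G}
    (hγ : IsMIntegralCurve (I := 𝓘(ℝ, E)) γ (mulInvariantVectorField X)) {s : ℝ}
    (hs : γ s ∈ (chartAt E (1 : G)).source) :
    HasDerivAt (fun r => chartAt E (1 : G) (γ r))
      (chartLeft E G (chartAt E (1 : G) (γ s)) (X : E)) s := by
  have : IsManifold 𝓘(ℝ, E) 1 G := IsManifold.of_le (n := ∞) (by simp)
  set c := chartAt E (1 : G) with hc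
  have hct := c.map_source hs
  have h1 := (mdifferentiableAt_chartAt (E := E) (1 : G) hs).hasMFDerivAt
  have h2 := h1.comp s (hγ s)
  have h3 := mfderiv_chart_symm_chartLeft (E := E) (G := G) hct (X : E)
  have h4 := DFunLike.congr_fun (mfderiv_chartAt_comp_symm (E := E) (1 : G) hct)
    (chartLeft E G (c (γ s)) (X : E))
  have h5 : (mfderiv 𝓘(ℝ, E) 𝓘(ℝ, E) c (c.symm (c (γ s))))
      (mulInvariantVectorField (I := 𝓘(ℝ, E)) (G := G) X (c.symm (c (γ s)))) =
      (chartLeft E G (c (γ s)) (X : E)) := by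
    refine (congrArg (fun v : E => (mfderiv 𝓘(ℝ, E) 𝓘(ℝ, E) c (c.symm (c (γ s))) : E → E) v)
      h3.symm).trans h4
  have h6 : (mfderiv 𝓘(ℝ, E) 𝓘(ℝ, E) c (γ s))
      (mulInvariantVectorField (I := 𝓘(ℝ, E)) (G := G) X (γ s)) =
      (chartLeft E G (c (γ s)) (X : E)) := by
    have : ∀ k, k = γ s → (mfderiv 𝓘(ℝ, E) 𝓘(ℝ, E) c k)
      (mulInvariantVectorField (I := 𝓘(ℝ, E)) (G := G) X k) =
      (chartLeft E G (c (γ s)) (X : E)) → (mfderiv 𝓘(ℝ, E) 𝓘(ℝ, E) c (γ s))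
      (mulInvariantVectorField (I := 𝓘(ℝ, E)) (G := G) X (γ s)) =
      (chartLeft E G (c (γ s)) (X : E)) := by
      rintro k rfl h; exact h
    exact this _ (c.left_inv hs) h5
  have h7 := (HasMFDerivAt.toModel h2).hasDerivAt
  refine h7.congr_deriv (Eq.trans ?_ h6)
  exact congrArg (mfderiv 𝓘(ℝ, E) 𝓘(ℝ, E) c (γ s) : E → E)
    (show ((1 : ℝ →L[ℝ] ℝ).smulRight (mulInvariantVectorField (I := 𝓘(ℝ, E)) (G := G) X (γ s) : E))
      1 = _ by simp)

theorem contMDiff_integralCurve {X : LieAlg E G} {γ : ℝ → G} (h0 : γ 0 = 1)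
    (hγ : IsMIntegralCurve (I := 𝓘(ℝ, E)) γ (mulInvariantVectorField X)) :
    ContMDiff 𝓘(ℝ, ℝ) 𝓘(ℝ, E) ∞ γ := by
  set c := chartAt E (1 : G) with hc
  have h1c : (1 : G) ∈ c.source := mem_chart_source E 1
  have hcont : Continuous γ := hγ.continuous
  set U := γ ⁻¹' c.source with hU
  have hUo : IsOpen U := c.open_source.preimage hcont
  have h0U : (0 : ℝ) ∈ U := by rw [hU, mem_preimage, h0]; exact h1c
  have hd : ∀ s ∈ U, HasDerivAt (fun r => c (γ r)) (chartLeft E G (c (γ s)) (X : E)) s :=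
    fun s hs => hasDerivAt_chart_integralCurve hγ hs
  have hn : ∀ n : ℕ, ContDiffOn ℝ n (fun r => c (γ r)) U := by
    intro n
    induction n with
    | zero =>
      exact contDiffOn_zero.2 fun s hs => (hd s hs).continuousAt.continuousWithinAt
    | succ n ih =>
      rw [Nat.cast_succ, contDiffOn_succ_iff_deriv_of_isOpen hUo]
      refine ⟨fun s hs => (hd s hs).differentiableAt.differentiableWithinAt, by simp, ?_⟩
      have h2 : ContDiffOn ℝ n (fun s => chartLeft E G (c (γ s)) (X : E)) U := by
        intro s hs
        have h3 : ContDiffAt ℝ n (chartLeft E G) (c (γ s)) :=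
          (contDiffAt_chartLeft (c.map_source hs)).of_le (by exact_mod_cast le_top)
        exact (h3.comp_contDiffWithinAt s (ih s hs)).clm_apply contDiffWithinAt_const
      exact h2.congr fun s hs => (hd s hs).deriv
  have hx : ContDiffAt ℝ ∞ (fun r => c (γ r)) 0 :=
    (contDiffOn_infty.2 hn).contDiffAt (hUo.mem_nhds h0U)
  have hg0 : ContMDiffAt 𝓘(ℝ, ℝ) 𝓘(ℝ, E) ∞ γ 0 := by
    have h4 : ContMDiffAt 𝓘(ℝ, E) 𝓘(ℝ, E) ∞ c.symm (c (γ 0)) :=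
      contMDiffOn_chart_symm.contMDiffAt (c.open_target.mem_nhds (c.map_source h0U))
    refine (h4.comp (0 : ℝ) hx.contMDiffAt).congr_of_eventuallyEq ?_
    filter_upwards [hUo.mem_nhds h0U] with s hs
    exact (c.left_inv hs).symm
  intro s
  have h5 : ContMDiffAt 𝓘(ℝ, ℝ) 𝓘(ℝ, ℝ) ∞ (fun r : ℝ => r - s) s :=
    (contDiff_id.sub contDiff_const).contDiffAt.contMDiffAt
  have h6 : ContMDiffAt 𝓘(ℝ, ℝ) 𝓘(ℝ, E) ∞ γ ((fun r : ℝ => r - s) s) := by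
    simpa using hg0
  have h7 : ContMDiffAt 𝓘(ℝ, ℝ) 𝓘(ℝ, E) ∞ (fun r : ℝ => γ (r - s)) s :=
    ContMDiffAt.comp (g := γ) (f := fun r : ℝ => r - s) s h6 h5
  refine ((contMDiff_mul_left (I := 𝓘(ℝ, E)) (a := γ s)).contMDiffAt.comp s
    h7).congr_of_eventuallyEq (Filter.Eventually.of_forall fun r => ?_)
  simp [← integralCurve_add h0 hγ]

theorem exists_isOneParameterSubgroup (X : LieAlg E G) : ∃ γ : ℝ → G,
    IsOneParameterSubgroup X γ := by
  obtain ⟨γ, h0, hγ⟩ := exists_oneParameterSubgroup_aux X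
  refine ⟨γ, contMDiff_integralCurve h0 hγ, integralCurve_add h0 hγ, ?_⟩
  have h1 : HasMFDerivAt 𝓘(ℝ, ℝ) 𝓘(ℝ, E) γ 0
    ((1 : ℝ →L[ℝ] ℝ).smulRight (X : E)) := by
    have h2 := hγ 0
    have h3 : ∀ k, k = (1 : G) → (mulInvariantVectorField (I := 𝓘(ℝ, E)) (G := G) X k : E) = X := by
      rintro k rfl
      have : (mfderiv 𝓘(ℝ, E) 𝓘(ℝ, E) (fun h : G => 1 * h) 1 : E →L[ℝ] E) =
          ContinuousLinearMap.id ℝ E := by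
        have e : (fun h : G => 1 * h) = id := by ext; simp
        rw [e]; exact mfderiv_id
      exact DFunLike.congr_fun this X
    refine h2.congr_mfderiv ?_
    exact congrArg (fun v : E => (1 : ℝ →L[ℝ] ℝ).smulRight v) (h3 _ h0)
  refine (DFunLike.congr_fun h1.mfderiv (1 : ℝ)).trans ?_
  exact (show ((1 : ℝ →L[ℝ] ℝ).smulRight (X : E)) 1 = X by simp)

variable (G) in
/-- The one-parameter subgroup `s ↦ exp(sX)`. -/
noncomputable def expCurve (X : E) : ℝ → G := (exists_isOneParameterSubgroup (G := G) X).choose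

theorem isOneParameterSubgroup_expCurve (X : E) :
    IsOneParameterSubgroup (E := E) (G := G) X (expCurve G X) :=
  (exists_isOneParameterSubgroup (G := G) X).choose_spec

namespace IsOneParameterSubgroup

variable {X : E} {γ : ℝ → G}

theorem map_zero (h : IsOneParameterSubgroup (E := E) (G := G) X γ) : γ 0 = 1 := by
  have := h.2.1 0 0
  simpa using this

theorem map_neg (h : IsOneParameterSubgroup (E := E) (G := G) X γ) (s : ℝ) :
    γ (-s) = (γ s)⁻¹ := by
  refine eq_inv_of_mul_eq_one_left ?_
  rw [← h.2.1]; simp [h.map_zero]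

theorem hasMFDerivAt_zero (h : IsOneParameterSubgroup (E := E) (G := G) X γ) :
    HasMFDerivAt 𝓘(ℝ, ℝ) 𝓘(ℝ, E) γ 0 ((1 : ℝ →L[ℝ] ℝ).smulRight X) := by
  have h1 := ((h.1 0).mdifferentiableAt (by simp)).hasMFDerivAt
  refine h1.congr_mfderiv ?_
  have h2 : ∀ L : ℝ →L[ℝ] E, L 1 = X → L = (1 : ℝ →L[ℝ] ℝ).smulRight X := by
    rintro L rfl
    exact ContinuousLinearMap.ext_ring (by simp)
  exact h2 _ h.2.2

theorem hasDerivAt_comp {V : Type*} [NormedAddCommGroup V] [NormedSpace ℝ V]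
    (h : IsOneParameterSubgroup (E := E) (G := G) X γ) {f : G → V} {f' : E →L[ℝ] V}
    (hf : HasMFDerivAt 𝓘(ℝ, E) 𝓘(ℝ, V) f 1 f') :
    HasDerivAt (fun s => f (γ s)) (f' X) 0 := by
  have h1 : ∀ k, k = (1 : G) → HasMFDerivAt 𝓘(ℝ, E) 𝓘(ℝ, V) f k f' := by
    rintro k rfl; exact hf
  have h2 : HasFDerivAt (f ∘ γ) (f'.comp ((1 : ℝ →L[ℝ] ℝ).smulRight X)) 0 :=
    hasMFDerivAt_iff_hasFDerivAt.1 ((h1 _ h.map_zero).comp (0 : ℝ) h.hasMFDerivAt_zero)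
  simpa [Function.comp_def] using h2.hasDerivAt

theorem hasDerivAt_Ad (h : IsOneParameterSubgroup (E := E) (G := G) X γ) (s : ℝ) :
    HasDerivAt (fun r => (AdModel E (γ r) : E →L[ℝ] E))
      ((AdDeriv E G X).comp (AdModel E (γ s))) s := by
  have h1 := h.hasDerivAt_comp (hasMFDerivAt_AdModel_one (E := E) (G := G))
  have h2 : HasDerivAt (fun r => (AdModel E (γ (r - s)) : E →L[ℝ] E)) (AdDeriv E G X) s := by
    have h3 : HasDerivAt (fun r => (AdModel E (γ r) : E →L[ℝ] E)) (AdDeriv E G X) (s - s) := by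
      rwa [sub_self]
    exact HasDerivAt.comp_sub_const s s h3
  have h4 := (((ContinuousLinearMap.compL ℝ E E E).flip
    (AdModel E (γ s))).hasFDerivAt).comp_hasDerivAt s h2
  refine (h4.congr_of_eventuallyEq (Filter.Eventually.of_forall fun r => ?_))
  change AdModel E (γ r) = (AdModel E (γ (r - s))).comp (AdModel E (γ s))
  rw [← AdModel_mul, ← h.2.1, sub_add_cancel]

theorem Ad_eq_exp (h : IsOneParameterSubgroup (E := E) (G := G) X γ) (s : ℝ) :
    (AdModel E (γ s) : E →L[ℝ] E) = NormedSpace.exp (s • AdDeriv E G X) := by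
  have : CompleteSpace E := FiniteDimensional.complete ℝ E
  set D := AdDeriv E G X
  have h1 : ∀ s, HasDerivAt (fun r : ℝ => NormedSpace.exp ((-r) • D) * AdModel E (γ r))
      0 s := by
    intro s
    have h2 : HasDerivAt (fun r : ℝ => NormedSpace.exp ((-r) • D))
        (-(NormedSpace.exp ((-s) • D) * D)) s := by
      have h3 := (hasDerivAt_exp_smul_const D (-s)).scomp s (hasDerivAt_neg s)
      simpa [Function.comp_def] using h3
    have h4 := h2.mul (h.hasDerivAt_Ad s)
    refine h4.congr_deriv ?_
    change -(NormedSpace.exp ((-s) • D) * D) * AdModel E (γ s) +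
      NormedSpace.exp ((-s) • D) * (D * AdModel E (γ s)) = 0
    rw [neg_mul, mul_assoc, neg_add_cancel]
  have h5 := is_const_of_deriv_eq_zero (fun s => (h1 s).differentiableAt)
    (fun s => (h1 s).deriv) s 0
  have h6 : NormedSpace.exp ((-s) • D) * AdModel E (γ s) = 1 := by
    rw [h5]; simp [h.map_zero, AdModel_one]; rfl
  have h7 : NormedSpace.exp (s • D) * NormedSpace.exp ((-s) • D) = 1 := by
    have h8 : Commute (s • D) ((-s) • D) := ((Commute.refl D).smul_left s).smul_right (-s)
    let _ : NormedAlgebra ℚ (E →L[ℝ] E) := NormedAlgebra.restrictScalars ℚ ℝ _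
    rw [← NormedSpace.exp_add_of_commute h8]
    simp
  calc AdModel E (γ s) = (NormedSpace.exp (s • D) * NormedSpace.exp ((-s) • D)) *
        AdModel E (γ s) := by rw [h7, one_mul]
    _ = _ := by rw [mul_assoc, h6, mul_one]

/-- The adjoint action of `exp(sX)` on eigenfunctionals of `ad X`. -/
theorem apply_Ad_of_eigen (h : IsOneParameterSubgroup (E := E) (G := G) X γ) (κ : E →L[ℝ] ℂ)
    {a : ℂ} (hκ : ∀ Y, κ (bracketModel G X Y) = a * κ Y) (s : ℝ) (Y : E) :
    κ (AdModel E (γ s) Y) = Complex.exp (s * a) * κ Y := by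
  have h1 : ∀ s : ℝ, HasDerivAt (fun r : ℝ => Complex.exp (-(r * a)) * κ (AdModel E (γ r) Y)) 0 s := by
    intro s
    have h2 : HasDerivAt (fun r : ℝ => Complex.exp (-(r * a))) (-(Complex.exp (-(s * a)) * a)) s := by
      have := (((Complex.ofRealCLM.hasDerivAt (x := s)).mul_const a).neg).cexp
      simpa using this
    have h3 := κ.hasFDerivAt.comp_hasDerivAt s ((h.hasDerivAt_Ad s).clm_apply
      (hasDerivAt_const s Y))
    have h4 := h2.mul h3
    refine h4.congr_deriv ?_
    simp only [_root_.map_zero, add_zero, ContinuousLinearMap.comp_apply, Function.comp]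
    rw [AdDeriv_apply, hκ]
    ring
  have h5 := is_const_of_deriv_eq_zero (fun s => (h1 s).differentiableAt)
    (fun s => (h1 s).deriv) s 0
  simp only [h.map_zero, AdModel_one] at h5
  have h6 : Complex.exp (s * a) * Complex.exp (-(s * a)) = 1 := by
    rw [← Complex.exp_add]; simp
  have h7 : Complex.exp (-(s * a)) * κ (AdModel E (γ s) Y) = κ Y := by simpa using h5
  rw [← h7, ← mul_assoc, h6, one_mul]

theorem Ad_apply_of_bracket_eq_zero (h : IsOneParameterSubgroup (E := E) (G := G) X γ) {Y : E}
    (hY : bracketModel G X Y = 0) (s : ℝ) : AdModel E (γ s) Y = Y := by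
  have : CompleteSpace E := FiniteDimensional.complete ℝ E
  have hcomm : ∀ s, (AdDeriv E G X).comp (AdModel E (γ s)) =
      (AdModel E (γ s)).comp (AdDeriv E G X) := by
    intro s
    rw [h.Ad_eq_exp]
    exact (((Commute.refl (AdDeriv E G X)).smul_right s).exp_right)
  have h1 : ∀ s, HasDerivAt (fun r => AdModel E (γ r) Y) 0 s := by
    intro s
    refine ((h.hasDerivAt_Ad s).clm_apply (hasDerivAt_const s Y)).congr_deriv ?_
    rw [hcomm]
    simp [AdDeriv_apply, hY]
  have h5 := is_const_of_deriv_eq_zero (fun s => (h1 s).differentiableAt)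
    (fun s => (h1 s).deriv) s 0
  rw [h5, h.map_zero, AdModel_one]; rfl

end IsOneParameterSubgroup

/-- The product rule at the unit of a Lie group. -/
theorem HasMFDerivAt.mul_at_one {F : Type*} [NormedAddCommGroup F] [NormedSpace ℝ F]
    {f g : F → G} {f' g' : F →L[ℝ] E} {z : F} (hf : HasMFDerivAt 𝓘(ℝ, F) 𝓘(ℝ, E) f z f')
    (hg : HasMFDerivAt 𝓘(ℝ, F) 𝓘(ℝ, E) g z g') (hf1 : f z = 1) (hg1 : g z = 1) :
    HasMFDerivAt 𝓘(ℝ, F) 𝓘(ℝ, E) (fun y => f y * g y) z (f' + g') := by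
  have : IsManifold 𝓘(ℝ, E) 1 G := IsManifold.of_le (n := ∞) (by simp)
  set c := chartAt E (1 : G) with hc
  have h1c : (1 : G) ∈ c.source := mem_chart_source E 1
  have hct := c.map_source h1c
  have hcd : ∀ k, k = (1 : G) → HasMFDerivAt 𝓘(ℝ, E) 𝓘(ℝ, E) c k (ContinuousLinearMap.id ℝ E) := by
    rintro k rfl; exact hasMFDerivAt_chartAt_self (E := E) (1 : G)
  have a1 : HasFDerivAt (fun y => c (f y)) f' z :=
    HasMFDerivAt.toModel ((hcd _ hf1).comp z hf)
  have a2 : HasFDerivAt (fun y => c (g y)) g' z :=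
    HasMFDerivAt.toModel ((hcd _ hg1).comp z hg)
  have hm : HasFDerivAt (chartMul E G) (fderiv ℝ (chartMul E G) (c 1, c 1)) (c 1, c 1) :=
    ((contDiffAt_chartMul_right_one hct).differentiableAt (by simp)).hasFDerivAt
  have hL : ∀ v w, fderiv ℝ (chartMul E G) (c 1, c 1) (v, w) = v + w := by
    intro v w
    have e1 := DFunLike.congr_fun (chartLeft_one (E := E) (G := G)) w
    have e2 := DFunLike.congr_fun (chartRight_one (E := E) (G := G)) v
    have e3 : (v, w) = (v, 0) + ((0, w) : E × E) := by simp
    rw [e3, _root_.map_add]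
    exact congrArg₂ (· + ·) e2 e1
  have a3 : HasFDerivAt (fun y => chartMul E G (c (f y), c (g y))) (f' + g') z := by
    have hm' : HasFDerivAt (chartMul E G) (fderiv ℝ (chartMul E G) (c 1, c 1))
        ((fun y => (c (f y), c (g y))) z) := by simpa [hf1, hg1] using hm
    refine (hm'.comp z (a1.prodMk a2)).congr_fderiv ?_
    ext v
    exact hL _ _
  have hfz : f z * g z = 1 := by simp [hf1, hg1]
  have a4 : HasMFDerivAt 𝓘(ℝ, E) 𝓘(ℝ, E) c.symm (chartMul E G (c (f z), c (g z)))
      (ContinuousLinearMap.id ℝ E) := by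
    have : chartMul E G (c (f z), c (g z)) = c 1 := by
      simp [chartMul, ← hc, hf1, hg1, c.left_inv h1c]
    rw [this]
    exact hasMFDerivAt_chartAt_symm_self (E := E) (1 : G)
  have a5 := a4.comp z a3.hasMFDerivAt
  refine HasMFDerivAt.congr_of_eventuallyEq a5 ?_
  have n1 : ∀ᶠ y in 𝓝 z, f y ∈ c.source := hf.continuousAt.eventually_mem
    (c.open_source.mem_nhds (by rw [hf1]; exact h1c))
  have n2 : ∀ᶠ y in 𝓝 z, g y ∈ c.source := hg.continuousAt.eventually_mem
    (c.open_source.mem_nhds (by rw [hg1]; exact h1c))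
  have : IsTopologicalGroup G := topologicalGroup_of_lieGroup 𝓘(ℝ, E) ∞
  have n3 : ∀ᶠ y in 𝓝 z, f y * g y ∈ c.source := (hf.continuousAt.mul hg.continuousAt).eventually_mem
    (c.open_source.mem_nhds (by change f z * g z ∈ _; rw [hfz]; exact h1c))
  filter_upwards [n1, n2, n3] with y y1 y2 y3
  simp only [Function.comp, chartMul, ← hc]
  rw [c.left_inv y1, c.left_inv y2, c.left_inv y3]

end OneParameterSmooth

section SecondKind

variable {E G : Type*} [NormedAddCommGroup E] [NormedSpace ℝ E] [FiniteDimensional ℝ E]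
  [TopologicalSpace G] [ChartedSpace E G] [Group G] [LieGroup 𝓘(ℝ, E) ∞ G]

variable (G) in
/-- Coordinates of the second kind: `y ↦ exp(y₀ X₀) ⋯ exp(yₙ₋₁ Xₙ₋₁)`. -/
noncomputable def expProd : ∀ {n : ℕ}, (Fin n → E) → (Fin n → ℝ) → G
  | 0, _, _ => 1
  | _ + 1, X, y => expCurve G (X 0) (y 0) * expProd (fun j => X j.succ) (fun j => y j.succ)

theorem contMDiff_expProd {n : ℕ} (X : Fin n → E) :
    ContMDiff 𝓘(ℝ, Fin n → ℝ) 𝓘(ℝ, E) ∞ (expProd G X) := by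
  induction n with
  | zero => exact contMDiff_const
  | succ n ih =>
    have h1 : ContMDiff 𝓘(ℝ, Fin (n + 1) → ℝ) 𝓘(ℝ, ℝ) ∞ (fun y : Fin (n + 1) → ℝ => y 0) :=
      (contDiff_apply ℝ ℝ 0).contMDiff
    have h2 : ContMDiff 𝓘(ℝ, Fin (n + 1) → ℝ) 𝓘(ℝ, Fin n → ℝ) ∞
        (fun (y : Fin (n + 1) → ℝ) (j : Fin n) => y j.succ) :=
      (ContinuousLinearMap.pi fun j : Fin n => ContinuousLinearMap.proj (R := ℝ)
        (φ := fun _ : Fin (n + 1) => ℝ) j.succ).contMDiff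
    exact ((isOneParameterSubgroup_expCurve (X 0)).1.comp h1).mul ((ih _).comp h2)

theorem expProd_zero {n : ℕ} (X : Fin n → E) : expProd G X 0 = 1 := by
  induction n with
  | zero => rfl
  | succ n ih =>
    change expCurve G (X 0) 0 * expProd G (fun j => X j.succ) 0 = 1
    rw [ih, (isOneParameterSubgroup_expCurve (G := G) (X 0)).map_zero, one_mul]

/-- The linear combinations of a finite family, as a continuous linear map. -/
noncomputable def linComb {n : ℕ} (X : Fin n → E) : (Fin n → ℝ) →L[ℝ] E :=
  ∑ j, (ContinuousLinearMap.proj (R := ℝ) (φ := fun _ : Fin n => ℝ) j).smulRight (X j)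

theorem linComb_apply {n : ℕ} (X : Fin n → E) (y : Fin n → ℝ) :
    linComb X y = ∑ j, y j • X j := by
  simp [linComb]

theorem hasMFDerivAt_expProd {n : ℕ} (X : Fin n → E) :
    HasMFDerivAt 𝓘(ℝ, Fin n → ℝ) 𝓘(ℝ, E) (expProd G X) 0
      (linComb X : (Fin n → ℝ) →L[ℝ] E) := by
  induction n with
  | zero =>
    have : (linComb X : (Fin 0 → ℝ) →L[ℝ] E) = 0 := by
      ext y; simp [linComb_apply]
    rw [this]
    exact hasMFDerivAt_const (1 : G) (0 : Fin 0 → ℝ)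
  | succ n ih =>
    let p0 : (Fin (n + 1) → ℝ) →L[ℝ] ℝ := ContinuousLinearMap.proj 0
    let p1 : (Fin (n + 1) → ℝ) →L[ℝ] (Fin n → ℝ) :=
      ContinuousLinearMap.pi fun j => ContinuousLinearMap.proj j.succ
    have h1 : HasMFDerivAt 𝓘(ℝ, Fin (n + 1) → ℝ) 𝓘(ℝ, E) (fun y => expCurve G (X 0) (p0 y)) 0
        (((1 : ℝ →L[ℝ] ℝ).smulRight (X 0)).comp p0) :=
      HasMFDerivAt.comp (f := p0) (g := expCurve G (X 0)) 0
        (isOneParameterSubgroup_expCurve (X 0)).hasMFDerivAt_zero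
        p0.hasMFDerivAt
    have h2 : HasMFDerivAt 𝓘(ℝ, Fin (n + 1) → ℝ) 𝓘(ℝ, E)
        (fun y => expProd G (fun j => X j.succ) (p1 y)) 0
        ((linComb fun j => X j.succ).comp p1) :=
      HasMFDerivAt.comp (f := p1) (g := expProd G fun j => X j.succ) 0 (ih _)
        p1.hasMFDerivAt
    refine (h1.mul_at_one h2 ?_ (expProd_zero _)).congr_mfderiv ?_
    · exact (isOneParameterSubgroup_expCurve (X 0)).map_zero
    · have : ∀ L L' : (Fin (n + 1) → ℝ) →L[ℝ] E, (∀ y, L y = L' y) → L = L' :=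
        fun L L' h => ContinuousLinearMap.ext h
      refine this _ _ fun y => ?_
      rw [linComb_apply, Fin.sum_univ_succ]
      change y 0 • X 0 + linComb (fun j => X j.succ) (p1 y) = _
      rw [linComb_apply]
      rfl

theorem expProd_mem {n : ℕ} {X : Fin n → E} {T : Subgroup G}
    (h : ∀ j s, expCurve G (X j) s ∈ T) (y : Fin n → ℝ) : expProd G X y ∈ T := by
  induction n with
  | zero => exact T.one_mem
  | succ n ih => exact T.mul_mem (h _ _) (ih (fun j s => h _ _) _)

theorem apply_expProd {n : ℕ} {X : Fin n → E} {T : Subgroup G} (χ : T →* Circle)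
    (h : ∀ j s, expCurve G (X j) s ∈ T) (m : Fin n → ℝ)
    (hχ : ∀ j s, (χ ⟨_, h j s⟩ : ℂ) = Complex.exp (Complex.I * (s * m j : ℝ)))
    (y : Fin n → ℝ) :
    (χ ⟨_, expProd_mem h y⟩ : ℂ) = Complex.exp (Complex.I * (∑ j, y j * m j : ℝ)) := by
  induction n with
  | zero =>
    have : (⟨_, expProd_mem h y⟩ : T) = 1 := rfl
    rw [this]; simp
  | succ n ih =>
    have e : (⟨_, expProd_mem h y⟩ : T) = ⟨_, h 0 (y 0)⟩ *
      ⟨_, expProd_mem (fun j s => h (Fin.succ j) s) (fun j => y j.succ)⟩ := rfl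
    rw [e, map_mul, Circle.coe_mul, hχ, ih (fun j s => h (Fin.succ j) s) (fun j => m j.succ)
      (fun j s => hχ _ _), ← Complex.exp_add, Fin.sum_univ_succ]
    congr 1
    push_cast
    ring

theorem analyticAt_Ad_expProd {n : ℕ} (X : Fin n → E) (y : Fin n → ℝ) :
    AnalyticAt ℝ (fun y => (AdModel E (expProd G X y) : E →L[ℝ] E)) y := by
  have : CompleteSpace E := FiniteDimensional.complete ℝ E
  induction n with
  | zero =>
    exact analyticAt_const (𝕜 := ℝ) (v := (AdModel E (1 : G) : E →L[ℝ] E)) (x := y)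
  | succ n ih =>
    let p0 : (Fin (n + 1) → ℝ) →L[ℝ] ℝ := ContinuousLinearMap.proj 0
    let p1 : (Fin (n + 1) → ℝ) →L[ℝ] (Fin n → ℝ) :=
      ContinuousLinearMap.pi fun j => ContinuousLinearMap.proj j.succ
    have h1 : AnalyticAt ℝ (fun y : Fin (n + 1) → ℝ =>
        NormedSpace.exp (p0.smulRight (AdDeriv E G (X 0)) y)) y := by
      let _ : NormedAlgebra ℚ (E →L[ℝ] E) := NormedAlgebra.restrictScalars ℚ ℝ _
      exact AnalyticAt.comp (g := NormedSpace.exp) (NormedSpace.exp_analytic (𝕂 := ℝ) _) ((p0.smulRight (AdDeriv E G (X 0))).analyticAt y)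
    have h2 : AnalyticAt ℝ (fun y : Fin (n + 1) → ℝ =>
        (AdModel E (expProd G (fun j => X j.succ) (p1 y)) : E →L[ℝ] E)) y :=
      AnalyticAt.comp (g := fun z => (AdModel E (expProd G (fun j => X j.succ) z) : E →L[ℝ] E))
        (f := p1) (ih _ (p1 y)) (p1.analyticAt y)
    refine (h1.mul h2).congr (Filter.Eventually.of_forall fun y => ?_)
    change NormedSpace.exp (y 0 • AdDeriv E G (X 0)) *
      (AdModel E (expProd G (fun j => X j.succ) (p1 y)) : E →L[ℝ] E) =
      AdModel E (expCurve G (X 0) (y 0) * expProd G (fun j => X j.succ) (fun j => y j.succ))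
    rw [AdModel_mul, ← (isOneParameterSubgroup_expCurve (G := G) (X 0)).Ad_eq_exp]
    rfl

/-- The inverse function theorem at the unit of a Lie group. -/
theorem exists_local_lift {F : Type*} [NormedAddCommGroup F] [NormedSpace ℝ F]
    [FiniteDimensional ℝ F] {e : F → G} (he : ContMDiff 𝓘(ℝ, F) 𝓘(ℝ, E) ∞ e) (h0 : e 0 = 1)
    {L : F ≃L[ℝ] E} (hL : HasMFDerivAt 𝓘(ℝ, F) 𝓘(ℝ, E) e 0 (L : F →L[ℝ] E)) :
    ∃ u : G → F, ContMDiffAt 𝓘(ℝ, E) 𝓘(ℝ, F) ∞ u 1 ∧ u 1 = 0 ∧ (∀ᶠ g in 𝓝 1, e (u g) = g) ∧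
      HasMFDerivAt 𝓘(ℝ, E) 𝓘(ℝ, F) u 1 (L.symm : E →L[ℝ] F) := by
  have : IsManifold 𝓘(ℝ, E) 1 G := IsManifold.of_le (n := ∞) (by simp)
  have : CompleteSpace F := FiniteDimensional.complete ℝ F
  set c := chartAt E (1 : G) with hc
  have h1c : (1 : G) ∈ c.source := mem_chart_source E 1
  have hcC : ContMDiffAt 𝓘(ℝ, E) 𝓘(ℝ, E) ∞ c 1 :=
    contMDiffOn_chart.contMDiffAt (c.open_source.mem_nhds h1c)
  have hcC' : ContMDiffAt 𝓘(ℝ, E) 𝓘(ℝ, E) ∞ c (e 0) := by rw [h0]; exact hcC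
  have hf : ContDiffAt ℝ ∞ (fun y => c (e y)) 0 := (hcC'.comp (0 : F) he.contMDiffAt).contDiffAt
  have hcd : ∀ k, k = (1 : G) → HasMFDerivAt 𝓘(ℝ, E) 𝓘(ℝ, E) c k (ContinuousLinearMap.id ℝ E) := by
    rintro k rfl; exact hasMFDerivAt_chartAt_self (E := E) (1 : G)
  have hfd : HasFDerivAt (fun y => c (e y)) (L : F →L[ℝ] E) 0 :=
    HasMFDerivAt.toModel ((hcd _ h0).comp (0 : F) hL)
  set P := hf.toOpenPartialHomeomorph (fun y => c (e y)) hfd (by simp)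
  have hP0 : (0 : F) ∈ P.source := hf.mem_toOpenPartialHomeomorph_source hfd (by simp)
  have hPe : ∀ y, P y = c (e y) := fun y => rfl
  have hy0 : c 1 ∈ P.target := by
    have := P.map_source hP0
    rwa [hPe, h0] at this
  have hs0 : P.symm (c 1) = 0 := by
    have := P.left_inv hP0
    rwa [hPe, h0] at this
  have hev : ∀ᶠ g in 𝓝 (1 : G), e (P.symm (c g)) = g := by
    have n1 : ∀ᶠ g in 𝓝 (1 : G), c g ∈ P.target :=
      (c.continuousAt h1c).eventually_mem (P.open_target.mem_nhds hy0)
    have n2 : ∀ᶠ x in 𝓝 (c 1), e (P.symm x) ∈ c.source := by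
      have : ContinuousAt (fun x => e (P.symm x)) (c 1) :=
        he.continuous.continuousAt.comp (P.continuousAt_symm hy0)
      exact this.eventually_mem (c.open_source.mem_nhds (by rw [hs0, h0]; exact h1c))
    filter_upwards [n1, (c.continuousAt h1c).eventually n2, c.open_source.mem_nhds h1c]
      with g g1 g2 g3
    refine c.injOn g2 g3 ?_
    rw [← hPe, P.right_inv g1]
  have hsC : ContDiffAt ℝ ∞ P.symm (c 1) := by
    have h := hf.to_localInverse hfd (by simp)
    rw [h0] at h
    exact h
  have huC : ContMDiffAt 𝓘(ℝ, E) 𝓘(ℝ, F) ∞ (fun g => P.symm (c g)) 1 :=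
    ContMDiffAt.comp (g := P.symm) (f := c) (1 : G) hsC.contMDiffAt hcC
  refine ⟨fun g => P.symm (c g), huC, hs0, hev, ?_⟩
  have hsd : HasFDerivAt P.symm (L.symm : E →L[ℝ] F) (c 1) := by
    refine P.hasFDerivAt_symm hy0 ?_
    rw [hs0]; exact hfd
  have h1 : HasMFDerivAt 𝓘(ℝ, E) 𝓘(ℝ, F) P.symm (c 1) (L.symm : E →L[ℝ] F) := hsd.hasMFDerivAt
  exact HasMFDerivAt.comp (g := P.symm) (f := c) (1 : G) h1
    (hasMFDerivAt_chartAt_self (E := E) (1 : G))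

theorem exists_mem_nhds_injOn_of_injective {F V : Type*} [NormedAddCommGroup F] [NormedSpace ℝ F]
    [FiniteDimensional ℝ F] [NormedAddCommGroup V] [NormedSpace ℝ V] [FiniteDimensional ℝ V]
    {q : F → V} {q' : F →L[ℝ] V} {x : F} (h : HasStrictFDerivAt q q' x)
    (hq : Function.Injective q') : ∃ U ∈ 𝓝 x, InjOn q U := by
  have : CompleteSpace F := FiniteDimensional.complete ℝ F
  obtain ⟨P, hP⟩ := LinearMap.exists_leftInverse_of_injective (q' : F →ₗ[ℝ] V)
    (LinearMap.ker_eq_bot.2 hq)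
  have h1 : HasStrictFDerivAt (fun y => P.toContinuousLinearMap (q y))
      ((ContinuousLinearEquiv.refl ℝ F : F ≃L[ℝ] F) : F →L[ℝ] F) x := by
    refine (P.toContinuousLinearMap.hasStrictFDerivAt.comp x h).congr_fderiv ?_
    ext v
    exact LinearMap.congr_fun hP v
  refine ⟨_, (h1.toOpenPartialHomeomorph _).open_source.mem_nhds
    h1.mem_toOpenPartialHomeomorph_source, fun a ha b hb hab => ?_⟩
  exact (h1.toOpenPartialHomeomorph _).injOn ha hb (congrArg P.toContinuousLinearMap hab)

end SecondKind

section TorusCoordinates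

variable {E G : Type*} [NormedAddCommGroup E] [NormedSpace ℝ E] [FiniteDimensional ℝ E]
  [TopologicalSpace G] [ChartedSpace E G] [Group G] [LieGroup 𝓘(ℝ, E) ∞ G]

theorem hasMFDerivAt_Ad_expProd {n : ℕ} (X : Fin n → E) (Y : E) :
    HasStrictFDerivAt (fun y => AdModel E (expProd G X y) Y)
      (((AdDeriv E G).flip Y).comp (linComb X)) 0 := by
  have h1 : ContDiff ℝ ∞ (fun y => (AdModel E (expProd G X y) : E →L[ℝ] E)) :=
    contMDiff_iff_contDiff.1 ((contMDiff_Ad E).comp (contMDiff_expProd (G := G) X))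
  have h2 : ContDiff ℝ ∞ (fun y => AdModel E (expProd G X y) Y) := h1.clm_apply contDiff_const
  refine h2.contDiffAt.hasStrictFDerivAt' ?_ (by simp)
  have h0 : HasMFDerivAt 𝓘(ℝ, E) 𝓘(ℝ, E →L[ℝ] E) (AdModel E : G → E →L[ℝ] E) (expProd G X 0)
      (AdDeriv E G) := by
    have : ∀ k, k = (1 : G) → HasMFDerivAt 𝓘(ℝ, E) 𝓘(ℝ, E →L[ℝ] E)
      (AdModel E : G → E →L[ℝ] E) k (AdDeriv E G) := by
      rintro k rfl; exact hasMFDerivAt_AdModel_one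
    exact this _ (expProd_zero X)
  have h3 : HasFDerivAt (fun y => (AdModel E (expProd G X y) : E →L[ℝ] E))
      ((AdDeriv E G).comp (linComb X)) 0 :=
    hasMFDerivAt_iff_hasFDerivAt.1 (h0.comp (0 : Fin n → ℝ) (hasMFDerivAt_expProd X))
  refine (h3.clm_apply (hasFDerivAt_const Y _)).congr_fderiv ?_
  ext v
  simp

/-- A character of a torus, given by a linear form along one-parameter subgroups, extends to a
smooth function near `1`. -/
theorem exists_smooth_extension_character {tE : Submodule ℝ E} {T : Subgroup G} (X₀ : E)
    (hT : ∀ X ∈ tE, ∀ s, expCurve G X s ∈ T) (hfix : ∀ g ∈ T, AdModel E g X₀ = X₀)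
    (hcent : ∀ Y, bracketModel G Y X₀ = 0 → Y ∈ tE) (χ : T →* Circle) (μ : tE →ₗ[ℝ] ℝ)
    (hχ : ∀ (X : tE) s, (χ ⟨expCurve G (X : E) s, hT _ X.2 s⟩ : ℂ) =
      Complex.exp (Complex.I * (s * μ X : ℝ))) :
    ∃ (φ : G → ℂ) (ℓ : E →L[ℝ] ℂ), ContMDiffAt 𝓘(ℝ, E) 𝓘(ℝ, ℂ) ∞ φ 1 ∧
      HasMFDerivAt 𝓘(ℝ, E) 𝓘(ℝ, ℂ) φ 1 ℓ ∧ (∀ X : tE, ℓ X = Complex.I * (μ X : ℝ)) ∧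
      ∀ᶠ g in 𝓝 1, ∀ h : g ∈ T, (χ ⟨g, h⟩ : ℂ) = φ g := by
  classical
  obtain ⟨V, hV⟩ := Submodule.exists_isCompl tE
  let bV := Module.finBasis ℝ V
  let bT := Module.finBasis ℝ tE
  set k := Module.finrank ℝ V
  set r := Module.finrank ℝ tE
  let XV : Fin k → E := fun j => bV j
  let XT : Fin r → E := fun j => bT j
  let L₀ : ((Fin k → ℝ) × (Fin r → ℝ)) ≃ₗ[ℝ] E :=
    (LinearEquiv.prodCongr bV.equivFun.symm bT.equivFun.symm).trans
      (Submodule.prodEquivOfIsCompl V tE hV.symm)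
  have hsumV : ∀ v : Fin k → ℝ, linComb XV v = (bV.equivFun.symm v : V) := fun v => by
    rw [linComb_apply, Module.Basis.equivFun_symm_apply]
    simp [XV]
  have hsumT : ∀ v : Fin r → ℝ, linComb XT v = (bT.equivFun.symm v : tE) := fun v => by
    rw [linComb_apply, Module.Basis.equivFun_symm_apply]
    simp [XT]
  have hL₀ : ∀ y, L₀ y = linComb XV y.1 + linComb XT y.2 := by
    intro y
    rw [hsumV, hsumT]
    rfl
  let L : ((Fin k → ℝ) × (Fin r → ℝ)) ≃L[ℝ] E := L₀.toContinuousLinearEquiv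
  let e : (Fin k → ℝ) × (Fin r → ℝ) → G := fun y => expProd G XV y.1 * expProd G XT y.2
  have he0 : e 0 = 1 := by simp [e, expProd_zero]
  have heC : ContMDiff 𝓘(ℝ, (Fin k → ℝ) × (Fin r → ℝ)) 𝓘(ℝ, E) ∞ e :=
    ((contMDiff_expProd XV).comp (ContinuousLinearMap.fst ℝ (Fin k → ℝ) (Fin r → ℝ)).contMDiff).mul
      ((contMDiff_expProd XT).comp (ContinuousLinearMap.snd ℝ (Fin k → ℝ) (Fin r → ℝ)).contMDiff)
  have heL : HasMFDerivAt 𝓘(ℝ, (Fin k → ℝ) × (Fin r → ℝ)) 𝓘(ℝ, E) e 0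
      (L : ((Fin k → ℝ) × (Fin r → ℝ)) →L[ℝ] E) := by
    have h1 := HasMFDerivAt.comp (f := ContinuousLinearMap.fst ℝ (Fin k → ℝ) (Fin r → ℝ))
      (g := expProd G XV) 0 (hasMFDerivAt_expProd XV)
      (ContinuousLinearMap.fst ℝ (Fin k → ℝ) (Fin r → ℝ)).hasMFDerivAt
    have h2 := HasMFDerivAt.comp (f := ContinuousLinearMap.snd ℝ (Fin k → ℝ) (Fin r → ℝ))
      (g := expProd G XT) 0 (hasMFDerivAt_expProd XT)
      (ContinuousLinearMap.snd ℝ (Fin k → ℝ) (Fin r → ℝ)).hasMFDerivAt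
    refine (HasMFDerivAt.mul_at_one h1 h2 (expProd_zero XV) (expProd_zero XT)).congr_mfderiv ?_
    have : ∀ A B : ((Fin k → ℝ) × (Fin r → ℝ)) →L[ℝ] E, (∀ y, A y = B y) → A = B :=
      fun A B h => ContinuousLinearMap.ext h
    exact this _ _ fun y => (hL₀ y).symm
  obtain ⟨u, huC, hu1, hue, huD⟩ := exists_local_lift heC he0 heL
  -- elements of `T` have no component transverse to the torus
  obtain ⟨U, hU, hinj⟩ := exists_mem_nhds_injOn_of_injective (hasMFDerivAt_Ad_expProd (G := G) XV X₀)
    (by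
      rw [injective_iff_map_eq_zero]
      intro v hv
      have h1 : linComb XV v ∈ tE := hcent _ (by rw [← AdDeriv_apply]; exact hv)
      rw [hsumV] at h1
      have h2 : ((bV.equivFun.symm v : V) : E) = 0 :=
        Submodule.disjoint_def.1 hV.disjoint _ h1 (Subtype.mem _)
      have h3 : bV.equivFun.symm v = 0 := Subtype.ext h2
      exact (LinearEquiv.map_eq_zero_iff _).1 h3)
  have hXT : ∀ j s, expCurve G (XT j) s ∈ T := fun j s => hT _ (bT j).2 s
  let m : Fin r → ℝ := fun j => μ (bT j)
  let lin : ((Fin k → ℝ) × (Fin r → ℝ)) →L[ℝ] ℝ :=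
    (∑ j, (m j) • ContinuousLinearMap.proj (R := ℝ) (φ := fun _ : Fin r => ℝ) j).comp
      (ContinuousLinearMap.snd ℝ (Fin k → ℝ) (Fin r → ℝ))
  have hlin : ∀ y, lin y = ∑ j, y.2 j * m j := fun y => by
    simp [lin, mul_comm]
  let ψ : ((Fin k → ℝ) × (Fin r → ℝ)) → ℂ := fun y => Complex.exp (Complex.I * (lin y : ℝ))
  have hψC : ContDiff ℝ ∞ ψ :=
    (contDiff_const.mul (Complex.ofRealCLM.contDiff.comp lin.contDiff)).cexp
  have hψD : HasFDerivAt ψ (Complex.I • Complex.ofRealCLM.comp lin) 0 := by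
    have h1 : HasFDerivAt (fun y => Complex.I * (lin y : ℂ)) (Complex.I • Complex.ofRealCLM.comp lin) 0 :=
      (Complex.ofRealCLM.comp lin).hasFDerivAt.const_mul Complex.I
    simpa using h1.cexp
  have hψ1 : ContMDiffAt 𝓘(ℝ, (Fin k → ℝ) × (Fin r → ℝ)) 𝓘(ℝ, ℂ) ∞ ψ (u 1) :=
    hψC.contMDiff.contMDiffAt
  have hψ2 : HasMFDerivAt 𝓘(ℝ, (Fin k → ℝ) × (Fin r → ℝ)) 𝓘(ℝ, ℂ) ψ (u 1)
      (Complex.I • Complex.ofRealCLM.comp lin) := by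
    rw [hu1]; exact hψD.hasMFDerivAt
  refine ⟨fun g => ψ (u g), (Complex.I • Complex.ofRealCLM.comp lin).comp
    (L.symm : E →L[ℝ] (Fin k → ℝ) × (Fin r → ℝ)),
    ContMDiffAt.comp (g := ψ) (f := u) (1 : G) hψ1 huC,
    HasMFDerivAt.comp (g := ψ) (f := u) (1 : G) hψ2 huD, fun X => ?_, ?_⟩
  · have h1 : L.symm (X : E) = (0, bT.equivFun X) := by
      rw [ContinuousLinearEquiv.symm_apply_eq]
      change (X : E) = L₀ _
      rw [hL₀, hsumT]
      simp
    have h2 : lin (L.symm (X : E)) = μ X := by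
      rw [h1, hlin]
      have h3 := congrArg μ (bT.sum_equivFun X)
      rw [map_sum] at h3
      rw [← h3]
      simp [m]
    change Complex.I * (lin (L.symm (X : E)) : ℂ) = _
    rw [h2]
  · have n1 : ∀ᶠ g in 𝓝 (1 : G), (u g).1 ∈ U := by
      have : ContinuousAt (fun g => (u g).1) 1 := continuous_fst.continuousAt.comp huC.continuousAt
      exact this.eventually_mem (by rw [hu1]; exact hU)
    filter_upwards [hue, n1] with g h1 h2 h3
    have hTm := expProd_mem hXT (u g).2
    have h4 : expProd G XV (u g).1 ∈ T := by
      have : expProd G XV (u g).1 = g * (expProd G XT (u g).2)⁻¹ := by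
        rw [eq_mul_inv_iff_mul_eq]; exact h1
      rw [this]
      exact T.mul_mem h3 (T.inv_mem hTm)
    have h5 : (u g).1 = 0 := by
      refine hinj h2 (mem_of_mem_nhds hU) ?_
      change AdModel E (expProd G XV (u g).1) X₀ = AdModel E (expProd G XV 0) X₀
      rw [hfix _ h4, expProd_zero, AdModel_one]; rfl
    have h6 : g = expProd G XT (u g).2 := by
      nth_rewrite 1 [← h1]
      change expProd G XV (u g).1 * _ = _
      rw [h5, expProd_zero, one_mul]
    have h7 := apply_expProd χ hXT m (fun j s => hχ (bT j) s) (u g).2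
    change _ = Complex.exp (Complex.I * (lin (u g) : ℝ))
    rw [hlin, ← h7]
    congr 2
    exact Subtype.ext h6

/-- The derivative of the inverse at the unit. -/
theorem HasMFDerivAt.inv_at_one {F : Type*} [NormedAddCommGroup F] [NormedSpace ℝ F]
    {f : F → G} {f' : F →L[ℝ] E} {z : F} (hf : HasMFDerivAt 𝓘(ℝ, F) 𝓘(ℝ, E) f z f')
    (hf1 : f z = 1) : HasMFDerivAt 𝓘(ℝ, F) 𝓘(ℝ, E) (fun y => (f y)⁻¹) z (-f') := by
  have h1 : MDifferentiableAt 𝓘(ℝ, E) 𝓘(ℝ, E) (fun g : G => g⁻¹) (f z) :=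
    ((contMDiff_inv 𝓘(ℝ, E) ∞).contMDiffAt (x := f z)).mdifferentiableAt (by simp)
  have h2 := (h1.comp z hf.mdifferentiableAt).hasMFDerivAt
  set D : F →L[ℝ] E := mfderiv 𝓘(ℝ, F) 𝓘(ℝ, E) ((fun g : G => g⁻¹) ∘ f) z with hD
  have h2' : HasMFDerivAt 𝓘(ℝ, F) 𝓘(ℝ, E) (fun y => (f y)⁻¹) z D := h2
  have h3 := HasMFDerivAt.mul_at_one hf h2' hf1 (by simp [hf1])
  have e : (fun y => f y * (f y)⁻¹) = fun _ => (1 : G) := by ext; simp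
  rw [e] at h3
  have h4 : f' + D = 0 := hasMFDerivAt_unique h3 (hasMFDerivAt_const (1 : G) z)
  have h5 : D = -f' := (neg_eq_of_add_eq_zero_right h4).symm
  rw [← h5]; exact h2'

end TorusCoordinates

section Centralizer

variable {E G : Type*} [NormedAddCommGroup E] [NormedSpace ℝ E] [FiniteDimensional ℝ E]
  [TopologicalSpace G] [ChartedSpace E G] [Group G] [LieGroup 𝓘(ℝ, E) ∞ G]

/-- The elements of the Lie group which are conjugate to an element of a subgroup `T` contain a
neighbourhood of `t₀ ∈ T`, if `𝔤 = (Ad t₀⁻¹ - 1) 𝔤 + 𝔱`. -/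
theorem eventually_exists_conj {tE : Submodule ℝ E} {T : Subgroup G}
    (hT : ∀ X ∈ tE, ∀ s, expCurve G X s ∈ T) {t₀ : G} (ht₀ : t₀ ∈ T)
    (hsurj : ∀ Y : E, ∃ Z, ∃ X ∈ tE, Y = AdModel E t₀⁻¹ Z - Z + X) :
    ∀ᶠ g in 𝓝 t₀, ∃ a, ∃ h ∈ T, g = a * h * a⁻¹ := by
  have : IsManifold 𝓘(ℝ, E) 1 G := IsManifold.of_le (n := ∞) (by simp)
  have : IsTopologicalGroup G := topologicalGroup_of_lieGroup 𝓘(ℝ, E) ∞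
  have : CompleteSpace E := FiniteDimensional.complete ℝ E
  let b := Module.finBasis ℝ E
  let bT := Module.finBasis ℝ tE
  set n := Module.finrank ℝ E
  set r := Module.finrank ℝ tE
  let XT : Fin r → E := fun j => bT j
  let F := (Fin n → ℝ) × (Fin r → ℝ)
  let p1 := ContinuousLinearMap.fst ℝ (Fin n → ℝ) (Fin r → ℝ)
  let p2 := ContinuousLinearMap.snd ℝ (Fin n → ℝ) (Fin r → ℝ)
  have a1 : HasMFDerivAt 𝓘(ℝ, F) 𝓘(ℝ, E) (fun y : F => expProd G b y.1) 0
      ((linComb b).comp p1) :=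
    HasMFDerivAt.comp (f := p1) (g := expProd G b) 0 (hasMFDerivAt_expProd b) p1.hasMFDerivAt
  have a2 : HasMFDerivAt 𝓘(ℝ, F) 𝓘(ℝ, E) (fun y : F => expProd G XT y.2) 0
      ((linComb XT).comp p2) :=
    HasMFDerivAt.comp (f := p2) (g := expProd G XT) 0 (hasMFDerivAt_expProd XT) p2.hasMFDerivAt
  have e1 : expProd G b (0 : F).1 = 1 := expProd_zero _
  have e2 : expProd G XT (0 : F).2 = 1 := expProd_zero _
  have a3 : HasMFDerivAt 𝓘(ℝ, F) 𝓘(ℝ, E) (fun y : F => t₀⁻¹ * expProd G b y.1 * t₀⁻¹⁻¹) 0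
      ((AdModel E t₀⁻¹).comp ((linComb b).comp p1)) := by
    have h1 : ∀ k, k = (1 : G) → HasMFDerivAt 𝓘(ℝ, E) 𝓘(ℝ, E) (fun h : G => t₀⁻¹ * h * t₀⁻¹⁻¹) k
        (AdModel E t₀⁻¹) := by
      rintro k rfl; exact hasMFDerivAt_conj (E := E) t₀⁻¹
    exact (h1 _ e1).comp (0 : F) a1
  have a4 := a1.inv_at_one e1
  have a5 := a3.mul_at_one a2 (by simp [expProd_zero]) e2
  have a6 := a5.mul_at_one a4 (by simp [expProd_zero]) (by simp [expProd_zero])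
  set q : F → G := fun y => (t₀⁻¹ * expProd G b y.1 * t₀⁻¹⁻¹ * expProd G XT y.2) *
    (expProd G b y.1)⁻¹ with hq
  set q' : F →L[ℝ] E := (AdModel E t₀⁻¹).comp ((linComb b).comp p1) + (linComb XT).comp p2 +
    -((linComb b).comp p1) with hq'
  have hq0 : q 0 = 1 := by simp [hq, expProd_zero]
  have hqC : ContMDiff 𝓘(ℝ, F) 𝓘(ℝ, E) ∞ q := by
    have b1 : ContMDiff 𝓘(ℝ, F) 𝓘(ℝ, E) ∞ (fun y : F => expProd G b y.1) :=
      (contMDiff_expProd b).comp p1.contMDiff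
    have b2 : ContMDiff 𝓘(ℝ, F) 𝓘(ℝ, E) ∞ (fun y : F => expProd G XT y.2) :=
      (contMDiff_expProd XT).comp p2.contMDiff
    exact (((contMDiff_const.mul b1).mul contMDiff_const).mul b2).mul b1.inv
  set c := chartAt E (1 : G) with hc
  have h1c : (1 : G) ∈ c.source := mem_chart_source E 1
  have hcC : ContMDiffAt 𝓘(ℝ, E) 𝓘(ℝ, E) ∞ c (q 0) := by
    rw [hq0]; exact contMDiffOn_chart.contMDiffAt (c.open_source.mem_nhds h1c)
  have hcd : ∀ k, k = (1 : G) → HasMFDerivAt 𝓘(ℝ, E) 𝓘(ℝ, E) c k (ContinuousLinearMap.id ℝ E) := by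
    rintro k rfl; exact hasMFDerivAt_chartAt_self (E := E) (1 : G)
  have hfd : HasFDerivAt (fun y => c (q y)) q' 0 :=
    HasMFDerivAt.toModel ((hcd _ hq0).comp (0 : F) a6)
  have hfs : HasStrictFDerivAt (fun y => c (q y)) q' 0 :=
    ((hcC.comp (0 : F) hqC.contMDiffAt).contDiffAt).hasStrictFDerivAt' hfd (by simp)
  have hrange : q'.range = ⊤ := by
    rw [LinearMap.range_eq_top]
    intro Y
    obtain ⟨Z, X, hX, hY⟩ := hsurj Y
    refine ⟨(b.equivFun Z, bT.equivFun ⟨X, hX⟩), ?_⟩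
    have h1 : linComb b (b.equivFun Z) = Z := by
      rw [linComb_apply]; exact b.sum_equivFun Z
    have h2 : linComb XT (bT.equivFun ⟨X, hX⟩) = X := by
      rw [linComb_apply]
      have := congrArg Subtype.val (bT.sum_equivFun ⟨X, hX⟩)
      rw [Submodule.coe_sum] at this
      exact this
    change AdModel E t₀⁻¹ (linComb b (b.equivFun Z)) + linComb XT (bT.equivFun ⟨X, hX⟩) +
      -(linComb b (b.equivFun Z)) = Y
    rw [h1, h2, hY]
    abel
  have hmap := hfs.map_nhds_eq_of_surj hrange
  have hev : ∀ᶠ x in 𝓝 (c (q 0)), ∃ y, q y ∈ c.source ∧ c (q y) = x := by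
    rw [← hmap, Filter.eventually_map]
    have : ∀ᶠ y in 𝓝 (0 : F), q y ∈ c.source :=
      hqC.continuous.continuousAt.eventually_mem (c.open_source.mem_nhds (by rw [hq0]; exact h1c))
    filter_upwards [this] with y hy using ⟨y, hy, rfl⟩
  rw [hq0] at hev
  have h2 : ∀ᶠ k in 𝓝 (1 : G), ∃ y, q y = k := by
    filter_upwards [(c.continuousAt h1c).eventually hev, c.open_source.mem_nhds h1c]
      with k ⟨y, hy, hk⟩ hks
    exact ⟨y, c.injOn hy hks hk⟩
  have h3 : Filter.Tendsto (fun g : G => t₀⁻¹ * g) (𝓝 t₀) (𝓝 1) := by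
    have : ContinuousAt (fun g : G => t₀⁻¹ * g) t₀ := by fun_prop
    rw [ContinuousAt, inv_mul_cancel] at this
    exact this
  filter_upwards [h3.eventually h2] with g ⟨y, hy⟩
  refine ⟨expProd G b y.1, t₀ * expProd G XT y.2,
    T.mul_mem ht₀ (expProd_mem (fun j s => hT _ (bT j).2 s) _), ?_⟩
  have : g = t₀ * q y := by rw [hy]; group
  rw [this]
  simp only [hq]
  group

/-- Every coefficient of `charpoly (Ad g - 1)` which vanishes on an open set vanishes
everywhere. -/
theorem coeff_charpoly_Ad_sub_one_eq_zero [ConnectedSpace G] {r : ℕ} {U : Set G} (hU : IsOpen U)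
    (hne : U.Nonempty)
    (h : ∀ g ∈ U, ∀ i < r, ((AdModel E g : E →ₗ[ℝ] E) - 1).charpoly.coeff i = 0) (g : G) :
    ∀ i < r, ((AdModel E g : E →ₗ[ℝ] E) - 1).charpoly.coeff i = 0 := by
  have : IsTopologicalGroup G := topologicalGroup_of_lieGroup 𝓘(ℝ, E) ∞
  set P : Set G := {g | ∀ i < r, ((AdModel E g : E →ₗ[ℝ] E) - 1).charpoly.coeff i = 0} with hP
  let b := Module.finBasis ℝ E
  have hb : HasMFDerivAt 𝓘(ℝ, Fin (Module.finrank ℝ E) → ℝ) 𝓘(ℝ, E) (expProd G b) 0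
      ((b.equivFun.symm.toContinuousLinearEquiv :
        (Fin (Module.finrank ℝ E) → ℝ) ≃L[ℝ] E) : (Fin (Module.finrank ℝ E) → ℝ) →L[ℝ] E) := by
    refine (hasMFDerivAt_expProd b).congr_mfderiv ?_
    have : ∀ A B : (Fin (Module.finrank ℝ E) → ℝ) →L[ℝ] E, (∀ y, A y = B y) → A = B :=
      fun A B h => ContinuousLinearMap.ext h
    refine this _ _ fun y => ?_
    rw [linComb_apply]
    exact (b.equivFun_symm_apply y).symm
  obtain ⟨u, -, -, hue, -⟩ := exists_local_lift (contMDiff_expProd b) (expProd_zero _) hb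
  have key : ∀ g₀ ∈ closure (interior P), g₀ ∈ interior P := by
    intro g₀ hg₀
    obtain ⟨W, hW, hWo, h1W⟩ := eventually_nhds_iff.1 hue
    have hn : (fun g => g₀⁻¹ * g) ⁻¹' W ∈ 𝓝 g₀ := by
      refine (hWo.preimage (continuous_const_mul g₀⁻¹)).mem_nhds ?_
      simpa using h1W
    obtain ⟨g₁, hg₁, hg₁P⟩ := mem_closure_iff_nhds.1 hg₀ _ hn
    have han : ∀ i < r, ∀ y : Fin (Module.finrank ℝ E) → ℝ,
        ((AdModel E (g₀ * expProd G b y) : E →ₗ[ℝ] E) - 1).charpoly.coeff i = 0 := by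
      intro i hi
      let bb := Module.finBasis ℝ (E →ₗ[ℝ] E)
      have hco : ∀ A : E →ₗ[ℝ] E, A.charpoly.coeff i =
          MvPolynomial.eval (bb.repr A) (((LinearMap.id : (E →ₗ[ℝ] E) →ₗ[ℝ]
            Module.End ℝ E).polyCharpoly bb).coeff i) := fun A => by
        rw [LinearMap.polyCharpoly_coeff_eval]; rfl
      have han1 : AnalyticOnNhd ℝ (fun y : Fin (Module.finrank ℝ E) → ℝ =>
          ((AdModel E (g₀ * expProd G b y) : E →ₗ[ℝ] E) - 1).charpoly.coeff i) univ := by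
        intro y _
        simp only [hco]
        have hlin : ∀ j, AnalyticAt ℝ (fun y : Fin (Module.finrank ℝ E) → ℝ =>
            bb.repr ((AdModel E (g₀ * expProd G b y) : E →ₗ[ℝ] E) - 1) j) y := by
          intro j
          let Lj : (E →L[ℝ] E) →ₗ[ℝ] ℝ := (bb.coord j).comp (ContinuousLinearMap.coeLM ℝ)
          have h1 : AnalyticAt ℝ (fun y => Lj.toContinuousLinearMap
              ((AdModel E g₀ : E →L[ℝ] E) * (AdModel E (expProd G b y) : E →L[ℝ] E) - 1)) y :=
            (Lj.toContinuousLinearMap.analyticAt _).comp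
              (((analyticAt_const.mul (analyticAt_Ad_expProd b y))).sub analyticAt_const)
          refine h1.congr (Filter.Eventually.of_forall fun z => ?_)
          change bb.repr _ j = bb.repr _ j
          rw [AdModel_mul]
          rfl
        exact AnalyticAt.aeval_mvPolynomial hlin _
      have hev : (fun y : Fin (Module.finrank ℝ E) → ℝ =>
          ((AdModel E (g₀ * expProd G b y) : E →ₗ[ℝ] E) - 1).charpoly.coeff i) =ᶠ[𝓝 (u (g₀⁻¹ * g₁))]
          0 := by
        have hcont : Continuous (fun y => g₀ * expProd G b y) :=
          continuous_const.mul (contMDiff_expProd b).continuous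
        have hmem : g₀ * expProd G b (u (g₀⁻¹ * g₁)) ∈ interior P := by
          rw [hW _ hg₁, mul_inv_cancel_left]; exact hg₁P
        filter_upwards [(isOpen_interior.preimage hcont).mem_nhds hmem] with y hy
        exact (interior_subset hy : _ ∈ P) i hi
      intro y
      exact han1.eqOn_zero_of_preconnected_of_eventuallyEq_zero isPreconnected_univ
        (mem_univ _) hev (mem_univ y)
    rw [mem_interior_iff_mem_nhds]
    filter_upwards [hn] with g hg i hi
    have := han i hi (u (g₀⁻¹ * g))
    rwa [hW _ hg, mul_inv_cancel_left] at this
  have hcl : IsClopen (interior P) :=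
    ⟨isClosed_of_closure_subset key, isOpen_interior⟩
  have huniv : interior P = univ := by
    refine hcl.eq_univ ?_
    obtain ⟨k, hk⟩ := hne
    exact ⟨k, mem_interior.2 ⟨U, fun g hg => h g hg, hU, hk⟩⟩
  have : g ∈ interior P := by rw [huniv]; trivial
  exact interior_subset this

end Centralizer

theorem countable_setOf_exp_eq {a : ℝ} (ha : a ≠ 0) (w : ℂ) :
    {s : ℝ | Complex.exp (s * (Complex.I * a)) = w}.Countable := by
  rcases eq_empty_or_nonempty {s : ℝ | Complex.exp (s * (Complex.I * a)) = w} with h | ⟨s₁, hs₁⟩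
  · rw [h]; exact countable_empty
  · refine (countable_range fun n : ℤ => s₁ + n * (2 * Real.pi) / a).mono ?_
    intro s hs
    have h1 : Complex.exp (s * (Complex.I * a)) = Complex.exp (s₁ * (Complex.I * a)) := hs.trans hs₁.symm
    obtain ⟨n, hn⟩ := Complex.exp_eq_exp_iff_exists_int.1 h1
    refine ⟨n, ?_⟩
    have h2 : (Complex.I * ((s * a : ℝ) : ℂ)) = Complex.I * ((s₁ * a + n * (2 * Real.pi) : ℝ) : ℂ) := by
      push_cast
      linear_combination hn
    have h3 : s * a = s₁ * a + n * (2 * Real.pi) := by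
      exact_mod_cast mul_left_cancel₀ Complex.I_ne_zero h2
    change s₁ + n * (2 * Real.pi) / a = s
    field_simp
    linarith

theorem exists_forall_exp_ne {ι : Type*} [Finite ι] {a : ι → ℝ} (ha : ∀ j, a j ≠ 0) {S : Set ℂ}
    (hS : S.Finite) : ∃ s : ℝ, ∀ j, ∀ w ∈ S, Complex.exp (s * (Complex.I * a j)) ≠ w := by
  have hc : (⋃ j, ⋃ w ∈ S, {s : ℝ | Complex.exp (s * (Complex.I * a j)) = w}).Countable :=
    countable_iUnion fun j => hS.countable.biUnion fun w _ => countable_setOf_exp_eq (ha j) w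
  have hne : (⋃ j, ⋃ w ∈ S, {s : ℝ | Complex.exp (s * (Complex.I * a j)) = w}) ≠ univ := by
    intro h
    rw [h] at hc
    exact Cardinal.not_countable_real hc
  obtain ⟨s, hs⟩ := (ne_univ_iff_exists_notMem _).1 hne
  refine ⟨s, fun j w hw h => hs ?_⟩
  simp only [mem_iUnion]
  exact ⟨j, w, hw, h⟩

section Centralizer

variable {E G : Type*} [NormedAddCommGroup E] [NormedSpace ℝ E] [FiniteDimensional ℝ E]
  [TopologicalSpace G] [ChartedSpace E G] [Group G] [LieGroup 𝓘(ℝ, E) ∞ G]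

/-- `Ad g` as a linear automorphism. -/
noncomputable def AdEquiv (E : Type*) {G : Type*} [NormedAddCommGroup E] [NormedSpace ℝ E]
    [TopologicalSpace G] [ChartedSpace E G] [Group G] [LieGroup 𝓘(ℝ, E) ∞ G] (g : G) : E ≃ₗ[ℝ] E :=
  LinearEquiv.ofLinearMap (AdModel E g : E →ₗ[ℝ] E) (AdModel E g⁻¹ : E →ₗ[ℝ] E)
    (LinearMap.ext fun Y => AdModel_apply_inv g Y) (LinearMap.ext fun Y => AdModel_inv_apply g Y)

theorem le_finrank_maxGenEigenspace_Ad [ConnectedSpace G] {ι : Type*} [Finite ι]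
    {tE : Submodule ℝ E} {T : Subgroup G} (hT : ∀ X ∈ tE, ∀ s, expCurve G X s ∈ T)
    (hfix : ∀ g ∈ T, ∀ X ∈ tE, AdModel E g X = X) {X₀ : E} (hX₀ : X₀ ∈ tE)
    (κ : ι → E →L[ℝ] ℂ) {a : ι → ℝ} (ha : ∀ j, a j ≠ 0)
    (hκ : ∀ j Y, κ j (bracketModel G X₀ Y) = Complex.I * a j * κ j Y)
    (hker : ∀ Y, (∀ j, κ j Y = 0) ↔ Y ∈ tE) (g : G) :
    Module.finrank ℝ tE ≤ Module.finrank ℝ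
      (Module.End.maxGenEigenspace ((AdModel E g : E →ₗ[ℝ] E) - 1) 0) := by
  obtain ⟨s, hs⟩ := exists_forall_exp_ne ha (finite_singleton (1 : ℂ))
  have hγ := isOneParameterSubgroup_expCurve (E := E) (G := G) X₀
  set t₀ := expCurve G X₀ (-s) with ht₀
  have ht₀T : t₀ ∈ T := hT _ hX₀ _
  have ht₀i : t₀⁻¹ = expCurve G X₀ s := by rw [ht₀, hγ.map_neg, inv_inv]
  set N : E →ₗ[ℝ] E := (AdModel E t₀⁻¹ : E →ₗ[ℝ] E) - 1 with hN
  have hNκ : ∀ j Y, κ j (N Y) = (Complex.exp (s * (Complex.I * a j)) - 1) * κ j Y := by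
    intro j Y
    have := hγ.apply_Ad_of_eigen (κ j) (hκ j) s Y
    change κ j (AdModel E t₀⁻¹ Y - Y) = _
    rw [map_sub, ht₀i, this, sub_mul, one_mul]
  have hNt : ∀ Y, N Y ∈ tE → Y ∈ tE := by
    intro Y hY
    rw [← hker] at hY ⊢
    intro j
    have := hY j
    rw [hNκ, mul_eq_zero] at this
    exact this.resolve_left (sub_ne_zero.2 (hs j 1 rfl))
  have hN0 : ∀ Y ∈ tE, N Y = 0 := fun Y hY =>
    sub_eq_zero.2 (hfix _ (T.inv_mem ht₀T) Y hY)
  have hkerN : LinearMap.ker N = tE := by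
    ext Y
    exact ⟨fun h => hNt Y (by rw [LinearMap.mem_ker.1 h]; exact tE.zero_mem), fun h => hN0 Y h⟩
  have htop : LinearMap.range N ⊔ LinearMap.ker N = ⊤ := by
    refine Submodule.eq_top_of_disjoint _ _ (LinearMap.finrank_range_add_finrank_ker N).ge ?_
    rw [Submodule.disjoint_def]
    rintro _ ⟨Y, rfl⟩ h
    rw [hkerN] at h
    exact hN0 Y (hNt Y h)
  have hev := eventually_exists_conj hT ht₀T (fun Y => by
    have : Y ∈ LinearMap.range N ⊔ LinearMap.ker N := by rw [htop]; trivial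
    obtain ⟨_, ⟨Z, rfl⟩, X, hX, rfl⟩ := Submodule.mem_sup.1 this
    rw [hkerN] at hX
    exact ⟨Z, X, hX, rfl⟩)
  obtain ⟨U, hU, hUo, htU⟩ := eventually_nhds_iff.1 hev
  have hcoef : ∀ g ∈ U, ∀ i < Module.finrank ℝ tE,
      ((AdModel E g : E →ₗ[ℝ] E) - 1).charpoly.coeff i = 0 := by
    intro g hg i hi
    obtain ⟨b, h, hh, rfl⟩ := hU g hg
    have e1 : (AdModel E (b * h * b⁻¹) : E →ₗ[ℝ] E) - 1 =
        (AdEquiv E b).conj ((AdModel E h : E →ₗ[ℝ] E) - 1) := by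
      ext Y
      have h1 : AdModel E (b * h * b⁻¹) Y = AdModel E b (AdModel E h (AdModel E b⁻¹ Y)) := by
        rw [AdModel_mul, AdModel_mul]; rfl
      change AdModel E (b * h * b⁻¹) Y - Y =
        AdModel E b (AdModel E h (AdModel E b⁻¹ Y) - AdModel E b⁻¹ Y)
      rw [h1, map_sub, AdModel_apply_inv]
    rw [e1, LinearEquiv.charpoly_conj]
    refine Polynomial.coeff_eq_zero_of_lt_natTrailingDegree (lt_of_lt_of_le hi ?_)
    rw [← LinearMap.finrank_maxGenEigenspace_zero_eq]
    refine Submodule.finrank_mono (fun X hX => ?_)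
    rw [Module.End.mem_maxGenEigenspace]
    refine ⟨1, ?_⟩
    rw [zero_smul, sub_zero, pow_one]
    exact sub_eq_zero.2 (hfix h hh X hX)
  have hall := coeff_charpoly_Ad_sub_one_eq_zero hUo ⟨t₀, htU⟩ hcoef g
  rw [LinearMap.finrank_maxGenEigenspace_zero_eq]
  by_contra hlt
  have h1 := hall _ (not_le.1 hlt)
  exact Polynomial.trailingCoeff_nonzero_iff_nonzero.2 (LinearMap.charpoly_monic _).ne_zero h1

/-- An element of a connected group which fixes a regular element of a compact Cartan subalgebra
centralizes the Cartan subalgebra. -/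
theorem Ad_eq_self_of_fixes_regular [ConnectedSpace G] {ι : Type*} [Finite ι]
    {tE : Submodule ℝ E} {T : Subgroup G} (hT : ∀ X ∈ tE, ∀ s, expCurve G X s ∈ T)
    (hfix : ∀ g ∈ T, ∀ X ∈ tE, AdModel E g X = X) {X₀ : E} (hX₀ : X₀ ∈ tE)
    (κ : ι → E →L[ℝ] ℂ) {a : ι → ℝ} (ha : ∀ j, a j ≠ 0)
    (hκ : ∀ j Y, κ j (bracketModel G X₀ Y) = Complex.I * a j * κ j Y)
    (hker : ∀ Y, (∀ j, κ j Y = 0) ↔ Y ∈ tE) (B : E →ₗ[ℝ] E →ₗ[ℝ] ℝ)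
    (hB : ∀ X ∈ tE, B X X = 0 → X = 0) {g : G}
    (hBg : ∀ X Y, B (AdModel E g X) (AdModel E g Y) = B X Y) (hg : AdModel E g X₀ = X₀) :
    ∀ X ∈ tE, AdModel E g X = X := by
  set D : E →ₗ[ℝ] E := (AdDeriv E G X₀ : E →ₗ[ℝ] E) with hD
  set A : E →ₗ[ℝ] E := (AdModel E g : E →ₗ[ℝ] E) with hA
  have hAD : ∀ Y, A (bracketModel G X₀ Y) = bracketModel G X₀ (A Y) := by
    intro Y
    have := AdModel_bracketModel g X₀ Y
    rwa [hg] at this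
  -- the action of `A` on complex valued linear forms
  let A' : Module.End ℂ (E →ₗ[ℝ] ℂ) :=
    { toFun := fun k => k.comp A, map_add' := fun _ _ => rfl, map_smul' := fun _ _ => rfl }
  have hfinE : Module.Finite ℂ (E →ₗ[ℝ] ℂ) := by
    have : Module.Finite ℝ (E →ₗ[ℝ] ℂ) := inferInstance
    exact Module.Finite.of_restrictScalars_finite ℝ ℂ _
  have hspec : {w : ℂ | A'.HasEigenvalue w⁻¹}.Finite := by
    have h1 : {w : ℂ | A'.HasEigenvalue w}.Finite := A'.finite_hasEigenvalue
    exact h1.preimage inv_injective.injOn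
  obtain ⟨s, hs⟩ := exists_forall_exp_ne ha hspec
  have hγ := isOneParameterSubgroup_expCurve (E := E) (G := G) X₀
  set h := expCurve G X₀ s with hh
  have hhT : h ∈ T := hT _ hX₀ _
  -- the eigenspaces of `ad X₀` on forms
  let W : ι → Submodule ℂ (E →ₗ[ℝ] ℂ) := fun j =>
    { carrier := {k | ∀ Y, k (bracketModel G X₀ Y) = Complex.I * a j * k Y}
      add_mem' := fun {k l} hk hl Y => by
        rw [LinearMap.add_apply, LinearMap.add_apply, hk, hl]; ring
      zero_mem' := fun Y => by simp
      smul_mem' := fun c k hk Y => by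
        rw [LinearMap.smul_apply, LinearMap.smul_apply, hk]; simp only [smul_eq_mul]; ring }
  have hWA : ∀ j, ∀ k ∈ W j, A' k ∈ W j := fun j k hk Y => by
    change k (A (bracketModel G X₀ Y)) = _ * k (A Y)
    rw [hAD, hk]
  have hWs : ∀ j, ∀ k ∈ W j, ∀ Y, k (AdModel E h Y) =
      Complex.exp (s * (Complex.I * a j)) * k Y := by
    intro j k hk Y
    exact hγ.apply_Ad_of_eigen k.toContinuousLinearMap hk s Y
  set C : E →ₗ[ℝ] E := (AdModel E (g * h) : E →ₗ[ℝ] E) - 1 with hC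
  have hCk : ∀ j, ∀ k ∈ W j, ∀ Y, k (C Y) =
      (Complex.exp (s * (Complex.I * a j)) • A' k - k) Y := by
    intro j k hk Y
    have e1 : C Y = A (AdModel E h Y) - Y := by
      rw [hC, AdModel_mul]; rfl
    rw [e1, map_sub]
    change (A' k) (AdModel E h Y) - k Y = _
    rw [hWs j _ (hWA j k hk)]
    rfl
  have hmem : ∀ Y, C Y ∈ tE → Y ∈ tE := by
    intro Y hY
    rw [← hker]
    intro j
    let R : W j →ₗ[ℂ] W j :=
      { toFun := fun k => ⟨Complex.exp (s * (Complex.I * a j)) • A' k.1 - k.1,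
          (W j).sub_mem ((W j).smul_mem _ (hWA j _ k.2)) k.2⟩
        map_add' := fun k l => Subtype.ext (by simp only [Submodule.coe_add, map_add, smul_add]; abel)
        map_smul' := fun c k => Subtype.ext (by
          simp only [Submodule.coe_smul, map_smul, RingHom.id_apply, smul_sub]
          rw [smul_comm]) }
    have hRinj : Function.Injective R := by
      rw [injective_iff_map_eq_zero]
      intro k hk
      by_contra hk0
      have h1 : Complex.exp (s * (Complex.I * a j)) • A' k.1 = k.1 :=
        sub_eq_zero.1 (congrArg Subtype.val hk)
      refine hs j (Complex.exp (s * (Complex.I * a j))) ?_ rfl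
      change A'.HasEigenvalue _
      refine Module.End.hasEigenvalue_of_hasEigenvector (x := k.1)
        ⟨Module.End.mem_eigenspace_iff.2 ?_, fun h0 => hk0 (Subtype.ext h0)⟩
      nth_rewrite 2 [← h1]
      rw [smul_smul, inv_mul_cancel₀ (Complex.exp_ne_zero _), one_smul]
    have hRsurj : Function.Surjective R := LinearMap.surjective_of_injective hRinj
    obtain ⟨k, hk⟩ := hRsurj ⟨(κ j : E →ₗ[ℝ] ℂ), hκ j⟩
    have h2 : ∀ Y, κ j Y = k.1 (C Y) := fun Y => by
      rw [hCk j k.1 k.2]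
      exact (LinearMap.congr_fun (congrArg Subtype.val hk) Y).symm
    rw [h2]
    -- forms in `W j` vanish on `tE`
    have h3 : ∀ Z ∈ tE, k.1 Z = 0 := by
      intro Z hZ
      have h4 := k.2 Z
      have h5 : bracketModel G X₀ Z = 0 := by
        have h6 := (hγ.hasDerivAt_Ad 0).clm_apply (hasDerivAt_const (0 : ℝ) Z)
        have h7 : (fun r => AdModel E (expCurve G X₀ r) Z) = fun _ => Z := by
          funext r; exact hfix _ (hT _ hX₀ _) Z hZ
        rw [h7] at h6
        have h8 := h6.unique (hasDerivAt_const (0 : ℝ) Z)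
        rw [hγ.map_zero, AdModel_one] at h8
        simpa [AdDeriv_apply] using h8
      rw [h5, map_zero] at h4
      have h9 : Complex.I * (a j : ℂ) ≠ 0 :=
        mul_ne_zero Complex.I_ne_zero (by exact_mod_cast ha j)
      exact (mul_eq_zero.1 h4.symm).resolve_left h9
    exact h3 _ hY
  have hle : Module.End.maxGenEigenspace C 0 ≤ tE := by
    intro Y hY
    rw [Module.End.mem_maxGenEigenspace] at hY
    obtain ⟨k, hk⟩ := hY
    rw [zero_smul, sub_zero] at hk
    have : ∀ k Y, (C ^ k) Y ∈ tE → Y ∈ tE := by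
      intro k
      induction k with
      | zero => intro Y h; simpa using h
      | succ k ih =>
        intro Y h
        rw [pow_succ] at h
        exact hmem _ (ih _ h)
    exact this k Y (by rw [hk]; exact tE.zero_mem)
  have heq : Module.End.maxGenEigenspace C 0 = tE :=
    Submodule.eq_of_le_of_finrank_le hle
      (le_finrank_maxGenEigenspace_Ad hT hfix hX₀ κ ha hκ hker (g * h))
  -- on `tE`, `A - 1` is nilpotent, and `A` is an isometry
  have hCt : ∀ X ∈ tE, C X = A X - X := by
    intro X hX
    change AdModel E (g * h) X - X = _
    rw [AdModel_mul, ContinuousLinearMap.comp_apply, hfix h hhT X hX]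
    rfl
  have hstab : ∀ X ∈ tE, C X ∈ tE := by
    intro X hX
    rw [← heq, Module.End.mem_maxGenEigenspace] at hX ⊢
    obtain ⟨k, hk⟩ := hX
    refine ⟨k, ?_⟩
    rw [zero_smul, sub_zero] at hk ⊢
    rw [← Module.End.mul_apply, ← pow_succ, pow_succ', Module.End.mul_apply, hk, map_zero]
  have hsq : ∀ X ∈ tE, C (C X) = 0 → C X = 0 := by
    intro X hX h0
    refine hB _ (hstab X hX) ?_
    have h1 : A (C X) = C X := by
      have := hCt _ (hstab X hX)
      rw [h0] at this
      exact (sub_eq_zero.1 this.symm)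
    have h2 := hBg X (C X)
    change B (A X) (A (C X)) = B X (C X) at h2
    rw [h1] at h2
    nth_rewrite 1 [hCt X hX]
    rw [map_sub, LinearMap.sub_apply, h2, sub_self]
  have hnil : ∀ k, ∀ X ∈ tE, (C ^ k) X = 0 → C X = 0 := by
    intro k
    induction k with
    | zero => intro X _ h; rw [pow_zero] at h; rw [show X = 0 from h, map_zero]
    | succ k ih =>
      intro X hX h
      rw [pow_succ] at h
      exact hsq X hX (ih _ (hstab X hX) h)
  intro X hX
  have hX' := hX
  rw [← heq, Module.End.mem_maxGenEigenspace] at hX'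
  obtain ⟨k, hk⟩ := hX'
  rw [zero_smul, sub_zero] at hk
  have := hnil k X hX hk
  rw [hCt X hX] at this
  exact sub_eq_zero.1 this

end Centralizer

section Complexification

open TensorProduct LieAlgebra LieModule

noncomputable local instance (priority := 5000) complexRealModule : Module ℝ ℂ := Algebra.toModule

variable {L : Type*} [LieRing L] [LieAlgebra ℝ L]

/-- The real part `ℂ ⊗ L → L`. -/
noncomputable def tensorRe : ℂ ⊗[ℝ] L →ₗ[ℝ] L :=
  (TensorProduct.lid ℝ L).toLinearMap ∘ₗ LinearMap.rTensor L Complex.reLm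

/-- The imaginary part `ℂ ⊗ L → L`. -/
noncomputable def tensorIm : ℂ ⊗[ℝ] L →ₗ[ℝ] L :=
  (TensorProduct.lid ℝ L).toLinearMap ∘ₗ LinearMap.rTensor L Complex.imLm

@[simp] theorem tensorRe_tmul (c : ℂ) (X : L) : tensorRe (c ⊗ₜ[ℝ] X) = c.re • X := rfl

@[simp] theorem tensorIm_tmul (c : ℂ) (X : L) : tensorIm (c ⊗ₜ[ℝ] X) = c.im • X := rfl

theorem tensor_eq_re_add_im (Z : ℂ ⊗[ℝ] L) :
    Z = (1 : ℂ) ⊗ₜ[ℝ] tensorRe Z + Complex.I • ((1 : ℂ) ⊗ₜ[ℝ] tensorIm Z) := by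
  induction Z using TensorProduct.induction_on with
  | zero => simp
  | tmul c X =>
    rw [tensorRe_tmul, tensorIm_tmul, TensorProduct.smul_tmul', ← TensorProduct.smul_tmul,
      ← TensorProduct.smul_tmul, ← TensorProduct.add_tmul]
    congr 1
    rw [Complex.real_smul, Complex.real_smul, mul_one, smul_eq_mul, mul_one]
    exact (Complex.re_add_im c).symm
  | add Z W hZ hW =>
    nth_rewrite 1 [hZ, hW]
    simp only [map_add, TensorProduct.tmul_add, smul_add]
    abel

theorem tensorRe_smul (c : ℂ) (Z : ℂ ⊗[ℝ] L) :
    tensorRe (c • Z) = c.re • tensorRe Z - c.im • tensorIm Z := by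
  induction Z using TensorProduct.induction_on with
  | zero => simp
  | tmul d X => simp [TensorProduct.smul_tmul', sub_smul, mul_smul]
  | add Z W hZ hW => simp only [smul_add, map_add, hZ, hW]; abel

theorem tensorIm_smul (c : ℂ) (Z : ℂ ⊗[ℝ] L) :
    tensorIm (c • Z) = c.re • tensorIm Z + c.im • tensorRe Z := by
  induction Z using TensorProduct.induction_on with
  | zero => simp
  | tmul d X => simp [TensorProduct.smul_tmul', add_smul, mul_smul]
  | add Z W hZ hW => simp only [smul_add, map_add, hZ, hW]; abel

theorem tensorRe_lie (X : L) (Z : ℂ ⊗[ℝ] L) :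
    tensorRe ⁅(1 : ℂ) ⊗ₜ[ℝ] X, Z⁆ = ⁅X, tensorRe Z⁆ := by
  induction Z using TensorProduct.induction_on with
  | zero => simp
  | tmul d Y => simp
  | add Z W hZ hW => simp only [lie_add, map_add, hZ, hW]

theorem tensorIm_lie (X : L) (Z : ℂ ⊗[ℝ] L) :
    tensorIm ⁅(1 : ℂ) ⊗ₜ[ℝ] X, Z⁆ = ⁅X, tensorIm Z⁆ := by
  induction Z using TensorProduct.induction_on with
  | zero => simp
  | tmul d Y => simp
  | add Z W hZ hW => simp only [lie_add, map_add, hZ, hW]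

theorem tensor_ext {Z W : ℂ ⊗[ℝ] L} (h1 : tensorRe Z = tensorRe W)
    (h2 : tensorIm Z = tensorIm W) : Z = W := by
  rw [tensor_eq_re_add_im Z, tensor_eq_re_add_im W, h1, h2]

/-- The complex conjugation of `ℂ ⊗ L`. -/
noncomputable def tensorConj (Z : ℂ ⊗[ℝ] L) : ℂ ⊗[ℝ] L :=
  (1 : ℂ) ⊗ₜ[ℝ] tensorRe Z - Complex.I • ((1 : ℂ) ⊗ₜ[ℝ] tensorIm Z)

theorem tensorRe_conj (Z : ℂ ⊗[ℝ] L) : tensorRe (tensorConj Z) = tensorRe Z := by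
  simp [tensorConj, TensorProduct.smul_tmul']

theorem tensorIm_conj (Z : ℂ ⊗[ℝ] L) : tensorIm (tensorConj Z) = -tensorIm Z := by
  simp [tensorConj, TensorProduct.smul_tmul']

theorem tensorConj_smul (c : ℂ) (Z : ℂ ⊗[ℝ] L) :
    tensorConj (c • Z) = (starRingEnd ℂ c) • tensorConj Z := by
  refine tensor_ext ?_ ?_
  · simp [tensorRe_conj, tensorRe_smul, tensorIm_conj]
  · simp only [tensorIm_conj, tensorIm_smul, tensorRe_conj, Complex.conj_re, Complex.conj_im]
    module

theorem tensorConj_lie (X : L) (Z : ℂ ⊗[ℝ] L) :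
    tensorConj ⁅(1 : ℂ) ⊗ₜ[ℝ] X, Z⁆ = ⁅(1 : ℂ) ⊗ₜ[ℝ] X, tensorConj Z⁆ := by
  refine tensor_ext ?_ ?_
  · simp [tensorRe_conj, tensorRe_lie]
  · simp [tensorIm_conj, tensorIm_lie]

theorem add_tensorConj (Z : ℂ ⊗[ℝ] L) :
    Z + tensorConj Z = (2 : ℂ) • ((1 : ℂ) ⊗ₜ[ℝ] tensorRe Z) := by
  nth_rewrite 1 [tensor_eq_re_add_im Z]
  rw [tensorConj, two_smul]
  abel

/-- The complexification of a Lie subalgebra. -/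
noncomputable def complexifySubalgebra (t : LieSubalgebra ℝ L) : LieSubalgebra ℂ (ℂ ⊗[ℝ] L) where
  carrier := {Z | tensorRe Z ∈ t ∧ tensorIm Z ∈ t}
  add_mem' {Z W} hZ hW := ⟨by rw [map_add]; exact t.add_mem hZ.1 hW.1,
    by rw [map_add]; exact t.add_mem hZ.2 hW.2⟩
  zero_mem' := ⟨by rw [map_zero]; exact t.zero_mem, by rw [map_zero]; exact t.zero_mem⟩
  smul_mem' c Z hZ := ⟨by
      rw [tensorRe_smul]; exact t.sub_mem (t.smul_mem _ hZ.1) (t.smul_mem _ hZ.2), by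
      rw [tensorIm_smul]; exact t.add_mem (t.smul_mem _ hZ.2) (t.smul_mem _ hZ.1)⟩
  lie_mem' {Z W} hZ hW := by
    rw [tensor_eq_re_add_im Z, add_lie, smul_lie]
    refine ⟨?_, ?_⟩
    · rw [map_add, tensorRe_smul, tensorRe_lie, tensorIm_lie]
      rw [Complex.I_re, Complex.I_im, zero_smul, one_smul, zero_sub, ← sub_eq_add_neg]
      exact t.sub_mem (t.lie_mem hZ.1 hW.1) (t.lie_mem hZ.2 hW.2)
    · rw [map_add, tensorIm_smul, tensorRe_lie, tensorIm_lie]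
      rw [Complex.I_re, Complex.I_im, zero_smul, one_smul, zero_add]
      exact t.add_mem (t.lie_mem hZ.1 hW.2) (t.lie_mem hZ.2 hW.1)

theorem one_tmul_mem_complexify {t : LieSubalgebra ℝ L} {X : L} :
    (1 : ℂ) ⊗ₜ[ℝ] X ∈ complexifySubalgebra t ↔ X ∈ t := by
  change tensorRe ((1 : ℂ) ⊗ₜ[ℝ] X) ∈ t ∧ tensorIm ((1 : ℂ) ⊗ₜ[ℝ] X) ∈ t ↔ _
  simp

theorem mem_complexify {t : LieSubalgebra ℝ L} {Z : ℂ ⊗[ℝ] L} :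
    Z ∈ complexifySubalgebra t ↔ tensorRe Z ∈ t ∧ tensorIm Z ∈ t := Iff.rfl

variable [FiniteDimensional ℝ L]

theorem killingForm_one_tmul (X Y : L) :
    killingForm ℂ (ℂ ⊗[ℝ] L) ((1 : ℂ) ⊗ₜ[ℝ] X) ((1 : ℂ) ⊗ₜ[ℝ] Y) = (killingForm ℝ L X Y : ℂ) := by
  rw [show killingForm ℂ (ℂ ⊗[ℝ] L) = (killingForm ℝ L).baseChange ℂ from
    traceForm_baseChange ℝ L L ℂ]
  simp

theorem killingForm_tmul_right (Z : ℂ ⊗[ℝ] L) (Y : L) :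
    killingForm ℂ (ℂ ⊗[ℝ] L) Z ((1 : ℂ) ⊗ₜ[ℝ] Y) =
      (killingForm ℝ L (tensorRe Z) Y : ℂ) + Complex.I * (killingForm ℝ L (tensorIm Z) Y : ℂ) := by
  conv_lhs => rw [tensor_eq_re_add_im Z]
  rw [map_add, map_smul, LinearMap.add_apply, LinearMap.smul_apply, killingForm_one_tmul,
    killingForm_one_tmul, smul_eq_mul]

theorem killingForm_tensorConj (Z : ℂ ⊗[ℝ] L) (Y : L) :
    killingForm ℂ (ℂ ⊗[ℝ] L) (tensorConj Z) ((1 : ℂ) ⊗ₜ[ℝ] Y) =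
      starRingEnd ℂ (killingForm ℂ (ℂ ⊗[ℝ] L) Z ((1 : ℂ) ⊗ₜ[ℝ] Y)) := by
  rw [killingForm_tmul_right, killingForm_tmul_right, tensorRe_conj, tensorIm_conj]
  simp

variable [IsKilling ℝ L]

theorem eq_zero_of_killingForm_eq_zero {X : L} (h : ∀ Y, killingForm ℝ L X Y = 0) : X = 0 := by
  have h1 : X ∈ LinearMap.ker (killingForm ℝ L) := LinearMap.ext h
  rw [IsKilling.ker_killingForm_eq_bot] at h1
  simpa using h1

theorem tensor_eq_zero_of_killingForm_eq_zero {Z : ℂ ⊗[ℝ] L}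
    (h : ∀ Y : L, killingForm ℂ (ℂ ⊗[ℝ] L) Z ((1 : ℂ) ⊗ₜ[ℝ] Y) = 0) : Z = 0 := by
  have h1 : ∀ Y, killingForm ℝ L (tensorRe Z) Y = 0 ∧ killingForm ℝ L (tensorIm Z) Y = 0 := by
    intro Y
    have := h Y
    rw [killingForm_tmul_right] at this
    constructor
    · simpa using congrArg Complex.re this
    · simpa using congrArg Complex.im this
  refine tensor_ext ?_ ?_
  · rw [map_zero]; exact eq_zero_of_killingForm_eq_zero fun Y => (h1 Y).1
  · rw [map_zero]; exact eq_zero_of_killingForm_eq_zero fun Y => (h1 Y).2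

instance isKilling_complexification : IsKilling ℂ (ℂ ⊗[ℝ] L) where
  killingCompl_top_eq_bot := by
    rw [eq_bot_iff]
    intro Z hZ
    rw [LieIdeal.mem_killingCompl] at hZ
    refine tensor_eq_zero_of_killingForm_eq_zero fun Y => ?_
    rw [LieModule.traceForm_comm]
    exact hZ _ trivial

variable (t : LieSubalgebra ℝ L) [t.IsCartanSubalgebra]

theorem lie_eq_zero_of_mem_cartan {X Y : L} (hX : X ∈ t) (hY : Y ∈ t) : ⁅X, Y⁆ = 0 := by
  have h : ⁅(⟨X, hX⟩ : t), (⟨Y, hY⟩ : t)⁆ = 0 := trivial_lie_zero _ _ _ _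
  exact congrArg Subtype.val h

theorem mem_cartan_of_lie_eq_zero {Y : L} (h : ∀ X ∈ t, ⁅X, Y⁆ = 0) : Y ∈ t := by
  rw [← LieSubalgebra.IsCartanSubalgebra.self_normalizing (H := t),
    LieSubalgebra.mem_normalizer_iff']
  intro X hX
  rw [h X hX]
  exact t.zero_mem

theorem lie_eq_zero_of_mem_complexify {Z W : ℂ ⊗[ℝ] L} (hZ : Z ∈ complexifySubalgebra t)
    (hW : W ∈ complexifySubalgebra t) : ⁅Z, W⁆ = 0 := by
  have h1 : ∀ X ∈ t, ⁅(1 : ℂ) ⊗ₜ[ℝ] X, W⁆ = 0 := by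
    intro X hX
    refine tensor_ext ?_ ?_
    · rw [tensorRe_lie, map_zero, lie_eq_zero_of_mem_cartan t hX hW.1]
    · rw [tensorIm_lie, map_zero, lie_eq_zero_of_mem_cartan t hX hW.2]
  rw [tensor_eq_re_add_im Z, add_lie, smul_lie, h1 _ hZ.1, h1 _ hZ.2, smul_zero, add_zero]

instance isLieAbelian_complexify : IsLieAbelian (complexifySubalgebra t) where
  trivial Z W := Subtype.ext (lie_eq_zero_of_mem_complexify t Z.2 W.2)

instance isCartan_complexify : (complexifySubalgebra t).IsCartanSubalgebra where
  nilpotent := inferInstance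
  self_normalizing := by
    refine le_antisymm (fun Z hZ => ?_) (LieSubalgebra.le_normalizer _)
    rw [LieSubalgebra.mem_normalizer_iff'] at hZ
    have h1 : ∀ X ∈ t, ⁅X, tensorRe Z⁆ ∈ t ∧ ⁅X, tensorIm Z⁆ ∈ t := by
      intro X hX
      have := hZ _ (one_tmul_mem_complexify.2 hX)
      rw [mem_complexify, tensorRe_lie, tensorIm_lie] at this
      exact this
    rw [mem_complexify]
    rw [← LieSubalgebra.IsCartanSubalgebra.self_normalizing (H := t),
      LieSubalgebra.mem_normalizer_iff', LieSubalgebra.mem_normalizer_iff']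
    exact ⟨fun X hX => (h1 X hX).1, fun X hX => (h1 X hX).2⟩

end Complexification

/-- The positive roots `α₁, …, α_N` of a compact Cartan subalgebra `𝔱` of a real semisimple Lie
algebra for the Weyl chamber of a regular element, with the components `𝔤 → ℂ` of the projection to
the corresponding root spaces. -/
structure RootData {L : Type*} [LieRing L] [LieAlgebra ℝ L] (t : LieSubalgebra ℝ L) (X₀ : t)
    (roots : Set (Module.Dual ℝ t)) where
  N : ℕ
  root : Fin N → Module.Dual ℝ t
  form : Fin N → L →ₗ[ℝ] ℂ
  form_lie : ∀ j (X : t) (Y : L), form j ⁅(X : L), Y⁆ = Complex.I * (root j X : ℝ) * form j Y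
  form_eq_zero_iff : ∀ Y, (∀ j, form j Y = 0) ↔ Y ∈ t
  form_surjective : ∀ z : Fin N → ℂ, ∃ Y, ∀ j, form j Y = z j
  root_neg : ∀ j, root j X₀ < 0
  root_injective : Function.Injective root
  form_unique : ∀ j (k : L →ₗ[ℝ] ℂ), (∀ (X : t) (Y : L),
    k ⁅(X : L), Y⁆ = Complex.I * (root j X : ℝ) * k Y) → ∃ c : ℂ, k = c • form j
  mem_roots : ∀ α, α ∈ roots ↔ ∃ j, α = root j ∨ α = -root j

section RootForms

open TensorProduct LieAlgebra LieModule

noncomputable local instance (priority := 5000) complexRealModule' : Module ℝ ℂ := Algebra.toModule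

variable {L : Type*} [LieRing L] [LieAlgebra ℝ L] [FiniteDimensional ℝ L] [IsKilling ℝ L]
  (t : LieSubalgebra ℝ L) [t.IsCartanSubalgebra]

/-- An element of `𝔱`, as an element of the complexification. -/
noncomputable def cartanEmb (X : t) : complexifySubalgebra t :=
  ⟨(1 : ℂ) ⊗ₜ[ℝ] (X : L), one_tmul_mem_complexify.2 X.2⟩

theorem complexify_eq (h : complexifySubalgebra t) : ∃ X Y : t,
    h = cartanEmb t X + Complex.I • cartanEmb t Y :=
  ⟨⟨_, h.2.1⟩, ⟨_, h.2.2⟩, Subtype.ext (tensor_eq_re_add_im h.1)⟩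

variable {t}

/-- The imaginary part of a root on the real Cartan subalgebra. -/
noncomputable def rootIm (α : Weight ℂ (complexifySubalgebra t) (ℂ ⊗[ℝ] L)) : Module.Dual ℝ t where
  toFun X := (α (cartanEmb t X)).im
  map_add' X Y := by
    have h : cartanEmb t (X + Y) = cartanEmb t X + cartanEmb t Y :=
      Subtype.ext (TensorProduct.tmul_add _ _ _)
    rw [h, ← Weight.toLinear_apply, map_add]
    simp
  map_smul' c X := by
    have h : cartanEmb t (c • X) = (c : ℂ) • cartanEmb t X := by
      refine Subtype.ext ?_
      change (1 : ℂ) ⊗ₜ[ℝ] (c • (X : L)) = (c : ℂ) • ((1 : ℂ) ⊗ₜ[ℝ] (X : L))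
      rw [← TensorProduct.smul_tmul, TensorProduct.smul_tmul', Complex.real_smul, smul_eq_mul]
    rw [h, ← Weight.toLinear_apply, map_smul]
    simp

theorem mem_rootSpace_of_forall {α : complexifySubalgebra t →ₗ[ℂ] ℂ} {Z : ℂ ⊗[ℝ] L}
    (h : ∀ X : t, ⁅(1 : ℂ) ⊗ₜ[ℝ] (X : L), Z⁆ = α (cartanEmb t X) • Z) :
    Z ∈ rootSpace (complexifySubalgebra t) α := by
  refine weightSpace_le_genWeightSpace _ _ ((mem_weightSpace _ _).2 fun x => ?_)
  obtain ⟨X, Y, rfl⟩ := complexify_eq t x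
  rw [map_add, map_smul, add_smul, add_lie, ← h X, smul_lie, smul_eq_mul, mul_smul, ← h Y]
  rfl

theorem lie_of_mem_rootSpace {α : complexifySubalgebra t → ℂ} {Z : ℂ ⊗[ℝ] L}
    (h : Z ∈ rootSpace (complexifySubalgebra t) α) (X : t) :
    ⁅(1 : ℂ) ⊗ₜ[ℝ] (X : L), Z⁆ = α (cartanEmb t X) • Z :=
  IsKilling.lie_eq_smul_of_mem_rootSpace h (cartanEmb t X)

theorem exists_ne_zero_mem_rootSpace (α : Weight ℂ (complexifySubalgebra t) (ℂ ⊗[ℝ] L)) :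
    ∃ Z ∈ rootSpace (complexifySubalgebra t) α, Z ≠ 0 := by
  by_contra! h
  exact α.genWeightSpace_ne_bot' ((LieSubmodule.eq_bot_iff _).2 h)

theorem exists_smul_of_mem_rootSpace {α : Weight ℂ (complexifySubalgebra t) (ℂ ⊗[ℝ] L)}
    (hα : α.IsNonZero) {Z W : ℂ ⊗[ℝ] L} (hZ : Z ∈ rootSpace (complexifySubalgebra t) α)
    (hZ0 : Z ≠ 0) (hW : W ∈ rootSpace (complexifySubalgebra t) α) : ∃ c : ℂ, W = c • Z := by
  have h1 := IsKilling.finrank_rootSpace_eq_one α hα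
  obtain ⟨c, hc⟩ := (finrank_eq_one_iff_of_nonzero'
    (⟨Z, hZ⟩ : rootSpace (complexifySubalgebra t) α) (fun h => hZ0 (congrArg Subtype.val h))).1 h1
    ⟨W, hW⟩
  exact ⟨c, (congrArg Subtype.val hc).symm⟩

theorem killingForm_lie_left (X : L) (Z W : ℂ ⊗[ℝ] L) :
    killingForm ℂ (ℂ ⊗[ℝ] L) Z ⁅(1 : ℂ) ⊗ₜ[ℝ] X, W⁆ =
      -killingForm ℂ (ℂ ⊗[ℝ] L) ⁅(1 : ℂ) ⊗ₜ[ℝ] X, Z⁆ W := by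
  have := traceForm_apply_lie_apply' ℂ (ℂ ⊗[ℝ] L) (ℂ ⊗[ℝ] L) ((1 : ℂ) ⊗ₜ[ℝ] X) Z W
  rw [neg_eq_iff_eq_neg.2 this]

/-- The elements which are orthogonal to all root spaces are in the Cartan subalgebra. -/
theorem mem_cartan_of_orthogonal {Y : L}
    (h : ∀ α : Weight ℂ (complexifySubalgebra t) (ℂ ⊗[ℝ] L), α.IsNonZero →
      ∀ Z ∈ rootSpace (complexifySubalgebra t) α,
        killingForm ℂ (ℂ ⊗[ℝ] L) Z ((1 : ℂ) ⊗ₜ[ℝ] Y) = 0) : Y ∈ t := by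
  refine mem_cartan_of_lie_eq_zero t fun X hX => ?_
  have h1 : ∀ Z : ℂ ⊗[ℝ] L, killingForm ℂ (ℂ ⊗[ℝ] L) Z ⁅(1 : ℂ) ⊗ₜ[ℝ] X, (1 : ℂ) ⊗ₜ[ℝ] Y⁆ = 0 := by
    intro Z
    let S : Submodule ℂ (ℂ ⊗[ℝ] L) :=
      LinearMap.ker ((killingForm ℂ (ℂ ⊗[ℝ] L)).flip ⁅(1 : ℂ) ⊗ₜ[ℝ] X, (1 : ℂ) ⊗ₜ[ℝ] Y⁆)
    have hS : (⊤ : Submodule ℂ (ℂ ⊗[ℝ] L)) ≤ S := by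
      have h2 := congrArg LieSubmodule.toSubmodule
        (cartan_sup_iSup_rootSpace_eq_top (K := ℂ) (L := ℂ ⊗[ℝ] L) (H := complexifySubalgebra t))
      rw [LieSubmodule.top_toSubmodule] at h2
      rw [← h2, LieSubmodule.sup_toSubmodule, LieSubmodule.iSup_toSubmodule]
      refine sup_le (fun W hW => ?_) (iSup_le fun α => ?_)
      · change killingForm ℂ (ℂ ⊗[ℝ] L) W ⁅(1 : ℂ) ⊗ₜ[ℝ] X, (1 : ℂ) ⊗ₜ[ℝ] Y⁆ = 0
        rw [killingForm_lie_left,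
          lie_eq_zero_of_mem_complexify t (one_tmul_mem_complexify.2 hX) hW]
        simp
      · rw [LieSubmodule.iSup_toSubmodule]
        refine iSup_le fun hα W hW => ?_
        change killingForm ℂ (ℂ ⊗[ℝ] L) W ⁅(1 : ℂ) ⊗ₜ[ℝ] X, (1 : ℂ) ⊗ₜ[ℝ] Y⁆ = 0
        rw [killingForm_lie_left, lie_of_mem_rootSpace hW ⟨X, hX⟩, map_smul, LinearMap.smul_apply,
          h α hα W hW, smul_zero, neg_zero]
    exact hS (Submodule.mem_top (x := Z))
  have h3 : ∀ W : L, killingForm ℝ L W ⁅X, Y⁆ = 0 := by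
    intro W
    have := h1 ((1 : ℂ) ⊗ₜ[ℝ] W)
    rw [show ⁅(1 : ℂ) ⊗ₜ[ℝ] X, (1 : ℂ) ⊗ₜ[ℝ] Y⁆ = (1 : ℂ) ⊗ₜ[ℝ] ⁅X, Y⁆ by simp,
      killingForm_one_tmul] at this
    exact_mod_cast this
  exact eq_zero_of_killingForm_eq_zero fun W => by rw [traceForm_comm]; exact h3 W

section Imaginary

variable (himag : ∀ X ∈ t, ∀ (k : L →ₗ[ℝ] ℂ) (c : ℂ), k ≠ 0 → (∀ Y, k ⁅X, Y⁆ = c * k Y) → c.re = 0)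

include himag

theorem weight_eq_I_mul_rootIm (α : Weight ℂ (complexifySubalgebra t) (ℂ ⊗[ℝ] L)) (X : t) :
    α (cartanEmb t X) = Complex.I * (rootIm α X : ℝ) := by
  obtain ⟨Z, hZ, hZ0⟩ := exists_ne_zero_mem_rootSpace α
  let k : L →ₗ[ℝ] ℂ :=
    { toFun := fun Y => killingForm ℂ (ℂ ⊗[ℝ] L) Z ((1 : ℂ) ⊗ₜ[ℝ] Y)
      map_add' := fun Y W => by rw [TensorProduct.tmul_add, map_add]
      map_smul' := fun c Y => by
        rw [← TensorProduct.smul_tmul]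
        have : (c • (1 : ℂ)) ⊗ₜ[ℝ] Y = (c : ℂ) • ((1 : ℂ) ⊗ₜ[ℝ] Y) := by
          rw [TensorProduct.smul_tmul', Complex.real_smul, smul_eq_mul]
        rw [this, map_smul]
        exact (Complex.real_smul).symm }
  have hk : k ≠ 0 := fun h => hZ0 (tensor_eq_zero_of_killingForm_eq_zero fun Y =>
    LinearMap.congr_fun h Y)
  have := himag X X.2 k (-α (cartanEmb t X)) hk (fun Y => by
    change killingForm ℂ (ℂ ⊗[ℝ] L) Z ((1 : ℂ) ⊗ₜ[ℝ] ⁅(X : L), Y⁆) = _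
    rw [show (1 : ℂ) ⊗ₜ[ℝ] ⁅(X : L), Y⁆ = ⁅(1 : ℂ) ⊗ₜ[ℝ] (X : L), (1 : ℂ) ⊗ₜ[ℝ] Y⁆ by simp,
      killingForm_lie_left, lie_of_mem_rootSpace hZ X, map_smul, LinearMap.smul_apply, smul_eq_mul,
      neg_mul]
    rfl)
  rw [Complex.neg_re, neg_eq_zero] at this
  apply Complex.ext
  · simpa using this
  · simp [rootIm]

theorem rootIm_injective : Function.Injective
    (rootIm : Weight ℂ (complexifySubalgebra t) (ℂ ⊗[ℝ] L) → Module.Dual ℝ t) := by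
  intro α β h
  refine DFunLike.ext _ _ fun x => ?_
  obtain ⟨X, Y, rfl⟩ := complexify_eq t x
  rw [← Weight.toLinear_apply, ← Weight.toLinear_apply, map_add, map_add, map_smul, map_smul]
  simp only [Weight.toLinear_apply]
  rw [weight_eq_I_mul_rootIm himag, weight_eq_I_mul_rootIm himag, weight_eq_I_mul_rootIm himag,
    weight_eq_I_mul_rootIm himag, h]

omit himag in
theorem rootIm_neg (α : Weight ℂ (complexifySubalgebra t) (ℂ ⊗[ℝ] L)) :
    rootIm (-α) = -rootIm α := by
  ext X
  simp [rootIm]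

theorem isNonZero_iff_rootIm_ne_zero (α : Weight ℂ (complexifySubalgebra t) (ℂ ⊗[ℝ] L)) :
    α.IsNonZero ↔ rootIm α ≠ 0 := by
  rw [Weight.IsNonZero, not_iff_not, ← Weight.coe_eq_zero_iff]
  constructor
  · intro h
    ext X
    simp [rootIm, h]
  · intro h
    funext x
    obtain ⟨X, Y, rfl⟩ := complexify_eq t x
    rw [← Weight.toLinear_apply, map_add, map_smul]
    simp only [Weight.toLinear_apply]
    rw [weight_eq_I_mul_rootIm himag, weight_eq_I_mul_rootIm himag, h]
    simp

/-- The real roots are the imaginary parts of the roots of the complexification. -/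
theorem exists_weight_of_eigenvector {α : Module.Dual ℝ t} {Z : ℂ ⊗[ℝ] L} (hZ : Z ≠ 0)
    (h : ∀ X : t, ⁅(1 : ℂ) ⊗ₜ[ℝ] (X : L), Z⁆ = (Complex.I * (α X : ℂ)) • Z) :
    ∃ β : Weight ℂ (complexifySubalgebra t) (ℂ ⊗[ℝ] L), rootIm β = α := by
  let a : complexifySubalgebra t →ₗ[ℂ] ℂ :=
    { toFun := fun h => Complex.I * (α ⟨_, h.2.1⟩ : ℝ) - (α ⟨_, h.2.2⟩ : ℝ)
      map_add' := fun h k => by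
        have e1 : (⟨_, (h + k).2.1⟩ : t) = ⟨_, h.2.1⟩ + ⟨_, k.2.1⟩ :=
          Subtype.ext (map_add tensorRe h.1 k.1)
        have e2 : (⟨_, (h + k).2.2⟩ : t) = ⟨_, h.2.2⟩ + ⟨_, k.2.2⟩ :=
          Subtype.ext (map_add tensorIm h.1 k.1)
        rw [e1, e2, map_add, map_add]
        push_cast
        ring
      map_smul' := fun c h => by
        have e1 : (⟨_, (c • h).2.1⟩ : t) = c.re • ⟨_, h.2.1⟩ - c.im • ⟨_, h.2.2⟩ :=
          Subtype.ext (tensorRe_smul c h.1)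
        have e2 : (⟨_, (c • h).2.2⟩ : t) = c.re • ⟨_, h.2.2⟩ + c.im • ⟨_, h.2.1⟩ :=
          Subtype.ext (tensorIm_smul c h.1)
        rw [e1, e2, map_add, map_sub, map_smul, map_smul, map_smul, map_smul]
        simp only [smul_eq_mul, RingHom.id_apply]
        apply Complex.ext <;> simp <;> ring }
  have ha : ∀ X : t, a (cartanEmb t X) = Complex.I * (α X : ℝ) := by
    intro X
    have e1 : (⟨_, (cartanEmb t X).2.1⟩ : t) = X := Subtype.ext (by simp [cartanEmb])
    have e2 : (⟨_, (cartanEmb t X).2.2⟩ : t) = 0 := Subtype.ext (by simp [cartanEmb])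
    change Complex.I * (α ⟨_, (cartanEmb t X).2.1⟩ : ℝ) - (α ⟨_, (cartanEmb t X).2.2⟩ : ℝ) = _
    rw [e1, e2]
    simp
  have hmem : Z ∈ rootSpace (complexifySubalgebra t) a :=
    mem_rootSpace_of_forall fun X => by rw [h, ha]
  refine ⟨⟨a, fun h0 => hZ ((LieSubmodule.eq_bot_iff _).1 h0 Z hmem)⟩, ?_⟩
  ext X
  change (a (cartanEmb t X)).im = _
  rw [ha]
  simp

/-- The Killing form is definite on a compact Cartan subalgebra. -/
theorem eq_zero_of_killingForm_self {X : L} (hX : X ∈ t) (h : killingForm ℝ L X X = 0) : X = 0 := by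
  have h1 := congrArg (fun B => B (cartanEmb t ⟨X, hX⟩) (cartanEmb t ⟨X, hX⟩))
    (IsKilling.restrict_killingForm_eq_sum (K := ℂ) (L := ℂ ⊗[ℝ] L) (H := complexifySubalgebra t))
  have h2 : (killingForm ℂ (ℂ ⊗[ℝ] L)).restrict (complexifySubalgebra t).toSubmodule
      (cartanEmb t ⟨X, hX⟩) (cartanEmb t ⟨X, hX⟩) = (killingForm ℝ L X X : ℂ) :=
    killingForm_one_tmul X X
  rw [h2, h] at h1
  simp only [LinearMap.sum_apply, LinearMap.smulRight_apply,
    LinearMap.smul_apply, smul_eq_mul] at h1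
  have h3 : ∑ α ∈ (complexifySubalgebra t).root, (rootIm α ⟨X, hX⟩) ^ 2 = 0 := by
    have h4 : ∑ α ∈ (complexifySubalgebra t).root, α (cartanEmb t ⟨X, hX⟩) * α (cartanEmb t ⟨X, hX⟩) =
        ((-∑ α ∈ (complexifySubalgebra t).root, (rootIm α ⟨X, hX⟩) ^ 2 : ℝ) : ℂ) := by
      push_cast
      rw [← Finset.sum_neg_distrib]
      refine Finset.sum_congr rfl fun α _ => ?_
      rw [weight_eq_I_mul_rootIm himag]
      linear_combination ((rootIm α ⟨X, hX⟩ : ℝ) : ℂ) ^ 2 * Complex.I_sq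
    have h5 : ((0 : ℝ) : ℂ) = _ := h1.trans h4
    have h6 := Complex.ofReal_injective h5
    linarith
  rw [Finset.sum_eq_zero_iff_of_nonneg (fun _ _ => sq_nonneg _)] at h3
  have h4 : cartanEmb t ⟨X, hX⟩ = 0 := by
    have h5 : (cartanEmb t ⟨X, hX⟩) ∈ ⨅ α : Weight ℂ (complexifySubalgebra t) (ℂ ⊗[ℝ] L),
        LinearMap.ker (Weight.toLinear ℂ (complexifySubalgebra t) (ℂ ⊗[ℝ] L) α) := by
      rw [Submodule.mem_iInf]
      intro α
      rw [LinearMap.mem_ker, Weight.toLinear_apply, weight_eq_I_mul_rootIm himag]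
      by_cases hα : α.IsNonZero
      · have := h3 α (by simpa using hα)
        rw [pow_eq_zero_iff (by norm_num)] at this
        simp [this]
      · have : rootIm α = 0 := by
          by_contra hne
          exact hα ((isNonZero_iff_rootIm_ne_zero himag α).2 hne)
        simp [this]
    rw [IsKilling.iInf_ker_weight_eq_bot] at h5
    simpa using h5
  have h5 := congrArg tensorRe (congrArg Subtype.val h4)
  simpa [cartanEmb] using h5

end Imaginary

end RootForms

section RootDataExistence

open TensorProduct LieAlgebra LieModule

noncomputable local instance (priority := 5000) complexRealModule'' : Module ℝ ℂ := Algebra.toModule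

variable {L : Type*} [LieRing L] [LieAlgebra ℝ L] [FiniteDimensional ℝ L] [IsKilling ℝ L]
  {t : LieSubalgebra ℝ L} [t.IsCartanSubalgebra]

/-- The functional on `L` given by the Killing form and an element of the complexification. -/
noncomputable def killingFunctional (Z : ℂ ⊗[ℝ] L) : L →ₗ[ℝ] ℂ where
  toFun Y := killingForm ℂ (ℂ ⊗[ℝ] L) Z ((1 : ℂ) ⊗ₜ[ℝ] Y)
  map_add' Y W := by rw [TensorProduct.tmul_add, map_add]
  map_smul' c Y := by
    rw [← TensorProduct.smul_tmul]
    have : (c • (1 : ℂ)) ⊗ₜ[ℝ] Y = (c : ℂ) • ((1 : ℂ) ⊗ₜ[ℝ] Y) := by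
      rw [TensorProduct.smul_tmul', Complex.real_smul, smul_eq_mul]
    rw [this, map_smul]
    exact (Complex.real_smul).symm

theorem killingFunctional_apply (Z : ℂ ⊗[ℝ] L) (Y : L) :
    killingFunctional Z Y = killingForm ℂ (ℂ ⊗[ℝ] L) Z ((1 : ℂ) ⊗ₜ[ℝ] Y) := rfl

theorem exists_killingForm_eq (f : Module.Dual ℝ L) : ∃ X : L, ∀ Y, f Y = killingForm ℝ L X Y := by
  have hinj : Function.Injective (killingForm ℝ L) := LinearMap.ker_eq_bot.1
    (IsKilling.ker_killingForm_eq_bot ℝ L)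
  have hsurj := (LinearMap.injective_iff_surjective_of_finrank_eq_finrank
    (Subspace.dual_finrank_eq (K := ℝ) (V := L)).symm).1 hinj
  obtain ⟨X, hX⟩ := hsurj f
  exact ⟨X, fun Y => by rw [hX]⟩

theorem exists_killingFunctional_eq (k : L →ₗ[ℝ] ℂ) : ∃ Z : ℂ ⊗[ℝ] L, k = killingFunctional Z := by
  obtain ⟨X, hX⟩ := exists_killingForm_eq (Complex.reLm ∘ₗ k)
  obtain ⟨Y, hY⟩ := exists_killingForm_eq (Complex.imLm ∘ₗ k)
  refine ⟨(1 : ℂ) ⊗ₜ[ℝ] X + Complex.I • ((1 : ℂ) ⊗ₜ[ℝ] Y), LinearMap.ext fun W => ?_⟩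
  rw [killingFunctional_apply, map_add, map_smul, LinearMap.add_apply, LinearMap.smul_apply,
    killingForm_one_tmul, killingForm_one_tmul, ← hX, ← hY, smul_eq_mul, mul_comm]
  exact (Complex.re_add_im (k W)).symm

theorem killingFunctional_injective :
    Function.Injective (killingFunctional : ℂ ⊗[ℝ] L → L →ₗ[ℝ] ℂ) := by
  intro Z W h
  rw [← sub_eq_zero]
  refine tensor_eq_zero_of_killingForm_eq_zero fun Y => ?_
  rw [map_sub, LinearMap.sub_apply, sub_eq_zero]
  exact LinearMap.congr_fun h Y

/-- A choice of a root vector. -/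
noncomputable def rootVector (α : Weight ℂ (complexifySubalgebra t) (ℂ ⊗[ℝ] L)) : ℂ ⊗[ℝ] L :=
  (exists_ne_zero_mem_rootSpace α).choose

theorem rootVector_mem (α : Weight ℂ (complexifySubalgebra t) (ℂ ⊗[ℝ] L)) :
    rootVector α ∈ rootSpace (complexifySubalgebra t) α :=
  (exists_ne_zero_mem_rootSpace α).choose_spec.1

theorem rootVector_ne_zero (α : Weight ℂ (complexifySubalgebra t) (ℂ ⊗[ℝ] L)) :
    rootVector α ≠ 0 := (exists_ne_zero_mem_rootSpace α).choose_spec.2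

variable (himag : ∀ X ∈ t, ∀ (k : L →ₗ[ℝ] ℂ) (c : ℂ), k ≠ 0 → (∀ Y, k ⁅X, Y⁆ = c * k Y) → c.re = 0)

include himag

theorem tensorConj_mem_rootSpace {α : Weight ℂ (complexifySubalgebra t) (ℂ ⊗[ℝ] L)}
    {Z : ℂ ⊗[ℝ] L} (hZ : Z ∈ rootSpace (complexifySubalgebra t) α) :
    tensorConj Z ∈ rootSpace (complexifySubalgebra t) (-α : Weight ℂ _ _) := by
  refine mem_rootSpace_of_forall (α := Weight.toLinear ℂ _ _ (-α)) fun X => ?_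
  rw [← tensorConj_lie, lie_of_mem_rootSpace hZ, tensorConj_smul, weight_eq_I_mul_rootIm himag,
    Weight.toLinear_apply, weight_eq_I_mul_rootIm himag, rootIm_neg]
  simp

theorem exists_rootData (X₀ : t) (hreg : ∀ α : Module.Dual ℝ t, α ≠ 0 →
      (∃ Z : ℂ ⊗[ℝ] L, Z ≠ 0 ∧ ∀ X : t, ⁅(1 : ℂ) ⊗ₜ[ℝ] (X : L), Z⁆ =
        (Complex.I * (α X : ℂ)) • Z) → α X₀ ≠ 0) :
    Nonempty (RootData t X₀ {α | α ≠ 0 ∧ ∃ Z : ℂ ⊗[ℝ] L, Z ≠ 0 ∧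
      ∀ X : t, ⁅(1 : ℂ) ⊗ₜ[ℝ] (X : L), Z⁆ = (Complex.I * (α X : ℂ)) • Z}) := by
  classical
  have hroot : ∀ α : Weight ℂ (complexifySubalgebra t) (ℂ ⊗[ℝ] L), ∃ Z : ℂ ⊗[ℝ] L, Z ≠ 0 ∧
      ∀ X : t, ⁅(1 : ℂ) ⊗ₜ[ℝ] (X : L), Z⁆ = (Complex.I * (rootIm α X : ℂ)) • Z := fun α =>
    ⟨rootVector α, rootVector_ne_zero α, fun X => by
      rw [lie_of_mem_rootSpace (rootVector_mem α), weight_eq_I_mul_rootIm himag]⟩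
  have hreg' : ∀ α : Weight ℂ (complexifySubalgebra t) (ℂ ⊗[ℝ] L), α.IsNonZero →
      rootIm α X₀ ≠ 0 := fun α hα =>
    hreg _ ((isNonZero_iff_rootIm_ne_zero himag α).1 hα) (hroot α)
  let P := {α : Weight ℂ (complexifySubalgebra t) (ℂ ⊗[ℝ] L) // rootIm α X₀ < 0}
  have hP : ∀ α : P, α.1.IsNonZero := fun α =>
    (isNonZero_iff_rootIm_ne_zero himag α.1).2 fun h => by
      have := α.2; rw [h] at this; simp at this
  let e := (Fintype.equivFin P).symm
  let k : P → L →ₗ[ℝ] ℂ := fun α => killingFunctional (rootVector (-α.1))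
  have hlie : ∀ (α : P) (X : t) (Y : L), k α ⁅(X : L), Y⁆ =
      Complex.I * (rootIm α.1 X : ℝ) * k α Y := by
    intro α X Y
    change killingForm ℂ (ℂ ⊗[ℝ] L) (rootVector (-α.1)) ((1 : ℂ) ⊗ₜ[ℝ] ⁅(X : L), Y⁆) = _
    rw [show (1 : ℂ) ⊗ₜ[ℝ] ⁅(X : L), Y⁆ = ⁅(1 : ℂ) ⊗ₜ[ℝ] (X : L), (1 : ℂ) ⊗ₜ[ℝ] Y⁆ by simp,
      killingForm_lie_left, lie_of_mem_rootSpace (rootVector_mem _) X, map_smul,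
      LinearMap.smul_apply, smul_eq_mul, weight_eq_I_mul_rootIm himag, rootIm_neg]
    change _ = Complex.I * (rootIm α.1 X : ℝ) *
      killingForm ℂ (ℂ ⊗[ℝ] L) (rootVector (-α.1)) ((1 : ℂ) ⊗ₜ[ℝ] Y)
    simp
  have horth : ∀ {α β : Weight ℂ (complexifySubalgebra t) (ℂ ⊗[ℝ] L)} {Z W : ℂ ⊗[ℝ] L},
      Z ∈ rootSpace (complexifySubalgebra t) α → W ∈ rootSpace (complexifySubalgebra t) β →
      rootIm α + rootIm β ≠ 0 → killingForm ℂ (ℂ ⊗[ℝ] L) Z W = 0 := by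
    intro α β Z W hZ hW h
    refine killingForm_apply_eq_zero_of_mem_rootSpace_of_add_ne_zero ℂ (ℂ ⊗[ℝ] L)
      (complexifySubalgebra t) hZ hW fun h0 => h ?_
    ext X
    have := congrFun h0 (cartanEmb t X)
    rw [Pi.add_apply] at this
    have h2 := congrArg Complex.im this
    simpa [rootIm] using h2
  have hker1 : ∀ (α : P) (Y : L), Y ∈ t → k α Y = 0 := by
    intro α Y hY
    refine killingForm_apply_eq_zero_of_mem_rootSpace_of_add_ne_zero ℂ (ℂ ⊗[ℝ] L)
      (complexifySubalgebra t) (α := (-α.1 : Weight ℂ _ _)) (β := 0) (rootVector_mem _) ?_ ?_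
    · rw [rootSpace_zero_eq]
      exact one_tmul_mem_complexify.2 hY
    · rw [add_zero]
      exact fun h => (hP α).neg (Weight.coe_eq_zero_iff _ |>.1 h)
  have hker2 : ∀ Y : L, (∀ α : P, k α Y = 0) → Y ∈ t := by
    intro Y hY
    refine mem_cartan_of_orthogonal fun α hα Z hZ => ?_
    have hneg : ∀ β : Weight ℂ (complexifySubalgebra t) (ℂ ⊗[ℝ] L), β.IsNonZero →
        0 < rootIm β X₀ → ∀ W ∈ rootSpace (complexifySubalgebra t) β,
        killingForm ℂ (ℂ ⊗[ℝ] L) W ((1 : ℂ) ⊗ₜ[ℝ] Y) = 0 := by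
      intro β hβ hpos W hW
      have hβ' : rootIm (-β) X₀ < 0 := by rw [rootIm_neg]; simpa using hpos
      have h1 : killingForm ℂ (ℂ ⊗[ℝ] L) (rootVector (- -β)) ((1 : ℂ) ⊗ₜ[ℝ] Y) = 0 := hY ⟨-β, hβ'⟩
      rw [neg_neg] at h1
      obtain ⟨c, rfl⟩ := exists_smul_of_mem_rootSpace hβ (rootVector_mem β) (rootVector_ne_zero β) hW
      rw [map_smul, LinearMap.smul_apply, h1, smul_zero]
    rcases lt_or_gt_of_ne (hreg' α hα) with h | h
    · have h1 := hneg (-α) hα.neg (by rw [rootIm_neg]; simpa using h) _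
        (tensorConj_mem_rootSpace himag hZ)
      rw [killingForm_tensorConj] at h1
      simpa using h1
    · exact hneg α hα h Z hZ
  have hsurj : ∀ z : P → ℂ, ∃ Y, ∀ α, k α Y = z α := by
    have hdual : ∀ α : P, ∃ f ∈ rootSpace (complexifySubalgebra t) α.1,
        killingForm ℂ (ℂ ⊗[ℝ] L) (rootVector (-α.1)) f = 1 := by
      intro α
      have h1 : ∃ f ∈ rootSpace (complexifySubalgebra t) (-(-α.1 : Weight ℂ _ _) : Weight ℂ _ _),
          killingForm ℂ (ℂ ⊗[ℝ] L) (rootVector (-α.1)) f ≠ 0 := by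
        by_contra! hall
        refine rootVector_ne_zero (-α.1) ?_
        have := mem_ker_killingForm_of_mem_rootSpace_of_forall_rootSpace_neg ℂ (ℂ ⊗[ℝ] L)
          (complexifySubalgebra t) (rootVector_mem (-α.1)) hall
        rw [IsKilling.ker_killingForm_eq_bot] at this
        simpa using this
      rw [neg_neg] at h1
      obtain ⟨f, hf, hf0⟩ := h1
      exact ⟨(killingForm ℂ (ℂ ⊗[ℝ] L) (rootVector (-α.1)) f)⁻¹ • f,
        Submodule.smul_mem _ _ hf, by rw [map_smul, smul_eq_mul, inv_mul_cancel₀ hf0]⟩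
    choose f hf hf1 using hdual
    intro z
    have hre : ∀ (α β : P) (c : ℂ), k α (tensorRe ((2 * c) • f β)) = if α = β then c else 0 := by
      intro α β c
      have hmem : (2 * c) • f β ∈ rootSpace (complexifySubalgebra t) β.1 :=
        Submodule.smul_mem _ _ (hf β)
      have h1 := congrArg (killingForm ℂ (ℂ ⊗[ℝ] L) (rootVector (-α.1)))
        (add_tensorConj ((2 * c) • f β))
      have h2 : killingForm ℂ (ℂ ⊗[ℝ] L) (rootVector (-α.1)) (tensorConj ((2 * c) • f β)) = 0 := by
        refine horth (rootVector_mem _) (tensorConj_mem_rootSpace himag hmem) fun h => ?_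
        have h3 := LinearMap.congr_fun h X₀
        rw [rootIm_neg, rootIm_neg] at h3
        have h4 := α.2
        have h5 := β.2
        simp at h3
        linarith
      rw [map_add, h2, add_zero, map_smul, map_smul, smul_eq_mul, smul_eq_mul] at h1
      have h3 : k α (tensorRe ((2 * c) • f β)) =
          c * killingForm ℂ (ℂ ⊗[ℝ] L) (rootVector (-α.1)) (f β) := by
        refine mul_left_cancel₀ (two_ne_zero (α := ℂ)) ?_
        rw [← mul_assoc]
        exact h1.symm
      rw [h3]
      split_ifs with h
      · rw [h, hf1, mul_one]
      · rw [horth (rootVector_mem _) (hf β), mul_zero]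
        rw [rootIm_neg]
        intro h4
        exact h (Subtype.ext (rootIm_injective himag (neg_add_eq_zero.1 h4)))
    refine ⟨∑ β, tensorRe ((2 * z β) • f β), fun α => ?_⟩
    rw [map_sum]
    exact (Finset.sum_congr rfl fun β _ => hre α β (z β)).trans
      (by rw [Finset.sum_ite_eq, if_pos (Finset.mem_univ _)])
  refine ⟨⟨Fintype.card P, fun j => rootIm (e j).1, fun j => k (e j), fun j X Y => hlie (e j) X Y,
    fun Y => ⟨fun h => hker2 Y fun α => by simpa using h (e.symm α), fun h j => hker1 _ Y h⟩,
    fun z => ?_, fun j => (e j).2, fun i j h =>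
      e.injective (Subtype.ext (rootIm_injective himag h)), fun j l hl => ?_, fun α => ?_⟩⟩
  · obtain ⟨Y, hY⟩ := hsurj fun α => z (e.symm α)
    exact ⟨Y, fun j => by simpa using hY (e j)⟩
  · obtain ⟨Z, rfl⟩ := exists_killingFunctional_eq l
    have hZ : Z ∈ rootSpace (complexifySubalgebra t) (-(e j).1 : Weight ℂ _ _) := by
      refine mem_rootSpace_of_forall (α := Weight.toLinear ℂ _ _ (-(e j).1)) fun X => ?_
      refine killingFunctional_injective (LinearMap.ext fun Y => ?_)
      have h1 := hl X Y
      rw [killingFunctional_apply,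
        show (1 : ℂ) ⊗ₜ[ℝ] ⁅(X : L), Y⁆ = ⁅(1 : ℂ) ⊗ₜ[ℝ] (X : L), (1 : ℂ) ⊗ₜ[ℝ] Y⁆ by simp,
        killingForm_lie_left, neg_eq_iff_eq_neg] at h1
      rw [killingFunctional_apply, killingFunctional_apply, h1, map_smul, LinearMap.smul_apply,
        Weight.toLinear_apply, weight_eq_I_mul_rootIm himag, rootIm_neg, killingFunctional_apply]
      simp
    obtain ⟨c, rfl⟩ := exists_smul_of_mem_rootSpace (hP (e j)).neg (rootVector_mem _)
      (rootVector_ne_zero _) hZ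
    refine ⟨c, LinearMap.ext fun Y => ?_⟩
    rw [killingFunctional_apply, map_smul]
    rfl
  · constructor
    · rintro ⟨hα, Z, hZ, h⟩
      obtain ⟨β, rfl⟩ := exists_weight_of_eigenvector himag hZ h
      have hβ := (isNonZero_iff_rootIm_ne_zero himag β).2 hα
      rcases lt_or_gt_of_ne (hreg' β hβ) with hl | hl
      · exact ⟨e.symm ⟨β, hl⟩, Or.inl (by simp)⟩
      · exact ⟨e.symm ⟨-β, by rw [rootIm_neg]; simpa using hl⟩, Or.inr (by simp [rootIm_neg])⟩
    · rintro ⟨j, rfl | rfl⟩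
      · exact ⟨(isNonZero_iff_rootIm_ne_zero himag _).1 (hP _), hroot _⟩
      · rw [← rootIm_neg]
        exact ⟨(isNonZero_iff_rootIm_ne_zero himag _).1 (hP _).neg, hroot _⟩

end RootDataExistence

/-- The data of a compact Cartan subgroup `T` of a Lie group and of a regular element of the dual of
its Lie algebra which are used for the construction of equivariant bundles over the coadjoint orbit.
All the data are read on the normed space `E` which underlies `𝔤 = T₁G`. -/
structure TorusData {E G : Type*} [NormedAddCommGroup E] [NormedSpace ℝ E]
    [FiniteDimensional ℝ E] [TopologicalSpace G] [ChartedSpace E G] [Group G]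
    [LieGroup 𝓘(ℝ, E) ∞ G] (torus : Subgroup G) (cartan : Submodule ℝ E) (lam : E →L[ℝ] ℝ) where
  N : ℕ
  elt : E
  elt_mem : elt ∈ cartan
  curve_mem : ∀ X ∈ cartan, ∀ γ : ℝ → G, IsOneParameterSubgroup (E := E) (G := G) X γ →
    ∀ s, γ s ∈ torus
  fix : ∀ g ∈ torus, ∀ X ∈ cartan, AdModel E g X = X
  centralizer : ∀ Y, bracketModel G Y elt = 0 → Y ∈ cartan
  stabilizer : ∀ g, coAd E G g lam = lam ↔ g ∈ torus
  lam_bracket : ∀ Y, (∀ Z, lam (bracketModel G Y Z) = 0) ↔ Y ∈ cartan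
  form : Fin N → E →L[ℝ] ℂ
  form_eq_zero_iff : ∀ Y, (∀ j, form j Y = 0) ↔ Y ∈ cartan
  form_surjective : ∀ z : Fin N → ℂ, ∃ Y, ∀ j, form j Y = z j
  root : Fin N → cartan →ₗ[ℝ] ℝ
  root_injective : Function.Injective root
  root_neg : ∀ j, root j ⟨elt, elt_mem⟩ < 0
  char : Fin N → torus →* Circle
  form_Ad : ∀ j (g : torus) Y, form j (AdModel E (g : G) Y) = char j g * form j Y
  char_curve : ∀ j (X : cartan) (γ : ℝ → torus),
    IsOneParameterSubgroup (E := E) (G := G) (X : E) (fun s => (γ s : G)) →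
    ∀ s : ℝ, (char j (γ s) : ℂ) = Complex.exp (Complex.I * (s * root j X : ℝ))

section TorusDataConstruction

open LieAlgebra

variable {E G : Type*} [NormedAddCommGroup E] [NormedSpace ℝ E] [FiniteDimensional ℝ E]
  [TopologicalSpace G] [ChartedSpace E G] [Group G] [LieGroup 𝓘(ℝ, E) ∞ G]

/-- `Ad g` as an automorphism of the Lie algebra. -/
noncomputable def AdLieEquiv (E : Type*) {G : Type*} [NormedAddCommGroup E] [NormedSpace ℝ E]
    [FiniteDimensional ℝ E] [TopologicalSpace G] [ChartedSpace E G] [Group G]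
    [LieGroup 𝓘(ℝ, E) ∞ G] (g : G) : LieAlg E G ≃ₗ⁅ℝ⁆ LieAlg E G :=
  { (AdEquiv E g : LieAlg E G ≃ₗ[ℝ] LieAlg E G) with
    map_lie' := fun {X Y} => AdModel_bracketModel (E := E) g X Y }

theorem killingForm_Ad (g : G) (X Y : LieAlg E G) :
    killingForm ℝ (LieAlg E G) (Ad E g X) (Ad E g Y) = killingForm ℝ (LieAlg E G) X Y :=
  killingForm_of_equiv_apply (AdLieEquiv E g) X Y

theorem Ad_lie (g : G) (X Y : LieAlg E G) : Ad E g ⁅X, Y⁆ = ⁅Ad E g X, Ad E g Y⁆ :=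
  AdModel_bracketModel (E := E) g X Y

variable [IsSemisimple ℝ (LieAlg E G)]

theorem curve_mem_cartanSubgroup {t : LieSubalgebra ℝ (LieAlg E G)} [t.IsCartanSubalgebra]
    {X : LieAlg E G} (hX : X ∈ t) {γ : ℝ → G} (hγ : IsOneParameterSubgroup X γ) (s : ℝ) :
    γ s ∈ cartanSubgroup t := fun _ hY =>
  IsOneParameterSubgroup.Ad_apply_of_bracket_eq_zero (E := E) (G := G) hγ
    (lie_eq_zero_of_mem_cartan t hX hY) s

/-- The eigenvalues of a compact Cartan subalgebra are imaginary. -/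
theorem re_eq_zero_of_compact {t : LieSubalgebra ℝ (LieAlg E G)} [t.IsCartanSubalgebra]
    (hT : IsCompact (cartanSubgroup t : Set G)) (X : LieAlg E G) (hX : X ∈ t)
    (k : LieAlg E G →ₗ[ℝ] ℂ) (c : ℂ) (hk : k ≠ 0) (h : ∀ Y, k ⁅X, Y⁆ = c * k Y) : c.re = 0 := by
  obtain ⟨Y, hY⟩ : ∃ Y, k Y ≠ 0 := by
    by_contra! hall
    exact hk (LinearMap.ext hall)
  let kE : E →ₗ[ℝ] ℂ := k
  let kc : E →L[ℝ] ℂ := LinearMap.toContinuousLinearMap kE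
  let X' : E := X
  let Y' : E := Y
  have hγ := isOneParameterSubgroup_expCurve (E := E) (G := G) X'
  have h1 : ∀ s : ℝ, kc (AdModel E (expCurve G X' s) Y') = Complex.exp (s * c) * kc Y' :=
    fun s => hγ.apply_Ad_of_eigen kc h s Y'
  have hcont : Continuous (fun g : G => kc (AdModel E g Y')) :=
    kc.continuous.comp ((contMDiff_Ad E).continuous.clm_apply continuous_const)
  obtain ⟨C, hC⟩ := (hT.image hcont).isBounded.exists_norm_le
  have h2 : ∀ s : ℝ, Real.exp (s * c.re) ≤ C / ‖kc Y'‖ := by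
    intro s
    have h3 := hC _ ⟨expCurve G X' s, curve_mem_cartanSubgroup hX hγ s, rfl⟩
    simp only [h1, norm_mul, Complex.norm_exp] at h3
    refine (le_div_iff₀ (show 0 < ‖kc Y'‖ from norm_pos_iff.2 hY)).2 ?_
    simpa using h3
  by_contra hne
  have h3 := h2 (C / ‖kc Y'‖ / c.re)
  rw [div_mul_cancel₀ _ hne] at h3
  have := Real.add_one_le_exp (C / ‖kc Y'‖)
  linarith

variable (t : LieSubalgebra ℝ (LieAlg E G)) [t.IsCartanSubalgebra]
  (lam : LieDual E G)

/-- The element of `𝔱` which represents `lam` for the Killing form. -/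
noncomputable def cartanRep : t :=
  (IsKilling.cartanEquivDual t).symm (restrictCartan t lam)

theorem killingForm_cartanEquivDual_symm (μ : Module.Dual ℝ t) (Y : t) :
    killingForm ℝ (LieAlg E G) ((IsKilling.cartanEquivDual t).symm μ) Y = μ Y := by
  have h := LinearMap.congr_fun ((IsKilling.cartanEquivDual t).apply_symm_apply μ) Y
  exact h

variable {lam}

theorem killingForm_cartanRep (hlam : IsInCartanDual t lam) (Y : LieAlg E G) :
    killingForm ℝ (LieAlg E G) (cartanRep t lam) Y = lam Y := by
  let Z : t := (IsKilling.cartanEquivDual t).symm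
    ((killingForm ℝ (LieAlg E G) Y).comp t.toSubmodule.subtype)
  have hZ : ∀ W : t, killingForm ℝ (LieAlg E G) Z W = killingForm ℝ (LieAlg E G) Y W :=
    fun W => killingForm_cartanEquivDual_symm t _ W
  have h1 : lam (Y - Z) = 0 := hlam _ fun W hW => by
    rw [map_sub, LinearMap.sub_apply, ← hZ ⟨W, hW⟩, sub_self]
  have h2 : killingForm ℝ (LieAlg E G) (cartanRep t lam) Z = lam Z :=
    killingForm_cartanEquivDual_symm t _ Z
  rw [map_sub, sub_eq_zero] at h1
  rw [h1, ← h2, LieModule.traceForm_comm ℝ _ _ _ (Z : LieAlg E G), hZ, LieModule.traceForm_comm]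

theorem coAd_eq_iff (hlam : IsInCartanDual t lam) (g : G) :
    coAd E G g lam.toModel = lam.toModel ↔
      Ad E g (cartanRep t lam : LieAlg E G) = cartanRep t lam := by
  have h1 : ∀ Y : LieAlg E G, coAd E G g lam.toModel (Y : E) =
      killingForm ℝ (LieAlg E G) (Ad E g (cartanRep t lam : LieAlg E G)) Y := by
    intro Y
    have h2 : coAd E G g lam.toModel (Y : E) = lam (Ad E g⁻¹ Y) := rfl
    have h3 : Ad E g (Ad E g⁻¹ Y) = Y := AdModel_apply_inv (E := E) g Y
    rw [h2, ← killingForm_cartanRep t hlam, ← killingForm_Ad g, h3]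
  constructor
  · intro h
    rw [← sub_eq_zero]
    refine eq_zero_of_killingForm_eq_zero fun Y => ?_
    rw [map_sub, LinearMap.sub_apply, ← h1, h, killingForm_cartanRep t hlam]
    exact sub_self _
  · intro h
    refine ContinuousLinearMap.ext fun Y => ?_
    refine (h1 Y).trans ?_
    rw [h]
    exact killingForm_cartanRep t hlam Y

theorem dualForm_restrictCartan (α : Module.Dual ℝ t) :
    dualForm t α (restrictCartan t lam) = -α (cartanRep t lam) :=
  congrArg Neg.neg (killingForm_cartanEquivDual_symm t α _)

theorem exists_rootData_of_compact (hT : IsCompact (cartanSubgroup t : Set G))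
    (hreg : IsRegularElement t lam) : Nonempty (RootData t (cartanRep t lam) (realRoots t)) := by
  refine exists_rootData (re_eq_zero_of_compact hT) (cartanRep t lam) fun α hα hZ h0 => ?_
  have h1 := hreg α ⟨hα, hZ⟩
  have h2 : dualForm t (restrictCartan t lam) α = dualForm t α (restrictCartan t lam) := by
    unfold dualForm
    rw [LieModule.traceForm_comm]
  rw [h2, dualForm_restrictCartan, h0, neg_zero] at h1
  exact h1 rfl

/-- A compact group acts by phases on the eigenfunctional attached to a root. -/
theorem exists_root_character {roots} (R : RootData t (cartanRep t lam) roots)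
    (hT : IsCompact (cartanSubgroup t : Set G)) (j : Fin R.N) :
    ∃ χ : cartanSubgroup t →* Circle, ∀ (g : cartanSubgroup t) (Y : LieAlg E G),
      R.form j (Ad E (g : G) Y) = χ g * R.form j Y := by
  classical
  have h1 : ∀ g : cartanSubgroup t, ∃ c : ℂ, ∀ Y, R.form j (Ad E (g : G) Y) = c * R.form j Y := by
    intro g
    obtain ⟨c, hc⟩ := R.form_unique j (R.form j ∘ₗ (Ad E (g : G) : LieAlg E G →ₗ[ℝ] LieAlg E G))
      fun X Y => by
        change R.form j (Ad E (g : G) ⁅(X : LieAlg E G), Y⁆) = _ * R.form j (Ad E (g : G) Y)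
        rw [Ad_lie, g.2 X X.2, R.form_lie]
    exact ⟨c, fun Y => LinearMap.congr_fun hc Y⟩
  choose c hc using h1
  obtain ⟨Y₀, hY₀⟩ := R.form_surjective fun _ => 1
  have hval : ∀ g : cartanSubgroup t, R.form j (Ad E (g : G) Y₀) = c g := fun g => by
    rw [hc, hY₀, mul_one]
  have hone : c 1 = 1 := by
    rw [← hval, Subgroup.coe_one, Ad_one]; exact hY₀ j
  have hmul : ∀ a b, c (a * b) = c a * c b := fun a b => by
    rw [← hval, Subgroup.coe_mul, Ad_mul, ContinuousLinearMap.comp_apply, hc, hval]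
  let f : E →ₗ[ℝ] ℂ := R.form j
  let fc : E →L[ℝ] ℂ := LinearMap.toContinuousLinearMap f
  let Y' : E := Y₀
  have hcont : Continuous (fun g : G => fc (AdModel E g Y')) :=
    fc.continuous.comp ((contMDiff_Ad E).continuous.clm_apply continuous_const)
  obtain ⟨C, hC⟩ := (hT.image hcont).isBounded.exists_norm_le
  have hbd : ∀ g, ‖c g‖ ≤ C := fun g => by
    rw [← hval]
    exact hC _ ⟨g, g.2, rfl⟩
  have hpow : ∀ g (n : ℕ), c (g ^ n) = c g ^ n := fun g n => by
    induction n with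
    | zero => rw [pow_zero, pow_zero, hone]
    | succ n ih => rw [pow_succ, hmul, ih, pow_succ]
  have hle : ∀ g, ‖c g‖ ≤ 1 := fun g => by
    by_contra! hlt
    obtain ⟨n, hn⟩ := pow_unbounded_of_one_lt C hlt
    have := hbd (g ^ n)
    rw [hpow, norm_pow] at this
    linarith
  have hnorm : ∀ g, ‖c g‖ = 1 := fun g => by
    have h2 := hmul g g⁻¹
    rw [mul_inv_cancel, hone] at h2
    have h3 := congrArg norm h2
    rw [norm_one, norm_mul] at h3
    nlinarith [hle g, hle g⁻¹, norm_nonneg (c g), norm_nonneg (c g⁻¹)]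
  refine ⟨{ toFun := fun g => ⟨c g, mem_sphere_zero_iff_norm.2 (hnorm g)⟩
            map_one' := Circle.ext hone
            map_mul' := fun a b => Circle.ext (hmul a b) }, fun g Y => hc g Y⟩

theorem lam_lie_eq_zero_iff {roots} (R : RootData t (cartanRep t lam) roots)
    (hlam : IsInCartanDual t lam) (Y : LieAlg E G) :
    (∀ Z, lam ⁅Y, Z⁆ = 0) ↔ Y ∈ t := by
  have h1 : ∀ Z, lam ⁅Y, Z⁆ = killingForm ℝ (LieAlg E G) ⁅(cartanRep t lam : LieAlg E G), Y⁆ Z :=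
    fun Z => by
      rw [← killingForm_cartanRep t hlam]
      exact (LieModule.traceForm_apply_lie_apply ℝ _ _ _ _ _).symm
  constructor
  · intro h
    have h2 : ⁅(cartanRep t lam : LieAlg E G), Y⁆ = 0 :=
      eq_zero_of_killingForm_eq_zero fun Z => by rw [← h1, h]
    refine (R.form_eq_zero_iff Y).1 fun j => ?_
    have h3 := R.form_lie j (cartanRep t lam) Y
    rw [h2, map_zero, eq_comm, mul_eq_zero, mul_eq_zero] at h3
    rcases h3 with (h3 | h3) | h3
    · exact absurd h3 Complex.I_ne_zero
    · exact absurd (Complex.ofReal_eq_zero.1 h3) (R.root_neg j).ne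
    · exact h3
  · intro h Z
    rw [h1, lie_eq_zero_of_mem_cartan t (cartanRep t lam).2 h]
    simp

theorem mem_cartan_of_lie_cartanRep {roots} (R : RootData t (cartanRep t lam) roots)
    (hlam : IsInCartanDual t lam) {Y : LieAlg E G}
    (h : ⁅Y, (cartanRep t lam : LieAlg E G)⁆ = 0) : Y ∈ t := by
  refine (lam_lie_eq_zero_iff t R hlam Y).1 fun Z => ?_
  rw [← killingForm_cartanRep t hlam]
  refine (LieModule.traceForm_apply_lie_apply ℝ _ _ _ _ _).symm.trans ?_
  rw [← lie_skew, h]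
  simp

theorem rhoShift_eq (R : RootData t (cartanRep t lam) (realRoots t)) :
    rhoShift t (restrictCartan t lam) = (1 / 2 : ℝ) • ∑ j, R.root j := by
  classical
  unfold rhoShift
  congr 1
  have h : {α | α ∈ realRoots t ∧ 0 < dualForm t α (restrictCartan t lam)} = Set.range R.root := by
    ext α
    rw [Set.mem_ofPred_eq, dualForm_restrictCartan, R.mem_roots, Set.mem_range]
    constructor
    · rintro ⟨⟨j, rfl | rfl⟩, h⟩
      · exact ⟨j, rfl⟩
      · have := R.root_neg j
        rw [LinearMap.neg_apply] at h
        linarith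
    · rintro ⟨j, rfl⟩
      exact ⟨⟨j, Or.inl rfl⟩, neg_pos.2 (R.root_neg j)⟩
  rw [h, finsum_mem_range R.root_injective, finsum_eq_sum_of_fintype]

/-- The data attached to a regular element of the dual of a compact Cartan subalgebra. -/
noncomputable def RootData.toTorusData [ConnectedSpace G]
    (R : RootData t (cartanRep t lam) (realRoots t))
    (hT : IsCompact (cartanSubgroup t : Set G)) (hlam : IsInCartanDual t lam) :
    TorusData (E := E) (cartanSubgroup t) (t.toSubmodule : Submodule ℝ E) lam.toModel where
  N := R.N
  elt := (cartanRep t lam : LieAlg E G)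
  elt_mem := (cartanRep t lam).2
  curve_mem X hX γ hγ s := curve_mem_cartanSubgroup hX hγ s
  fix g hg X hX := hg X hX
  centralizer Y hY := mem_cartan_of_lie_cartanRep t R hlam hY
  stabilizer g := by
    refine (coAd_eq_iff t hlam g).trans ⟨fun h => ?_, fun h => h _ (cartanRep t lam).2⟩
    have himag := re_eq_zero_of_compact hT
    let κ : Fin R.N → E →L[ℝ] ℂ := fun j => LinearMap.toContinuousLinearMap (R.form j : E →ₗ[ℝ] ℂ)
    exact Ad_eq_self_of_fixes_regular (E := E) (tE := (t.toSubmodule : Submodule ℝ E))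
      (T := cartanSubgroup t)
      (fun X hX s => curve_mem_cartanSubgroup hX (isOneParameterSubgroup_expCurve X) s)
      (fun g hg X hX => hg X hX) (cartanRep t lam).2 κ (fun j => (R.root_neg j).ne)
      (fun j Y => R.form_lie j _ Y) (fun Y => R.form_eq_zero_iff Y)
      (killingForm ℝ (LieAlg E G)) (fun X hX h => eq_zero_of_killingForm_self himag hX h)
      (killingForm_Ad g) h
  lam_bracket Y := lam_lie_eq_zero_iff t R hlam Y
  form j := LinearMap.toContinuousLinearMap (R.form j : E →ₗ[ℝ] ℂ)
  form_eq_zero_iff := R.form_eq_zero_iff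
  form_surjective := R.form_surjective
  root := R.root
  root_injective := R.root_injective
  root_neg := R.root_neg
  char j := (exists_root_character t R hT j).choose
  form_Ad j g Y := (exists_root_character t R hT j).choose_spec g Y
  char_curve j X γ hγ s := by
    obtain ⟨Y₀, hY₀⟩ := R.form_surjective fun _ => 1
    let κ : E →L[ℝ] ℂ := LinearMap.toContinuousLinearMap (R.form j : E →ₗ[ℝ] ℂ)
    have h1 := (exists_root_character t R hT j).choose_spec (γ s) Y₀
    have h2 : κ (AdModel E (γ s : G) Y₀) = _ := hγ.apply_Ad_of_eigen κ (R.form_lie j X) s Y₀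
    rw [hY₀, mul_one] at h1
    refine h1.symm.trans (h2.trans ?_)
    have h3 : κ Y₀ = 1 := hY₀ j
    rw [h3, mul_one]
    congr 1
    rw [Complex.ofReal_mul]
    exact mul_left_comm _ _ _

end TorusDataConstruction

/-- A module of spinors for `ℂ^N`, with its grading `ε`, the action `τ` of the diagonal torus, and
the conjugate linear map `conj` which commutes with Clifford multiplication. -/
structure SpinorModel (N : ℕ) (V : Type*) [NormedAddCommGroup V] [NormedSpace ℂ V] where
  c : (Fin N → ℂ) →ₗ[ℝ] Module.End ℂ V
  c_c : ∀ z v, c z (c z v) = -(((∑ j, ‖z j‖ ^ 2 : ℝ) : ℂ) • v)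
  adjoin_eq_top : Algebra.adjoin ℂ (range c) = ⊤
  ε : Module.End ℂ V
  ε_ε : ∀ v, ε (ε v) = v
  ε_c : ∀ z v, ε (c z v) = -c z (ε v)
  τ : (Fin N → ℂ) → Module.End ℂ V
  τ_one : τ 1 = 1
  τ_mul : ∀ u v, τ (u * v) = τ u * τ v
  τ_ε : ∀ u v, τ u (ε v) = ε (τ u v)
  τ_c : ∀ u z v, (∀ j, ‖u j‖ = 1) → τ u (c z v) = c (u * z) (τ u v)
  contDiff_τ : ∀ v, ContDiff ℝ ∞ fun u => τ u v
  conj : V →ₛₗ[starRingEnd ℂ] V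
  conj_c : ∀ z v, conj (c z v) = c z (conj v)
  conj_bijective : Function.Bijective conj
  τ_conj : ∀ u v, (∀ j, ‖u j‖ = 1) → τ u (conj v) = (∏ j, u j) • conj (τ u v)
  finrank_eq : Module.finrank ℂ V = 2 ^ N

namespace SpinorModel

/-- The spinors of the zero dimensional space. -/
noncomputable def zero : SpinorModel 0 ℂ where
  c := 0
  c_c z v := by simp
  adjoin_eq_top := by
    refine eq_top_iff.2 fun T _ => ?_
    have h : T = algebraMap ℂ (Module.End ℂ ℂ) (T 1) := by
      ext
      simp
    rw [h]
    exact Subalgebra.algebraMap_mem _ _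
  ε := 1
  ε_ε v := rfl
  ε_c z v := by simp
  τ _ := 1
  τ_one := rfl
  τ_mul _ _ := rfl
  τ_ε _ _ := rfl
  τ_c u z v _ := by simp
  contDiff_τ v := contDiff_const
  conj :=
    { toFun := starRingEnd ℂ
      map_add' := map_add _
      map_smul' := fun a b => by simp }
  conj_c z v := by simp
  conj_bijective := Function.Involutive.bijective Complex.conj_conj
  τ_conj u v _ := by simp
  finrank_eq := by simp

variable {N : ℕ} {V : Type*} [NormedAddCommGroup V] [NormedSpace ℂ V]

/-- Clifford multiplication on `V × V`. -/
noncomputable def succC (S : SpinorModel N V) : (Fin (N + 1) → ℂ) →ₗ[ℝ] Module.End ℂ (V × V) where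
  toFun z := ((S.c (Fin.tail z) ∘ₗ LinearMap.fst ℂ V V) -
      (starRingEnd ℂ (z 0)) • LinearMap.snd ℂ V V).prod
    (z 0 • LinearMap.fst ℂ V V - (S.c (Fin.tail z)) ∘ₗ LinearMap.snd ℂ V V)
  map_add' z w := by
    have h : Fin.tail (z + w) = Fin.tail z + Fin.tail w := rfl
    refine LinearMap.ext fun x => Prod.ext ?_ ?_
    · simp [h]; module
    · simp [h]; module
  map_smul' a z := by
    have h : Fin.tail (a • z) = a • Fin.tail z := rfl
    refine LinearMap.ext fun x => Prod.ext ?_ ?_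
    · simp [h]; module
    · simp [h]; module

theorem succC_apply (S : SpinorModel N V) (z : Fin (N + 1) → ℂ) (f g : V) :
    S.succC z (f, g) = (S.c (Fin.tail z) f - starRingEnd ℂ (z 0) • g,
      z 0 • f - S.c (Fin.tail z) g) := rfl

theorem adjoin_succC (S : SpinorModel N V) : Algebra.adjoin ℂ (range S.succC) = ⊤ := by
  set A := Algebra.adjoin ℂ (range S.succC) with hA
  have hmem : ∀ z, S.succC z ∈ A := fun z => Algebra.subset_adjoin ⟨z, rfl⟩
  let J : Module.End ℂ (V × V) := S.succC (Fin.cons 1 0)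
  let K : Module.End ℂ (V × V) := S.succC (Fin.cons Complex.I 0)
  have hJ : ∀ f g, J (f, g) = (-g, f) := fun f g => by
    simp [J, succC_apply]
  have hK : ∀ f g, K (f, g) = (Complex.I • g, Complex.I • f) := fun f g => by
    simp [K, succC_apply]
  let P : Module.End ℂ (V × V) := (LinearMap.fst ℂ V V).prod 0
  let D : Module.End ℂ (V × V) := (LinearMap.fst ℂ V V).prod (-LinearMap.snd ℂ V V)
  have hD : D = Complex.I • (J * K) := LinearMap.ext fun ⟨f, g⟩ => by
    change (f, -g) = Complex.I • J (K (f, g))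
    rw [hK, hJ, Prod.smul_mk, smul_neg, smul_smul, smul_smul, Complex.I_mul_I]
    simp
  have hDA : D ∈ A := hD ▸ A.smul_mem (A.mul_mem (hmem _) (hmem _)) _
  have hPA : P ∈ A := by
    have h : P = (1 / 2 : ℂ) • (1 + D) := LinearMap.ext fun ⟨f, g⟩ => by
      change (f, 0) = (1 / 2 : ℂ) • ((f, g) + (f, -g))
      refine Prod.ext ?_ ?_
      · change f = (1 / 2 : ℂ) • (f + f); module
      · change 0 = (1 / 2 : ℂ) • (g + -g); module
    rw [h]
    exact A.smul_mem (A.add_mem A.one_mem hDA) _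
  let ι : Module.End ℂ V →ₐ[ℂ] Module.End ℂ (V × V) :=
    AlgHom.ofLinearMap
      { toFun := fun T => T.prodMap T
        map_add' := fun _ _ => rfl
        map_smul' := fun _ _ => rfl } rfl (fun _ _ => rfl)
  have hι : ∀ T, ι T ∈ A := by
    intro T
    have h1 : T ∈ Algebra.adjoin ℂ (range S.c) := by rw [S.adjoin_eq_top]; trivial
    have h2 : (Algebra.adjoin ℂ (range S.c)).map ι ≤ A := by
      rw [AlgHom.map_adjoin, Algebra.adjoin_le_iff]
      rintro _ ⟨_, ⟨z, rfl⟩, rfl⟩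
      have h3 : ι (S.c z) = D * S.succC (Fin.cons 0 z) := LinearMap.ext fun ⟨f, g⟩ => by
        change (S.c z f, S.c z g) = D (S.succC (Fin.cons 0 z) (f, g))
        rw [succC_apply]
        refine Prod.ext ?_ ?_ <;> simp [D]
      rw [h3]
      exact A.mul_mem hDA (hmem _)
    exact h2 ⟨T, h1, rfl⟩
  refine eq_top_iff.2 fun T _ => ?_
  let T₁₁ : Module.End ℂ V := LinearMap.fst ℂ V V ∘ₗ T ∘ₗ LinearMap.inl ℂ V V
  let T₁₂ : Module.End ℂ V := LinearMap.fst ℂ V V ∘ₗ T ∘ₗ LinearMap.inr ℂ V V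
  let T₂₁ : Module.End ℂ V := LinearMap.snd ℂ V V ∘ₗ T ∘ₗ LinearMap.inl ℂ V V
  let T₂₂ : Module.End ℂ V := LinearMap.snd ℂ V V ∘ₗ T ∘ₗ LinearMap.inr ℂ V V
  have hT : T = ι T₁₁ * P - P * (ι T₁₂ * J) + (J * P * ι T₂₁ + ι T₂₂ * (1 - P)) - (J * P * ι T₂₁) * (1 - P) := by
    refine LinearMap.ext fun ⟨f, g⟩ => ?_
    have h0 : T (f, g) = (T₁₁ f + T₁₂ g, T₂₁ f + T₂₂ g) := by
      have : (f, g) = (f, 0) + (0, g) := by simp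
      rw [this, map_add]
      rfl
    rw [h0]
    have e1 : (ι T₁₁ * P) (f, g) = (T₁₁ f, 0) := by
      change (T₁₁ f, T₁₁ 0) = _
      rw [map_zero]
    have e2 : (P * (ι T₁₂ * J)) (f, g) = (-T₁₂ g, 0) := by
      change P (ι T₁₂ (J (f, g))) = _
      rw [hJ]
      change (T₁₂ (-g), (0 : V)) = _
      rw [map_neg]
    have e3 : ∀ f g, (J * P * ι T₂₁) (f, g) = (0, T₂₁ f) := by
      intro f g
      change J (T₂₁ f, 0) = _
      rw [hJ, neg_zero]
    have e4 : (1 - P) (f, g) = (0, g) := by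
      change (f, g) - (f, 0) = _
      simp
    have e5 : (ι T₂₂ * (1 - P)) (f, g) = (0, T₂₂ g) := by
      change ι T₂₂ ((1 - P) (f, g)) = _
      rw [e4]
      change (T₂₂ 0, T₂₂ g) = _
      rw [map_zero]
    have e6 : (J * P * ι T₂₁ * (1 - P)) (f, g) = (0, 0) := by
      change (J * P * ι T₂₁) ((1 - P) (f, g)) = _
      rw [e4, e3, map_zero]
    rw [LinearMap.sub_apply, LinearMap.add_apply, LinearMap.sub_apply, LinearMap.add_apply,
      e1, e2, e3, e5, e6]
    simp
  rw [hT]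
  have hJA : J ∈ A := hmem _
  have h1P : 1 - P ∈ A := A.sub_mem A.one_mem hPA
  have hJP := A.mul_mem (A.mul_mem hJA hPA) (hι T₂₁)
  exact A.sub_mem (A.add_mem (A.sub_mem (A.mul_mem (hι _) hPA)
    (A.mul_mem hPA (A.mul_mem (hι _) hJA))) (A.add_mem hJP (A.mul_mem (hι _) h1P)))
    (A.mul_mem hJP h1P)

/-- The spinors of `ℂ^(N+1) = ℂ × ℂ^N`. -/
noncomputable def succ [FiniteDimensional ℂ V] (S : SpinorModel N V) : SpinorModel (N + 1) (V × V) where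
  c := S.succC
  c_c z := by
    rintro ⟨f, g⟩
    have h1 : ∀ v, S.c (Fin.tail z) (S.c (Fin.tail z) v) = _ := S.c_c (Fin.tail z)
    have h2 : z 0 * starRingEnd ℂ (z 0) = ((‖z 0‖ ^ 2 : ℝ) : ℂ) := by
      rw [Complex.mul_conj, Complex.normSq_eq_norm_sq]
    have h3 : ∑ j, ‖z j‖ ^ 2 = ‖z 0‖ ^ 2 + ∑ j, ‖Fin.tail z j‖ ^ 2 := Fin.sum_univ_succ _
    rw [succC_apply, succC_apply, h3, Complex.ofReal_add, ← h2]
    refine Prod.ext ?_ ?_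
    · simp only [map_sub, map_smul, h1, Prod.smul_mk, Prod.neg_mk]
      module
    · simp only [map_sub, map_smul, h1, Prod.smul_mk, Prod.neg_mk]
      module
  adjoin_eq_top := S.adjoin_succC
  ε := S.ε.prodMap (-S.ε)
  ε_ε := by
    rintro ⟨f, g⟩
    simp [S.ε_ε]
  ε_c z := by
    rintro ⟨f, g⟩
    simp only [LinearMap.prodMap_apply, succC_apply, LinearMap.neg_apply, map_sub, map_smul, S.ε_c,
      map_neg, Prod.neg_mk]
    refine Prod.ext ?_ ?_
    · simp only; module
    · simp only; module
  τ u := (S.τ (Fin.tail u)).prodMap (u 0 • S.τ (Fin.tail u))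
  τ_one := by
    have h : Fin.tail (1 : Fin (N + 1) → ℂ) = 1 := rfl
    refine LinearMap.ext fun ⟨f, g⟩ => ?_
    simp [h, S.τ_one]
  τ_mul u v := by
    have h : Fin.tail (u * v) = Fin.tail u * Fin.tail v := rfl
    refine LinearMap.ext fun ⟨f, g⟩ => ?_
    simp [h, S.τ_mul, mul_smul, smul_comm (v 0) (u 0)]
  τ_ε u := by
    rintro ⟨f, g⟩
    simp [S.τ_ε]
  τ_c u z := by
    rintro ⟨f, g⟩ hu
    have h : Fin.tail (u * z) = Fin.tail u * Fin.tail z := rfl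
    have h2 : starRingEnd ℂ (u 0) * u 0 = 1 := by
      rw [Complex.conj_mul', hu 0]; simp
    have h3 : ∀ v, S.τ (Fin.tail u) (S.c (Fin.tail z) v) = _ := fun v =>
      S.τ_c (Fin.tail u) (Fin.tail z) v fun j => hu _
    simp only [LinearMap.prodMap_apply, succC_apply, LinearMap.smul_apply, map_sub, map_smul, h3, h,
      Pi.mul_apply, map_mul]
    refine Prod.ext ?_ ?_
    · simp only [smul_smul, mul_right_comm, h2, one_mul]
    · simp only; module
  contDiff_τ := by
    rintro ⟨f, g⟩
    have ht : ContDiff ℝ ∞ (fun u : Fin (N + 1) → ℂ => Fin.tail u) :=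
      contDiff_pi.2 fun j => contDiff_apply ℝ ℂ j.succ
    exact ((S.contDiff_τ f).comp ht).prodMk
      ((contDiff_apply ℝ ℂ (0 : Fin (N + 1))).smul ((S.contDiff_τ g).comp ht))
  conj :=
    { toFun := fun x => (S.conj (S.ε x.2), -S.conj (S.ε x.1))
      map_add' := fun x y => by simp; abel
      map_smul' := fun a x => by simp }
  conj_c z := by
    rintro ⟨f, g⟩
    simp only [succC_apply, LinearMap.coe_mk, AddHom.coe_mk, map_sub, map_smul, map_neg,
      LinearMap.map_smulₛₗ, S.ε_c, S.conj_c, Complex.conj_conj]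
    refine Prod.ext ?_ ?_
    · simp only; module
    · simp only; module
  conj_bijective := by
    constructor
    · rintro ⟨f, g⟩ ⟨f', g'⟩ h
      have h1 := S.conj_bijective.1 (congrArg Prod.fst h)
      have h2 := S.conj_bijective.1 (neg_injective (congrArg Prod.snd h))
      have h3 := congrArg S.ε h1
      have h4 := congrArg S.ε h2
      rw [S.ε_ε, S.ε_ε] at h3 h4
      exact Prod.ext h4 h3
    · rintro ⟨f, g⟩
      obtain ⟨x, rfl⟩ := S.conj_bijective.2 f
      obtain ⟨y, rfl⟩ := S.conj_bijective.2 g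
      exact ⟨(S.ε (-y), S.ε x), by simp [S.ε_ε]⟩
  τ_conj u := by
    rintro ⟨f, g⟩ hu
    have h2 : u 0 * starRingEnd ℂ (u 0) = 1 := by
      rw [Complex.mul_conj', hu 0]; simp
    have h3 : ∀ v, S.τ (Fin.tail u) (S.conj v) = _ := fun v =>
      S.τ_conj (Fin.tail u) v fun j => hu _
    rw [Fin.prod_univ_succ]
    simp only [LinearMap.prodMap_apply, LinearMap.coe_mk, AddHom.coe_mk, LinearMap.smul_apply,
      map_smul, LinearMap.map_smulₛₗ, map_neg, h3, S.τ_ε, Prod.smul_mk, smul_smul]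
    refine Prod.ext ?_ ?_
    · simp only [mul_right_comm _ _ (starRingEnd ℂ (u 0)), h2, one_mul]
      rfl
    · simp only [smul_neg]
      rfl
  finrank_eq := by
    rw [Module.finrank_prod, S.finrank_eq]
    ring

theorem exists_model (N : ℕ) : ∃ (V : Type) (_ : NormedAddCommGroup V) (_ : NormedSpace ℂ V)
    (_ : FiniteDimensional ℂ V), Nonempty (SpinorModel N V) := by
  induction N with
  | zero => exact ⟨ℂ, inferInstance, inferInstance, inferInstance, ⟨zero⟩⟩
  | succ N ih =>
    obtain ⟨V, _, _, _, ⟨S⟩⟩ := ih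
    exact ⟨V × V, inferInstance, inferInstance, inferInstance, ⟨S.succ⟩⟩

/-- Transport of a spinor module along a linear equivalence. -/
noncomputable def transport [FiniteDimensional ℂ V] {W : Type*} [NormedAddCommGroup W] [NormedSpace ℂ W] (e : V ≃L[ℂ] W)
    (S : SpinorModel N V) : SpinorModel N W where
  c := ((e.toLinearEquiv.conjAlgEquiv ℂ).toLinearMap.restrictScalars ℝ) ∘ₗ S.c
  c_c z v := by
    change e (S.c z (e.symm (e (S.c z (e.symm v))))) = _
    rw [e.symm_apply_apply, S.c_c]
    simp
  adjoin_eq_top := by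
    have h : range (((e.toLinearEquiv.conjAlgEquiv ℂ).toLinearMap.restrictScalars ℝ) ∘ₗ S.c) =
        (e.toLinearEquiv.conjAlgEquiv ℂ).toAlgHom '' range S.c := by
      rw [← range_comp]; rfl
    rw [h, ← AlgHom.map_adjoin, S.adjoin_eq_top, Algebra.map_top]
    exact (AlgHom.range_eq_top _).2 (e.toLinearEquiv.conjAlgEquiv ℂ).surjective
  ε := e.toLinearEquiv.conjAlgEquiv ℂ S.ε
  ε_ε v := by
    change e (S.ε (e.symm (e (S.ε (e.symm v))))) = v
    rw [e.symm_apply_apply, S.ε_ε, e.apply_symm_apply]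
  ε_c z v := by
    change e (S.ε (e.symm (e (S.c z (e.symm v))))) = -e (S.c z (e.symm (e (S.ε (e.symm v)))))
    rw [e.symm_apply_apply, S.ε_c, e.symm_apply_apply, map_neg]
  τ u := e.toLinearEquiv.conjAlgEquiv ℂ (S.τ u)
  τ_one := by rw [S.τ_one, map_one]
  τ_mul u v := by rw [S.τ_mul, map_mul]
  τ_ε u v := by
    change e (S.τ u (e.symm (e (S.ε (e.symm v))))) = e (S.ε (e.symm (e (S.τ u (e.symm v)))))
    rw [e.symm_apply_apply, S.τ_ε, e.symm_apply_apply]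
  τ_c u z v hu := by
    change e (S.τ u (e.symm (e (S.c z (e.symm v))))) =
      e (S.c (u * z) (e.symm (e (S.τ u (e.symm v)))))
    rw [e.symm_apply_apply, S.τ_c u z _ hu, e.symm_apply_apply]
  contDiff_τ v := ((e : V →L[ℂ] W).restrictScalars ℝ).contDiff.comp (S.contDiff_τ (e.symm v))
  conj :=
    { toFun := fun v => e (S.conj (e.symm v))
      map_add' := fun x y => by simp
      map_smul' := fun a x => by simp }
  conj_c z v := by
    change e (S.conj (e.symm (e (S.c z (e.symm v))))) = e (S.c z (e.symm (e (S.conj (e.symm v)))))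
    rw [e.symm_apply_apply, S.conj_c, e.symm_apply_apply]
  conj_bijective := (e.bijective.comp S.conj_bijective).comp e.symm.bijective
  τ_conj u v hu := by
    change e (S.τ u (e.symm (e (S.conj (e.symm v))))) =
      (∏ j, u j) • e (S.conj (e.symm (e (S.τ u (e.symm v)))))
    rw [e.symm_apply_apply, S.τ_conj u _ hu, e.symm_apply_apply, map_smul]
  finrank_eq := by rw [← S.finrank_eq, e.toLinearEquiv.finrank_eq]

theorem nonempty_euclideanSpace (N : ℕ) :
    ∃ r : ℕ, Nonempty (SpinorModel N (EuclideanSpace ℂ (Fin r))) := by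
  obtain ⟨V, _, _, _, ⟨S⟩⟩ := exists_model N
  refine ⟨Module.finrank ℂ V, ⟨S.transport ?_⟩⟩
  exact (LinearEquiv.ofFinrankEq _ _ (by simp)).toContinuousLinearEquiv

/-- An endomorphism which commutes with Clifford multiplication is a scalar. -/
theorem exists_eq_smul (S : SpinorModel N V) {A : Module.End ℂ V}
    (hA : ∀ z v, A (S.c z v) = S.c z (A v)) : ∃ a : ℂ, ∀ v, A v = a • v := by
  have h1 : ∀ B : Module.End ℂ V, Commute A B := by
    intro B
    have h2 : B ∈ Algebra.adjoin ℂ (range S.c) := by rw [S.adjoin_eq_top]; trivial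
    have h3 : Algebra.adjoin ℂ (range S.c) ≤ Subalgebra.centralizer ℂ {A} := by
      rw [Algebra.adjoin_le_iff]
      rintro _ ⟨z, rfl⟩
      rw [SetLike.mem_coe, Subalgebra.mem_centralizer_iff]
      rintro _ rfl
      exact LinearMap.ext fun v => hA z v
    exact Subalgebra.mem_centralizer_iff ℂ |>.1 (h3 h2) A rfl
  have h4 : A ∈ Subalgebra.center ℂ (Module.End ℂ V) := by
    rw [Subalgebra.mem_center_iff]
    exact fun B => (h1 B).eq.symm
  obtain ⟨a, _, rfl⟩ := Module.End.mem_subalgebraCenter_iff.1 h4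
  exact ⟨a, fun v => rfl⟩

section Clifford

open TensorProduct

noncomputable local instance (priority := 5000) complexRealModuleSpinor : Module ℝ ℂ := Algebra.toModule

variable {U : Type*} [AddCommGroup U] [Module ℝ U] {Q : QuadraticForm ℝ U}
  (z : U →ₗ[ℝ] (Fin N → ℂ)) (hz : ∀ u, Q u = -∑ j, ‖z u j‖ ^ 2)

/-- The Clifford module structure of the spinors of a quadratic space identified with `ℂ^N`. -/
noncomputable def clifford (S : SpinorModel N V) : CliffordAlgebra Q →ₐ[ℝ] Module.End ℂ V :=
  CliffordAlgebra.lift Q ⟨S.c ∘ₗ z, fun u => LinearMap.ext fun v => by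
    change S.c (z u) (S.c (z u) v) = (algebraMap ℝ (Module.End ℂ V) (Q u)) v
    rw [S.c_c, hz, Module.algebraMap_end_apply, neg_smul, Complex.coe_smul]⟩

theorem clifford_ι (S : SpinorModel N V) (u : U) :
    S.clifford z hz (CliffordAlgebra.ι Q u) = S.c (z u) :=
  CliffordAlgebra.lift_ι_apply _ _ _

/-- The complexification of a map from a real algebra to a complex one. -/
noncomputable def baseChangeHom {W : Type*} [AddCommGroup W] [Module ℂ W] {A : Type*} [Ring A]
    [Algebra ℝ A] (f : A →ₐ[ℝ] Module.End ℂ W) : ℂ ⊗[ℝ] A →ₐ[ℂ] Module.End ℂ W :=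
  Algebra.TensorProduct.lift (Algebra.ofId ℂ _) f fun a b => by
    rw [Algebra.ofId_apply]
    exact Algebra.commutes a (f b)

theorem baseChangeHom_tmul {W : Type*} [AddCommGroup W] [Module ℂ W] {A : Type*} [Ring A]
    [Algebra ℝ A] (f : A →ₐ[ℝ] Module.End ℂ W) (a : ℂ) (b : A) : baseChangeHom f (a ⊗ₜ b) = a • f b := by
  rw [baseChangeHom, Algebra.TensorProduct.lift_tmul, Algebra.ofId_apply, Algebra.smul_def]

theorem baseChangeHom_toLinearMap {W : Type*} [AddCommGroup W] [Module ℂ W] {A : Type*} [Ring A]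
    [Algebra ℝ A] (f : A →ₐ[ℝ] Module.End ℂ W) :
    (baseChangeHom f).toLinearMap = LinearMap.liftBaseChange ℂ f.toLinearMap := by
  refine TensorProduct.AlgebraTensorModule.ext fun a b => ?_
  exact baseChangeHom_tmul f a b

theorem finrank_cliffordAlgebra [FiniteDimensional ℝ U] (Q : QuadraticForm ℝ U) :
    Module.finrank ℝ (CliffordAlgebra Q) = 2 ^ Module.finrank ℝ U ∧
      FiniteDimensional ℝ (CliffordAlgebra Q) := by
  have : Invertible (2 : ℝ) := invertibleOfNonzero two_ne_zero
  have b := (Module.finBasis ℝ U).ExteriorAlgebra.map (CliffordAlgebra.equivExterior Q).symm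
  refine ⟨?_, b.finiteDimensional_of_finite⟩
  rw [Module.finrank_eq_card_basis b, Fintype.card_finset, Fintype.card_fin]

theorem bijective_clifford [FiniteDimensional ℂ V] (S : SpinorModel N V)
    (hbij : Function.Bijective z) :
    Function.Bijective (LinearMap.liftBaseChange ℂ (S.clifford z hz).toLinearMap :
      ℂ ⊗[ℝ] CliffordAlgebra Q →ₗ[ℂ] Module.End ℂ V) := by
  let e := LinearEquiv.ofBijective z hbij
  have hfin : FiniteDimensional ℝ U := e.symm.finiteDimensional
  obtain ⟨h1, h2⟩ := finrank_cliffordAlgebra Q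
  have h3 : Module.finrank ℝ U = 2 * N := by
    rw [e.finrank_eq, Module.finrank_pi_fintype]
    simp [mul_comm]
  have h4 : Module.finrank ℂ (ℂ ⊗[ℝ] CliffordAlgebra Q) = Module.finrank ℂ (Module.End ℂ V) := by
    rw [Module.finrank_baseChange, h1, h3, Module.finrank_linearMap, S.finrank_eq]
    ring
  have hsurj : Function.Surjective (LinearMap.liftBaseChange ℂ (S.clifford z hz).toLinearMap) := by
    rw [← baseChangeHom_toLinearMap]
    change Function.Surjective (baseChangeHom (S.clifford z hz))
    rw [← AlgHom.range_eq_top, eq_top_iff, ← S.adjoin_eq_top, Algebra.adjoin_le_iff]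
    rintro _ ⟨w, rfl⟩
    obtain ⟨u, rfl⟩ := hbij.2 w
    exact ⟨1 ⊗ₜ CliffordAlgebra.ι Q u, by
      change baseChangeHom _ _ = _
      rw [baseChangeHom_tmul, one_smul, clifford_ι]⟩
  exact ⟨(LinearMap.injective_iff_surjective_of_finrank_eq_finrank h4).2 hsurj, hsurj⟩

/-- Uniqueness of the spinor representation. -/
theorem exists_equiv [FiniteDimensional ℂ V] (S : SpinorModel N V)
    (hz : ∀ u, Q u = -∑ j, ‖z u j‖ ^ 2) (hbij : Function.Bijective z) {W : Type*}
    [AddCommGroup W] [Module ℂ W] (f : CliffordAlgebra Q →ₐ[ℝ] Module.End ℂ W)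
    (hf : Function.Bijective (LinearMap.liftBaseChange ℂ f.toLinearMap :
      ℂ ⊗[ℝ] CliffordAlgebra Q →ₗ[ℂ] Module.End ℂ W)) :
    ∃ T : V ≃ₗ[ℂ] W, ∀ u v, T (S.c (z u) v) = f (CliffordAlgebra.ι Q u) (T v) := by
  have h1 := S.bijective_clifford z hz hbij
  rw [← baseChangeHom_toLinearMap] at h1 hf
  obtain ⟨e₁, he₁⟩ : ∃ e : ℂ ⊗[ℝ] CliffordAlgebra Q ≃ₐ[ℂ] Module.End ℂ V,
      ∀ x, e x = baseChangeHom (S.clifford z hz) x := ⟨AlgEquiv.ofBijective _ h1, fun x => rfl⟩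
  obtain ⟨e₂, he₂⟩ : ∃ e : ℂ ⊗[ℝ] CliffordAlgebra Q ≃ₐ[ℂ] Module.End ℂ W,
      ∀ x, e x = baseChangeHom f x := ⟨AlgEquiv.ofBijective _ hf, fun x => rfl⟩
  obtain ⟨T, hT⟩ := (e₁.symm.trans e₂).eq_linearEquivConjAlgEquiv
  refine ⟨T, fun u v => ?_⟩
  have h2 : e₁ (1 ⊗ₜ CliffordAlgebra.ι Q u) = S.c (z u) := by
    rw [he₁, baseChangeHom_tmul, one_smul, clifford_ι]
  have h3 : e₂ (1 ⊗ₜ CliffordAlgebra.ι Q u) = f (CliffordAlgebra.ι Q u) := by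
    rw [he₂, baseChangeHom_tmul, one_smul]
  have h4 := congrArg (fun φ => φ (S.c (z u)) (T v)) hT
  simp only [AlgEquiv.trans_apply, ← h2, AlgEquiv.symm_apply_apply, h3,
    LinearEquiv.conjAlgEquiv_apply, LinearMap.comp_apply, LinearEquiv.coe_coe,
    LinearEquiv.symm_apply_apply] at h4
  rw [h2] at h4
  exact h4.symm

end Clifford

end SpinorModel

section LeftDeriv

variable {E G F N N' F' : Type*} [NormedAddCommGroup E] [NormedSpace ℝ E]
  [TopologicalSpace G] [ChartedSpace E G] [Group G]
  [NormedAddCommGroup F] [NormedSpace ℝ F] [TopologicalSpace N] [ChartedSpace F N]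
  [NormedAddCommGroup F'] [NormedSpace ℝ F'] [TopologicalSpace N'] [ChartedSpace F' N']

variable (E F') in
/-- The derivative at `1` of `x ↦ f (a x)`. -/
noncomputable def leftDeriv (f : G → N') (a : G) : E →L[ℝ] F' :=
  mfderiv 𝓘(ℝ, E) 𝓘(ℝ, F') (fun x => f (a * x)) 1

variable [LieGroup 𝓘(ℝ, E) ∞ G]

theorem hasMFDerivAt_leftDeriv {f : G → N'} {a : G} (hf : MDifferentiableAt 𝓘(ℝ, E) 𝓘(ℝ, F') f a) :
    HasMFDerivAt 𝓘(ℝ, E) 𝓘(ℝ, F') (fun x => f (a * x)) 1 (leftDeriv E F' f a) := by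
  have h1 : MDifferentiableAt 𝓘(ℝ, E) 𝓘(ℝ, F') f (a * 1) := by rwa [mul_one]
  exact (h1.comp 1 ((contMDiff_mul_left (I := 𝓘(ℝ, E)) (n := ∞) (a := a)).mdifferentiableAt
    (by simp))).hasMFDerivAt

theorem hasMFDerivAt_leftLogDeriv {s : N → G} {z : N}
    (hs : MDifferentiableAt 𝓘(ℝ, F) 𝓘(ℝ, E) s z) :
    HasMFDerivAt 𝓘(ℝ, F) 𝓘(ℝ, E) (fun y => (s z)⁻¹ * s y) z (leftLogDeriv (F := F) E s z) :=
  (((contMDiff_mul_left (I := 𝓘(ℝ, E)) (n := ∞) (a := (s z)⁻¹)).mdifferentiableAt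
    (by simp)).comp z hs).hasMFDerivAt

/-- The chain rule, in left trivialization. -/
theorem HasMFDerivAt.comp_leftLogDeriv {f : G → N'} {s : N → G} {z : N}
    (hf : MDifferentiableAt 𝓘(ℝ, E) 𝓘(ℝ, F') f (s z))
    (hs : MDifferentiableAt 𝓘(ℝ, F) 𝓘(ℝ, E) s z) :
    HasMFDerivAt 𝓘(ℝ, F) 𝓘(ℝ, F') (fun y => f (s y)) z
      ((leftDeriv E F' f (s z)).comp (leftLogDeriv (F := F) E s z)) := by
  have h1 : ∀ k : G, k = 1 → HasMFDerivAt 𝓘(ℝ, E) 𝓘(ℝ, F') (fun x => f (s z * x)) k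
      (leftDeriv E F' f (s z)) := by
    rintro k rfl
    exact hasMFDerivAt_leftDeriv hf
  have h2 := HasMFDerivAt.comp (f := fun y => (s z)⁻¹ * s y) (g := fun x => f (s z * x)) z
    (h1 _ (inv_mul_cancel (s z))) (hasMFDerivAt_leftLogDeriv (F := F) hs)
  refine h2.congr_of_eventuallyEq (Filter.Eventually.of_forall fun y => ?_)
  simp [Function.comp]

end LeftDeriv

namespace LinearOrbit

variable {E G W : Type*} [NormedAddCommGroup E] [NormedSpace ℝ E] [FiniteDimensional ℝ E]
  [TopologicalSpace G] [ChartedSpace E G] [Group G] [LieGroup 𝓘(ℝ, E) ∞ G]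
  [NormedAddCommGroup W] [NormedSpace ℝ W] [FiniteDimensional ℝ W]
  {ρ : G →* (W →L[ℝ] W)} {w : W} [hρ : SmoothRep E ρ]

/-- The group element which defines the chart at `p`. -/
noncomputable def chartElt (p : LinearOrbit E ρ w) : G :=
  (mem_atlas (chart_mem_atlas (OrbitModel E ρ w) p)).choose

theorem chartAt_toPartialEquiv (p : LinearOrbit E ρ w) :
    (chartAt (OrbitModel E ρ w) p).toPartialEquiv = chart (slice E ρ w) (chartElt p) :=
  (mem_atlas (chart_mem_atlas (OrbitModel E ρ w) p)).choose_spec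

/-- The smooth section of the orbit map over the domain of the chart at `p`, in the chart. -/
noncomputable def secCoord (p : LinearOrbit E ρ w) (y : OrbitModel E ρ w) : G :=
  chartElt p * (slice E ρ w).sec y

/-- The smooth section of the orbit map over the domain of the chart at `p`. -/
noncomputable def sec (p z : LinearOrbit E ρ w) : G :=
  secCoord p (chartAt (OrbitModel E ρ w) p z)

theorem chartAt_target (p : LinearOrbit E ρ w) :
    (chartAt (OrbitModel E ρ w) p).target = (slice E ρ w).base := by
  rw [chartAt_toPartialEquiv]; rfl

theorem contMDiffOn_secCoord (p : LinearOrbit E ρ w) :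
    ContMDiffOn 𝓘(ℝ, OrbitModel E ρ w) 𝓘(ℝ, E) ∞ (secCoord p)
      (chartAt (OrbitModel E ρ w) p).target := by
  rw [chartAt_target]
  exact contMDiffOn_mul_sec (slice E ρ w) (chartElt p)

theorem chartAt_symm_eq (p : LinearOrbit E ρ w) (y : OrbitModel E ρ w) :
    (chartAt (OrbitModel E ρ w) p).symm y = mk E ρ w (secCoord p y) := by
  change (chartAt (OrbitModel E ρ w) p).toPartialEquiv.symm y = _
  rw [chartAt_toPartialEquiv]; rfl

theorem mk_sec {p z : LinearOrbit E ρ w} (hz : z ∈ (chartAt (OrbitModel E ρ w) p).source) :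
    mk E ρ w (sec p z) = z := by
  rw [sec, ← chartAt_symm_eq]
  exact (chartAt (OrbitModel E ρ w) p).left_inv hz

theorem mk_sec_self (p : LinearOrbit E ρ w) : mk E ρ w (sec p p) = p :=
  mk_sec (mem_chart_source _ p)

theorem contMDiffAt_sec {p z : LinearOrbit E ρ w}
    (hz : z ∈ (chartAt (OrbitModel E ρ w) p).source) :
    ContMDiffAt 𝓘(ℝ, OrbitModel E ρ w) 𝓘(ℝ, E) ∞ (sec p) z := by
  have h1 : ContMDiffAt 𝓘(ℝ, OrbitModel E ρ w) 𝓘(ℝ, OrbitModel E ρ w) ∞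
      (chartAt (OrbitModel E ρ w) p) z :=
    contMDiffOn_chart.contMDiffAt ((chartAt (OrbitModel E ρ w) p).open_source.mem_nhds hz)
  exact ((contMDiffOn_secCoord p).contMDiffAt ((chartAt (OrbitModel E ρ w) p).open_target.mem_nhds
    ((chartAt (OrbitModel E ρ w) p).map_source hz))).comp z h1

theorem mdifferentiableAt_sec {p z : LinearOrbit E ρ w}
    (hz : z ∈ (chartAt (OrbitModel E ρ w) p).source) :
    MDifferentiableAt 𝓘(ℝ, OrbitModel E ρ w) 𝓘(ℝ, E) (sec p) z :=
  (contMDiffAt_sec hz).mdifferentiableAt (by simp)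

variable (E ρ w) in
/-- The derivative of `x ↦ mk (a x)` at `1`, a map of `𝔤` onto the tangent space at `mk a`. -/
noncomputable def orbitFrame (a : G) : E →L[ℝ] OrbitModel E ρ w :=
  leftDeriv E (OrbitModel E ρ w) (mk E ρ w) a

theorem mdifferentiableAt_mk (a : G) :
    MDifferentiableAt 𝓘(ℝ, E) 𝓘(ℝ, OrbitModel E ρ w) (mk E ρ w) a :=
  contMDiff_mk.mdifferentiableAt (by simp)

theorem hasMFDerivAt_orbitFrame (a : G) :
    HasMFDerivAt 𝓘(ℝ, E) 𝓘(ℝ, OrbitModel E ρ w) (fun x => mk E ρ w (a * x)) 1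
      (orbitFrame E ρ w a) :=
  hasMFDerivAt_leftDeriv (mdifferentiableAt_mk a)

/-- The logarithmic derivative of a section is a right inverse of the frame. -/
theorem orbitFrame_leftLogDeriv {σ : LinearOrbit E ρ w → G} {m : LinearOrbit E ρ w}
    (hσ : MDifferentiableAt 𝓘(ℝ, OrbitModel E ρ w) 𝓘(ℝ, E) σ m)
    (h : ∀ᶠ z in 𝓝 m, mk E ρ w (σ z) = z) (v : OrbitModel E ρ w) :
    orbitFrame E ρ w (σ m) (leftLogDeriv (F := OrbitModel E ρ w) E σ m v) = v := by
  have h1 := HasMFDerivAt.comp_leftLogDeriv (mdifferentiableAt_mk (ρ := ρ) (w := w) (σ m)) hσ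
  have h2 := h1.congr_of_eventuallyEq (f₁ := id) (h.mono fun z hz => hz.symm)
  exact DFunLike.congr_fun (hasMFDerivAt_unique h2 (hasMFDerivAt_id m)) v

theorem orbitFrame_sec {p m : LinearOrbit E ρ w}
    (hm : m ∈ (chartAt (OrbitModel E ρ w) p).source) (v : OrbitModel E ρ w) :
    orbitFrame E ρ w (sec p m) (leftLogDeriv (F := OrbitModel E ρ w) E (sec p) m v) = v :=
  orbitFrame_leftLogDeriv (mdifferentiableAt_sec hm)
    (by filter_upwards [(chartAt (OrbitModel E ρ w) p).open_source.mem_nhds hm] with z hz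
          using mk_sec hz) v

theorem mk_mul_of_stabilizer (a : G) {t : G} (ht : ρ t w = w) : mk E ρ w (a * t) = mk E ρ w a := by
  rw [mk_eq_mk, map_mul, mul_apply_eq_comp, ht]

theorem orbitFrame_mul_stabilizer (a : G) {t : G} (ht : ρ t w = w) (X : E) :
    orbitFrame E ρ w (a * t) X = orbitFrame E ρ w a (AdModel E t X) := by
  have h1 : ∀ k : G, k = 1 → HasMFDerivAt 𝓘(ℝ, E) 𝓘(ℝ, OrbitModel E ρ w)
      (fun x => mk E ρ w (a * x)) k (orbitFrame E ρ w a) := by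
    rintro k rfl
    exact hasMFDerivAt_orbitFrame a
  have h2 := HasMFDerivAt.comp (f := fun x => t * x * t⁻¹) (g := fun x => mk E ρ w (a * x)) 1
    (h1 _ (by simp)) (hasMFDerivAt_conj t)
  have h3 : ((fun x => mk E ρ w (a * x)) ∘ fun x => t * x * t⁻¹) = fun x => mk E ρ w (a * t * x) := by
    funext x
    change mk E ρ w (a * (t * x * t⁻¹)) = _
    rw [← mk_mul_of_stabilizer _ ht]
    congr 1
    group
  rw [h3] at h2
  have h4 : ∀ A B : E →L[ℝ] OrbitModel E ρ w, A = B → A X = B X := by rintro A _ rfl; rfl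
  exact h4 _ _ (hasMFDerivAt_unique (hasMFDerivAt_orbitFrame (a * t)) h2)

theorem hasMFDerivAt_smul_mk (a : G) :
    HasMFDerivAt 𝓘(ℝ, E) 𝓘(ℝ, OrbitModel E ρ w) (fun g : G => g • mk E ρ w a) 1
      ((orbitFrame E ρ w a).comp (AdModel E a⁻¹)) := by
  have h1 : ∀ k : G, k = 1 → HasMFDerivAt 𝓘(ℝ, E) 𝓘(ℝ, OrbitModel E ρ w)
      (fun x => mk E ρ w (a * x)) k (orbitFrame E ρ w a) := by
    rintro k rfl
    exact hasMFDerivAt_orbitFrame a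
  have h2 := HasMFDerivAt.comp (f := fun x => a⁻¹ * x * a⁻¹⁻¹) (g := fun x => mk E ρ w (a * x)) 1
    (h1 _ (by simp)) (hasMFDerivAt_conj a⁻¹)
  refine h2.congr_of_eventuallyEq (Filter.Eventually.of_forall fun g => ?_)
  change g • mk E ρ w a = mk E ρ w (a * (a⁻¹ * g * a⁻¹⁻¹))
  rw [smul_mk]
  congr 1
  group

theorem fundamentalField_mk (a : G) (X : LieAlg E G) :
    (fundamentalField (OrbitModel E ρ w) X (mk E ρ w a) : OrbitModel E ρ w) =
      -orbitFrame E ρ w a (AdModel E a⁻¹ X) := by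
  have h4 : ∀ A B : E →L[ℝ] OrbitModel E ρ w, A = B → ∀ X : E, -A X = -B X := by rintro A _ rfl X; rfl
  exact h4 _ _ (hasMFDerivAt_smul_mk a).mfderiv X

theorem surjective_orbitFrame (a : G) : Function.Surjective (orbitFrame E ρ w a) := by
  intro v
  obtain ⟨X, hX⟩ := surjective_mfderiv_smul (E := E) (mk E ρ w a) v
  have h4 : ∀ A B : E →L[ℝ] OrbitModel E ρ w, A = B → ∀ X : E, A X = B X := by rintro A _ rfl X; rfl
  exact ⟨AdModel E a⁻¹ X, (h4 _ _ (hasMFDerivAt_smul_mk a).mfderiv X).symm.trans hX⟩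

theorem mdifferentiableAt_smul (g : G) (m : LinearOrbit E ρ w) : MDifferentiableAt
    𝓘(ℝ, OrbitModel E ρ w) 𝓘(ℝ, OrbitModel E ρ w) (fun x : LinearOrbit E ρ w => g • x) m :=
  ((contMDiff_smul (I := 𝓘(ℝ, E)) (I' := 𝓘(ℝ, OrbitModel E ρ w)) (n := ∞) (G := G)
      (M := LinearOrbit E ρ w)).comp
    ((contMDiff_const (c := g)).prodMk contMDiff_id)).mdifferentiableAt (by simp)

theorem smulDeriv_orbitFrame (g a : G) (X : E) :
    (smulDeriv (OrbitModel E ρ w) g (mk E ρ w a) (orbitFrame E ρ w a X) : OrbitModel E ρ w) =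
      orbitFrame E ρ w (g * a) X := by
  have h1 : ∀ k : G, k = a → HasMFDerivAt 𝓘(ℝ, OrbitModel E ρ w) 𝓘(ℝ, OrbitModel E ρ w)
      (fun x : LinearOrbit E ρ w => g • x) (mk E ρ w k)
      (smulDeriv (OrbitModel E ρ w) g (mk E ρ w a) : OrbitModel E ρ w →L[ℝ] OrbitModel E ρ w) := by
    rintro k rfl
    exact (mdifferentiableAt_smul g _).hasMFDerivAt
  have h2 := HasMFDerivAt.comp (f := fun x => mk E ρ w (a * x))
    (g := fun x : LinearOrbit E ρ w => g • x) 1 (h1 _ (mul_one a)) (hasMFDerivAt_orbitFrame a)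
  have h3 : ((fun x : LinearOrbit E ρ w => g • x) ∘ fun x => mk E ρ w (a * x)) =
      fun x => mk E ρ w (g * a * x) := by
    funext x
    change g • mk E ρ w (a * x) = _
    rw [smul_mk, mul_assoc]
  rw [h3] at h2
  have h4 : ∀ A B : E →L[ℝ] OrbitModel E ρ w, A = B → A X = B X := by rintro A _ rfl; rfl
  exact (h4 _ _ (hasMFDerivAt_unique (hasMFDerivAt_orbitFrame (g * a)) h2)).symm

/-- The kernel of the frame is contained in the stabilizer algebra. -/
theorem orbitDeriv_eq_zero_of_orbitFrame {a : G} {X : E} (h : orbitFrame E ρ w a X = 0) :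
    orbitDeriv E ρ w X = 0 := by
  obtain ⟨s, hs, hsy⟩ := exists_section (mk E ρ w a)
  have hval : ContMDiffAt 𝓘(ℝ, OrbitModel E ρ w) 𝓘(ℝ, W) ∞
      (fun z : LinearOrbit E ρ w => z.1) (mk E ρ w a) := by
    have h1 : ContMDiffAt 𝓘(ℝ, OrbitModel E ρ w) 𝓘(ℝ, W) ∞ (fun z => ρ (s z) w) (mk E ρ w a) :=
      (hρ.contMDiff.clm_apply contMDiff_const).contMDiffAt.comp _ hs
    refine h1.congr_of_eventuallyEq ?_
    filter_upwards [hsy] with z hz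
    rw [← hz, val_mk, hz]
  have h1 : ∀ k : G, k = a → HasMFDerivAt 𝓘(ℝ, OrbitModel E ρ w) 𝓘(ℝ, W)
      (fun z : LinearOrbit E ρ w => z.1) (mk E ρ w k)
      (mfderiv 𝓘(ℝ, OrbitModel E ρ w) 𝓘(ℝ, W) (fun z : LinearOrbit E ρ w => z.1) (mk E ρ w a) :
        OrbitModel E ρ w →L[ℝ] W) := by
    rintro k rfl
    exact (hval.mdifferentiableAt (by simp)).hasMFDerivAt
  have h2 := HasMFDerivAt.comp (f := fun x => mk E ρ w (a * x))
    (g := fun x : LinearOrbit E ρ w => x.1) 1 (h1 _ (mul_one a)) (hasMFDerivAt_orbitFrame a)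
  have h3 : HasMFDerivAt 𝓘(ℝ, E) 𝓘(ℝ, W) (fun g : G => ρ g w) 1
      (orbitDeriv E ρ w : E →L[ℝ] W) :=
    ((hρ.contMDiff.clm_apply contMDiff_const).mdifferentiableAt (by simp)).hasMFDerivAt
  have h4 : HasMFDerivAt 𝓘(ℝ, W) 𝓘(ℝ, W) (fun x : W => ρ a x) (ρ 1 w) (ρ a) :=
    hasMFDerivAt_iff_hasFDerivAt.2 (ρ a).hasFDerivAt
  have h5 := HasMFDerivAt.comp (f := fun g : G => ρ g w) (g := fun x : W => ρ a x) 1 h4 h3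
  have h6 : ((fun z : LinearOrbit E ρ w => z.1) ∘ fun x => mk E ρ w (a * x)) =
      (fun x : W => ρ a x) ∘ fun g : G => ρ g w := by
    funext x
    change ρ (a * x) w = ρ a (ρ x w)
    rw [map_mul, mul_apply_eq_comp]
  rw [h6] at h2
  have h7 : ∀ (A B : E →L[ℝ] W), A = B → A X = B X := by rintro A _ rfl; rfl
  have h8 : _ = ρ a (orbitDeriv E ρ w X) := h7 _ _ (hasMFDerivAt_unique h2 h5)
  have h9 : ρ a (orbitDeriv E ρ w X) = 0 := by
    refine h8.symm.trans ?_
    refine Eq.trans ?_ ((mfderiv 𝓘(ℝ, OrbitModel E ρ w) 𝓘(ℝ, W)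
      (fun z : LinearOrbit E ρ w => z.1) (mk E ρ w a) : OrbitModel E ρ w →L[ℝ] W).map_zero)
    exact congrArg _ h
  have h10 : ρ a⁻¹ (ρ a (orbitDeriv E ρ w X)) = orbitDeriv E ρ w X := by
    rw [← mul_apply_eq_comp, ← map_mul, inv_mul_cancel, map_one]; rfl
  rw [← h10, h9, map_zero]

/-- The frame vanishes on the velocities of one-parameter subgroups of the stabilizer. -/
theorem orbitFrame_eq_zero_of_curve (a : G) {X : E} {γ : ℝ → G}
    (hγ : IsOneParameterSubgroup (E := E) (G := G) X γ) (h : ∀ s, ρ (γ s) w = w) :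
    orbitFrame E ρ w a X = 0 := by
  have h1 : ∀ k : G, k = 1 → HasMFDerivAt 𝓘(ℝ, E) 𝓘(ℝ, OrbitModel E ρ w)
      (fun x => mk E ρ w (a * x)) k (orbitFrame E ρ w a) := by
    rintro k rfl
    exact hasMFDerivAt_orbitFrame a
  have h2 := HasMFDerivAt.comp (f := γ) (g := fun x => mk E ρ w (a * x)) 0
    (h1 _ hγ.map_zero) hγ.hasMFDerivAt_zero
  have h3 : ((fun x => mk E ρ w (a * x)) ∘ γ) = fun _ => mk E ρ w a := by
    funext s
    exact mk_mul_of_stabilizer a (h s)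
  rw [h3] at h2
  have h4 : ∀ A : ℝ →L[ℝ] OrbitModel E ρ w, A = 0 → A 1 = 0 := by rintro A rfl; rfl
  have h5 : orbitFrame E ρ w a ((1 : ℝ) • X) = 0 :=
    h4 _ (hasMFDerivAt_unique h2 (hasMFDerivAt_const _ _))
  rwa [one_smul] at h5

end LinearOrbit

/-- A representation of a subgroup `H` of a Lie group, given by a function on the whole group whose
values outside of `H` are irrelevant, which agrees near `1` with a smooth function on the group. -/
structure SubgroupRep (E : Type*) {G : Type*} [NormedAddCommGroup E] [NormedSpace ℝ E]
    [TopologicalSpace G] [ChartedSpace E G] [Group G] (H : Subgroup G)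
    (V : Type*) [NormedAddCommGroup V] [NormedSpace ℂ V] where
  toFun : G → V →L[ℂ] V
  map_one : toFun 1 = 1
  map_mul : ∀ a ∈ H, ∀ b ∈ H, toFun (a * b) = toFun a * toFun b
  exists_ext : ∃ Φ : G → V →L[ℂ] V, ContMDiffAt 𝓘(ℝ, E) 𝓘(ℝ, V →L[ℂ] V) ∞ Φ 1 ∧
    ∀ᶠ g in 𝓝 1, g ∈ H → toFun g = Φ g

namespace SubgroupRep

variable {E G : Type*} [NormedAddCommGroup E] [NormedSpace ℝ E] [FiniteDimensional ℝ E]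
  [TopologicalSpace G] [ChartedSpace E G] [Group G] [LieGroup 𝓘(ℝ, E) ∞ G] {H : Subgroup G}
  {V : Type*} [NormedAddCommGroup V] [NormedSpace ℂ V] (τ : SubgroupRep E H V)
  {F N : Type*} [NormedAddCommGroup F] [NormedSpace ℝ F] [TopologicalSpace N]

instance : CoeFun (SubgroupRep E H V) fun _ => G → V →L[ℂ] V := ⟨toFun⟩

theorem mul_apply {a b : G} (ha : a ∈ H) (hb : b ∈ H) (v : V) : τ (a * b) v = τ a (τ b v) := by
  rw [τ.map_mul a ha b hb]; rfl

theorem one_apply (v : V) : τ 1 v = v := by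
  rw [τ.map_one]; rfl

theorem inv_apply_self {a : G} (ha : a ∈ H) (v : V) : τ a⁻¹ (τ a v) = v := by
  rw [← τ.mul_apply (H.inv_mem ha) ha, inv_mul_cancel, τ.one_apply]

theorem apply_inv_self {a : G} (ha : a ∈ H) (v : V) : τ a (τ a⁻¹ v) = v := by
  rw [← τ.mul_apply ha (H.inv_mem ha), mul_inv_cancel, τ.one_apply]

theorem contMDiffAt_comp {n : ℕ∞} {I' : ModelWithCorners ℝ F N} {N' : Type*} [TopologicalSpace N'] [ChartedSpace N N'] {f : N' → G} {x : N'}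
    (hf : ContMDiffAt I' 𝓘(ℝ, E) n f x) (hfH : ∀ᶠ y in 𝓝 x, f y ∈ H) :
    ContMDiffAt I' 𝓘(ℝ, V →L[ℂ] V) n (fun y => τ (f y)) x := by
  obtain ⟨Φ, hΦ, hΦτ⟩ := τ.exists_ext
  have h0 : f x ∈ H := hfH.self_of_nhds
  have h1 : ContMDiffAt I' 𝓘(ℝ, E) n (fun y => (f x)⁻¹ * f y) x := contMDiffAt_const.mul hf
  have h2 : ∀ k : G, k = 1 → ContMDiffAt 𝓘(ℝ, E) 𝓘(ℝ, V →L[ℂ] V) n Φ k := by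
    rintro k rfl
    exact hΦ.of_le (by exact_mod_cast le_top)
  have h3 : ContMDiffAt I' 𝓘(ℝ, V →L[ℂ] V) n (fun y => Φ ((f x)⁻¹ * f y)) x :=
    ContMDiffAt.comp (g := Φ) (f := fun y => (f x)⁻¹ * f y) x (h2 _ (inv_mul_cancel _)) h1
  have h4 : ContMDiffAt I' 𝓘(ℝ, V →L[ℂ] V) n (fun y => τ (f x) * Φ ((f x)⁻¹ * f y)) x := by
    have h5 : ContDiff ℝ n (fun A : V →L[ℂ] V => τ (f x) * A) :=
      ((ContinuousLinearMap.mul ℝ (V →L[ℂ] V)) (τ (f x))).contDiff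
    exact h5.contMDiff.contMDiffAt.comp x h3
  refine h4.congr_of_eventuallyEq ?_
  have h6 : Filter.Tendsto (fun y => (f x)⁻¹ * f y) (𝓝 x) (𝓝 1) := by
    have := h1.continuousAt.tendsto
    rwa [inv_mul_cancel] at this
  filter_upwards [hfH, h6.eventually hΦτ] with y hy h7
  rw [← h7 (H.mul_mem (H.inv_mem h0) hy), ← τ.map_mul _ h0 _ (H.mul_mem (H.inv_mem h0) hy),
    mul_inv_cancel_left]

end SubgroupRep

/-- A complex vector bundle is a real vector bundle. -/
theorem VectorBundle.complexToReal {B V : Type*} {Fib : B → Type*} [NormedAddCommGroup V]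
    [NormedSpace ℂ V] [TopologicalSpace B] [∀ b, AddCommGroup (Fib b)] [∀ b, Module ℂ (Fib b)]
    [∀ b, TopologicalSpace (Fib b)] [TopologicalSpace (TotalSpace V Fib)] [FiberBundle V Fib]
    [h : VectorBundle ℂ V Fib] : VectorBundle ℝ V Fib := by
  have hlin : ∀ (e : Trivialization V (π V Fib)) [MemTrivializationAtlas e], e.IsLinear ℝ := by
    intro e he
    have h1 : e.IsLinear ℂ := h.trivialization_linear' e
    refine ⟨fun b hb => ⟨(h1.linear b hb).map_add, fun c x => ?_⟩⟩
    have := (h1.linear b hb).map_smul (c : ℂ) x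
    simpa using this
  refine ⟨hlin, fun e e' he he' => ?_⟩
  have h1 := h.continuousOn_coordChange' e e'
  have h2 : Continuous (fun A : V →L[ℂ] V => A.restrictScalars ℝ) :=
    (ContinuousLinearMap.restrictScalarsL ℂ V V ℝ ℝ).continuous
  refine (h2.comp_continuousOn h1).congr fun b hb => ?_
  have : e.IsLinear ℂ := h.trivialization_linear' e
  have : e'.IsLinear ℂ := h.trivialization_linear' e'
  have : e.IsLinear ℝ := hlin e
  have : e'.IsLinear ℝ := hlin e'
  refine ContinuousLinearMap.ext fun v => ?_
  refine (Trivialization.coordChangeL_apply' (R := ℝ) e e' hb v).trans ?_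
  exact (Trivialization.coordChangeL_apply' (R := ℂ) e e' hb v).symm

namespace LinearOrbit

variable {E G W : Type*} [NormedAddCommGroup E] [NormedSpace ℝ E] [FiniteDimensional ℝ E]
  [TopologicalSpace G] [ChartedSpace E G] [Group G] [LieGroup 𝓘(ℝ, E) ∞ G]
  [NormedAddCommGroup W] [NormedSpace ℝ W] [FiniteDimensional ℝ W]
  {ρ : G →* (W →L[ℝ] W)} {w : W} [hρ : SmoothRep E ρ] {H : Subgroup G}
  {V : Type} [NormedAddCommGroup V] [NormedSpace ℂ V]

theorem inv_mul_mem (hst : ∀ g, ρ g w = w ↔ g ∈ H) {a b : G} (h : mk E ρ w a = mk E ρ w b) :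
    a⁻¹ * b ∈ H := by
  rw [← hst, map_mul, mul_apply_eq_comp, ← mk_eq_mk.1 h, ← mul_apply_eq_comp, ← map_mul,
    inv_mul_cancel, map_one]
  rfl

/-- The vector bundle over an orbit associated with a representation of the stabilizer. -/
noncomputable def homBundle (hst : ∀ g, ρ g w = w ↔ g ∈ H) (τ : SubgroupRep E H V) :
    VectorBundleCore ℂ (LinearOrbit E ρ w) V (LinearOrbit E ρ w) where
  baseSet p := (chartAt (OrbitModel E ρ w) p).source
  isOpen_baseSet p := (chartAt (OrbitModel E ρ w) p).open_source
  indexAt p := p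
  mem_baseSet_at p := mem_chart_source _ p
  coordChange p q m := τ ((sec q m)⁻¹ * sec p m)
  coordChange_self p m _ v := by rw [inv_mul_cancel, τ.one_apply]
  continuousOn_coordChange p q m hm := by
    refine ContinuousAt.continuousWithinAt ?_
    refine (τ.contMDiffAt_comp (n := 0) (I' := 𝓘(ℝ, OrbitModel E ρ w)) ?_ ?_).continuousAt
    · exact (((contMDiffAt_sec hm.2).inv).mul (contMDiffAt_sec hm.1)).of_le (by simp)
    · filter_upwards [(chartAt (OrbitModel E ρ w) p).open_source.mem_nhds hm.1,
        (chartAt (OrbitModel E ρ w) q).open_source.mem_nhds hm.2] with z hp hq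
      exact inv_mul_mem hst ((mk_sec hq).trans (mk_sec hp).symm)
  coordChange_comp p q r m hm v := by
    rw [← τ.mul_apply (inv_mul_mem hst ((mk_sec hm.2).trans (mk_sec hm.1.2).symm))
      (inv_mul_mem hst ((mk_sec hm.1.2).trans (mk_sec hm.1.1).symm))]
    congr 2
    group

section

variable (hst : ∀ g, ρ g w = w ↔ g ∈ H) (τ : SubgroupRep E H V)

theorem contMDiffAt_coordChange {p q m : LinearOrbit E ρ w} (hst : ∀ g, ρ g w = w ↔ g ∈ H)
    (hp : m ∈ (chartAt (OrbitModel E ρ w) p).source)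
    (hq : m ∈ (chartAt (OrbitModel E ρ w) q).source) :
    ContMDiffAt 𝓘(ℝ, OrbitModel E ρ w) 𝓘(ℝ, V →L[ℂ] V) ∞ (fun m => τ ((sec q m)⁻¹ * sec p m)) m := by
  refine τ.contMDiffAt_comp (((contMDiffAt_sec hq).inv).mul (contMDiffAt_sec hp)) ?_
  filter_upwards [(chartAt (OrbitModel E ρ w) p).open_source.mem_nhds hp,
    (chartAt (OrbitModel E ρ w) q).open_source.mem_nhds hq] with z hp hq
  exact inv_mul_mem hst ((mk_sec hq).trans (mk_sec hp).symm)

instance vectorBundleReal_homBundle : VectorBundle ℝ V (homBundle hst τ).Fiber :=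
  VectorBundle.complexToReal

instance contMDiffVectorBundle_homBundle :
    ContMDiffVectorBundle ∞ V (homBundle hst τ).Fiber 𝓘(ℝ, OrbitModel E ρ w) := by
  constructor
  rintro _ _ ⟨p, rfl⟩ ⟨q, rfl⟩ m hm
  refine ContMDiffAt.contMDiffWithinAt ?_
  have h1 := contMDiffAt_coordChange (p := p) (q := q) τ hst hm.1 hm.2
  have h2 : ContMDiff 𝓘(ℝ, V →L[ℂ] V) 𝓘(ℝ, V →L[ℝ] V) ∞
      (fun A : V →L[ℂ] V => A.restrictScalars ℝ) :=
    (ContinuousLinearMap.restrictScalarsL ℂ V V ℝ ℝ).contMDiff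
  refine (h2.contMDiffAt.comp m h1).congr_of_eventuallyEq ?_
  filter_upwards [(chartAt (OrbitModel E ρ w) p).open_source.mem_nhds hm.1,
    (chartAt (OrbitModel E ρ w) q).open_source.mem_nhds hm.2] with z hp hq
  refine ContinuousLinearMap.ext fun v => ?_
  have hℝ : ∀ p, ((homBundle hst τ).localTriv p).IsLinear ℝ := fun p =>
    @VectorBundle.trivialization_linear' ℝ _ V (homBundle hst τ).Fiber _ _ _ _ _ _ _ _ _ _ _ ⟨⟨p, rfl⟩⟩
  have := hℝ p
  have := hℝ q
  refine (Trivialization.coordChangeL_apply' (R := ℝ) ((homBundle hst τ).localTriv p)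
    ((homBundle hst τ).localTriv q) ⟨hp, hq⟩ v).trans ?_
  have h3 := Trivialization.coordChangeL_apply' (R := ℂ) ((homBundle hst τ).localTriv p)
    ((homBundle hst τ).localTriv q) ⟨hp, hq⟩ v
  exact h3.symm.trans ((homBundle hst τ).localTriv_coordChange_eq p q ⟨hp, hq⟩ v)

/-- The equivariant function on the group which corresponds to a section of the bundle. -/
noncomputable def lift (s : LinearOrbit E ρ w → V) (a : G) : V :=
  τ (a⁻¹ * sec (mk E ρ w a) (mk E ρ w a)) (s (mk E ρ w a))

theorem lift_of_mk (s : LinearOrbit E ρ w → V) {a : G} {m : LinearOrbit E ρ w}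
    (h : mk E ρ w a = m) : lift τ s a = τ (a⁻¹ * sec m m) (s m) := by
  subst h; rfl

theorem lift_sec_self (s : LinearOrbit E ρ w → V) (m : LinearOrbit E ρ w) :
    lift τ s (sec m m) = s m := by
  rw [lift_of_mk τ s (mk_sec_self m), inv_mul_cancel, τ.one_apply]

variable {τ}

theorem inv_mul_sec_mem (hst : ∀ g, ρ g w = w ↔ g ∈ H) {a : G} {m : LinearOrbit E ρ w}
    (h : mk E ρ w a = m) : a⁻¹ * sec m m ∈ H :=
  inv_mul_mem hst (h.trans (mk_sec_self m).symm)

theorem lift_mul (hst : ∀ g, ρ g w = w ↔ g ∈ H) (s : LinearOrbit E ρ w → V) (a : G) {t : G}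
    (ht : t ∈ H) : lift τ s (a * t) = τ t⁻¹ (lift τ s a) := by
  rw [lift_of_mk τ s (mk_mul_of_stabilizer a ((hst t).2 ht)), lift,
    ← τ.mul_apply (H.inv_mem ht) (inv_mul_sec_mem hst rfl), mul_inv_rev, mul_assoc]

theorem lift_eq_of_mk (hst : ∀ g, ρ g w = w ↔ g ∈ H) (s : LinearOrbit E ρ w → V) {a b : G}
    (h : mk E ρ w a = mk E ρ w b) : lift τ s a = τ (a⁻¹ * b) (lift τ s b) := by
  have h1 := lift_mul (τ := τ) hst s b (inv_mul_mem hst h.symm)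
  rw [mul_inv_cancel_left] at h1
  rw [h1, mul_inv_rev, inv_inv]

theorem localTriv_section (hst : ∀ g, ρ g w = w ↔ g ∈ H) (τ : SubgroupRep E H V) (s : LinearOrbit E ρ w → V) {p m : LinearOrbit E ρ w}
    (hm : m ∈ (chartAt (OrbitModel E ρ w) p).source) :
    (((homBundle hst τ).localTriv p) ⟨m, s m⟩).2 = lift τ s (sec p m) := by
  rw [lift_of_mk τ s (mk_sec hm)]
  rfl

theorem smoothSectionAt_iff_sec (s : ∀ m, (homBundle hst τ).Fiber m) (p : LinearOrbit E ρ w) :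
    SmoothSectionAt (OrbitModel E ρ w) V s p ↔
      ContMDiffAt 𝓘(ℝ, OrbitModel E ρ w) 𝓘(ℝ, V) ∞ (fun m => lift τ s (sec p m)) p := by
  refine (contMDiffAt_section (IB := 𝓘(ℝ, OrbitModel E ρ w)) (n := ∞) p).trans ?_
  refine Filter.EventuallyEq.contMDiffAt_iff ?_
  filter_upwards [chart_source_mem_nhds (OrbitModel E ρ w) p] with m hm
  exact localTriv_section (E := E) hst τ s hm

theorem differentiableSectionAt_iff_sec (s : ∀ m, (homBundle hst τ).Fiber m)
    (p : LinearOrbit E ρ w) :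
    DifferentiableSectionAt (OrbitModel E ρ w) V s p ↔
      MDifferentiableAt 𝓘(ℝ, OrbitModel E ρ w) 𝓘(ℝ, V) (fun m => lift τ s (sec p m)) p := by
  refine (mdifferentiableAt_section 𝓘(ℝ, OrbitModel E ρ w) s (b₀ := p)).trans ?_
  refine Filter.EventuallyEq.mdifferentiableAt_iff ?_
  filter_upwards [chart_source_mem_nhds (OrbitModel E ρ w) p] with m hm
  exact localTriv_section (E := E) hst τ s hm

theorem eventually_mk_mem_source (a : G) :
    ∀ᶠ b in 𝓝 a, mk E ρ w b ∈ (chartAt (OrbitModel E ρ w) (mk E ρ w a)).source :=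
  (continuous_mk (E := E) (ρ := ρ) (w := w)).continuousAt.preimage_mem_nhds
    (chart_source_mem_nhds (OrbitModel E ρ w) (mk E ρ w a))

theorem lift_eventuallyEq (hst : ∀ g, ρ g w = w ↔ g ∈ H) (s : LinearOrbit E ρ w → V) (a : G) :
    lift τ s =ᶠ[𝓝 a] fun b => τ (b⁻¹ * sec (mk E ρ w a) (mk E ρ w b))
        (lift τ s (sec (mk E ρ w a) (mk E ρ w b))) := by
  filter_upwards [eventually_mk_mem_source (E := E) (ρ := ρ) (w := w) a] with b hb
  exact lift_eq_of_mk hst s (mk_sec hb).symm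

theorem contMDiffAt_sec_mk (a : G) : ContMDiffAt 𝓘(ℝ, E) 𝓘(ℝ, E) ∞
    (fun b => sec (mk E ρ w a) (mk E ρ w b)) a :=
  ContMDiffAt.comp (g := sec (mk E ρ w a)) (f := mk E ρ w) a
    (contMDiffAt_sec (mem_chart_source _ _)) contMDiff_mk.contMDiffAt

theorem contMDiffAt_transition (hst : ∀ g, ρ g w = w ↔ g ∈ H) (τ : SubgroupRep E H V) (a : G) :
    ContMDiffAt 𝓘(ℝ, E) 𝓘(ℝ, V →L[ℂ] V) ∞
      (fun b => τ (b⁻¹ * sec (mk E ρ w a) (mk E ρ w b))) a := by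
  refine τ.contMDiffAt_comp (contMDiffAt_id.inv.mul (contMDiffAt_sec_mk a)) ?_
  filter_upwards [eventually_mk_mem_source (E := E) (ρ := ρ) (w := w) a] with b hb
  exact inv_mul_mem hst (mk_sec hb).symm

/-- The evaluation of complex linear maps is a smooth real map. -/
theorem contDiff_eval {n : WithTop ℕ∞} : ContDiff ℝ n (fun q : (V →L[ℂ] V) × V => q.1 q.2) := by
  have h : IsBoundedBilinearMap ℂ (fun q : (V →L[ℂ] V) × V => q.1 q.2) :=
    isBoundedBilinearMap_apply
  exact (h.contDiff (n := n)).restrict_scalars ℝ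

theorem contMDiffAt_lift {s : ∀ m, (homBundle hst τ).Fiber m} {a : G}
    (hs : SmoothSectionAt (OrbitModel E ρ w) V s (mk E ρ w a)) :
    ContMDiffAt 𝓘(ℝ, E) 𝓘(ℝ, V) ∞ (lift τ s) a := by
  have h1 : ContMDiffAt 𝓘(ℝ, E) 𝓘(ℝ, V) ∞
      (fun b => lift τ s (sec (mk E ρ w a) (mk E ρ w b))) a :=
    ContMDiffAt.comp (f := mk E ρ w) a ((smoothSectionAt_iff_sec hst s _).1 hs) contMDiff_mk.contMDiffAt
  have h2 := contDiff_eval.contMDiff.contMDiffAt.comp a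
    ((contMDiffAt_transition hst τ a).prodMk_space h1)
  exact h2.congr_of_eventuallyEq (lift_eventuallyEq hst s a)

theorem mdifferentiableAt_lift {s : ∀ m, (homBundle hst τ).Fiber m} {a : G}
    (hs : DifferentiableSectionAt (OrbitModel E ρ w) V s (mk E ρ w a)) :
    MDifferentiableAt 𝓘(ℝ, E) 𝓘(ℝ, V) (lift τ s) a := by
  have h1 : MDifferentiableAt 𝓘(ℝ, E) 𝓘(ℝ, V)
      (fun b => lift τ s (sec (mk E ρ w a) (mk E ρ w b))) a :=
    MDifferentiableAt.comp (f := mk E ρ w) a ((differentiableSectionAt_iff_sec hst s _).1 hs)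
      (mdifferentiableAt_mk a)
  have h2 := MDifferentiableAt.comp (g := fun q : (V →L[ℂ] V) × V => q.1 q.2) a
    (contDiff_eval.contMDiff.contMDiffAt.mdifferentiableAt (n := 1) (by simp))
    (((contMDiffAt_transition hst τ a).mdifferentiableAt (by simp)).prodMk_space h1)
  exact h2.congr_of_eventuallyEq (lift_eventuallyEq hst s a)

/-- The action of the group on the bundle. -/
noncomputable def homAct (hst : ∀ g, ρ g w = w ↔ g ∈ H) (τ : SubgroupRep E H V) (g : G)
    (m : LinearOrbit E ρ w) : V ≃ₗ[ℂ] V where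
  toFun v := τ ((sec (g • m) (g • m))⁻¹ * (g * sec m m)) v
  map_add' := by simp
  map_smul' := by simp
  invFun v := τ ((sec (g • m) (g • m))⁻¹ * (g * sec m m))⁻¹ v
  left_inv v := τ.inv_apply_self (inv_mul_mem hst (by
    rw [mk_sec_self, ← smul_mk, mk_sec_self])) v
  right_inv v := τ.apply_inv_self (inv_mul_mem hst (by
    rw [mk_sec_self, ← smul_mk, mk_sec_self])) v

theorem homAct_apply (g : G) (m : LinearOrbit E ρ w) (v : V) :
    homAct hst τ g m v = τ ((sec (g • m) (g • m))⁻¹ * (g * sec m m)) v := rfl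

theorem lift_translate (hst : ∀ g, ρ g w = w ↔ g ∈ H) (g : G) (s : LinearOrbit E ρ w → V) (a : G) :
    lift τ (fun m => (homAct hst τ g m).symm (s (g • m))) a = lift τ s (g * a) := by
  have h1 : ∀ m, (homAct hst τ g m).symm (s (g • m)) =
      τ ((sec (g • m) (g • m))⁻¹ * (g * sec m m))⁻¹ (s (g • m)) := fun m => rfl
  rw [lift, h1, ← τ.mul_apply (inv_mul_sec_mem hst rfl) (H.inv_mem (inv_mul_mem hst (by
    rw [mk_sec_self, ← smul_mk, mk_sec_self]))), lift_of_mk τ s (smul_mk g a).symm]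
  congr 2
  group

end

end LinearOrbit

section

variable {P F' M V : Type*} {Fib : M → Type*} [NormedAddCommGroup F'] [NormedSpace ℝ F']
  [TopologicalSpace M] [ChartedSpace F' M] [NormedAddCommGroup V] [NormedSpace ℝ V]
  [∀ m, AddCommGroup (Fib m)] [∀ m, Module ℝ (Fib m)] [∀ m, TopologicalSpace (Fib m)]
  [TopologicalSpace (TotalSpace V Fib)] [FiberBundle V Fib] [VectorBundle ℝ V Fib]
  {E' : Type*} [NormedAddCommGroup E'] [NormedSpace ℝ E'] [TopologicalSpace P] [ChartedSpace E' P]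

theorem contMDiff_proj_snd : ContMDiff (𝓘(ℝ, E').prod (𝓘(ℝ, F').prod 𝓘(ℝ, V))) 𝓘(ℝ, F') ∞
    (fun q : P × TotalSpace V Fib => q.2.proj) :=
  (contMDiff_proj Fib).comp contMDiff_snd

theorem contMDiffAt_coord_snd [IsManifold 𝓘(ℝ, F') ∞ M] [ContMDiffVectorBundle ∞ V Fib 𝓘(ℝ, F')]
    (q₀ : P × TotalSpace V Fib) :
    ContMDiffAt (𝓘(ℝ, E').prod (𝓘(ℝ, F').prod 𝓘(ℝ, V))) 𝓘(ℝ, V) ∞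
    (fun q : P × TotalSpace V Fib => (trivializationAt V Fib q₀.2.proj q.2).2) q₀ :=
  ((contMDiffAt_totalSpace (IB := 𝓘(ℝ, F')) (f := fun q : P × TotalSpace V Fib => q.2)).1
    contMDiffAt_snd).2

theorem contMDiffAt_pair_totalSpace [IsManifold 𝓘(ℝ, F') ∞ M]
    [ContMDiffVectorBundle ∞ V Fib 𝓘(ℝ, F')]
    {f : P × TotalSpace V Fib → TotalSpace V Fib} {q₀ : P × TotalSpace V Fib}
    (h1 : ContMDiffAt (𝓘(ℝ, E').prod (𝓘(ℝ, F').prod 𝓘(ℝ, V))) 𝓘(ℝ, F') ∞ (fun q => (f q).proj) q₀)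
    (h2 : ContMDiffAt (𝓘(ℝ, E').prod (𝓘(ℝ, F').prod 𝓘(ℝ, V))) 𝓘(ℝ, V) ∞
      (fun q => (trivializationAt V Fib (f q₀).proj (f q)).2) q₀) :
    ContMDiffAt (𝓘(ℝ, E').prod (𝓘(ℝ, F').prod 𝓘(ℝ, V))) (𝓘(ℝ, F').prod 𝓘(ℝ, V)) ∞ f q₀ :=
  (contMDiffAt_totalSpace (IB := 𝓘(ℝ, F'))).2 ⟨h1, h2⟩

end

namespace LinearOrbit

variable {E G W : Type*} [NormedAddCommGroup E] [NormedSpace ℝ E] [FiniteDimensional ℝ E]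
  [TopologicalSpace G] [ChartedSpace E G] [Group G] [LieGroup 𝓘(ℝ, E) ∞ G]
  [NormedAddCommGroup W] [NormedSpace ℝ W] [FiniteDimensional ℝ W]
  {ρ : G →* (W →L[ℝ] W)} {w : W} [hρ : SmoothRep E ρ] {H : Subgroup G}
  {V : Type} [NormedAddCommGroup V] [NormedSpace ℂ V]

/-- The action of the group on the total space of the bundle. -/
noncomputable def homAction (hst : ∀ g, ρ g w = w ↔ g ∈ H) (τ : SubgroupRep E H V) :
    BundleAction E (OrbitModel E ρ w) G V (homBundle hst τ).Fiber where
  act g m := by exact homAct (V := V) hst τ g m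
  act_one := by
    intro m (v : V)
    have h : ∀ (m' : LinearOrbit E ρ w) (u : V), m' = m → u = τ ((sec m' m')⁻¹ * sec m m) v →
        (⟨m', u⟩ : TotalSpace V (homBundle hst τ).Fiber) = ⟨m, v⟩ := by
      rintro m' u rfl rfl
      exact congrArg (fun x : V => (⟨m', x⟩ : TotalSpace V (homBundle hst τ).Fiber))
        (by rw [inv_mul_cancel, τ.one_apply])
    exact h _ _ (one_smul G m) ((homAct_apply (V := V) hst (τ := τ) 1 m v).trans (by rw [one_mul]))
  act_mul := by
    intro a b m (v : V)
    have h : ∀ (m₁ m₂ : LinearOrbit E ρ w) (u₁ u₂ : V), m₁ = m₂ →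
        u₁ = τ ((sec m₁ m₁)⁻¹ * (a * b * sec m m)) v →
        u₂ = τ ((sec m₂ m₂)⁻¹ * (a * b * sec m m)) v →
        (⟨m₁, u₁⟩ : TotalSpace V (homBundle hst τ).Fiber) = ⟨m₂, u₂⟩ := by
      rintro m₁ m₂ u₁ u₂ rfl rfl rfl
      rfl
    refine h _ _ _ _ (mul_smul a b m) rfl ?_
    change homAct hst τ a (b • m) (homAct hst τ b m v) = _
    rw [homAct_apply, homAct_apply, ← τ.mul_apply]
    · congr 2
      group
    · exact inv_mul_mem hst (by rw [mk_sec_self, ← smul_mk, mk_sec_self])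
    · exact inv_mul_mem hst (by rw [mk_sec_self, ← smul_mk, mk_sec_self])
  contMDiff_act := by
    rintro ⟨g₀, ⟨m₀, v₀⟩⟩
    have hproj : ContMDiff (𝓘(ℝ, E).prod (𝓘(ℝ, OrbitModel E ρ w).prod 𝓘(ℝ, V)))
        𝓘(ℝ, OrbitModel E ρ w) ∞
        (fun q : G × TotalSpace V (homBundle hst τ).Fiber => q.2.proj) :=
      contMDiff_proj_snd
    have hsm : ContMDiff (𝓘(ℝ, E).prod (𝓘(ℝ, OrbitModel E ρ w).prod 𝓘(ℝ, V)))
        𝓘(ℝ, OrbitModel E ρ w) ∞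
        (fun q : G × TotalSpace V (homBundle hst τ).Fiber => q.1 • q.2.proj) :=
      (contMDiff_smul (I := 𝓘(ℝ, E)) (I' := 𝓘(ℝ, OrbitModel E ρ w)) (n := ∞) (G := G)
        (M := LinearOrbit E ρ w)).comp (contMDiff_fst.prodMk hproj)
    have hcoord : ContMDiffAt (𝓘(ℝ, E).prod (𝓘(ℝ, OrbitModel E ρ w).prod 𝓘(ℝ, V))) 𝓘(ℝ, V) ∞
        (fun q : G × TotalSpace V (homBundle hst τ).Fiber =>
          τ ((sec m₀ q.2.proj)⁻¹ * sec q.2.proj q.2.proj) q.2.2) (g₀, ⟨m₀, v₀⟩) :=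
      contMDiffAt_coord_snd (E' := E) (F' := OrbitModel E ρ w) (V := V)
        (Fib := (homBundle hst τ).Fiber) (g₀, ⟨m₀, v₀⟩)
    refine contMDiffAt_pair_totalSpace hsm.contMDiffAt ?_
    have hU : ∀ᶠ q : G × TotalSpace V (homBundle hst τ).Fiber in 𝓝 (g₀, ⟨m₀, v₀⟩),
        q.2.proj ∈ (chartAt (OrbitModel E ρ w) m₀).source :=
      hproj.continuous.continuousAt.preimage_mem_nhds (chart_source_mem_nhds (OrbitModel E ρ w) m₀)
    have hU' : ∀ᶠ q : G × TotalSpace V (homBundle hst τ).Fiber in 𝓝 (g₀, ⟨m₀, v₀⟩),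
        q.1 • q.2.proj ∈ (chartAt (OrbitModel E ρ w) (g₀ • m₀)).source :=
      hsm.continuous.continuousAt.preimage_mem_nhds
        (chart_source_mem_nhds (OrbitModel E ρ w) (g₀ • m₀))
    have htr : ContMDiffAt (𝓘(ℝ, E).prod (𝓘(ℝ, OrbitModel E ρ w).prod 𝓘(ℝ, V))) 𝓘(ℝ, V →L[ℂ] V) ∞
        (fun q : G × TotalSpace V (homBundle hst τ).Fiber =>
          τ ((sec (g₀ • m₀) (q.1 • q.2.proj))⁻¹ * (q.1 * sec m₀ q.2.proj))) (g₀, ⟨m₀, v₀⟩) := by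
      have h1 : ContMDiffAt (𝓘(ℝ, E).prod (𝓘(ℝ, OrbitModel E ρ w).prod 𝓘(ℝ, V))) 𝓘(ℝ, E) ∞
          (fun q : G × TotalSpace V (homBundle hst τ).Fiber => sec (g₀ • m₀) (q.1 • q.2.proj))
          (g₀, ⟨m₀, v₀⟩) :=
        ContMDiffAt.comp (g := sec (g₀ • m₀)) _
            (contMDiffAt_sec (mem_chart_source _ (g₀ • m₀))) hsm.contMDiffAt
      have h2 : ContMDiffAt (𝓘(ℝ, E).prod (𝓘(ℝ, OrbitModel E ρ w).prod 𝓘(ℝ, V))) 𝓘(ℝ, E) ∞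
          (fun q : G × TotalSpace V (homBundle hst τ).Fiber => sec m₀ q.2.proj)
          (g₀, ⟨m₀, v₀⟩) :=
        ContMDiffAt.comp (g := sec m₀) _
            (contMDiffAt_sec (mem_chart_source _ m₀)) hproj.contMDiffAt
      refine τ.contMDiffAt_comp (h1.inv.mul (contMDiffAt_fst.mul h2)) ?_
      filter_upwards [hU, hU'] with q h1 h2
      exact inv_mul_mem hst (by rw [mk_sec h2, ← smul_mk, mk_sec h1])
    have h3 := contDiff_eval.contMDiff.contMDiffAt.comp _ (htr.prodMk_space hcoord)
    refine h3.congr_of_eventuallyEq ?_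
    filter_upwards [hU, hU'] with q h1 h2
    have h4 : ∀ (m : LinearOrbit E ρ w) (v : V), m ∈ (chartAt (OrbitModel E ρ w) m₀).source →
        q.1 • m ∈ (chartAt (OrbitModel E ρ w) (g₀ • m₀)).source →
        τ ((sec (g₀ • m₀) (q.1 • m))⁻¹ * sec (q.1 • m) (q.1 • m)) (homAct hst τ q.1 m v) =
        τ ((sec (g₀ • m₀) (q.1 • m))⁻¹ * (q.1 * sec m₀ m)) (τ ((sec m₀ m)⁻¹ * sec m m) v) := by
      intro m v h1 h2
      rw [homAct_apply, ← τ.mul_apply, ← τ.mul_apply]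
      · congr 2
        group
      · exact inv_mul_mem hst (by rw [mk_sec h2, ← smul_mk, mk_sec h1])
      · exact inv_mul_mem hst (by rw [mk_sec_self, mk_sec h1])
      · exact inv_mul_mem hst (by rw [mk_sec h2, mk_sec_self])
      · exact inv_mul_mem hst (by rw [mk_sec_self, ← smul_mk, mk_sec_self])
    exact h4 q.2.proj q.2.2 h1 h2

end LinearOrbit

/-- A family of complex linear maps depends smoothly on a parameter if its values do. -/
theorem contMDiffAt_clm_of_apply {F H' N V : Type*} [NormedAddCommGroup F] [NormedSpace ℝ F]
    [TopologicalSpace H'] [TopologicalSpace N] [ChartedSpace H' N] {I' : ModelWithCorners ℝ F H'}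
    [NormedAddCommGroup V] [NormedSpace ℂ V] [FiniteDimensional ℂ V] {n : WithTop ℕ∞}
    {A : N → V →L[ℂ] V} {x : N} (h : ∀ v, ContMDiffAt I' 𝓘(ℝ, V) n (fun y => A y v) x) :
    ContMDiffAt I' 𝓘(ℝ, V →L[ℂ] V) n A x := by
  let b := Module.finBasis ℂ V
  let p : Fin (Module.finrank ℂ V) → V →L[ℂ] ℂ := fun i => (b.coord i).toContinuousLinearMap
  have h1 : A = fun y => ∑ i, ((ContinuousLinearMap.smulRightL ℂ V V (p i)).restrictScalars ℝ)
      (A y (b i)) := by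
    funext y
    refine ContinuousLinearMap.ext fun v => ?_
    rw [_root_.sum_apply]
    conv_lhs => rw [← b.sum_repr v]
    rw [map_sum]
    refine Finset.sum_congr rfl fun i _ => ?_
    rw [map_smul]
    rfl
  rw [h1]
  refine ContMDiffAt.sum fun i _ => ?_
  exact ((ContinuousLinearMap.smulRightL ℂ V V (p i)).restrictScalars ℝ).contMDiff.contMDiffAt.comp
    x (h (b i))

theorem ContMDiffAt.complex_smul {F H' N V : Type*} [NormedAddCommGroup F] [NormedSpace ℝ F]
    [TopologicalSpace H'] [TopologicalSpace N] [ChartedSpace H' N] {I' : ModelWithCorners ℝ F H'}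
    [NormedAddCommGroup V] [NormedSpace ℂ V] {n : WithTop ℕ∞} {φ : N → ℂ} {f : N → V} {x : N}
    (hφ : ContMDiffAt I' 𝓘(ℝ, ℂ) n φ x) (hf : ContMDiffAt I' 𝓘(ℝ, V) n f x) :
    ContMDiffAt I' 𝓘(ℝ, V) n (fun y => φ y • f y) x := by
  have h : ContDiff ℝ n (fun q : ℂ × V => q.1 • q.2) :=
    (contDiff_smul (𝕜 := ℂ) (F := V) (n := n)).restrict_scalars ℝ
  exact h.contMDiff.contMDiffAt.comp x (hφ.prodMk_space hf)

namespace TorusData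

variable {E G : Type*} [NormedAddCommGroup E] [NormedSpace ℝ E] [FiniteDimensional ℝ E]
  [TopologicalSpace G] [ChartedSpace E G] [Group G] [LieGroup 𝓘(ℝ, E) ∞ G]

variable {H : Subgroup G} {cartan : Submodule ℝ E} {lam : E →L[ℝ] ℝ} (D : TorusData H cartan lam)

section Shortcuts

noncomputable scoped instance : NormedAddCommGroup (OrbitModel E (coAd E G) lam) := inferInstance

noncomputable scoped instance : NormedSpace ℝ (OrbitModel E (coAd E G) lam) := inferInstance

scoped instance : IsManifold 𝓘(ℝ, OrbitModel E (coAd E G) lam) 1 (LinearOrbit E (coAd E G) lam) :=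
  inferInstance

noncomputable scoped instance (m : LinearOrbit E (coAd E G) lam) :
    TopologicalSpace (TangentSpace 𝓘(ℝ, OrbitModel E (coAd E G) lam) m) := inferInstance

noncomputable scoped instance : TopologicalSpace (TotalSpace (OrbitModel E (coAd E G) lam)
    (TangentSpace 𝓘(ℝ, OrbitModel E (coAd E G) lam) : LinearOrbit E (coAd E G) lam → Type _)) :=
  inferInstance

noncomputable scoped instance (m : LinearOrbit E (coAd E G) lam) :
    AddCommGroup (TangentSpace 𝓘(ℝ, OrbitModel E (coAd E G) lam) m) := inferInstance

noncomputable scoped instance : SMul G (LinearOrbit E (coAd E G) lam) := inferInstance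

noncomputable scoped instance : NormedSpace ℝ (E →L[ℝ] ℝ) := inferInstance

end Shortcuts

theorem orbitDeriv_coAd (X Z : E) :
    orbitDeriv E (coAd E G) lam X Z = -lam (bracketModel G X Z) := by
  have hγ := isOneParameterSubgroup_expCurve (G := G) X
  have h0 : ContMDiff 𝓘(ℝ, E) 𝓘(ℝ, E →L[ℝ] ℝ) ∞ (fun g : G => coAd E G g lam) :=
    (SmoothRep.contMDiff (ρ := coAd E G)).clm_apply contMDiff_const
  have h1 : HasMFDerivAt 𝓘(ℝ, E) 𝓘(ℝ, E →L[ℝ] ℝ) (fun g : G => coAd E G g lam) 1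
      (orbitDeriv E (coAd E G) lam) := (h0.mdifferentiableAt (by simp)).hasMFDerivAt
  have h2 := (hγ.hasDerivAt_comp h1).clm_apply (hasDerivAt_const (0 : ℝ) Z)
  have h3 : HasDerivAt (fun s => (AdModel E (expCurve G X s) : E →L[ℝ] E)) (AdDeriv E G X) (-0) := by
    rw [neg_zero]
    exact hγ.hasDerivAt_comp (hasMFDerivAt_AdModel_one (E := E) (G := G))
  have h4 : HasDerivAt (fun s => (AdModel E (expCurve G X (-s)) : E →L[ℝ] E))
      ((-1 : ℝ) • AdDeriv E G X) 0 := HasDerivAt.scomp (0 : ℝ) h3 (hasDerivAt_neg (0 : ℝ))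
  have h5 : HasDerivAt (fun s => lam (AdModel E (expCurve G X (-s)) Z))
      (lam (((-1 : ℝ) • AdDeriv E G X) Z)) 0 := by
    have h := lam.hasFDerivAt.comp_hasDerivAt (0 : ℝ) (h4.clm_apply (hasDerivAt_const (0 : ℝ) Z))
    rw [map_zero, add_zero] at h
    exact h
  have h6 : (fun s => coAd E G (expCurve G X s) lam Z) =
      fun s => lam (AdModel E (expCurve G X (-s)) Z) := by
    funext s
    rw [hγ.map_neg]; rfl
  rw [h6] at h2
  have h7 := h2.unique h5
  rw [← AdDeriv_apply]
  simpa using h7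

theorem coAd_curve (D : TorusData H cartan lam) {X : E} (hX : X ∈ cartan) {γ : ℝ → G}
    (hγ : IsOneParameterSubgroup (E := E) (G := G) X γ) (s : ℝ) : coAd E G (γ s) lam = lam :=
  (D.stabilizer _).2 (D.curve_mem X hX γ hγ s)

theorem orbitFrame_eq_zero_iff (D : TorusData H cartan lam) (a : G) (X : E) :
    LinearOrbit.orbitFrame E (coAd E G) lam a X = 0 ↔ X ∈ cartan := by
  refine ⟨fun h => (D.lam_bracket X).1 fun Z => ?_, fun h => ?_⟩
  · have h1 := orbitDeriv_coAd (G := G) (lam := lam) X Z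
    rw [LinearOrbit.orbitDeriv_eq_zero_of_orbitFrame h] at h1
    simpa using h1.symm
  · exact LinearOrbit.orbitFrame_eq_zero_of_curve a (isOneParameterSubgroup_expCurve (G := G) X)
      fun s => D.coAd_curve h (isOneParameterSubgroup_expCurve (G := G) X) s

/-- The complex coordinates on `𝔤 / 𝔱`. -/
noncomputable def formMap : E →L[ℝ] (Fin D.N → ℂ) := ContinuousLinearMap.pi D.form

theorem formMap_apply (X : E) (j : Fin D.N) : D.formMap X j = D.form j X := rfl

theorem formMap_eq_zero_iff (X : E) : D.formMap X = 0 ↔ X ∈ cartan := by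
  rw [← D.form_eq_zero_iff, funext_iff]; rfl

theorem exists_coord (a : G) : ∃ κ : OrbitModel E (coAd E G) lam →L[ℝ] (Fin D.N → ℂ),
    ∀ X, κ (LinearOrbit.orbitFrame E (coAd E G) lam a X) = D.formMap X := by
  obtain ⟨r, hr⟩ := LinearMap.exists_rightInverse_of_surjective
    (LinearOrbit.orbitFrame E (coAd E G) lam a : E →ₗ[ℝ] OrbitModel E (coAd E G) lam)
    (LinearMap.range_eq_top.2 (LinearOrbit.surjective_orbitFrame a))
  refine ⟨LinearMap.toContinuousLinearMap ((D.formMap : E →ₗ[ℝ] (Fin D.N → ℂ)).comp r),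
    fun X => ?_⟩
  have h1 := LinearMap.congr_fun hr (LinearOrbit.orbitFrame E (coAd E G) lam a X)
  have h2 : LinearOrbit.orbitFrame E (coAd E G) lam a
      (r (LinearOrbit.orbitFrame E (coAd E G) lam a X) - X) = 0 := by
    rw [map_sub, sub_eq_zero]; exact h1
  rw [D.orbitFrame_eq_zero_iff, ← D.formMap_eq_zero_iff, map_sub, sub_eq_zero] at h2
  exact h2

/-- The complex coordinates on the tangent space at `mk a` of the orbit. -/
noncomputable def coord (a : G) : OrbitModel E (coAd E G) lam →L[ℝ] (Fin D.N → ℂ) :=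
  (D.exists_coord a).choose

theorem coord_orbitFrame (a : G) (X : E) :
    D.coord a (LinearOrbit.orbitFrame E (coAd E G) lam a X) = D.formMap X :=
  (D.exists_coord a).choose_spec X

theorem bijective_coord (a : G) : Function.Bijective (D.coord a) := by
  refine ⟨(injective_iff_map_eq_zero _).2 fun u hu => ?_, fun z => ?_⟩
  · obtain ⟨X, rfl⟩ := LinearOrbit.surjective_orbitFrame a u
    rw [coord_orbitFrame, formMap_eq_zero_iff] at hu
    exact (D.orbitFrame_eq_zero_iff a X).2 hu
  · obtain ⟨Y, hY⟩ := D.form_surjective z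
    exact ⟨_, (D.coord_orbitFrame a Y).trans (funext hY)⟩

theorem coord_smul (g a : G) (u : OrbitModel E (coAd E G) lam) :
    D.coord (g * a) (smulDeriv (OrbitModel E (coAd E G) lam) g (LinearOrbit.mk E (coAd E G) lam a) u :
      OrbitModel E (coAd E G) lam) = D.coord a u := by
  obtain ⟨X, rfl⟩ := LinearOrbit.surjective_orbitFrame a u
  refine (congrArg _ (LinearOrbit.smulDeriv_orbitFrame g a X)).trans ?_
  rw [coord_orbitFrame, coord_orbitFrame]

/-- The extension by `1` of a character of the subgroup to the group. -/
noncomputable def extend (χ : H →* Circle) (g : G) : Circle := by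
  classical exact if h : g ∈ H then χ ⟨g, h⟩ else 1

theorem extend_apply (χ : H →* Circle) {g : G} (h : g ∈ H) : extend χ g = χ ⟨g, h⟩ := dif_pos h

theorem extend_one (χ : H →* Circle) : extend χ 1 = 1 := by
  rw [extend_apply χ H.one_mem]; exact map_one χ

theorem extend_mul (χ : H →* Circle) {a b : G} (ha : a ∈ H) (hb : b ∈ H) :
    extend χ (a * b) = extend χ a * extend χ b := by
  rw [extend_apply χ ha, extend_apply χ hb, extend_apply χ (H.mul_mem ha hb), ← map_mul]; rfl

theorem coord_mul (a : G) {t : G} (ht : t ∈ H) (u : OrbitModel E (coAd E G) lam) (j : Fin D.N) :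
    D.coord a u j = extend (D.char j) t * D.coord (a * t) u j := by
  obtain ⟨X, rfl⟩ := LinearOrbit.surjective_orbitFrame (a * t) u
  rw [coord_orbitFrame, LinearOrbit.orbitFrame_mul_stabilizer a ((D.stabilizer t).2 ht),
    coord_orbitFrame, formMap_apply, formMap_apply, extend_apply _ ht, ← D.form_Ad j ⟨t, ht⟩]

theorem coord_sec {p m : LinearOrbit E (coAd E G) lam}
    (hm : m ∈ (chartAt (OrbitModel E (coAd E G) lam) p).source) (v : OrbitModel E (coAd E G) lam) :
    D.coord (LinearOrbit.sec p m) v =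
      D.formMap (leftLogDeriv (F := OrbitModel E (coAd E G) lam) E (LinearOrbit.sec p) m v) := by
  conv_lhs => rw [← LinearOrbit.orbitFrame_sec hm v]
  rw [coord_orbitFrame]

/-- The character `χ` of the torus has weight `μ`. -/
def IsWeight (χ : H →* Circle) (μ : cartan →ₗ[ℝ] ℝ) : Prop :=
  ∀ (X : cartan) (γ : ℝ → H), IsOneParameterSubgroup (E := E) (G := G) (X : E) (fun s => (γ s : G)) →
    ∀ s : ℝ, (χ (γ s) : ℂ) = Complex.exp (Complex.I * (s * μ X : ℝ))

theorem isWeight_char (j : Fin D.N) : IsWeight (D.char j) (D.root j) := D.char_curve j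

theorem exists_smooth_extension (D : TorusData H cartan lam) {χ : H →* Circle}
    {μ : cartan →ₗ[ℝ] ℝ} (hχ : IsWeight χ μ) :
    ∃ (φ : G → ℂ) (ℓ : E →L[ℝ] ℂ), ContMDiffAt 𝓘(ℝ, E) 𝓘(ℝ, ℂ) ∞ φ 1 ∧
      HasMFDerivAt 𝓘(ℝ, E) 𝓘(ℝ, ℂ) φ 1 ℓ ∧ (∀ X : cartan, ℓ X = Complex.I * (μ X : ℝ)) ∧
      ∀ᶠ g in 𝓝 1, g ∈ H → (extend χ g : ℂ) = φ g := by
  obtain ⟨φ, ℓ, h1, h2, h3, h4⟩ := exists_smooth_extension_character (G := G) D.elt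
    (fun X hX s => D.curve_mem X hX _ (isOneParameterSubgroup_expCurve (G := G) X) s)
    (fun g hg => D.fix g hg _ D.elt_mem) D.centralizer χ μ
    (fun X s => hχ X (fun s => ⟨expCurve G (X : E) s, D.curve_mem X X.2 _
      (isOneParameterSubgroup_expCurve (G := G) (X : E)) s⟩)
      (isOneParameterSubgroup_expCurve (G := G) (X : E)) s)
  refine ⟨φ, ℓ, h1, h2, h3, ?_⟩
  filter_upwards [h4] with g hg h
  rw [extend_apply χ h, hg h]

/-- The one-dimensional representation given by a character. -/
noncomputable def lineRep (D : TorusData H cartan lam) {χ : H →* Circle} {μ : cartan →ₗ[ℝ] ℝ}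
    (hχ : IsWeight χ μ) : SubgroupRep E H ℂ where
  toFun g := (extend χ g : ℂ) • (1 : ℂ →L[ℂ] ℂ)
  map_one := by rw [extend_one]; simp
  map_mul a ha b hb := by
    rw [extend_mul χ ha hb]
    ext
    simp [mul_comm]
  exists_ext := by
    obtain ⟨φ, -, h1, -, -, h2⟩ := D.exists_smooth_extension hχ
    refine ⟨fun g => φ g • (1 : ℂ →L[ℂ] ℂ), h1.complex_smul contMDiffAt_const, ?_⟩
    filter_upwards [h2] with g hg h
    rw [hg h]

theorem lineRep_apply {χ : H →* Circle} {μ : cartan →ₗ[ℝ] ℝ} (hχ : IsWeight χ μ) (g : G) (v : ℂ) :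
    D.lineRep hχ g v = extend χ g * v := rfl

/-- The values of the characters given by the roots. -/
noncomputable def charVec (g : G) (j : Fin D.N) : ℂ := extend (D.char j) g

theorem norm_charVec (g : G) (j : Fin D.N) : ‖D.charVec g j‖ = 1 := Circle.norm_coe _

theorem charVec_one : D.charVec 1 = 1 := by
  funext j
  simp [charVec, extend_one]

theorem charVec_mul {a b : G} (ha : a ∈ H) (hb : b ∈ H) :
    D.charVec (a * b) = D.charVec a * D.charVec b := by
  funext j
  simp [charVec, extend_mul _ ha hb]

theorem coord_mul' (a : G) {t : G} (ht : t ∈ H) (u : OrbitModel E (coAd E G) lam) :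
    D.coord a u = D.charVec t * D.coord (a * t) u := by
  funext j
  rw [D.coord_mul a ht u j]; rfl

variable {V : Type*} [NormedAddCommGroup V] [NormedSpace ℂ V] [FiniteDimensional ℂ V]
  (S : SpinorModel D.N V)

/-- The representation of the torus on the spinors, twisted by a character. -/
noncomputable def spinRep {χ : H →* Circle} {μ : cartan →ₗ[ℝ] ℝ} (hχ : IsWeight χ μ) :
    SubgroupRep E H V where
  toFun g := (extend χ g : ℂ) • LinearMap.toContinuousLinearMap (S.τ (D.charVec g))
  map_one := by
    rw [extend_one, charVec_one, S.τ_one]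
    refine ContinuousLinearMap.ext fun v => ?_
    simp
  map_mul a ha b hb := by
    rw [extend_mul χ ha hb, D.charVec_mul ha hb, S.τ_mul]
    refine ContinuousLinearMap.ext fun v => ?_
    simp [mul_smul, smul_comm (extend χ a : ℂ)]
  exists_ext := by
    obtain ⟨φ, -, h1, -, -, h2⟩ := D.exists_smooth_extension hχ
    have h3 := fun j => D.exists_smooth_extension (D.isWeight_char j)
    choose φ' ℓ' h4 _ _ h5 using h3
    refine ⟨fun g => φ g • LinearMap.toContinuousLinearMap (S.τ (fun j => φ' j g)),
      h1.complex_smul (contMDiffAt_clm_of_apply fun v => ?_), ?_⟩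
    · exact (S.contDiff_τ v).contMDiff.contMDiffAt.comp (1 : G) (contMDiffAt_pi_space.2 h4)
    · filter_upwards [h2, Filter.eventually_all.2 h5] with g hg hg' h
      rw [hg h]
      congr 3
      funext j
      exact hg' j h

theorem spinRep_apply {χ : H →* Circle} {μ : cartan →ₗ[ℝ] ℝ} (hχ : IsWeight χ μ) (g : G) (v : V) :
    D.spinRep S hχ g v = (extend χ g : ℂ) • S.τ (D.charVec g) v := rfl

end TorusData

section

variable {F M F₁ V : Type*} {E₁ Fib : M → Type*} [NormedAddCommGroup F] [NormedSpace ℝ F]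
  [TopologicalSpace M] [ChartedSpace F M]
  [NormedAddCommGroup F₁] [NormedSpace ℝ F₁] [FiniteDimensional ℝ F₁]
  [∀ m, AddCommGroup (E₁ m)] [∀ m, Module ℝ (E₁ m)] [∀ m, TopologicalSpace (E₁ m)]
  [TopologicalSpace (TotalSpace F₁ E₁)] [FiberBundle F₁ E₁] [VectorBundle ℝ F₁ E₁]
  [NormedAddCommGroup V] [NormedSpace ℝ V]
  [∀ m, AddCommGroup (Fib m)] [∀ m, Module ℝ (Fib m)] [∀ m, TopologicalSpace (Fib m)]
  [TopologicalSpace (TotalSpace V Fib)] [FiberBundle V Fib] [VectorBundle ℝ V Fib]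
  [∀ m, IsTopologicalAddGroup (Fib m)] [∀ m, ContinuousSMul ℝ (Fib m)]
  [IsManifold 𝓘(ℝ, F) ∞ M] [ContMDiffVectorBundle ∞ F₁ E₁ 𝓘(ℝ, F)]
  [ContMDiffVectorBundle ∞ V Fib 𝓘(ℝ, F)]

/-- The section with constant coordinates in the trivialization at `m₀`. -/
theorem smoothSectionAt_symmL (m₀ : M) (v : F₁) :
    SmoothSectionAt F F₁ (fun m => (trivializationAt F₁ E₁ m₀).symmL ℝ m v) m₀ := by
  refine (contMDiffAt_section (IB := 𝓘(ℝ, F)) (n := ∞) m₀).2 ?_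
  refine (contMDiffAt_const (c := v)).congr_of_eventuallyEq ?_
  filter_upwards [(trivializationAt F₁ E₁ m₀).open_baseSet.mem_nhds
    (mem_baseSet_trivializationAt F₁ E₁ m₀)] with m hm
  have h := (trivializationAt F₁ E₁ m₀).continuousLinearMapAt_symmL (R := ℝ) hm v
  rw [Trivialization.continuousLinearMapAt_apply, Trivialization.linearMapAt_apply, if_pos hm] at h
  exact h

/-- A family of linear maps between the fibres of two bundles is smooth if it maps smooth sections
to smooth sections. -/
theorem contMDiffAt_hom_of_apply {A : ∀ m, E₁ m →L[ℝ] Fib m} {m₀ : M}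
    (h : ∀ X : ∀ m, E₁ m, SmoothSectionAt F F₁ X m₀ →
      SmoothSectionAt F V (fun m => A m (X m)) m₀) :
    ContMDiffAt 𝓘(ℝ, F) (𝓘(ℝ, F).prod 𝓘(ℝ, F₁ →L[ℝ] V)) ∞
      (fun m => TotalSpace.mk' (F₁ →L[ℝ] V) (E := fun m => E₁ m →L[ℝ] Fib m) m (A m)) m₀ := by
  refine (contMDiffAt_hom_bundle _).2 ⟨contMDiffAt_id, ?_⟩
  have key : ∀ v : F₁, ContMDiffAt 𝓘(ℝ, F) 𝓘(ℝ, V) ∞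
      (fun m => ContinuousLinearMap.inCoordinates F₁ E₁ V Fib m₀ m m₀ m (A m) v) m₀ := by
    intro v
    have h1 := (contMDiffAt_section (IB := 𝓘(ℝ, F)) (n := ∞) m₀).1
      (h _ (smoothSectionAt_symmL (F := F) (E₁ := E₁) m₀ v))
    refine h1.congr_of_eventuallyEq ?_
    filter_upwards [(trivializationAt V Fib m₀).open_baseSet.mem_nhds
      (mem_baseSet_trivializationAt V Fib m₀)] with m hm
    change (trivializationAt V Fib m₀).continuousLinearMapAt ℝ m
      (A m ((trivializationAt F₁ E₁ m₀).symmL ℝ m v)) = _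
    rw [Trivialization.continuousLinearMapAt_apply, Trivialization.linearMapAt_apply, if_pos hm]
  let b := Module.finBasis ℝ F₁
  let p : Fin (Module.finrank ℝ F₁) → F₁ →L[ℝ] ℝ := fun i => (b.coord i).toContinuousLinearMap
  have h1 : ∀ B : F₁ →L[ℝ] V, B = ∑ i, ContinuousLinearMap.smulRightL ℝ F₁ V (p i) (B (b i)) := by
    intro B
    refine ContinuousLinearMap.ext fun v => ?_
    rw [_root_.sum_apply]
    conv_lhs => rw [← b.sum_repr v]
    rw [map_sum]
    refine Finset.sum_congr rfl fun i _ => ?_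
    rw [map_smul]
    rfl
  have h2 : ContMDiffAt 𝓘(ℝ, F) 𝓘(ℝ, F₁ →L[ℝ] V) ∞ (fun m => ∑ i,
      ContinuousLinearMap.smulRightL ℝ F₁ V (p i)
        (ContinuousLinearMap.inCoordinates F₁ E₁ V Fib m₀ m m₀ m (A m) (b i))) m₀ :=
    ContMDiffAt.sum fun i _ =>
      (ContinuousLinearMap.smulRightL ℝ F₁ V (p i)).contMDiff.contMDiffAt.comp m₀ (key (b i))
  exact h2.congr_of_eventuallyEq (Filter.Eventually.of_forall fun m => h1 _)

/-- The coordinates of a smooth vector field in the chart at `m₀`. -/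
theorem SmoothSectionAt.mfderiv_chartAt {X : ∀ m : M, TangentSpace 𝓘(ℝ, F) m} {m₀ : M}
    [IsManifold 𝓘(ℝ, F) 1 M]
    (hX : SmoothSectionAt F F X m₀) : ContMDiffAt 𝓘(ℝ, F) 𝓘(ℝ, F) ∞
      (fun m => (mfderiv 𝓘(ℝ, F) 𝓘(ℝ, F) (chartAt F m₀) m (X m) : F)) m₀ := by
  have h1 := (contMDiffAt_section (IB := 𝓘(ℝ, F)) (n := ∞) m₀).1 hX
  refine h1.congr_of_eventuallyEq ?_
  filter_upwards [chart_source_mem_nhds F m₀] with m hm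
  have h2 := TangentBundle.continuousLinearMapAt_trivializationAt (I := 𝓘(ℝ, F)) hm
  have h3 := DFunLike.congr_fun h2 (X m)
  rw [Trivialization.continuousLinearMapAt_apply, Trivialization.linearMapAt_apply,
    if_pos (by simpa using hm)] at h3
  refine Eq.trans ?_ h3.symm
  have h4 : ∀ f g : M → F, f = g → (mfderiv 𝓘(ℝ, F) 𝓘(ℝ, F) f m : F →L[ℝ] F) (X m) =
      (mfderiv 𝓘(ℝ, F) 𝓘(ℝ, F) g m : F →L[ℝ] F) (X m) := by rintro f _ rfl; rfl
  exact h4 _ _ (by ext; simp)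

end

namespace LinearOrbit

variable {E G W : Type*} [NormedAddCommGroup E] [NormedSpace ℝ E] [FiniteDimensional ℝ E]
  [TopologicalSpace G] [ChartedSpace E G] [Group G] [LieGroup 𝓘(ℝ, E) ∞ G]
  [NormedAddCommGroup W] [NormedSpace ℝ W] [FiniteDimensional ℝ W]
  {ρ : G →* (W →L[ℝ] W)} {w : W} [hρ : SmoothRep E ρ]

theorem leftLogDeriv_sec {p m : LinearOrbit E ρ w}
    (hm : m ∈ (chartAt (OrbitModel E ρ w) p).source) (v : OrbitModel E ρ w) :
    leftLogDeriv (F := OrbitModel E ρ w) E (sec p) m v =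
      leftLogDeriv (F := OrbitModel E ρ w) E (secCoord p) (chartAt (OrbitModel E ρ w) p m)
        (mfderiv 𝓘(ℝ, OrbitModel E ρ w) 𝓘(ℝ, OrbitModel E ρ w) (chartAt (OrbitModel E ρ w) p) m v :
          OrbitModel E ρ w) := by
  have h1 : MDifferentiableAt 𝓘(ℝ, OrbitModel E ρ w) 𝓘(ℝ, E) (secCoord p)
      (chartAt (OrbitModel E ρ w) p m) :=
    ((contMDiffOn_secCoord p).contMDiffAt ((chartAt (OrbitModel E ρ w) p).open_target.mem_nhds
      ((chartAt (OrbitModel E ρ w) p).map_source hm))).mdifferentiableAt (by simp)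
  have h2 := hasMFDerivAt_leftLogDeriv (E := E) h1
  have h3 := (mdifferentiableAt_chartAt p hm).hasMFDerivAt
  have h4 := HasMFDerivAt.comp (f := chartAt (OrbitModel E ρ w) p) m h2 h3
  have h5 := hasMFDerivAt_leftLogDeriv (mdifferentiableAt_sec hm)
  have h6 : ∀ A B : OrbitModel E ρ w →L[ℝ] E, A = B → A v = B v := by rintro A _ rfl; rfl
  exact h6 _ _ (hasMFDerivAt_unique h5 h4)

theorem contMDiffAt_leftLogDeriv_sec
    {X : ∀ m : LinearOrbit E ρ w, TangentSpace 𝓘(ℝ, OrbitModel E ρ w) m} {m₀ : LinearOrbit E ρ w}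
    (hX : SmoothSectionAt (OrbitModel E ρ w) (OrbitModel E ρ w) X m₀) :
    ContMDiffAt 𝓘(ℝ, OrbitModel E ρ w) 𝓘(ℝ, E) ∞
      (fun m => leftLogDeriv (F := OrbitModel E ρ w) E (sec m₀) m (X m)) m₀ := by
  have : CompleteSpace E := FiniteDimensional.complete ℝ E
  have hm₀ := mem_chart_source (OrbitModel E ρ w) m₀
  have h1 := contDiffAt_leftLogDeriv (E := E) (chartAt (OrbitModel E ρ w) m₀).open_target
    (contMDiffOn_secCoord m₀) ((chartAt (OrbitModel E ρ w) m₀).map_source hm₀)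
  have h2 : ContMDiffAt 𝓘(ℝ, OrbitModel E ρ w) 𝓘(ℝ, OrbitModel E ρ w) ∞
      (chartAt (OrbitModel E ρ w) m₀) m₀ :=
    contMDiffOn_chart.contMDiffAt (chart_source_mem_nhds _ m₀)
  have h3 := (h1.contMDiffAt.comp m₀ h2).clm_apply hX.mfderiv_chartAt
  refine h3.congr_of_eventuallyEq ?_
  filter_upwards [chart_source_mem_nhds (OrbitModel E ρ w) m₀] with m hm
  exact leftLogDeriv_sec hm (X m)

end LinearOrbit

/-- The standard scalar product on `ℂ^N`, as a real bilinear form. -/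
noncomputable def realHerm (N : ℕ) : (Fin N → ℂ) →L[ℝ] (Fin N → ℂ) →L[ℝ] ℝ :=
  ∑ j, ((Complex.reCLM.comp (ContinuousLinearMap.proj (R := ℝ) (φ := fun _ : Fin N => ℂ) j)).smulRight
      (Complex.reCLM.comp (ContinuousLinearMap.proj (R := ℝ) (φ := fun _ : Fin N => ℂ) j)) +
    (Complex.imCLM.comp (ContinuousLinearMap.proj (R := ℝ) (φ := fun _ : Fin N => ℂ) j)).smulRight
      (Complex.imCLM.comp (ContinuousLinearMap.proj (R := ℝ) (φ := fun _ : Fin N => ℂ) j)))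

theorem realHerm_apply {N : ℕ} (z w : Fin N → ℂ) :
    realHerm N z w = ∑ j, ((z j).re * (w j).re + (z j).im * (w j).im) := by
  simp [realHerm, _root_.sum_apply]

theorem realHerm_self {N : ℕ} (z : Fin N → ℂ) : realHerm N z z = ∑ j, ‖z j‖ ^ 2 := by
  rw [realHerm_apply]
  refine Finset.sum_congr rfl fun j _ => ?_
  rw [Complex.sq_norm, Complex.normSq_apply]

theorem realHerm_comm {N : ℕ} (z w : Fin N → ℂ) : realHerm N z w = realHerm N w z := by
  simp only [realHerm_apply, mul_comm]

theorem realHerm_mul {N : ℕ} {u : Fin N → ℂ} (hu : ∀ j, ‖u j‖ = 1) (z w : Fin N → ℂ) :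
    realHerm N (u * z) (u * w) = realHerm N z w := by
  rw [realHerm_apply, realHerm_apply]
  refine Finset.sum_congr rfl fun j _ => ?_
  have h : (u j).re * (u j).re + (u j).im * (u j).im = 1 := by
    rw [← Complex.normSq_apply, ← Complex.sq_norm, hu j, one_pow]
  simp only [Pi.mul_apply, Complex.mul_re, Complex.mul_im]
  linear_combination ((z j).re * (w j).re + (z j).im * (w j).im) * h

section

variable {F M F₁ : Type*} {E₁ : M → Type*} [NormedAddCommGroup F] [NormedSpace ℝ F]
  [TopologicalSpace M] [ChartedSpace F M]
  [NormedAddCommGroup F₁] [NormedSpace ℝ F₁] [FiniteDimensional ℝ F₁]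
  [∀ m, AddCommGroup (E₁ m)] [∀ m, Module ℝ (E₁ m)] [∀ m, TopologicalSpace (E₁ m)]
  [TopologicalSpace (TotalSpace F₁ E₁)] [FiberBundle F₁ E₁] [VectorBundle ℝ F₁ E₁]
  [∀ m, IsTopologicalAddGroup (E₁ m)] [∀ m, ContinuousSMul ℝ (E₁ m)]
  [IsManifold 𝓘(ℝ, F) ∞ M] [ContMDiffVectorBundle ∞ F₁ E₁ 𝓘(ℝ, F)]

/-- A family of bilinear forms on the fibres of a bundle is smooth if it maps smooth sections to
smooth functions. -/
theorem contMDiffAt_bilin_of_apply {A : ∀ m, E₁ m →L[ℝ] E₁ m →L[ℝ] ℝ} {m₀ : M}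
    (h : ∀ X Y : ∀ m, E₁ m, SmoothSectionAt F F₁ X m₀ → SmoothSectionAt F F₁ Y m₀ →
      ContMDiffAt 𝓘(ℝ, F) 𝓘(ℝ, ℝ) ∞ (fun m => A m (X m) (Y m)) m₀) :
    ContMDiffAt 𝓘(ℝ, F) (𝓘(ℝ, F).prod 𝓘(ℝ, F₁ →L[ℝ] F₁ →L[ℝ] ℝ)) ∞
      (fun m => TotalSpace.mk' (F₁ →L[ℝ] F₁ →L[ℝ] ℝ)
        (E := fun m => E₁ m →L[ℝ] E₁ m →L[ℝ] ℝ) m (A m)) m₀ := by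
  refine contMDiffAt_hom_of_apply (Fib := fun m => E₁ m →L[ℝ] ℝ) fun X hX => ?_
  refine contMDiffAt_hom_of_apply (Fib := Trivial M ℝ) fun Y hY => ?_
  exact (contMDiffAt_section (IB := 𝓘(ℝ, F)) (n := ∞) m₀).2 (h X Y hX hY)

end

namespace TorusData

variable {E G : Type*} [NormedAddCommGroup E] [NormedSpace ℝ E] [FiniteDimensional ℝ E]
  [TopologicalSpace G] [ChartedSpace E G] [Group G] [LieGroup 𝓘(ℝ, E) ∞ G]
  {H : Subgroup G} {cartan : Submodule ℝ E} {lam : E →L[ℝ] ℝ} (D : TorusData H cartan lam)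

open LinearOrbit

/-- The invariant scalar product on the tangent space at `mk a`. -/
noncomputable def scalar (a : G) :
    OrbitModel E (coAd E G) lam →L[ℝ] OrbitModel E (coAd E G) lam →L[ℝ] ℝ :=
  (realHerm D.N).bilinearComp (D.coord a) (D.coord a)

theorem scalar_apply (a : G) (u v : OrbitModel E (coAd E G) lam) :
    D.scalar a u v = realHerm D.N (D.coord a u) (D.coord a v) := rfl

theorem scalar_self (a : G) (u : OrbitModel E (coAd E G) lam) :
    D.scalar a u u = ∑ j, ‖D.coord a u j‖ ^ 2 := realHerm_self _

theorem scalar_mul (a : G) {t : G} (ht : t ∈ H) : D.scalar (a * t) = D.scalar a := by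
  refine ContinuousLinearMap.ext fun u => ContinuousLinearMap.ext fun v => ?_
  rw [scalar_apply, scalar_apply, D.coord_mul' a ht u, D.coord_mul' a ht v,
    realHerm_mul (D.norm_charVec t)]

theorem scalar_eq_of_mk (D : TorusData H cartan lam) {a b : G}
    (h : LinearOrbit.mk E (coAd E G) lam a = LinearOrbit.mk E (coAd E G) lam b) : D.scalar a = D.scalar b := by
  rw [← D.scalar_mul a (inv_mul_mem D.stabilizer h), mul_inv_cancel_left]

theorem scalar_pos (a : G) {u : OrbitModel E (coAd E G) lam} (hu : u ≠ 0) : 0 < D.scalar a u u := by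
  rw [scalar_self]
  have h1 : ∀ j, 0 ≤ ‖D.coord a u j‖ ^ 2 := fun j => by positivity
  refine lt_of_le_of_ne (Finset.sum_nonneg fun j _ => h1 j) fun h => hu ?_
  have h2 := (Finset.sum_eq_zero_iff_of_nonneg fun j _ => h1 j).1 h.symm
  refine (injective_iff_map_eq_zero _).1 (D.bijective_coord a).1 u (funext fun j => ?_)
  simpa using h2 j (Finset.mem_univ j)

theorem isVonNBounded_scalar (a : G) :
    Bornology.IsVonNBounded ℝ {u : OrbitModel E (coAd E G) lam | D.scalar a u u < 1} := by
  let e : OrbitModel E (coAd E G) lam ≃L[ℝ] (Fin D.N → ℂ) :=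
    (LinearEquiv.ofBijective (D.coord a : OrbitModel E (coAd E G) lam →ₗ[ℝ] (Fin D.N → ℂ))
      (D.bijective_coord a)).toContinuousLinearEquiv
  have h1 : Bornology.IsVonNBounded ℝ (Metric.closedBall (0 : Fin D.N → ℂ) 1) :=
    NormedSpace.isVonNBounded_closedBall ℝ _ 1
  refine (h1.image (e.symm : (Fin D.N → ℂ) →L[ℝ] OrbitModel E (coAd E G) lam)).subset ?_
  intro u hu
  refine ⟨e u, ?_, e.symm_apply_apply u⟩
  rw [mem_closedBall_zero_iff, pi_norm_le_iff_of_nonneg zero_le_one]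
  intro j
  have h2 : ∑ j, ‖D.coord a u j‖ ^ 2 < 1 := by rw [← scalar_self]; exact hu
  have h3 := Finset.single_le_sum (f := fun j => ‖D.coord a u j‖ ^ 2)
    (fun j _ => by positivity) (Finset.mem_univ j)
  have h4 : ‖D.coord a u j‖ ^ 2 ≤ 1 := h3.trans h2.le
  exact (sq_le_one_iff₀ (norm_nonneg _)).1 h4

theorem contMDiffAt_coord_sec (D : TorusData H cartan lam)
    {X : ∀ m : LinearOrbit E (coAd E G) lam, TangentSpace 𝓘(ℝ, OrbitModel E (coAd E G) lam) m}
    {m₀ : LinearOrbit E (coAd E G) lam}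
    (hX : SmoothSectionAt (OrbitModel E (coAd E G) lam) (OrbitModel E (coAd E G) lam) X m₀) :
    ContMDiffAt 𝓘(ℝ, OrbitModel E (coAd E G) lam) 𝓘(ℝ, Fin D.N → ℂ) ∞
      (fun m => D.coord (sec m₀ m) (X m)) m₀ := by
  have h1 := D.formMap.contMDiff.contMDiffAt.comp m₀ (contMDiffAt_leftLogDeriv_sec hX)
  refine h1.congr_of_eventuallyEq ?_
  filter_upwards [chart_source_mem_nhds (OrbitModel E (coAd E G) lam) m₀] with m hm
  exact D.coord_sec hm (X m)

theorem contMDiffAt_scalar (D : TorusData H cartan lam)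
    {X Y : ∀ m : LinearOrbit E (coAd E G) lam, TangentSpace 𝓘(ℝ, OrbitModel E (coAd E G) lam) m}
    {m₀ : LinearOrbit E (coAd E G) lam}
    (hX : SmoothSectionAt (OrbitModel E (coAd E G) lam) (OrbitModel E (coAd E G) lam) X m₀)
    (hY : SmoothSectionAt (OrbitModel E (coAd E G) lam) (OrbitModel E (coAd E G) lam) Y m₀) :
    ContMDiffAt 𝓘(ℝ, OrbitModel E (coAd E G) lam) 𝓘(ℝ, ℝ) ∞
      (fun m => D.scalar (sec m m) (X m) (Y m)) m₀ := by
  have h1 := ((realHerm D.N).contMDiff.contMDiffAt.comp m₀ (D.contMDiffAt_coord_sec hX)).clm_apply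
    (D.contMDiffAt_coord_sec hY)
  refine h1.congr_of_eventuallyEq ?_
  filter_upwards [chart_source_mem_nhds (OrbitModel E (coAd E G) lam) m₀] with m hm
  have h2 : D.scalar (sec m m) = D.scalar (sec m₀ m) :=
    D.scalar_eq_of_mk ((mk_sec_self m).trans (mk_sec hm).symm)
  have h3 : ∀ A B : OrbitModel E (coAd E G) lam →L[ℝ] OrbitModel E (coAd E G) lam →L[ℝ] ℝ,
    A = B → A (X m) (Y m) = B (X m) (Y m) := by rintro A _ rfl; rfl
  exact h3 _ _ h2

/-- The invariant metric on the orbit for which the coordinates are unitary. -/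
noncomputable def metric :
    RiemannianMetricOn (OrbitModel E (coAd E G) lam) (LinearOrbit E (coAd E G) lam) where
  inner m := D.scalar (sec m m)
  symm m u v := realHerm_comm _ _
  pos m u hu := D.scalar_pos (sec m m) hu
  isVonNBounded m := D.isVonNBounded_scalar (sec m m)
  contMDiff := by
    intro m₀
    exact contMDiffAt_bilin_of_apply
      (E₁ := fun m : LinearOrbit E (coAd E G) lam => TangentSpace 𝓘(ℝ, OrbitModel E (coAd E G) lam) m)
      fun X Y hX hY => D.contMDiffAt_scalar hX hY

theorem coord_smul_sec (g : G) (m : LinearOrbit E (coAd E G) lam)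
    (u : TangentSpace 𝓘(ℝ, OrbitModel E (coAd E G) lam) m) :
    D.coord (g * sec m m) (smulDeriv (OrbitModel E (coAd E G) lam) g m u :
      OrbitModel E (coAd E G) lam) = D.coord (sec m m) u := by
  have h : ∀ (a : G), LinearOrbit.mk E (coAd E G) lam a = m → D.coord (g * a)
      (smulDeriv (OrbitModel E (coAd E G) lam) g m u : OrbitModel E (coAd E G) lam) =
      D.coord a u := by
    rintro a rfl
    exact D.coord_smul g a u
  exact h _ (mk_sec_self m)

theorem invariantMetric_metric : InvariantMetric G D.metric := by
  intro g m u v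
  have h1 : D.scalar (sec (g • m) (g • m)) = D.scalar (g * sec m m) :=
    D.scalar_eq_of_mk (by rw [mk_sec_self, ← smul_mk, mk_sec_self])
  have h2 : ∀ (A B : OrbitModel E (coAd E G) lam →L[ℝ] OrbitModel E (coAd E G) lam →L[ℝ] ℝ)
      (u' v' : OrbitModel E (coAd E G) lam), A = B → A u' v' = B u' v' := by rintro A _ _ _ rfl; rfl
  refine (h2 _ _ _ _ h1).trans ?_
  exact congrArg₂ (fun z w => realHerm D.N z w) (D.coord_smul_sec g m u) (D.coord_smul_sec g m v)

end TorusData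

namespace TorusData

variable {E G : Type*} [NormedAddCommGroup E] [NormedSpace ℝ E] [FiniteDimensional ℝ E]
  [TopologicalSpace G] [ChartedSpace E G] [Group G] [LieGroup 𝓘(ℝ, E) ∞ G]
  {H : Subgroup G} {cartan : Submodule ℝ E} {lam : E →L[ℝ] ℝ} (D : TorusData H cartan lam)
  {χ : H →* Circle} {μ : cartan →ₗ[ℝ] ℝ} (hχ : IsWeight χ μ)

open LinearOrbit

theorem inner_lineRep (g : G) (u v : ℂ) :
    inner ℂ (D.lineRep hχ g u) (D.lineRep hχ g v) = inner ℂ u v := by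
  rw [lineRep_apply, lineRep_apply]
  simp only [RCLike.inner_apply, map_mul]
  have h : (extend χ g : ℂ) * starRingEnd ℂ (extend χ g : ℂ) = 1 := by
    rw [Complex.mul_conj, Circle.normSq_coe, Complex.ofReal_one]
  linear_combination (v * (starRingEnd ℂ) u) * h

theorem inner_lift (s t : LinearOrbit E (coAd E G) lam → ℂ) {a : G} {m : LinearOrbit E (coAd E G) lam}
    (h : LinearOrbit.mk E (coAd E G) lam a = m) :
    inner ℂ (lift (D.lineRep hχ) s a) (lift (D.lineRep hχ) t a) = inner ℂ (s m) (t m) := by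
  rw [lift_of_mk _ s h, lift_of_mk _ t h, inner_lineRep]

theorem contDiff_inner_complex {n : WithTop ℕ∞} :
    ContDiff ℝ n (fun q : ℂ × ℂ => (inner ℂ q.1 q.2 : ℂ)) := by
  have h : (fun q : ℂ × ℂ => (inner ℂ q.1 q.2 : ℂ)) = fun q => q.2 * Complex.conjCLE q.1 := by
    funext q
    simp [RCLike.inner_apply]
  rw [h]
  exact contDiff_snd.mul (Complex.conjCLE.contDiff.comp contDiff_fst)

/-- The Hermitian line bundle associated with a character. -/
noncomputable def lineBundle : EquivariantHermitianLineBundle E (OrbitModel E (coAd E G) lam) G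
    (LinearOrbit E (coAd E G) lam) where
  Fiber := (homBundle D.stabilizer (D.lineRep hχ)).Fiber
  normedAddCommGroup _ := inferInstanceAs (NormedAddCommGroup ℂ)
  innerProductSpace _ := inferInstanceAs (InnerProductSpace ℂ ℂ)
  topTotal := (homBundle D.stabilizer (D.lineRep hχ)).toTopologicalSpace
  fiberBundle := (homBundle D.stabilizer (D.lineRep hχ)).fiberBundle
  vectorBundle := (homBundle D.stabilizer (D.lineRep hχ)).vectorBundle
  vectorBundleReal := vectorBundleReal_homBundle D.stabilizer (D.lineRep hχ)
  contMDiffVectorBundle := contMDiffVectorBundle_homBundle D.stabilizer (D.lineRep hχ)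
  smooth_inner s t m₀ hs ht := by
    have h1 := (smoothSectionAt_iff_sec D.stabilizer (τ := D.lineRep hχ) s m₀).1 hs
    have h2 := (smoothSectionAt_iff_sec D.stabilizer (τ := D.lineRep hχ) t m₀).1 ht
    have h3 := contDiff_inner_complex.contMDiff.contMDiffAt.comp m₀ (h1.prodMk_space h2)
    refine h3.congr_of_eventuallyEq ?_
    filter_upwards [chart_source_mem_nhds (OrbitModel E (coAd E G) lam) m₀] with m hm
    exact (D.inner_lift hχ s t (mk_sec hm)).symm
  action := homAction D.stabilizer (D.lineRep hχ)
  inner_act g m s t := D.inner_lineRep hχ _ s t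

noncomputable scoped instance (m : LinearOrbit E (coAd E G) lam) : TopologicalSpace ((D.lineBundle hχ).Fiber m) :=
  inferInstance

noncomputable scoped instance (m : LinearOrbit E (coAd E G) lam) :
    AddCommGroup ((D.lineBundle hχ).Fiber m) := inferInstance

theorem lift_translate_lineBundle (g : G) (s : ∀ m, (D.lineBundle hχ).Fiber m) :
    lift (D.lineRep hχ) ((D.lineBundle hχ).translate g s) =
      fun a => lift (D.lineRep hχ) s (g * a) := by
  funext a
  exact lift_translate D.stabilizer g s a

end TorusData

namespace TorusData

variable {E G : Type*} [NormedAddCommGroup E] [NormedSpace ℝ E] [FiniteDimensional ℝ E]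
  [TopologicalSpace G] [ChartedSpace E G] [Group G] [LieGroup 𝓘(ℝ, E) ∞ G]
  {H : Subgroup G} {cartan : Submodule ℝ E} {lam : E →L[ℝ] ℝ} (D : TorusData H cartan lam)
  {χ : H →* Circle} {μ : cartan →ₗ[ℝ] ℝ} (hχ : IsWeight χ μ)

open LinearOrbit

variable (lam) in
/-- The invariant form `2iλ`. -/
noncomputable def theta : E →L[ℝ] ℂ := (2 * Complex.I) • Complex.ofRealCLM.comp lam

theorem theta_apply (X : E) : theta lam X = 2 * Complex.I * lam X := rfl

theorem lam_Ad (D : TorusData H cartan lam) {t : G} (ht : t ∈ H) (X : E) :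
    lam (AdModel E t X) = lam X := by
  have h1 := (D.stabilizer t).2 ht
  have h2 : (coAd E G t lam) (AdModel E t X) = lam (AdModel E t⁻¹ (AdModel E t X)) := rfl
  rw [h1, AdModel_inv_apply] at h2
  exact h2

/-- The covariant derivative of an equivariant function in the direction of a left invariant
vector field. -/
noncomputable def covLift (f : G → ℂ) (a : G) : E →L[ℝ] ℂ :=
  leftDeriv E ℂ f a + (theta lam).smulRight (f a)

theorem covLift_apply (f : G → ℂ) (a : G) (X : E) :
    covLift (lam := lam) f a X = leftDeriv E ℂ f a X + 2 * Complex.I * lam X * f a := rfl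

theorem hasDerivAt_leftDeriv {f : G → ℂ} {a : G} (hf : MDifferentiableAt 𝓘(ℝ, E) 𝓘(ℝ, ℂ) f a)
    (X : E) : HasDerivAt (fun s => f (a * expCurve G X s)) (leftDeriv E ℂ f a X) 0 :=
  (isOneParameterSubgroup_expCurve (G := G) X).hasDerivAt_comp (hasMFDerivAt_leftDeriv hf)

/-- Derivatives can be computed along one-parameter subgroups. -/
theorem leftDeriv_eq {f : G → ℂ} {a : G} (hf : MDifferentiableAt 𝓘(ℝ, E) 𝓘(ℝ, ℂ) f a) {X : E}
    {c : ℂ} (h : HasDerivAt (fun s => f (a * expCurve G X s)) c 0) : leftDeriv E ℂ f a X = c :=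
  (hasDerivAt_leftDeriv hf X).unique h

theorem covLift_cartan (hμ : ∀ X : cartan, μ X = 2 * lam X) (s : LinearOrbit E (coAd E G) lam → ℂ)
    {a : G} (hf : MDifferentiableAt 𝓘(ℝ, E) 𝓘(ℝ, ℂ) (lift (D.lineRep hχ) s) a) {X : E}
    (hX : X ∈ cartan) : covLift (lam := lam) (lift (D.lineRep hχ) s) a X = 0 := by
  have hγ := isOneParameterSubgroup_expCurve (G := G) X
  have h1 : HasDerivAt (fun r => lift (D.lineRep hχ) s (a * expCurve G X r))
      (-(2 * Complex.I * lam X * lift (D.lineRep hχ) s a)) 0 := by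
    have h2 : (fun r => lift (D.lineRep hχ) s (a * expCurve G X r)) = fun r : ℝ =>
        Complex.exp (-(r * (2 * Complex.I * lam X))) * lift (D.lineRep hχ) s a := by
      funext r
      have hr := D.curve_mem X hX _ hγ r
      rw [lift_mul D.stabilizer s a hr, lineRep_apply, ← hγ.map_neg,
        extend_apply χ (D.curve_mem X hX _ hγ (-r)),
        hχ ⟨X, hX⟩ (fun r => ⟨expCurve G X r, D.curve_mem X hX _ hγ r⟩) hγ (-r), hμ]
      congr 2
      push_cast
      ring
    rw [h2]
    have h3 : HasDerivAt (fun r : ℝ => -((r : ℂ) * (2 * Complex.I * lam X)))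
        (-(1 * (2 * Complex.I * lam X))) 0 :=
      ((Complex.ofRealCLM.hasDerivAt (x := (0 : ℝ))).mul_const _).neg
    have h4 := h3.cexp.mul_const (lift (D.lineRep hχ) s a)
    refine h4.congr_deriv ?_
    simp
  rw [covLift_apply, leftDeriv_eq hf h1]
  ring

theorem covLift_mul (s : LinearOrbit E (coAd E G) lam → ℂ) {a t : G} (ht : t ∈ H)
    (hf : ∀ b, LinearOrbit.mk E (coAd E G) lam b = LinearOrbit.mk E (coAd E G) lam a →
      MDifferentiableAt 𝓘(ℝ, E) 𝓘(ℝ, ℂ) (lift (D.lineRep hχ) s) b) (X : E) :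
    covLift (lam := lam) (lift (D.lineRep hχ) s) (a * t) X =
      D.lineRep hχ t⁻¹ (covLift (lam := lam) (lift (D.lineRep hχ) s) a (AdModel E t X)) := by
  have h1 : ∀ k : G, k = 1 → HasMFDerivAt 𝓘(ℝ, E) 𝓘(ℝ, ℂ)
      (fun x => lift (D.lineRep hχ) s (a * x)) k (leftDeriv E ℂ (lift (D.lineRep hχ) s) a) := by
    rintro k rfl
    exact hasMFDerivAt_leftDeriv (hf a rfl)
  have h2 := HasMFDerivAt.comp (f := fun x => t * x * t⁻¹)
    (g := fun x => lift (D.lineRep hχ) s (a * x)) 1 (h1 _ (by group)) (hasMFDerivAt_conj t)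
  have h3 : HasMFDerivAt 𝓘(ℝ, E) 𝓘(ℝ, ℂ)
      (fun x => (extend χ t⁻¹ : ℂ) * lift (D.lineRep hχ) s (a * (t * x * t⁻¹))) 1
      ((extend χ t⁻¹ : ℂ) • (leftDeriv E ℂ (lift (D.lineRep hχ) s) a).comp (AdModel E t)) := by
    have h4 : ∀ z : ℂ, HasMFDerivAt 𝓘(ℝ, ℂ) 𝓘(ℝ, ℂ) (fun z => (extend χ t⁻¹ : ℂ) * z) z
        ((extend χ t⁻¹ : ℂ) • (1 : ℂ →L[ℝ] ℂ)) := fun z =>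
      hasMFDerivAt_iff_hasFDerivAt.2 (((extend χ t⁻¹ : ℂ) • (1 : ℂ →L[ℝ] ℂ)).hasFDerivAt)
    exact HasMFDerivAt.comp (g := fun z => (extend χ t⁻¹ : ℂ) * z) 1 (h4 _) h2
  have h5 : (fun x => lift (D.lineRep hχ) s (a * t * x)) =
      fun x => (extend χ t⁻¹ : ℂ) * lift (D.lineRep hχ) s (a * (t * x * t⁻¹)) := by
    funext x
    rw [← lineRep_apply D hχ, ← lift_mul D.stabilizer s _ ht]
    congr 1
    group
  rw [← h5] at h3
  have h6 : ∀ A B : E →L[ℝ] ℂ, A = B → A X = B X := by rintro A _ rfl; rfl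
  have h7 : leftDeriv E ℂ (lift (D.lineRep hχ) s) (a * t) X =
      (extend χ t⁻¹ : ℂ) * leftDeriv E ℂ (lift (D.lineRep hχ) s) a (AdModel E t X) :=
    h6 _ _ (hasMFDerivAt_unique (hasMFDerivAt_leftDeriv
    (hf (a * t) (mk_mul_of_stabilizer a ((D.stabilizer t).2 ht)))) h3)
  rw [covLift_apply, h7, lineRep_apply, covLift_apply, D.lam_Ad ht, lift_mul D.stabilizer s a ht,
    lineRep_apply]
  ring

theorem mdifferentiableAt_lift_of_mk {s : ∀ m, (D.lineBundle hχ).Fiber m}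
    {m : LinearOrbit E (coAd E G) lam} (hs : DifferentiableSectionAt (OrbitModel E (coAd E G) lam) ℂ s m)
    {b : G} (hb : LinearOrbit.mk E (coAd E G) lam b = m) :
    MDifferentiableAt 𝓘(ℝ, E) 𝓘(ℝ, ℂ) (lift (D.lineRep hχ) s) b := by
  subst hb
  exact mdifferentiableAt_lift (hst := D.stabilizer) (τ := D.lineRep hχ) hs

/-- The values of the connection. -/
noncomputable def covAt (s : ∀ m, (D.lineBundle hχ).Fiber m) (m : LinearOrbit E (coAd E G) lam) :
    OrbitModel E (coAd E G) lam →L[ℝ] ℂ :=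
  (covLift (lam := lam) (lift (D.lineRep hχ) s) (sec m m)).comp
    (leftLogDeriv (F := OrbitModel E (coAd E G) lam) E (sec m) m)

theorem covAt_eq (hμ : ∀ X : cartan, μ X = 2 * lam X) {s : ∀ m, (D.lineBundle hχ).Fiber m}
    {m : LinearOrbit E (coAd E G) lam} (hs : DifferentiableSectionAt (OrbitModel E (coAd E G) lam) ℂ s m)
    {a : G} (ha : LinearOrbit.mk E (coAd E G) lam a = m) {X : E}
    {v : OrbitModel E (coAd E G) lam} (hv : orbitFrame E (coAd E G) lam a X = v) :
    D.lineRep hχ (a⁻¹ * sec m m) (D.covAt hχ s m v) =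
      covLift (lam := lam) (lift (D.lineRep hχ) s) a X := by
  obtain ⟨t, ht, hat⟩ : ∃ t, t ∈ H ∧ a = sec m m * t :=
    ⟨(sec m m)⁻¹ * a, inv_mul_mem D.stabilizer ((mk_sec_self m).trans ha.symm), by group⟩
  have hd : ∀ b, LinearOrbit.mk E (coAd E G) lam b = LinearOrbit.mk E (coAd E G) lam (sec m m) →
      MDifferentiableAt 𝓘(ℝ, E) 𝓘(ℝ, ℂ) (lift (D.lineRep hχ) s) b := fun b hb =>
    D.mdifferentiableAt_lift_of_mk hχ hs (hb.trans (mk_sec_self m))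
  subst hat
  have h1 : (sec m m * t)⁻¹ * sec m m = t⁻¹ := by group
  rw [h1, D.covLift_mul hχ s ht hd]
  congr 1
  have h2 := orbitFrame_sec (mem_chart_source (OrbitModel E (coAd E G) lam) m) v
  rw [orbitFrame_mul_stabilizer _ ((D.stabilizer t).2 ht)] at hv
  set Y := leftLogDeriv (F := OrbitModel E (coAd E G) lam) E (sec m) m v with hY
  have h3 : Y - AdModel E t X ∈ cartan := by
    rw [← D.orbitFrame_eq_zero_iff (sec m m), map_sub, h2, hv, sub_self]
  have h4 := D.covLift_cartan hχ hμ s (hd _ rfl) h3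
  rw [map_sub, sub_eq_zero] at h4
  exact h4

theorem covAt_eq_self (hμ : ∀ X : cartan, μ X = 2 * lam X) {s : ∀ m, (D.lineBundle hχ).Fiber m}
    {m : LinearOrbit E (coAd E G) lam} (hs : DifferentiableSectionAt (OrbitModel E (coAd E G) lam) ℂ s m)
    {X : E} {v : OrbitModel E (coAd E G) lam} (hv : orbitFrame E (coAd E G) lam (sec m m) X = v) :
    D.covAt hχ s m v = covLift (lam := lam) (lift (D.lineRep hχ) s) (sec m m) X := by
  have h := D.covAt_eq hχ hμ hs (mk_sec_self m) hv
  rwa [inv_mul_cancel, SubgroupRep.one_apply] at h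

end TorusData

set_option synthInstance.maxHeartbeats 400000

namespace TorusData

variable {E G : Type*} [NormedAddCommGroup E] [NormedSpace ℝ E] [FiniteDimensional ℝ E]
  [TopologicalSpace G] [ChartedSpace E G] [Group G] [LieGroup 𝓘(ℝ, E) ∞ G]
  {H : Subgroup G} {cartan : Submodule ℝ E} {lam : E →L[ℝ] ℝ} (D : TorusData H cartan lam)
  {χ : H →* Circle} {μ : cartan →ₗ[ℝ] ℝ} (hχ : IsWeight χ μ)

open LinearOrbit

theorem hasDerivAt_comp_mk {V : Type*} [NormedAddCommGroup V] [NormedSpace ℝ V]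
    {f : LinearOrbit E (coAd E G) lam → V} {m : LinearOrbit E (coAd E G) lam}
    {f' : OrbitModel E (coAd E G) lam →L[ℝ] V}
    (hf : HasMFDerivAt 𝓘(ℝ, OrbitModel E (coAd E G) lam) 𝓘(ℝ, V) f m f') {a : G}
    (ha : LinearOrbit.mk E (coAd E G) lam a = m) (X : E) :
    HasDerivAt (fun r => f (LinearOrbit.mk E (coAd E G) lam (a * expCurve G X r)))
      (f' (orbitFrame E (coAd E G) lam a X)) 0 := by
  have h1 : ∀ k, k = m → HasMFDerivAt 𝓘(ℝ, OrbitModel E (coAd E G) lam) 𝓘(ℝ, V) f k f' := by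
    rintro k rfl
    exact hf
  have h2 := HasMFDerivAt.comp (f := fun x => LinearOrbit.mk E (coAd E G) lam (a * x)) 1
    (h1 _ (by rw [mul_one, ha])) (hasMFDerivAt_orbitFrame a)
  exact (isOneParameterSubgroup_expCurve (G := G) X).hasDerivAt_comp h2

theorem lift_add (s t : LinearOrbit E (coAd E G) lam → ℂ) (a : G) :
    lift (D.lineRep hχ) (fun m => s m + t m) a =
      lift (D.lineRep hχ) s a + lift (D.lineRep hχ) t a :=
  map_add (D.lineRep hχ _) _ _

theorem lift_fun_mul (f s : LinearOrbit E (coAd E G) lam → ℂ) (a : G) :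
    lift (D.lineRep hχ) (fun m => f m * s m) a =
      f (LinearOrbit.mk E (coAd E G) lam a) * lift (D.lineRep hχ) s a :=
  map_smul (D.lineRep hχ _) _ _

theorem covAt_add {s t : ∀ m, (D.lineBundle hχ).Fiber m} {m : LinearOrbit E (coAd E G) lam}
    (hs : DifferentiableSectionAt (OrbitModel E (coAd E G) lam) ℂ s m)
    (ht : DifferentiableSectionAt (OrbitModel E (coAd E G) lam) ℂ t m)
    (v : OrbitModel E (coAd E G) lam) :
    D.covAt hχ (s + t) m v = D.covAt hχ s m v + D.covAt hχ t m v := by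
  have h1 := D.mdifferentiableAt_lift_of_mk hχ hs (mk_sec_self m)
  have h2 := D.mdifferentiableAt_lift_of_mk hχ ht (mk_sec_self m)
  have h4 : lift (D.lineRep hχ) (s + t) = lift (D.lineRep hχ) s + lift (D.lineRep hχ) t :=
    funext (D.lift_add hχ s t)
  have h3 : ∀ X, covLift (lam := lam) (lift (D.lineRep hχ) (s + t)) (sec m m) X =
      covLift (lam := lam) (lift (D.lineRep hχ) s) (sec m m) X +
        covLift (lam := lam) (lift (D.lineRep hχ) t) (sec m m) X := by
    intro X
    have h5 : leftDeriv E ℂ (lift (D.lineRep hχ) s + lift (D.lineRep hχ) t) (sec m m) X =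
        leftDeriv E ℂ (lift (D.lineRep hχ) s) (sec m m) X +
          leftDeriv E ℂ (lift (D.lineRep hχ) t) (sec m m) X :=
      leftDeriv_eq (h1.add h2) ((hasDerivAt_leftDeriv h1 X).add (hasDerivAt_leftDeriv h2 X))
    rw [h4, covLift_apply, h5, covLift_apply, covLift_apply, Pi.add_apply]
    ring
  exact h3 _

theorem covAt_smul {s : ∀ m, (D.lineBundle hχ).Fiber m} {f : LinearOrbit E (coAd E G) lam → ℝ}
    {m : LinearOrbit E (coAd E G) lam}
    (hs : DifferentiableSectionAt (OrbitModel E (coAd E G) lam) ℂ s m)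
    {f' : OrbitModel E (coAd E G) lam →L[ℝ] ℝ}
    (hf : HasMFDerivAt 𝓘(ℝ, OrbitModel E (coAd E G) lam) 𝓘(ℝ, ℝ) f m f')
    (v : OrbitModel E (coAd E G) lam) {c : ℂ} (hc : s m = c) :
    D.covAt hχ (f • s) m v = (f m : ℂ) * D.covAt hχ s m v + (f' v : ℂ) * c := by
  have h1 := D.mdifferentiableAt_lift_of_mk hχ hs (mk_sec_self m)
  set X := leftLogDeriv (F := OrbitModel E (coAd E G) lam) E (sec m) m v with hX
  have h4 : lift (D.lineRep hχ) (f • s) = fun a =>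
      (f (LinearOrbit.mk E (coAd E G) lam a) : ℂ) * lift (D.lineRep hχ) s a :=
    funext (D.lift_fun_mul hχ (fun m => (f m : ℂ)) s)
  have h6 := ((hasDerivAt_comp_mk hf (mk_sec_self m) X).ofReal_comp).mul
    (hasDerivAt_leftDeriv h1 X)
  have h7 : orbitFrame E (coAd E G) lam (sec m m) X = v :=
    orbitFrame_sec (mem_chart_source (OrbitModel E (coAd E G) lam) m) v
  have h9 : MDifferentiableAt 𝓘(ℝ, E) 𝓘(ℝ, ℂ) (fun a =>
      (f (LinearOrbit.mk E (coAd E G) lam a) : ℂ) * lift (D.lineRep hχ) s a) (sec m m) := by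
    have h10 : MDifferentiableAt 𝓘(ℝ, E) 𝓘(ℝ, ℝ)
        (fun a => f (LinearOrbit.mk E (coAd E G) lam a)) (sec m m) :=
      MDifferentiableAt.comp (f := LinearOrbit.mk E (coAd E G) lam) (sec m m)
        (by rw [mk_sec_self]; exact hf.mdifferentiableAt) (mdifferentiableAt_mk _)
    have h11 : MDifferentiableAt 𝓘(ℝ, E) 𝓘(ℝ, ℂ)
        (fun a => (f (LinearOrbit.mk E (coAd E G) lam a) : ℂ)) (sec m m) :=
      MDifferentiableAt.comp (g := fun r : ℝ => (r : ℂ)) (sec m m)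
        ((Complex.ofRealCLM.contMDiff (n := 1)).mdifferentiableAt (by simp)) h10
    have h12 : ContDiff ℝ 1 (fun q : ℂ × ℂ => q.1 * q.2) := contDiff_mul
    exact MDifferentiableAt.comp (g := fun q : ℂ × ℂ => q.1 * q.2) (sec m m)
      (h12.contMDiff.mdifferentiableAt (by simp)) (h11.prodMk_space h1)
  have h5 := leftDeriv_eq h9 h6
  have hc' : lift (D.lineRep hχ) s (sec m m) = c := (lift_sec_self _ s m).trans hc
  change covLift (lam := lam) (lift (D.lineRep hχ) (f • s)) (sec m m) X = _ *
    covLift (lam := lam) (lift (D.lineRep hχ) s) (sec m m) X + _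
  rw [h4, covLift_apply, h5, covLift_apply, h7,
    (isOneParameterSubgroup_expCurve (G := G) X).map_zero, mul_one, mk_sec_self, hc']
  ring

/-- The connection on the line bundle, as a covariant derivative. -/
noncomputable def cov :
    CovariantDerivative 𝓘(ℝ, OrbitModel E (coAd E G) lam) ℂ (D.lineBundle hχ).Fiber where
  toFun s m := D.covAt hχ s m
  isCovariantDerivativeOnUniv :=
    { add := by
        intro s t m hs ht _
        exact ContinuousLinearMap.ext fun v => D.covAt_add hχ hs ht v
      leibniz := by
        intro s f m hs hf _
        refine ContinuousLinearMap.ext fun v => (D.covAt_smul hχ hs hf.hasMFDerivAt v rfl).trans ?_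
        rfl }

end TorusData

section

variable {F M V : Type*} [NormedAddCommGroup F] [NormedSpace ℝ F]
  [TopologicalSpace M] [ChartedSpace F M] [IsManifold 𝓘(ℝ, F) ∞ M] [IsManifold 𝓘(ℝ, F) 1 M]
  [NormedAddCommGroup V] [NormedSpace ℝ V]

variable (F) in
/-- The derivative of a function on a manifold, as a linear map between the model spaces. -/
noncomputable def modelDeriv (f : M → V) (m : M) : F →L[ℝ] V := mfderiv 𝓘(ℝ, F) 𝓘(ℝ, V) f m

/-- The derivative of a function in terms of its expression in a chart. -/
theorem modelDeriv_eq_fderiv_chart {f : M → V} {m₀ m : M} (hm : m ∈ (chartAt F m₀).source)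
    (hf : MDifferentiableAt 𝓘(ℝ, F) 𝓘(ℝ, V) f m) (v : TangentSpace 𝓘(ℝ, F) m) :
    modelDeriv F f m v =
      fderiv ℝ (fun y => f ((chartAt F m₀).symm y)) (chartAt F m₀ m)
        (mfderiv 𝓘(ℝ, F) 𝓘(ℝ, F) (chartAt F m₀) m v : F) := by
  have h0 := (chartAt F m₀).map_source hm
  have h1 : MDifferentiableAt 𝓘(ℝ, F) 𝓘(ℝ, V) (fun y => f ((chartAt F m₀).symm y))
      (chartAt F m₀ m) :=
    MDifferentiableAt.comp (f := (chartAt F m₀).symm) _ (by rwa [(chartAt F m₀).left_inv hm])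
      (mdifferentiableAt_chartAt_symm m₀ h0)
  have h2 : HasMFDerivAt 𝓘(ℝ, F) 𝓘(ℝ, V) (fun y => f ((chartAt F m₀).symm y))
      (chartAt F m₀ m) (fderiv ℝ (fun y => f ((chartAt F m₀).symm y)) (chartAt F m₀ m)) :=
    hasMFDerivAt_iff_hasFDerivAt.2 (mdifferentiableAt_iff_differentiableAt.1 h1).hasFDerivAt
  have h3 := HasMFDerivAt.comp (f := chartAt F m₀) m h2
    (mdifferentiableAt_chartAt m₀ hm).hasMFDerivAt
  have h4 := h3.congr_of_eventuallyEq (f₁ := f) (by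
    filter_upwards [(chartAt F m₀).open_source.mem_nhds hm] with z hz
    exact congrArg f ((chartAt F m₀).left_inv hz).symm)
  have h6 : ∀ A B : F →L[ℝ] V, A = B → A v = B v := by rintro A _ rfl; rfl
  exact h6 _ _ (hasMFDerivAt_unique hf.hasMFDerivAt h4)

theorem ContMDiffAt.modelDeriv_apply {f : M → V} {m₀ : M}
    (hf : ContMDiffAt 𝓘(ℝ, F) 𝓘(ℝ, V) ∞ f m₀) {X : ∀ m : M, TangentSpace 𝓘(ℝ, F) m}
    (hX : SmoothSectionAt F F X m₀) : ContMDiffAt 𝓘(ℝ, F) 𝓘(ℝ, V) ∞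
      (fun m => modelDeriv F f m (X m)) m₀ := by
  have hm₀ := mem_chart_source F m₀
  have h0 := (chartAt F m₀).map_source hm₀
  have h1 : ContDiffAt ℝ ∞ (fun y => f ((chartAt F m₀).symm y)) (chartAt F m₀ m₀) := by
    refine ContMDiffAt.contDiffAt ?_
    exact ContMDiffAt.comp (f := (chartAt F m₀).symm) _ (by rwa [(chartAt F m₀).left_inv hm₀])
      (contMDiffOn_chart_symm.contMDiffAt ((chartAt F m₀).open_target.mem_nhds h0))
  have h2 : ContDiffAt ℝ ∞ (fderiv ℝ (fun y => f ((chartAt F m₀).symm y))) (chartAt F m₀ m₀) :=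
    h1.fderiv_right (by simp)
  have h3 : ContMDiffAt 𝓘(ℝ, F) 𝓘(ℝ, F) ∞ (chartAt F m₀) m₀ :=
    contMDiffOn_chart.contMDiffAt (chart_source_mem_nhds _ m₀)
  have h4 := (h2.contMDiffAt.comp m₀ h3).clm_apply hX.mfderiv_chartAt
  refine h4.congr_of_eventuallyEq ?_
  have h5 : ∀ᶠ m in 𝓝 m₀, ContMDiffAt 𝓘(ℝ, F) 𝓘(ℝ, V) 1 f m :=
    (contMDiffAt_iff_contMDiffAt_nhds (by simp)).1 (hf.of_le (by norm_cast))
  filter_upwards [chart_source_mem_nhds F m₀, h5] with m hm hfm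
  exact modelDeriv_eq_fderiv_chart hm (hfm.mdifferentiableAt (by simp)) (X m)

theorem contMDiffCovariantDerivative_of_apply [FiniteDimensional ℝ F] {Fib : M → Type*}
    [∀ m, AddCommGroup (Fib m)] [∀ m, Module ℝ (Fib m)] [∀ m, TopologicalSpace (Fib m)]
    [TopologicalSpace (TotalSpace V Fib)] [FiberBundle V Fib] [VectorBundle ℝ V Fib]
    [∀ m, IsTopologicalAddGroup (Fib m)] [∀ m, ContinuousSMul ℝ (Fib m)]
    [ContMDiffVectorBundle ∞ V Fib 𝓘(ℝ, F)]
    (cov : CovariantDerivative 𝓘(ℝ, F) V Fib)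
    (h : ∀ (s : ∀ m, Fib m) (X : ∀ m : M, TangentSpace 𝓘(ℝ, F) m) (m₀ : M),
      (∀ m, SmoothSectionAt F V s m) → SmoothSectionAt F F X m₀ →
      SmoothSectionAt F V (fun m => cov s m (X m)) m₀) :
    CovariantDerivative.ContMDiffCovariantDerivative cov ∞ where
  contMDiff :=
    { contMDiff := by
        intro s hs m₀ _
        have hs' : ∀ m, SmoothSectionAt F V s m := fun m =>
          (hs.contMDiffAt Filter.univ_mem).of_le (by simp)
        exact (contMDiffAt_hom_of_apply
          (E₁ := fun m : M => TangentSpace 𝓘(ℝ, F) m) (A := fun m => cov s m)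
          fun X hX => h s X m₀ hs' hX).contMDiffWithinAt }

end


namespace TorusData

variable {E G : Type*} [NormedAddCommGroup E] [NormedSpace ℝ E] [FiniteDimensional ℝ E]
  [TopologicalSpace G] [ChartedSpace E G] [Group G] [LieGroup 𝓘(ℝ, E) ∞ G]
  {H : Subgroup G} {cartan : Submodule ℝ E} {lam : E →L[ℝ] ℝ} (D : TorusData H cartan lam)
  {χ : H →* Circle} {μ : cartan →ₗ[ℝ] ℝ} (hχ : IsWeight χ μ)

open LinearOrbit

theorem lift_covAt_sec (hμ : ∀ X : cartan, μ X = 2 * lam X) {s : ∀ m, (D.lineBundle hχ).Fiber m}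
    {m₀ m : LinearOrbit E (coAd E G) lam}
    (hm : m ∈ (chartAt (OrbitModel E (coAd E G) lam) m₀).source)
    (hs : DifferentiableSectionAt (OrbitModel E (coAd E G) lam) ℂ s m)
    (v : LinearOrbit E (coAd E G) lam → OrbitModel E (coAd E G) lam) :
    lift (D.lineRep hχ) (fun m => D.covAt hχ s m (v m)) (sec m₀ m) =
      modelDeriv (OrbitModel E (coAd E G) lam) (fun m => lift (D.lineRep hχ) s (sec m₀ m)) m (v m) +
      2 * Complex.I *
        lam (leftLogDeriv (F := OrbitModel E (coAd E G) lam) E (sec m₀) m (v m)) *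
        lift (D.lineRep hχ) s (sec m₀ m) := by
  rw [lift_of_mk _ _ (mk_sec hm), D.covAt_eq hχ hμ hs (mk_sec hm) (orbitFrame_sec hm (v m)),
    covLift_apply]
  congr 1
  have h1 := HasMFDerivAt.comp_leftLogDeriv (D.mdifferentiableAt_lift_of_mk hχ hs (mk_sec hm))
    (mdifferentiableAt_sec hm)
  have h6 : ∀ A B : OrbitModel E (coAd E G) lam →L[ℝ] ℂ, A = B → A (v m) = B (v m) := by
    rintro A _ rfl; rfl
  exact (h6 _ _ h1.mfderiv).symm

theorem smoothSectionAt_covAt (hμ : ∀ X : cartan, μ X = 2 * lam X)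
    {s : ∀ m, (D.lineBundle hχ).Fiber m} {m₀ : LinearOrbit E (coAd E G) lam}
    (hs : ∀ m, SmoothSectionAt (OrbitModel E (coAd E G) lam) ℂ s m)
    {X : ∀ m : LinearOrbit E (coAd E G) lam, TangentSpace 𝓘(ℝ, OrbitModel E (coAd E G) lam) m}
    (hX : SmoothSectionAt (OrbitModel E (coAd E G) lam) (OrbitModel E (coAd E G) lam) X m₀) :
    SmoothSectionAt (OrbitModel E (coAd E G) lam) ℂ (V := (D.lineBundle hχ).Fiber)
      (fun m => D.covAt hχ s m (X m)) m₀ := by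
  refine (smoothSectionAt_iff_sec D.stabilizer (τ := D.lineRep hχ) _ m₀).2 ?_
  have h1 := (smoothSectionAt_iff_sec D.stabilizer (τ := D.lineRep hχ) s m₀).1 (hs m₀)
  have h2 := h1.modelDeriv_apply hX
  have h3 := (theta lam).contMDiff.contMDiffAt.comp m₀ (contMDiffAt_leftLogDeriv_sec hX)
  have h4 := h2.add (h3.complex_smul h1)
  refine h4.congr_of_eventuallyEq ?_
  filter_upwards [chart_source_mem_nhds (OrbitModel E (coAd E G) lam) m₀] with m hm
  exact D.lift_covAt_sec hχ hμ hm ((hs m).mdifferentiableAt (by simp)) X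

theorem contMDiffCovariantDerivative_cov (hμ : ∀ X : cartan, μ X = 2 * lam X) :
    CovariantDerivative.ContMDiffCovariantDerivative (D.cov hχ) ∞ :=
  contMDiffCovariantDerivative_of_apply _ fun _ _ _ hs hX => D.smoothSectionAt_covAt hχ hμ hs hX

end TorusData

namespace TorusData

variable {E G : Type*} [NormedAddCommGroup E] [NormedSpace ℝ E] [FiniteDimensional ℝ E]
  [TopologicalSpace G] [ChartedSpace E G] [Group G] [LieGroup 𝓘(ℝ, E) ∞ G]
  {H : Subgroup G} {cartan : Submodule ℝ E} {lam : E →L[ℝ] ℝ} (D : TorusData H cartan lam)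
  {χ : H →* Circle} {μ : cartan →ₗ[ℝ] ℝ} (hχ : IsWeight χ μ)

open LinearOrbit

theorem covAt_I_smul {s : ∀ m, (D.lineBundle hχ).Fiber m} {m : LinearOrbit E (coAd E G) lam}
    (hs : DifferentiableSectionAt (OrbitModel E (coAd E G) lam) ℂ s m)
    (v : OrbitModel E (coAd E G) lam) :
    D.covAt hχ (fun m => Complex.I • s m) m v = Complex.I * D.covAt hχ s m v := by
  have h1 := D.mdifferentiableAt_lift_of_mk hχ hs (mk_sec_self m)
  have h4 : lift (D.lineRep hχ) (fun m => Complex.I • s m) =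
      fun a => Complex.I * lift (D.lineRep hχ) s a :=
    funext (D.lift_fun_mul hχ (fun _ => Complex.I) s)
  have h3 : ∀ X, covLift (lam := lam) (lift (D.lineRep hχ) (fun m => Complex.I • s m)) (sec m m) X =
      Complex.I * covLift (lam := lam) (lift (D.lineRep hχ) s) (sec m m) X := by
    intro X
    have h9 : MDifferentiableAt 𝓘(ℝ, E) 𝓘(ℝ, ℂ)
        (fun a => Complex.I * lift (D.lineRep hχ) s a) (sec m m) :=
      MDifferentiableAt.comp (g := fun z : ℂ => Complex.I * z) (sec m m)
        (((contDiff_const.mul contDiff_id : ContDiff ℝ 1 (fun z : ℂ => Complex.I * z)).contMDiff).mdifferentiableAt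
          (by simp)) h1
    have h5 := leftDeriv_eq h9 ((hasDerivAt_leftDeriv h1 X).const_mul Complex.I)
    rw [h4, covLift_apply, h5, covLift_apply]
    ring
  exact h3 _

theorem hermitian_covAt {s t : ∀ m, (D.lineBundle hχ).Fiber m} {m : LinearOrbit E (coAd E G) lam}
    (hs : DifferentiableSectionAt (OrbitModel E (coAd E G) lam) ℂ s m)
    (ht : DifferentiableSectionAt (OrbitModel E (coAd E G) lam) ℂ t m)
    (v : OrbitModel E (coAd E G) lam) {z w : ℂ} (hz : s m = z) (hw : t m = w) :
    modelDeriv (OrbitModel E (coAd E G) lam) (fun m => (inner ℂ (s m) (t m) : ℂ)) m v =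
      inner ℂ (D.covAt hχ s m v) w + inner ℂ z (D.covAt hχ t m v) := by
  have h1 := D.mdifferentiableAt_lift_of_mk hχ hs (mk_sec_self m)
  have h2 := D.mdifferentiableAt_lift_of_mk hχ ht (mk_sec_self m)
  have hs' := (differentiableSectionAt_iff_sec D.stabilizer (τ := D.lineRep hχ) s m).1 hs
  have ht' := (differentiableSectionAt_iff_sec D.stabilizer (τ := D.lineRep hχ) t m).1 ht
  have hd : MDifferentiableAt 𝓘(ℝ, OrbitModel E (coAd E G) lam) 𝓘(ℝ, ℂ)
      (fun m => (inner ℂ (s m) (t m) : ℂ)) m := by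
    have h3 := MDifferentiableAt.comp (g := fun q : ℂ × ℂ => (inner ℂ q.1 q.2 : ℂ)) m
      (contDiff_inner_complex.contMDiff.mdifferentiableAt (n := 1) (by simp)) (hs'.prodMk_space ht')
    refine h3.congr_of_eventuallyEq ?_
    filter_upwards [chart_source_mem_nhds (OrbitModel E (coAd E G) lam) m] with x hx
    exact (D.inner_lift hχ s t (mk_sec hx)).symm
  set X := leftLogDeriv (F := OrbitModel E (coAd E G) lam) E (sec m) m v with hX
  have h7 : orbitFrame E (coAd E G) lam (sec m m) X = v :=
    orbitFrame_sec (mem_chart_source (OrbitModel E (coAd E G) lam) m) v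
  have h4 := hasDerivAt_comp_mk (f' := modelDeriv (OrbitModel E (coAd E G) lam)
    (fun m => (inner ℂ (s m) (t m) : ℂ)) m) hd.hasMFDerivAt (mk_sec_self m) X
  have h5 : (fun r => (inner ℂ (s (LinearOrbit.mk E (coAd E G) lam (sec m m * expCurve G X r)))
      (t (LinearOrbit.mk E (coAd E G) lam (sec m m * expCurve G X r))) : ℂ)) = fun r =>
      inner ℂ (lift (D.lineRep hχ) s (sec m m * expCurve G X r))
        (lift (D.lineRep hχ) t (sec m m * expCurve G X r)) := by
    funext r
    exact (D.inner_lift hχ s t rfl).symm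
  rw [h5, h7] at h4
  have h6 := h4.unique ((hasDerivAt_leftDeriv h1 X).inner ℂ (hasDerivAt_leftDeriv h2 X))
  rw [h6, (isOneParameterSubgroup_expCurve (G := G) X).map_zero, mul_one]
  have hz' : lift (D.lineRep hχ) s (sec m m) = z := (lift_sec_self _ s m).trans hz
  have hw' : lift (D.lineRep hχ) t (sec m m) = w := (lift_sec_self _ t m).trans hw
  change _ = inner ℂ (covLift (lam := lam) (lift (D.lineRep hχ) s) (sec m m) X) w +
    inner ℂ z (covLift (lam := lam) (lift (D.lineRep hχ) t) (sec m m) X)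
  rw [covLift_apply, covLift_apply, hz', hw']
  simp only [RCLike.inner_apply, map_add, map_mul, Complex.conj_I, Complex.conj_ofReal, map_ofNat]
  ring

theorem differentiableSectionAt_translate (g : G) {s : ∀ m, (D.lineBundle hχ).Fiber m}
    {m : LinearOrbit E (coAd E G) lam}
    (hs : DifferentiableSectionAt (OrbitModel E (coAd E G) lam) ℂ s (g • m)) :
    DifferentiableSectionAt (OrbitModel E (coAd E G) lam) ℂ ((D.lineBundle hχ).translate g s) m := by
  refine (differentiableSectionAt_iff_sec D.stabilizer (τ := D.lineRep hχ) _ m).2 ?_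
  rw [lift_translate_lineBundle]
  have h1 : MDifferentiableAt 𝓘(ℝ, OrbitModel E (coAd E G) lam) 𝓘(ℝ, E) (fun x => g * sec m x) m :=
    MDifferentiableAt.comp (g := fun x : G => g * x) m
      ((contMDiff_mul_left (I := 𝓘(ℝ, E)) (n := ∞) (a := g)).mdifferentiableAt (by simp))
      (mdifferentiableAt_sec (mem_chart_source _ m))
  exact MDifferentiableAt.comp (g := lift (D.lineRep hχ) s) m
    (D.mdifferentiableAt_lift_of_mk hχ hs (by rw [← smul_mk, mk_sec_self])) h1

theorem covLift_translate (f : G → ℂ) (g a : G) :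
    covLift (lam := lam) (fun x => f (g * x)) a = covLift (lam := lam) f (g * a) := by
  have h1 : ∀ f₁ f₂ : G → ℂ, f₁ = f₂ → (mfderiv 𝓘(ℝ, E) 𝓘(ℝ, ℂ) f₁ 1 : E →L[ℝ] ℂ) =
      mfderiv 𝓘(ℝ, E) 𝓘(ℝ, ℂ) f₂ 1 := by rintro f₁ _ rfl; rfl
  have h2 : leftDeriv E ℂ (fun x => f (g * x)) a = leftDeriv E ℂ f (g * a) :=
    h1 _ _ (by funext x; rw [mul_assoc])
  rw [covLift, h2]; rfl

theorem invariant_covAt (hμ : ∀ X : cartan, μ X = 2 * lam X) (g : G)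
    {s : ∀ m, (D.lineBundle hχ).Fiber m} {m : LinearOrbit E (coAd E G) lam}
    (hs : DifferentiableSectionAt (OrbitModel E (coAd E G) lam) ℂ s (g • m))
    (v : OrbitModel E (coAd E G) lam) :
    D.covAt hχ ((D.lineBundle hχ).translate g s) m v =
      (homAct D.stabilizer (D.lineRep hχ) g m).symm (D.covAt hχ s (g • m)
        (smulDeriv (OrbitModel E (coAd E G) lam) g m v : OrbitModel E (coAd E G) lam)) := by
  obtain ⟨X, hX⟩ := surjective_orbitFrame (ρ := coAd E G) (w := lam) (sec m m) v
  have hm : LinearOrbit.mk E (coAd E G) lam (g * sec m m) = g • m := by rw [← smul_mk, mk_sec_self]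
  have h1 : orbitFrame E (coAd E G) lam (g * sec m m) X =
      (smulDeriv (OrbitModel E (coAd E G) lam) g m v : OrbitModel E (coAd E G) lam) := by
    have h2 : ∀ a, LinearOrbit.mk E (coAd E G) lam a = m → orbitFrame E (coAd E G) lam (g * a) X =
      (smulDeriv (OrbitModel E (coAd E G) lam) g m (orbitFrame E (coAd E G) lam a X) :
        OrbitModel E (coAd E G) lam) := by
      rintro a rfl
      exact (smulDeriv_orbitFrame g a X).symm
    rw [h2 _ (mk_sec_self m), hX]
  rw [D.covAt_eq_self hχ hμ (D.differentiableSectionAt_translate hχ g hs) hX,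
    lift_translate_lineBundle, covLift_translate, ← D.covAt_eq hχ hμ hs hm h1]
  change _ = D.lineRep hχ ((sec (g • m) (g • m))⁻¹ * (g * sec m m))⁻¹ _
  congr 2
  group

theorem kostant_covAt (hμ : ∀ X : cartan, μ X = 2 * lam X) (X : E)
    {s : ∀ m, (D.lineBundle hχ).Fiber m} {m : LinearOrbit E (coAd E G) lam}
    (hs : DifferentiableSectionAt (OrbitModel E (coAd E G) lam) ℂ s m) {c : ℂ} (hc : s m = c) :
    -modelDeriv E (fun g : G => (lift (D.lineRep hχ) s (g * sec m m) : ℂ)) 1 X -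
      D.covAt hχ s m (fundamentalField (E := E) (G := G) (OrbitModel E (coAd E G) lam) X m :
        OrbitModel E (coAd E G) lam) = (Complex.I * ((2 : ℝ) * m.1 X : ℝ)) * c := by
  obtain ⟨a, ha⟩ : ∃ a, a = sec m m := ⟨_, rfl⟩
  have hm : LinearOrbit.mk E (coAd E G) lam a = m := by rw [ha, mk_sec_self]
  have h1 := D.mdifferentiableAt_lift_of_mk hχ hs hm
  have h2 : HasMFDerivAt 𝓘(ℝ, E) 𝓘(ℝ, ℂ) (fun g : G => lift (D.lineRep hχ) s (g * a)) 1
      ((leftDeriv E ℂ (lift (D.lineRep hχ) s) a).comp (AdModel E a⁻¹)) := by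
    have h3 : ∀ k : G, k = 1 → HasMFDerivAt 𝓘(ℝ, E) 𝓘(ℝ, ℂ)
        (fun x => lift (D.lineRep hχ) s (a * x)) k (leftDeriv E ℂ (lift (D.lineRep hχ) s) a) := by
      rintro k rfl
      exact hasMFDerivAt_leftDeriv h1
    have h4 := HasMFDerivAt.comp (f := fun x => a⁻¹ * x * a⁻¹⁻¹)
      (g := fun x => lift (D.lineRep hχ) s (a * x)) 1 (h3 _ (by group)) (hasMFDerivAt_conj a⁻¹)
    have h5 : (fun g : G => lift (D.lineRep hχ) s (g * a)) =
        fun g => lift (D.lineRep hχ) s (a * (a⁻¹ * g * a⁻¹⁻¹)) := by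
      funext g
      congr 1
      group
    rw [h5]
    exact h4
  have h3 : ∀ A B : E →L[ℝ] ℂ, A = B → A X = B X := by rintro A _ rfl; rfl
  have h4 : modelDeriv E (fun g : G => (lift (D.lineRep hχ) s (g * a) : ℂ)) 1 X =
      leftDeriv E ℂ (lift (D.lineRep hχ) s) a (AdModel E a⁻¹ X) := h3 _ _ h2.mfderiv
  have h5 : orbitFrame E (coAd E G) lam a (-(AdModel E a⁻¹ X)) =
      (fundamentalField (E := E) (G := G) (OrbitModel E (coAd E G) lam) X m :
        OrbitModel E (coAd E G) lam) := by
    subst hm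
    rw [map_neg]
    exact (fundamentalField_mk a (X : LieAlg E G)).symm
  have h6 : m.1 X = lam (AdModel E a⁻¹ X) := by
    rw [← hm]; rfl
  have h7 : lift (D.lineRep hχ) s a = c := by
    rw [ha]; exact (lift_sec_self _ s m).trans hc
  have h8 := D.covAt_eq_self hχ hμ hs ((congrArg (fun b => orbitFrame E (coAd E G) lam b _) ha.symm).trans h5)
  rw [← ha, covLift_apply, map_neg, map_neg] at h8
  rw [← ha, h6]
  refine (congrArg₂ (fun x y : ℂ => -x - y) h4 h8).trans ?_
  rw [h7]
  push_cast
  ring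

end TorusData

/-- The curvature of the connection `d + Θ ∘ A` on a trivial line bundle over a normed space. -/
theorem curvature_trivial {F E : Type*} [NormedAddCommGroup F] [NormedSpace ℝ F]
    [NormedAddCommGroup E] [NormedSpace ℝ E] {f gV gW : F → ℂ} {A : F → F →L[ℝ] E}
    (Θ : E →L[ℝ] ℂ) {V W : F → F} {z : F} (hf : ContDiffAt ℝ 2 f z)
    (hA : DifferentiableAt ℝ A z) (hV : DifferentiableAt ℝ V z) (hW : DifferentiableAt ℝ W z)
    (hgV : gV =ᶠ[𝓝 z] fun y => fderiv ℝ f y (V y) + Θ (A y (V y)) * f y)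
    (hgW : gW =ᶠ[𝓝 z] fun y => fderiv ℝ f y (W y) + Θ (A y (W y)) * f y) :
    (fderiv ℝ gW z (V z) + Θ (A z (V z)) * gW z) - (fderiv ℝ gV z (W z) + Θ (A z (W z)) * gV z) -
      (fderiv ℝ f z (fderiv ℝ W z (V z) - fderiv ℝ V z (W z)) +
        Θ (A z (fderiv ℝ W z (V z) - fderiv ℝ V z (W z))) * f z) =
      Θ (fderiv ℝ A z (V z) (W z) - fderiv ℝ A z (W z) (V z)) * f z := by
  have key : ∀ {g : F → ℂ} {U : F → F}, DifferentiableAt ℝ U z →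
      (g =ᶠ[𝓝 z] fun y => fderiv ℝ f y (U y) + Θ (A y (U y)) * f y) → ∀ v,
      fderiv ℝ g z v = fderiv ℝ (fderiv ℝ f) z v (U z) + fderiv ℝ f z (fderiv ℝ U z v) +
        (Θ (fderiv ℝ A z v (U z)) + Θ (A z (fderiv ℝ U z v))) * f z +
        Θ (A z (U z)) * fderiv ℝ f z v := by
    intro g U hU hg v
    have h1 : HasFDerivAt (fderiv ℝ f) (fderiv ℝ (fderiv ℝ f) z) z :=
      ((hf.fderiv_right (m := 1) (by norm_num)).differentiableAt (by simp)).hasFDerivAt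
    have h2 : HasFDerivAt f (fderiv ℝ f z) z := (hf.differentiableAt (by simp)).hasFDerivAt
    have h3 := Θ.hasFDerivAt.comp z (hA.hasFDerivAt.clm_apply hU.hasFDerivAt)
    have h4 := (h1.clm_apply hU.hasFDerivAt).add (h3.mul h2)
    rw [(h4.congr_of_eventuallyEq hg).fderiv]
    simp
    ring
  have hsym : IsSymmSndFDerivAt ℝ f z := hf.isSymmSndFDerivAt (by simp)
  rw [key hW hgW, key hV hgV, hgV.self_of_nhds, hgW.self_of_nhds, hsym.eq (V z) (W z)]
  simp only [map_sub]
  ring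

namespace TorusData

variable {E G : Type*} [NormedAddCommGroup E] [NormedSpace ℝ E] [FiniteDimensional ℝ E]
  [TopologicalSpace G] [ChartedSpace E G] [Group G] [LieGroup 𝓘(ℝ, E) ∞ G]
  {H : Subgroup G} {cartan : Submodule ℝ E} {lam : E →L[ℝ] ℝ} (D : TorusData H cartan lam)
  {χ : H →* Circle} {μ : cartan →ₗ[ℝ] ℝ} (hχ : IsWeight χ μ)

open LinearOrbit

theorem lift_covAt_secCoord (hμ : ∀ X : cartan, μ X = 2 * lam X)
    {s : ∀ m, (D.lineBundle hχ).Fiber m} {m₀ : LinearOrbit E (coAd E G) lam}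
    (hs : ∀ m ∈ (chartAt (OrbitModel E (coAd E G) lam) m₀).source,
      DifferentiableSectionAt (OrbitModel E (coAd E G) lam) ℂ s m)
    (v : LinearOrbit E (coAd E G) lam → OrbitModel E (coAd E G) lam)
    {y : OrbitModel E (coAd E G) lam}
    (hy : y ∈ (chartAt (OrbitModel E (coAd E G) lam) m₀).target)
    {v' : OrbitModel E (coAd E G) lam}
    (hv : (mfderiv 𝓘(ℝ, OrbitModel E (coAd E G) lam) 𝓘(ℝ, OrbitModel E (coAd E G) lam)
      (chartAt (OrbitModel E (coAd E G) lam) m₀)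
        ((chartAt (OrbitModel E (coAd E G) lam) m₀).symm y)
        (v ((chartAt (OrbitModel E (coAd E G) lam) m₀).symm y)) :
        OrbitModel E (coAd E G) lam) = v') :
    lift (D.lineRep hχ) (fun m => D.covAt hχ s m (v m)) (secCoord m₀ y) =
      fderiv ℝ (fun y => lift (D.lineRep hχ) s (secCoord m₀ y)) y v' +
      theta lam (leftLogDeriv (F := OrbitModel E (coAd E G) lam) E (secCoord m₀) y v') *
        lift (D.lineRep hχ) s (secCoord m₀ y) := by
  set c := chartAt (OrbitModel E (coAd E G) lam) m₀ with hc
  have hm := c.map_target hy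
  have hcy := c.right_inv hy
  obtain ⟨m, hmy⟩ : ∃ m, c.symm y = m := ⟨_, rfl⟩
  rw [hmy] at hm hv hcy
  have h0 : sec m₀ m = secCoord m₀ y := by rw [sec, ← hc, hcy]
  have h1 : MDifferentiableAt 𝓘(ℝ, OrbitModel E (coAd E G) lam) 𝓘(ℝ, ℂ)
      (fun m => lift (D.lineRep hχ) s (sec m₀ m)) m :=
    MDifferentiableAt.comp (f := sec m₀) _
      (D.mdifferentiableAt_lift_of_mk hχ (hs m hm) (mk_sec hm)) (mdifferentiableAt_sec hm)
  have h2 := modelDeriv_eq_fderiv_chart hm h1 (v m)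
  have h3 : (fun y => lift (D.lineRep hχ) s (sec m₀ (c.symm y))) =ᶠ[𝓝 y]
      fun y => lift (D.lineRep hχ) s (secCoord m₀ y) := by
    filter_upwards [c.open_target.mem_nhds hy] with x hx
    rw [sec, ← hc, c.right_inv hx]
  have h4 := leftLogDeriv_sec hm (v m)
  have h5 := D.lift_covAt_sec hχ hμ hm (hs m hm) v
  rw [h2, h4, h0] at h5
  rw [← hc, hcy, h3.fderiv_eq] at h5
  rw [h5, theta_apply, ← hv]
  rfl

theorem covAt_eq_fderiv (hμ : ∀ X : cartan, μ X = 2 * lam X)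
    {s : ∀ m, (D.lineBundle hχ).Fiber m} {m : LinearOrbit E (coAd E G) lam}
    (hs : ∀ m, DifferentiableSectionAt (OrbitModel E (coAd E G) lam) ℂ s m)
    (v : OrbitModel E (coAd E G) lam) :
    D.covAt hχ s m v =
      fderiv ℝ (fun y => lift (D.lineRep hχ) s (secCoord m y))
        (chartAt (OrbitModel E (coAd E G) lam) m m) v +
      theta lam (leftLogDeriv (F := OrbitModel E (coAd E G) lam) E (secCoord m)
        (chartAt (OrbitModel E (coAd E G) lam) m m) v) *
        lift (D.lineRep hχ) s (secCoord m (chartAt (OrbitModel E (coAd E G) lam) m m)) := by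
  have hm := mem_chart_source (OrbitModel E (coAd E G) lam) m
  have h6 : ∀ {A B : OrbitModel E (coAd E G) lam →L[ℝ] OrbitModel E (coAd E G) lam},
      A = B → A v = B v := by
    rintro A _ rfl; rfl
  have h1 := D.lift_covAt_secCoord hχ hμ (m₀ := m) (fun m _ => hs m) (fun _ => v)
    ((chartAt (OrbitModel E (coAd E G) lam) m).map_source hm) (v' := v) (by
      rw [(chartAt (OrbitModel E (coAd E G) lam) m).left_inv hm]
      exact h6 (hasMFDerivAt_chartAt_self m).mfderiv)
  exact (lift_sec_self (D.lineRep hχ) (fun m => D.covAt hχ s m v) m).symm.trans h1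

set_option maxHeartbeats 2000000 in
theorem curvature_covAt (hμ : ∀ X : cartan, μ X = 2 * lam X)
    {s : ∀ m, (D.lineBundle hχ).Fiber m}
    (hs : ∀ m, SmoothSectionAt (OrbitModel E (coAd E G) lam) ℂ s m)
    {V W : ∀ m : LinearOrbit E (coAd E G) lam, TangentSpace 𝓘(ℝ, OrbitModel E (coAd E G) lam) m}
    (hV : ∀ m, SmoothSectionAt (OrbitModel E (coAd E G) lam) (OrbitModel E (coAd E G) lam) V m)
    (hW : ∀ m, SmoothSectionAt (OrbitModel E (coAd E G) lam) (OrbitModel E (coAd E G) lam) W m)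
    (m : LinearOrbit E (coAd E G) lam) {c : ℂ} (hc : s m = c) :
    D.covAt hχ (fun x => D.covAt hχ s x (W x)) m (V m) -
      D.covAt hχ (fun x => D.covAt hχ s x (V x)) m (W m) -
      D.covAt hχ s m (VectorField.mlieBracket 𝓘(ℝ, OrbitModel E (coAd E G) lam) V W m :
        OrbitModel E (coAd E G) lam) =
      -Complex.I * (2 * lam (bracketModel G
        (leftLogDeriv (F := OrbitModel E (coAd E G) lam) E (sec m) m (V m))
        (leftLogDeriv (F := OrbitModel E (coAd E G) lam) E (sec m) m (W m))) : ℝ) * c := by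
  have : CompleteSpace E := FiniteDimensional.complete ℝ E
  have hm := mem_chart_source (OrbitModel E (coAd E G) lam) m
  set φ := chartAt (OrbitModel E (coAd E G) lam) m with hφ
  have hz := φ.map_source hm
  have hsd : ∀ m, DifferentiableSectionAt (OrbitModel E (coAd E G) lam) ℂ s m :=
    fun m => (hs m).mdifferentiableAt (by simp)
  have hcd : ∀ {U : ∀ m : LinearOrbit E (coAd E G) lam,
      TangentSpace 𝓘(ℝ, OrbitModel E (coAd E G) lam) m},
      (∀ m, SmoothSectionAt (OrbitModel E (coAd E G) lam) (OrbitModel E (coAd E G) lam) U m) →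
      ∀ m, DifferentiableSectionAt (OrbitModel E (coAd E G) lam) ℂ
        (V := (D.lineBundle hχ).Fiber) (fun x => D.covAt hχ s x (U x)) m :=
    fun hU m => (D.smoothSectionAt_covAt hχ hμ hs (hU m)).mdifferentiableAt (by simp)
  let U' : (∀ m : LinearOrbit E (coAd E G) lam, TangentSpace 𝓘(ℝ, OrbitModel E (coAd E G) lam) m) →
      OrbitModel E (coAd E G) lam → OrbitModel E (coAd E G) lam := fun U y =>
    mfderiv 𝓘(ℝ, OrbitModel E (coAd E G) lam) 𝓘(ℝ, OrbitModel E (coAd E G) lam) φ (φ.symm y)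
      (U (φ.symm y))
  have hU'z : ∀ U, U' U (φ m) = U m := by
    intro U
    have h6 : ∀ {A B : OrbitModel E (coAd E G) lam →L[ℝ] OrbitModel E (coAd E G) lam},
        A = B → ∀ v, A v = B v := by
      rintro A _ rfl v; rfl
    have h7 : ∀ p, p = m → (mfderiv 𝓘(ℝ, OrbitModel E (coAd E G) lam)
        𝓘(ℝ, OrbitModel E (coAd E G) lam) φ p (U p) : OrbitModel E (coAd E G) lam) = U m := by
      rintro p rfl
      exact h6 (hasMFDerivAt_chartAt_self p).mfderiv (U p)
    exact h7 _ (φ.left_inv hm)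
  have hU's : ∀ {U : ∀ m : LinearOrbit E (coAd E G) lam,
      TangentSpace 𝓘(ℝ, OrbitModel E (coAd E G) lam) m},
      (∀ m, SmoothSectionAt (OrbitModel E (coAd E G) lam) (OrbitModel E (coAd E G) lam) U m) →
      DifferentiableAt ℝ (U' U) (φ m) := by
    intro U hU
    have h1 := (hU m).mfderiv_chartAt
    have h2 : ContMDiffAt 𝓘(ℝ, OrbitModel E (coAd E G) lam) 𝓘(ℝ, OrbitModel E (coAd E G) lam) ∞
        (U' U) (φ m) :=
      ContMDiffAt.comp (f := φ.symm) _ (by rw [φ.left_inv hm]; exact h1)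
        (contMDiffOn_chart_symm.contMDiffAt (φ.open_target.mem_nhds hz))
    exact h2.contDiffAt.differentiableAt (by simp)
  have hU'm : ∀ U : ∀ m : LinearOrbit E (coAd E G) lam,
      TangentSpace 𝓘(ℝ, OrbitModel E (coAd E G) lam) m, ∀ᶠ x in 𝓝 (φ m),
      mfderiv 𝓘(ℝ, OrbitModel E (coAd E G) lam) 𝓘(ℝ, OrbitModel E (coAd E G) lam) φ.symm x
        (U' U x) = U (φ.symm x) := by
    intro U
    filter_upwards [φ.open_target.mem_nhds hz] with x hx
    exact DFunLike.congr_fun (mfderiv_chartAt_symm_comp m hx) (U (φ.symm x))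
  have hf : ContDiffAt ℝ 2 (fun y => lift (D.lineRep hχ) s (secCoord m y)) (φ m) := by
    have h1 : ContMDiffAt 𝓘(ℝ, OrbitModel E (coAd E G) lam) 𝓘(ℝ, ℂ) ∞
        (fun y => lift (D.lineRep hχ) s (secCoord m y)) (φ m) := by
      have h2 := (contMDiffOn_secCoord m).contMDiffAt (φ.open_target.mem_nhds hz)
      exact ContMDiffAt.comp (f := secCoord m) _ (contMDiffAt_lift
        (hst := D.stabilizer) (τ := D.lineRep hχ) (hs _)) h2
    exact h1.contDiffAt.of_le (by norm_cast)
  have hA := (contDiffAt_leftLogDeriv (E := E) φ.open_target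
    (contMDiffOn_secCoord m) hz).differentiableAt (by simp)
  have hg : ∀ U : ∀ m : LinearOrbit E (coAd E G) lam,
      TangentSpace 𝓘(ℝ, OrbitModel E (coAd E G) lam) m,
      (fun y => lift (D.lineRep hχ) (fun x => D.covAt hχ s x (U x)) (secCoord m y)) =ᶠ[𝓝 (φ m)]
      fun y => fderiv ℝ (fun y => lift (D.lineRep hχ) s (secCoord m y)) y (U' U y) +
        theta lam (leftLogDeriv (F := OrbitModel E (coAd E G) lam) E (secCoord m) y (U' U y)) *
          lift (D.lineRep hχ) s (secCoord m y) := by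
    intro U
    filter_upwards [φ.open_target.mem_nhds hz] with y hy
    exact D.lift_covAt_secCoord hχ hμ (fun m _ => hsd m) U hy rfl
  have key := curvature_trivial (theta lam) hf hA (hU's hV) (hU's hW) (hg V) (hg W)
  have hbr := mlieBracket_eq_fderiv (hU'm V) (hU'm W)
  rw [hU'z, hU'z] at key hbr
  have e1 := D.covAt_eq_fderiv hχ hμ (m := m) (hcd hW) (V m)
  have e2 := D.covAt_eq_fderiv hχ hμ (m := m) (hcd hV) (W m)
  have e3 := D.covAt_eq_fderiv hχ hμ (m := m) hsd
    (fderiv ℝ (U' W) (φ m) (V m) - fderiv ℝ (U' V) (φ m) (W m))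
  have e4 := (congrArg (D.covAt hχ s m) hbr).trans e3
  have h8 : lift (D.lineRep hχ) s (secCoord m (φ m)) = c :=
    (lift_sec_self (D.lineRep hχ) s m).trans hc
  refine (congrArg₂ (fun x y : ℂ => x - y) (congrArg₂ (fun x y : ℂ => x - y) e1 e2) e4).trans
    (key.trans ?_)
  have h9 := fderiv_leftLogDeriv (E := E) φ.open_target (contMDiffOn_secCoord m) hz (V m) (W m)
  have h10 : ∀ U : OrbitModel E (coAd E G) lam,
      leftLogDeriv (F := OrbitModel E (coAd E G) lam) E (sec m) m U =
      leftLogDeriv (F := OrbitModel E (coAd E G) lam) E (secCoord m) (φ m) U := by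
    intro U
    have h6 : ∀ {A B : OrbitModel E (coAd E G) lam →L[ℝ] OrbitModel E (coAd E G) lam},
        A = B → ∀ v, A v = B v := by
      rintro A _ rfl v; rfl
    exact (leftLogDeriv_sec hm U).trans (congrArg _ (h6 (hasMFDerivAt_chartAt_self m).mfderiv U))
  refine (congrArg₂ (fun x y => theta lam x * y) h9 h8).trans ?_
  refine Eq.trans ?_ (congrArg₂ (fun P Q : E => -Complex.I * (2 * lam (bracketModel G P Q) : ℝ) * c)
    (h10 (V m)) (h10 (W m))).symm
  rw [map_neg, theta_apply]
  push_cast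
  ring

end TorusData

namespace TorusData

variable {E G : Type*} [NormedAddCommGroup E] [NormedSpace ℝ E] [FiniteDimensional ℝ E]
  [TopologicalSpace G] [ChartedSpace E G] [Group G] [LieGroup 𝓘(ℝ, E) ∞ G]
  {H : Subgroup G} {cartan : Submodule ℝ E} {lam : LieDual E G}
  (D : TorusData H cartan lam.toModel)
  {χ : H →* Circle} {μ : cartan →ₗ[ℝ] ℝ} (hχ : IsWeight χ μ)

open LinearOrbit

/-- The symplectic form of the orbit in terms of the frames. -/
theorem kksForm_eq (D : TorusData H cartan lam.toModel) {a : G} {y : CoadjointOrbit E lam} {A B : E} {u v : CoadjointModel E lam}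
    (hy : LinearOrbit.mk E (coAd E G) lam.toModel a = y)
    (hu : orbitFrame E (coAd E G) lam.toModel a A = u)
    (hv : orbitFrame E (coAd E G) lam.toModel a B = v) :
    kksForm lam y u v = lam.toModel (bracketModel G A B) := by
  have hr := (exists_rightInverse_fundamentalField y).choose_spec
  set r := (exists_rightInverse_fundamentalField y).choose with hrdef
  have key : ∀ (C : E) (w : CoadjointModel E lam),
      orbitFrame E (coAd E G) lam.toModel a C = w →
      C + AdModel E a⁻¹ (r w : E) ∈ cartan := by
    rintro C w rfl
    rw [← D.orbitFrame_eq_zero_iff a, map_add]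
    have h1 := hr (orbitFrame E (coAd E G) lam.toModel a C)
    subst hy
    have h2 := (fundamentalField_mk (E := E) (ρ := coAd E G) (w := lam.toModel) a (r (orbitFrame E (coAd E G) lam.toModel a C))).symm.trans h1
    exact (congrArg (fun z => z + orbitFrame E (coAd E G) lam.toModel a
      (AdModel E a⁻¹ (r (orbitFrame E (coAd E G) lam.toModel a C) : E))) h2).symm.trans
        (neg_add_cancel _)
  have hA := key A u hu
  have hB := key B v hv
  have h1 : kksForm lam y u v = lam.toModel (bracketModel G (AdModel E a⁻¹ (r u : E))
      (AdModel E a⁻¹ (r v : E))) := by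
    have h0 := congrArg lam.toModel (AdModel_bracketModel (E := E) a⁻¹ (r u : E) (r v : E))
    refine Eq.trans ?_ h0
    subst hy
    rfl
  obtain ⟨X, hX⟩ : ∃ X : E, X = AdModel E a⁻¹ (r u : E) := ⟨_, rfl⟩
  obtain ⟨Y, hY⟩ : ∃ Y : E, Y = AdModel E a⁻¹ (r v : E) := ⟨_, rfl⟩
  refine h1.trans ?_
  rw [← hX, ← hY]
  rw [← hX] at hA
  rw [← hY] at hB
  have h2 : ∀ P Q : E, bracketModel G P Q = -bracketModel G Q P := fun P Q =>
    (lie_skew (L := LieAlg E G) P Q).symm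
  have h3 : ∀ P Q R : E, bracketModel G (P + Q) R = bracketModel G P R + bracketModel G Q R :=
    fun P Q R => add_lie (L := LieAlg E G) (M := LieAlg E G) P Q R
  have h4 : ∀ P Q : E, lam.toModel (bracketModel G P Q) = -lam.toModel (bracketModel G Q P) :=
    fun P Q => by rw [h2, map_neg]
  have h5 : ∀ P Q R : E, P + Q ∈ cartan →
      lam.toModel (bracketModel G P R) = -lam.toModel (bracketModel G Q R) := by
    intro P Q R h
    have h6 := (D.lam_bracket _).2 h R
    rw [h3, map_add] at h6
    linarith
  have h6 := h5 _ _ Y hA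
  have h7 := h5 _ _ A hB
  rw [h4 A B, h7, neg_neg, h4 Y A, h6, neg_neg]

theorem lieDerivative_eq (X : E) (s : ∀ m, (D.lineBundle hχ).Fiber m) (m : CoadjointOrbit E lam) :
    ((D.lineBundle hχ).lieDerivative (E := E) X s m : ℂ) =
      -modelDeriv E (fun g : G => (lift (D.lineRep hχ) s (g * sec m m) : ℂ)) 1 X := by
  have h1 : (fun g : G => ((D.lineBundle hχ).translate g s m : ℂ)) =
      fun g => lift (D.lineRep hχ) s (g * sec m m) := by
    funext g
    have h2 := congrFun (D.lift_translate_lineBundle hχ g s) (sec m m)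
    exact (lift_sec_self (D.lineRep hχ) ((D.lineBundle hχ).translate g s) m).symm.trans h2
  exact congrArg (fun f : G → ℂ => -modelDeriv E f 1 X) h1

theorem curvature_cov (hμ : ∀ X : cartan, μ X = 2 * lam.toModel X)
    {s : ∀ m, (D.lineBundle hχ).Fiber m}
    (hs : ∀ m, SmoothSectionAt (CoadjointModel E lam) ℂ s m)
    {V W : ∀ m : CoadjointOrbit E lam, TangentSpace 𝓘(ℝ, CoadjointModel E lam) m}
    (hV : ∀ m, SmoothSectionAt (CoadjointModel E lam) (CoadjointModel E lam) V m)
    (hW : ∀ m, SmoothSectionAt (CoadjointModel E lam) (CoadjointModel E lam) W m)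
    (m : CoadjointOrbit E lam) {c : ℂ} (hc : s m = c) :
    D.covAt hχ (fun x => D.covAt hχ s x (W x)) m (V m) -
      D.covAt hχ (fun x => D.covAt hχ s x (V x)) m (W m) -
      D.covAt hχ s m (VectorField.mlieBracket 𝓘(ℝ, CoadjointModel E lam) V W m :
        CoadjointModel E lam) =
      -Complex.I * ((2 : ℝ) * kksForm lam m (V m) (W m) : ℝ) * c := by
  have hm := mem_chart_source (CoadjointModel E lam) m
  have h1 := D.kksForm_eq (mk_sec_self m) (orbitFrame_sec hm (V m)) (orbitFrame_sec hm (W m))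
  refine (D.curvature_covAt hχ hμ hs hV hW m hc).trans ?_
  exact congrArg (fun x : ℝ => -Complex.I * ((2 : ℝ) * x : ℝ) * c) h1.symm

/-- The prequantum connection on the line bundle of weight `2 lam`. -/
noncomputable def prequantumConnection (hμ : ∀ X : cartan, μ X = 2 * lam.toModel X) :
    PrequantumConnection (D.lineBundle hχ) (fun m => (2 : ℝ) • kksForm lam m)
      (fun m => (2 : ℝ) • momentMap lam m) where
  cov := D.cov hχ
  smooth := D.contMDiffCovariantDerivative_cov hχ hμ
  complex_linear s m v hs := D.covAt_I_smul hχ hs v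
  hermitian s t m v hs ht := D.hermitian_covAt hχ hs ht v rfl rfl
  invariant g s m v hs := D.invariant_covAt hχ hμ g hs v
  kostant X s m hs := by
    refine Eq.trans ?_ (D.kostant_covAt hχ hμ X hs rfl)
    exact congrArg (fun x : ℂ => x - D.covAt hχ s m (fundamentalField (E := E) (G := G)
      (CoadjointModel E lam) X m : CoadjointModel E lam)) (D.lieDerivative_eq hχ X s m)
  curvature V W s hV hW hs m := D.curvature_cov hχ hμ hs hV hW m rfl

end TorusData

namespace SpinorModel

variable {N : ℕ} {V : Type} [NormedAddCommGroup V] [NormedSpace ℂ V] [FiniteDimensional ℂ V]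

theorem contDiff_c (S : SpinorModel N V) :
    ContDiff ℝ ∞ fun q : (Fin N → ℂ) × V => S.c q.1 q.2 := by
  let L : (Fin N → ℂ) →ₗ[ℝ] V →L[ℂ] V :=
    { toFun := fun z => LinearMap.toContinuousLinearMap (S.c z)
      map_add' := fun z w => by ext v; simp
      map_smul' := fun a z => by ext v; simp }
  have h1 : ContDiff ℝ ∞ L := (LinearMap.toContinuousLinearMap L).contDiff
  exact LinearOrbit.contDiff_eval.comp ((h1.comp contDiff_fst).prodMk contDiff_snd)

theorem contDiff_conj (S : SpinorModel N V) : ContDiff ℝ ∞ S.conj := by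
  have : FiniteDimensional ℝ V := FiniteDimensional.complexToReal V
  let L : V →ₗ[ℝ] V :=
    { toFun := S.conj
      map_add' := map_add S.conj
      map_smul' := fun a v => by
        rw [← Complex.coe_smul, LinearMap.map_smulₛₗ, Complex.conj_ofReal, Complex.coe_smul]
        rfl }
  exact (LinearMap.toContinuousLinearMap L).contDiff

/-- The conjugate linear maps which commute with Clifford multiplication form a line. -/
theorem exists_eq_smul_conj (S : SpinorModel N V) {A : V →ₛₗ[starRingEnd ℂ] V}
    (hA : ∀ z v, A (S.c z v) = S.c z (A v)) : ∃ a : ℂ, A = a • S.conj := by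
  obtain ⟨a, ha⟩ := S.exists_eq_smul (A := A.comp S.conj) fun z v => by
    simp only [LinearMap.comp_apply]
    rw [S.conj_c, hA]
  obtain ⟨b, hb⟩ := S.exists_eq_smul (A := S.conj.comp S.conj) fun z v => by
    simp only [LinearMap.comp_apply]
    rw [S.conj_c, S.conj_c]
  refine ⟨a / b, LinearMap.ext fun v => ?_⟩
  obtain ⟨w, rfl⟩ := S.conj_bijective.2 v
  have h1 : A (S.conj w) = a • w := ha w
  have h2 : S.conj (S.conj w) = b • w := hb w
  rw [LinearMap.smul_apply, h1, h2, smul_smul]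
  by_cases h0 : b = 0
  · have h3 : S.conj (S.conj w) = 0 := by rw [h2, h0, zero_smul]
    have h4 : w = 0 := S.conj_bijective.1 (S.conj_bijective.1 (by rw [h3, map_zero, map_zero]))
    rw [h4, smul_zero, smul_zero]
  · rw [div_mul_cancel₀ _ h0]

theorem conj_ne_zero (S : SpinorModel N V) : S.conj ≠ 0 := by
  intro h
  have h1 : Subsingleton V := ⟨fun v w => S.conj_bijective.1 (by rw [h]; rfl)⟩
  have h2 := S.finrank_eq
  rw [Module.finrank_zero_of_subsingleton] at h2
  exact (pow_ne_zero N (two_ne_zero (α := ℕ))) h2.symm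

end SpinorModel

/-- A conjugate linear map which commutes with the action of vectors commutes with the action of
the Clifford algebra. -/
theorem commute_clifford_of_ι {U W : Type*} [AddCommGroup U] [Module ℝ U] {Q : QuadraticForm ℝ U}
    [AddCommGroup W] [Module ℂ W] (f : CliffordAlgebra Q →ₐ[ℝ] Module.End ℂ W)
    (A : W →ₛₗ[starRingEnd ℂ] W)
    (hA : ∀ u w, A (f (CliffordAlgebra.ι Q u) w) = f (CliffordAlgebra.ι Q u) (A w))
    (x : CliffordAlgebra Q) (w : W) : A (f x w) = f x (A w) := by
  induction x using CliffordAlgebra.induction generalizing w with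
  | algebraMap r =>
    rw [AlgHom.commutes, Module.algebraMap_end_apply, Module.algebraMap_end_apply,
      ← Complex.coe_smul, LinearMap.map_smulₛₗ, Complex.conj_ofReal, Complex.coe_smul]
  | ι u => exact hA u w
  | mul a b ha hb => rw [map_mul, Module.End.mul_apply, ha, hb, Module.End.mul_apply]
  | add a b ha hb => rw [map_add, LinearMap.add_apply, map_add, ha, hb, LinearMap.add_apply]

namespace SpinorModel

variable {N : ℕ} {V : Type} [NormedAddCommGroup V] [NormedSpace ℂ V] [FiniteDimensional ℂ V]
  {U : Type*} [AddCommGroup U] [Module ℝ U] {Q : QuadraticForm ℝ U}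

/-- The conjugate linear maps which commute with a Clifford module structure. -/
def detLine {W : Type*} [AddCommGroup W] [Module ℂ W]
    (f : CliffordAlgebra Q →ₐ[ℝ] Module.End ℂ W) : Submodule ℂ (W →ₛₗ[starRingEnd ℂ] W) where
  carrier := {A | ∀ (a : CliffordAlgebra Q) (s : W), A (f a s) = f a (A s)}
  add_mem' hA hB a s := by simp [hA a s, hB a s]
  zero_mem' a s := by simp
  smul_mem' c A hA a s := by simp [hA a s]

theorem conj_mem_detLine (S : SpinorModel N V) (z : U →ₗ[ℝ] (Fin N → ℂ))
    (hz : ∀ u, Q u = -∑ j, ‖z u j‖ ^ 2) : S.conj ∈ detLine (S.clifford z hz) :=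
  commute_clifford_of_ι _ _ fun u w => by
    rw [S.clifford_ι]
    exact S.conj_c _ _

/-- The line of conjugate linear maps which commute with the Clifford module structure. -/
noncomputable def detLineEquiv (S : SpinorModel N V) (z : U →ₗ[ℝ] (Fin N → ℂ))
    (hz : ∀ u, Q u = -∑ j, ‖z u j‖ ^ 2) (hbij : Function.Bijective z) :
    ℂ ≃ₗ[ℂ] detLine (S.clifford z hz) :=
  LinearEquiv.ofBijective (LinearMap.toSpanSingleton ℂ _ ⟨S.conj, S.conj_mem_detLine z hz⟩) (by
    refine ⟨(injective_iff_map_eq_zero _).2 fun l hl => ?_, fun A => ?_⟩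
    · have h := congrArg Subtype.val hl
      exact (smul_eq_zero.1 (h : l • S.conj = 0)).resolve_right S.conj_ne_zero
    · obtain ⟨a, ha⟩ := S.exists_eq_smul_conj (A := A.1) fun w v => by
        obtain ⟨u, rfl⟩ := hbij.2 w
        rw [← S.clifford_ι z hz]
        exact A.2 _ _
      exact ⟨a, Subtype.ext ha.symm⟩)

end SpinorModel

namespace TorusData

variable {E G : Type*} [NormedAddCommGroup E] [NormedSpace ℝ E] [FiniteDimensional ℝ E]
  [TopologicalSpace G] [ChartedSpace E G] [Group G] [LieGroup 𝓘(ℝ, E) ∞ G]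
  {H : Subgroup G} {cartan : Submodule ℝ E} {lam : E →L[ℝ] ℝ}
  (D : TorusData H cartan lam)
  {ψ χ : H →* Circle} {μ ν : cartan →ₗ[ℝ] ℝ}

open LinearOrbit

theorem IsWeight.mul (h1 : IsWeight ψ μ) (h2 : IsWeight χ ν) : IsWeight (ψ * χ) (μ + ν) := by
  intro X γ hγ s
  rw [MonoidHom.mul_apply, Circle.coe_mul, h1 X γ hγ s, h2 X γ hγ s, ← Complex.exp_add]
  congr 1
  simp
  ring

theorem isWeight_one : IsWeight (1 : H →* Circle) (0 : cartan →ₗ[ℝ] ℝ) := by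
  intro X γ hγ s
  simp

theorem isWeight_prod {ι : Type*} (s : Finset ι) {χ : ι → H →* Circle}
    {μ : ι → cartan →ₗ[ℝ] ℝ} (h : ∀ i, IsWeight (χ i) (μ i)) :
    IsWeight (∏ i ∈ s, χ i) (∑ i ∈ s, μ i) := by
  classical
  induction s using Finset.induction_on with
  | empty => exact isWeight_one
  | insert i s hi ih =>
    rw [Finset.prod_insert hi, Finset.sum_insert hi]
    exact (h i).mul ih

variable {V : Type} [NormedAddCommGroup V] [NormedSpace ℂ V] [FiniteDimensional ℂ V]
  (S : SpinorModel D.N V) (hψ : IsWeight ψ μ)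

theorem spinRep_c (a : G) {t : G} (ht : t ∈ H) (u : OrbitModel E (coAd E G) lam) (v : V) :
    D.spinRep S hψ t (S.c (D.coord (a * t) u) v) = S.c (D.coord a u) (D.spinRep S hψ t v) := by
  rw [spinRep_apply, S.τ_c _ _ _ (D.norm_charVec t), ← D.coord_mul' a ht, spinRep_apply, map_smul]

theorem lift_c (X : LinearOrbit E (coAd E G) lam → OrbitModel E (coAd E G) lam)
    (s : LinearOrbit E (coAd E G) lam → V) {a : G} {m : LinearOrbit E (coAd E G) lam}
    (ha : LinearOrbit.mk E (coAd E G) lam a = m) :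
    lift (D.spinRep S hψ) (fun m => S.c (D.coord (sec m m) (X m)) (s m)) a =
      S.c (D.coord a (X m)) (lift (D.spinRep S hψ) s a) := by
  rw [lift_of_mk _ _ ha, lift_of_mk _ s ha]
  have h := D.spinRep_c S hψ a (inv_mul_sec_mem D.stabilizer ha) (X m) (s m)
  rwa [mul_inv_cancel_left] at h

theorem smoothSectionAt_c
    {X : ∀ m : LinearOrbit E (coAd E G) lam, TangentSpace 𝓘(ℝ, OrbitModel E (coAd E G) lam) m}
    {s : ∀ m, (homBundle D.stabilizer (D.spinRep S hψ)).Fiber m} {m₀ : LinearOrbit E (coAd E G) lam}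
    {σ : ∀ m, (homBundle D.stabilizer (D.spinRep S hψ)).Fiber m}
    (hσ : ∀ m, σ m = S.c (D.coord (sec m m) (X m)) (s m))
    (hX : SmoothSectionAt (OrbitModel E (coAd E G) lam) (OrbitModel E (coAd E G) lam) X m₀)
    (hs : SmoothSectionAt (OrbitModel E (coAd E G) lam) V s m₀) :
    SmoothSectionAt (OrbitModel E (coAd E G) lam) V σ m₀ := by
  obtain rfl : σ = fun m => S.c (D.coord (sec m m) (X m)) (s m) := funext hσ
  refine (smoothSectionAt_iff_sec D.stabilizer (τ := D.spinRep S hψ) _ m₀).2 ?_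
  have h1 := (smoothSectionAt_iff_sec D.stabilizer (τ := D.spinRep S hψ) s m₀).1 hs
  have h2 := S.contDiff_c.contMDiff.contMDiffAt.comp m₀ ((D.contMDiffAt_coord_sec hX).prodMk_space h1)
  refine h2.congr_of_eventuallyEq ?_
  filter_upwards [chart_source_mem_nhds (OrbitModel E (coAd E G) lam) m₀] with m hm
  exact D.lift_c S hψ X s (mk_sec hm)

theorem homAct_c (g : G) (m : LinearOrbit E (coAd E G) lam) (u : OrbitModel E (coAd E G) lam)
    (v : V) :
    homAct D.stabilizer (D.spinRep S hψ) g m (S.c (D.coord (sec m m) u) v) =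
      S.c (D.coord (sec (g • m) (g • m)) (smulDeriv (OrbitModel E (coAd E G) lam) g m u :
        OrbitModel E (coAd E G) lam)) (homAct D.stabilizer (D.spinRep S hψ) g m v) := by
  have h := D.spinRep_c S hψ (sec (g • m) (g • m)) (t := (sec (g • m) (g • m))⁻¹ * (g * sec m m))
    (inv_mul_mem D.stabilizer (by rw [mk_sec_self, ← smul_mk, mk_sec_self]))
    (smulDeriv (OrbitModel E (coAd E G) lam) g m u : OrbitModel E (coAd E G) lam) v
  rw [mul_inv_cancel_left] at h
  rw [homAct_apply, homAct_apply, ← h]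
  exact congrArg (fun z => D.spinRep S hψ _ (S.c z v)) (D.coord_smul_sec g m u).symm

/-- The coordinates of tangent vectors at a point of the orbit. -/
noncomputable def coordAt (m : LinearOrbit E (coAd E G) lam) :
    TangentSpace 𝓘(ℝ, OrbitModel E (coAd E G) lam) m →ₗ[ℝ] (Fin D.N → ℂ) :=
  (D.coord (sec m m) : OrbitModel E (coAd E G) lam →ₗ[ℝ] (Fin D.N → ℂ))

theorem cliffordForm_metric (m : LinearOrbit E (coAd E G) lam)
    (u : TangentSpace 𝓘(ℝ, OrbitModel E (coAd E G) lam) m) :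
    cliffordForm D.metric m u = -∑ j, ‖D.coordAt m u j‖ ^ 2 :=
  congrArg Neg.neg (D.scalar_self (sec m m) u)

/-- The spinor bundle of the orbit, twisted by a character of the stabilizer. -/
noncomputable def spincBundle {r : ℕ} (S : SpinorModel D.N (EuclideanSpace ℂ (Fin r))) :
    EquivariantSpincBundle E G D.metric where
  rank := r
  Fiber := (homBundle D.stabilizer (D.spinRep S hψ)).Fiber
  addCommGroup _ := inferInstanceAs (AddCommGroup (EuclideanSpace ℂ (Fin r)))
  module _ := inferInstanceAs (Module ℂ (EuclideanSpace ℂ (Fin r)))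
  topTotal := (homBundle D.stabilizer (D.spinRep S hψ)).toTopologicalSpace
  topFiber _ := inferInstanceAs (TopologicalSpace (EuclideanSpace ℂ (Fin r)))
  fiberBundle := (homBundle D.stabilizer (D.spinRep S hψ)).fiberBundle
  vectorBundle := (homBundle D.stabilizer (D.spinRep S hψ)).vectorBundle
  vectorBundleReal := vectorBundleReal_homBundle D.stabilizer (D.spinRep S hψ)
  contMDiffVectorBundle := contMDiffVectorBundle_homBundle D.stabilizer (D.spinRep S hψ)
  action := homAction D.stabilizer (D.spinRep S hψ)
  clifford m := S.clifford (D.coordAt m) (D.cliffordForm_metric m)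
  bijective_clifford m := S.bijective_clifford (D.coordAt m) (D.cliffordForm_metric m)
    (D.bijective_coord (sec m m))
  smooth_clifford X s m₀ hX hs := by
    refine D.smoothSectionAt_c S hψ (fun m => ?_) hX hs
    exact congrArg (fun A : Module.End ℂ (EuclideanSpace ℂ (Fin r)) => A (s m))
      (S.clifford_ι (D.coordAt m) (D.cliffordForm_metric m) (X m))
  equivariant_clifford g m u v := by
    refine (congrArg (fun A : Module.End ℂ (EuclideanSpace ℂ (Fin r)) =>
      homAct D.stabilizer (D.spinRep S hψ) g m (A v))
      (S.clifford_ι (D.coordAt m) (D.cliffordForm_metric m) u)).trans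
      ((D.homAct_c S hψ g m u v).trans ?_)
    exact congrArg (fun A : Module.End ℂ (EuclideanSpace ℂ (Fin r)) =>
      A (homAct D.stabilizer (D.spinRep S hψ) g m v))
      (S.clifford_ι (D.coordAt (g • m)) (D.cliffordForm_metric (g • m)) _).symm

/-- The character of the torus on the determinant line. -/
noncomputable def detChar (ψ : H →* Circle) : H →* Circle := ψ * ψ * ∏ j, D.char j

theorem isWeight_detChar (hψ : IsWeight ψ μ) : IsWeight (D.detChar ψ) (μ + μ + ∑ j, D.root j) :=
  (hψ.mul hψ).mul (isWeight_prod _ D.isWeight_char)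

theorem extend_detChar {t : G} (ht : t ∈ H) :
    (extend (D.detChar ψ) t : ℂ) = extend ψ t * extend ψ t * ∏ j, D.charVec t j := by
  have h : ∀ j, D.charVec t j = D.char j ⟨t, ht⟩ := fun j => by rw [charVec, extend_apply _ ht]
  simp only [h]
  rw [extend_apply _ ht, extend_apply _ ht, detChar, MonoidHom.mul_apply, MonoidHom.mul_apply,
    MonoidHom.finsetProd_apply, Circle.coe_mul, Circle.coe_mul]
  congr 1
  exact map_prod Circle.coeHom _ _

theorem spinRep_smul_conj {t : G} (ht : t ∈ H) (l : ℂ) (v : V) :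
    D.spinRep S hψ t (l • S.conj v) =
      D.lineRep (D.isWeight_detChar hψ) t l • S.conj (D.spinRep S hψ t v) := by
  have h1 : (extend ψ t : ℂ) * starRingEnd ℂ (extend ψ t : ℂ) = 1 := by
    rw [Complex.mul_conj, Circle.normSq_coe, Complex.ofReal_one]
  rw [spinRep_apply, spinRep_apply, map_smul, S.τ_conj _ _ (D.norm_charVec t), lineRep_apply,
    D.extend_detChar ht, LinearMap.map_smulₛₗ, smul_smul, smul_smul, smul_smul]
  congr 1
  linear_combination -((extend ψ t : ℂ) * l * ∏ j, D.charVec t j) * h1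

theorem lift_smul_conj (l : LinearOrbit E (coAd E G) lam → ℂ)
    (s : LinearOrbit E (coAd E G) lam → V) {a : G} {m : LinearOrbit E (coAd E G) lam}
    (ha : LinearOrbit.mk E (coAd E G) lam a = m) :
    lift (D.spinRep S hψ) (fun m => l m • S.conj (s m)) a =
      lift (D.lineRep (D.isWeight_detChar hψ)) l a • S.conj (lift (D.spinRep S hψ) s a) := by
  rw [lift_of_mk _ _ ha, lift_of_mk _ s ha, lift_of_mk _ l ha]
  exact D.spinRep_smul_conj S hψ (inv_mul_sec_mem D.stabilizer ha) (l m) (s m)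

theorem smoothSectionAt_smul_conj {l : ∀ m, (D.lineBundle (D.isWeight_detChar hψ)).Fiber m}
    {s : ∀ m, (homBundle D.stabilizer (D.spinRep S hψ)).Fiber m} {m₀ : LinearOrbit E (coAd E G) lam}
    {l' : LinearOrbit E (coAd E G) lam → ℂ} (hl' : ∀ m, l m = l' m)
    (hl : SmoothSectionAt (OrbitModel E (coAd E G) lam) ℂ l m₀)
    (hs : SmoothSectionAt (OrbitModel E (coAd E G) lam) V s m₀) :
    SmoothSectionAt (OrbitModel E (coAd E G) lam) V
      (V := (homBundle D.stabilizer (D.spinRep S hψ)).Fiber)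
      (fun m => l' m • S.conj (s m)) m₀ := by
  obtain rfl : l = l' := funext hl'
  refine (smoothSectionAt_iff_sec D.stabilizer (τ := D.spinRep S hψ) _ m₀).2 ?_
  have h1 := (smoothSectionAt_iff_sec D.stabilizer (τ := D.spinRep S hψ) s m₀).1 hs
  have h2 := (smoothSectionAt_iff_sec D.stabilizer
    (τ := D.lineRep (D.isWeight_detChar hψ)) l m₀).1 hl
  have h3 := h2.complex_smul (S.contDiff_conj.contMDiff.contMDiffAt.comp m₀ h1)
  refine h3.congr_of_eventuallyEq ?_
  filter_upwards [chart_source_mem_nhds (OrbitModel E (coAd E G) lam) m₀] with m hm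
  exact D.lift_smul_conj S hψ l s (mk_sec hm)

theorem homAct_smul_conj (g : G) (m : LinearOrbit E (coAd E G) lam) (l : ℂ) (v : V) :
    homAct D.stabilizer (D.spinRep S hψ) g m (l • S.conj v) =
      homAct D.stabilizer (D.lineRep (D.isWeight_detChar hψ)) g m l •
        S.conj (homAct D.stabilizer (D.spinRep S hψ) g m v) :=
  D.spinRep_smul_conj S hψ
    (inv_mul_mem D.stabilizer (by rw [mk_sec_self, ← smul_mk, mk_sec_self])) l v

/-- The determinant lines of the spinor bundle. -/
noncomputable def detEquiv {r : ℕ} (S : SpinorModel D.N (EuclideanSpace ℂ (Fin r)))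
    (m : LinearOrbit E (coAd E G) lam) :
    (D.lineBundle (D.isWeight_detChar hψ)).Fiber m ≃ₗ[ℂ] (D.spincBundle hψ S).detFiber m := by
  exact S.detLineEquiv (D.coordAt m) (D.cliffordForm_metric m) (D.bijective_coord (sec m m))

/-- The determinant line bundle of the spinor bundle is associated with the determinant
character. -/
noncomputable def detLineIso {r : ℕ} (S : SpinorModel D.N (EuclideanSpace ℂ (Fin r))) :
    DetLineIso (D.spincBundle hψ S) (D.lineBundle (D.isWeight_detChar hψ)) where
  iso := D.detEquiv hψ S
  smooth_iso _ _ _ hl hs := D.smoothSectionAt_smul_conj S hψ (fun _ => rfl) hl hs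
  equivariant_iso g m l v := (D.homAct_smul_conj S hψ g m l v).symm

end TorusData

namespace TorusData

variable {E G : Type*} [NormedAddCommGroup E] [NormedSpace ℝ E] [FiniteDimensional ℝ E]
  [TopologicalSpace G] [ChartedSpace E G] [Group G] [LieGroup 𝓘(ℝ, E) ∞ G]
  {H : Subgroup G} {cartan : Submodule ℝ E} {lam : LieDual E G}

/-- A regular orbit is prequantized if the shifted weight is the weight of a character. -/
theorem isSpincPrequantized (D : TorusData H cartan lam.toModel) {ψ : H →* Circle}
    {μ : cartan →ₗ[ℝ] ℝ} (hψ : IsWeight ψ μ)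
    (hμ : ∀ X : cartan, (μ + μ + ∑ j, D.root j) X = 2 * lam.toModel X) :
    IsSpincPrequantized (kksForm lam) (momentMap lam) := by
  obtain ⟨r, ⟨S⟩⟩ := SpinorModel.nonempty_euclideanSpace D.N
  exact ⟨D.metric, D.invariantMetric_metric, D.spincBundle hψ S,
    D.lineBundle (D.isWeight_detChar hψ), ⟨D.detLineIso hψ S⟩,
    ⟨D.prequantumConnection (D.isWeight_detChar hψ) hμ⟩⟩

end TorusData

/-- The identification of fibres over equal points. -/
noncomputable def fiberCast {M : Type*} (V : M → Type*) [∀ m, AddCommGroup (V m)]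
    [∀ m, Module ℂ (V m)] {m m' : M} (h : m = m') : V m ≃ₗ[ℂ] V m' :=
  h ▸ LinearEquiv.refl ℂ (V m)

section

variable {E F G M V₀ : Type*} [NormedAddCommGroup E] [NormedSpace ℝ E]
  [TopologicalSpace G] [ChartedSpace E G] [Group G] [NormedAddCommGroup F] [NormedSpace ℝ F]
  [TopologicalSpace M] [ChartedSpace F M] [MulAction G M]
  [NormedAddCommGroup V₀] [NormedSpace ℂ V₀] {V : M → Type*} [∀ m, AddCommGroup (V m)]
  [∀ m, Module ℂ (V m)]

theorem mk_fiberCast {m m' : M} (h : m = m') (v : V m) :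
    TotalSpace.mk' V₀ m' (fiberCast V h v) = TotalSpace.mk' V₀ m v := by
  subst h; rfl

variable [TopologicalSpace (TotalSpace V₀ V)] [∀ m, TopologicalSpace (V m)] [FiberBundle V₀ V]
  (A : BundleAction E F G V₀ V)

/-- The action of the stabilizer of a point on the fibre. -/
noncomputable def BundleAction.isotropy {g : G} {m : M} (h : g • m = m) : V m ≃ₗ[ℂ] V m :=
  (A.act g m).trans (fiberCast V h)

theorem BundleAction.isotropy_apply {g : G} {m : M} (h : g • m = m) (v : V m) :
    A.isotropy h v = fiberCast V h (A.act g m v) := rfl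

theorem BundleAction.mk_isotropy {g : G} {m : M} (h : g • m = m) (v : V m) :
    TotalSpace.mk' V₀ m (A.isotropy h v) = TotalSpace.mk' V₀ (g • m) (A.act g m v) :=
  mk_fiberCast h _

theorem BundleAction.isotropy_one {m : M} (v : V m) : A.isotropy (one_smul G m) v = v :=
  TotalSpace.mk_injective m ((A.mk_isotropy _ v).trans (A.act_one m v))

theorem BundleAction.isotropy_mul {a b : G} {m : M} (ha : a • m = m) (hb : b • m = m)
    (hab : (a * b) • m = m) (v : V m) :
    A.isotropy hab v = A.isotropy ha (A.isotropy hb v) := by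
  refine TotalSpace.mk_injective (F := V₀) m ?_
  refine (A.mk_isotropy _ v).trans ((A.act_mul a b m v).trans ?_)
  have h : ∀ (m' : M) (h : m' = m) (w : V m'), TotalSpace.mk' V₀ (a • m') (A.act a m' w) =
      TotalSpace.mk' V₀ (a • m) (A.act a m (fiberCast V h w)) := by
    rintro m' rfl w; rfl
  exact (h _ hb _).trans (A.mk_isotropy ha _).symm

theorem BundleAction.isotropy_congr {a b : G} {m : M} (h : a = b) (ha : a • m = m) (hb : b • m = m)
    (v : V m) : A.isotropy ha v = A.isotropy hb v := by
  subst h; rfl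

theorem BundleAction.mk_act_symm (g : G) (m : M) (v : V (g • m)) :
    TotalSpace.mk' V₀ m ((A.act g m).symm v) =
      TotalSpace.mk' V₀ (g⁻¹ • g • m) (A.act g⁻¹ (g • m) v) := by
  obtain ⟨w, rfl⟩ := (A.act g m).surjective v
  rw [LinearEquiv.symm_apply_apply]
  refine Eq.trans ?_ (A.act_mul g⁻¹ g m w)
  have h : ∀ k : G, k = 1 → TotalSpace.mk' V₀ m w = TotalSpace.mk' V₀ (k • m) (A.act k m w) := by
    rintro k rfl
    exact (A.act_one m w).symm
  exact h _ (inv_mul_cancel g)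

end

/-- A curve with a constant logarithmic derivative. -/
theorem eq_exp_smul_of_hasDerivAt {W : Type*} [NormedAddCommGroup W] [NormedSpace ℂ W] {y : ℝ → W}
    {a : ℂ} (h : ∀ s, HasDerivAt y (a • y s) s) (s : ℝ) : y s = Complex.exp (s * a) • y 0 := by
  have h1 : ∀ s : ℝ, HasDerivAt (fun r : ℝ => Complex.exp (-(r * a)) • y r) 0 s := by
    intro s
    have h2 : HasDerivAt (fun r : ℝ => Complex.exp (-(r * a))) (-(Complex.exp (-(s * a)) * a)) s := by
      have h3 : HasDerivAt (fun r : ℝ => -((r : ℂ) * a)) (-a) s := by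
        have h4 := ((Complex.ofRealCLM.hasDerivAt (x := s)).mul_const a).neg
        exact h4.congr_deriv (by simp)
      have h5 := h3.cexp
      simpa using h5
    have h6 := h2.smul (h s)
    refine h6.congr_deriv ?_
    rw [neg_smul, mul_smul]
    exact add_neg_cancel _
  have h2 := is_const_of_deriv_eq_zero (fun s => (h1 s).differentiableAt) (fun s => (h1 s).deriv) s 0
  simp only [Complex.ofReal_zero, zero_mul, neg_zero, Complex.exp_zero, one_smul] at h2
  rw [← h2, smul_smul, ← Complex.exp_add, add_neg_cancel, Complex.exp_zero, one_smul]

section Kostant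

variable {E F G M : Type*} [NormedAddCommGroup E] [NormedSpace ℝ E] [FiniteDimensional ℝ E]
  [TopologicalSpace G] [ChartedSpace E G] [Group G] [LieGroup 𝓘(ℝ, E) ∞ G]
  [NormedAddCommGroup F] [NormedSpace ℝ F]
  [TopologicalSpace M] [ChartedSpace F M] [MulAction G M] [IsManifold 𝓘(ℝ, F) ∞ M]
  [ContMDiffSMul 𝓘(ℝ, E) 𝓘(ℝ, F) ∞ G M]

/-- A curve in a fibre which is smooth in the total space is smooth. -/
theorem mdifferentiableAt_fiber {N E' V₀ : Type*} [NormedAddCommGroup E'] [NormedSpace ℝ E']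
    [TopologicalSpace N] [ChartedSpace E' N] [NormedAddCommGroup V₀] [NormedSpace ℝ V₀]
    {V : M → Type*} [∀ m, NormedAddCommGroup (V m)] [∀ m, NormedSpace ℝ (V m)]
    [TopologicalSpace (TotalSpace V₀ V)] [FiberBundle V₀ V] [VectorBundle ℝ V₀ V]
    [ContMDiffVectorBundle ∞ V₀ V 𝓘(ℝ, F)] {m : M} {f : N → V m} {x : N}
    (hf : ContMDiffAt 𝓘(ℝ, E') (𝓘(ℝ, F).prod 𝓘(ℝ, V₀)) ∞ (fun x => TotalSpace.mk' V₀ m (f x)) x) :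
    MDifferentiableAt 𝓘(ℝ, E') 𝓘(ℝ, V m) f x := by
  have h1 := ((contMDiffAt_totalSpace (IB := 𝓘(ℝ, F))).1 hf).2
  let e := (trivializationAt V₀ V m).continuousLinearEquivAt ℝ m (mem_baseSet_trivializationAt V₀ V m)
  have h2 := (e.symm : V₀ →L[ℝ] V m).contMDiff.contMDiffAt.comp x h1
  refine (h2.mdifferentiableAt (by simp)).congr_of_eventuallyEq
    (Filter.Eventually.of_forall fun x => ?_)
  exact (e.symm_apply_apply (f x)).symm

variable (L : EquivariantHermitianLineBundle E F G M)

theorem mdifferentiableAt_translate {s : ∀ m, L.Fiber m} {m : M} (hs : SmoothSectionAt F ℂ s m) :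
    MDifferentiableAt 𝓘(ℝ, E) 𝓘(ℝ, L.Fiber m) (fun g : G => L.translate g s m) 1 := by
  refine mdifferentiableAt_fiber (F := F) (V₀ := ℂ) (V := L.Fiber) ?_
  have h1 : ContMDiffAt 𝓘(ℝ, E) 𝓘(ℝ, F) ∞ (fun g : G => g • m) 1 :=
    ((contMDiff_smul (I := 𝓘(ℝ, E)) (I' := 𝓘(ℝ, F)) (n := ∞) (G := G)
      (M := M)).comp (contMDiff_id.prodMk contMDiff_const)).contMDiffAt
  have h2 : ContMDiffAt 𝓘(ℝ, E) (𝓘(ℝ, F).prod 𝓘(ℝ, ℂ)) ∞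
      (fun g : G => TotalSpace.mk' ℂ (g • m) (s (g • m))) 1 :=
    ContMDiffAt.comp (f := fun g : G => g • m) (g := fun m => TotalSpace.mk' ℂ m (s m)) _
      (by rw [one_smul]; exact hs) h1
  have h3 : ContMDiffAt 𝓘(ℝ, E) 𝓘(ℝ, E) ∞ (fun g : G => g⁻¹) 1 :=
    (contMDiff_inv 𝓘(ℝ, E) ∞).contMDiffAt
  have h4 := (L.action.contMDiff_act.contMDiffAt).comp (1 : G) (h3.prodMk h2)
  refine h4.congr_of_eventuallyEq (Filter.Eventually.of_forall fun g => ?_)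
  exact L.action.mk_act_symm g m (s (g • m))

theorem translate_eq_isotropy_symm {g : G} {m : M} (h : g • m = m) (s : ∀ m, L.Fiber m) :
    L.translate g s m = (L.action.isotropy h).symm (s m) := by
  rw [LinearEquiv.eq_symm_apply, BundleAction.isotropy_apply]
  have h1 : ∀ (m' : M) (h : m' = m), fiberCast L.Fiber h (s m') = s m := by
    rintro _ rfl; rfl
  refine Eq.trans ?_ (h1 _ h)
  exact congrArg _ ((L.action.act g m).apply_symm_apply (s (g • m)))

/-- The infinitesimal action of a one-parameter group of stabilizers vanishes. -/
theorem fundamentalField_eq_zero {X : LieAlg E G} {γ : ℝ → G} (hγ : IsOneParameterSubgroup X γ)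
    {m : M} (h : ∀ s, γ s • m = m) : fundamentalField F X m = 0 := by
  have h1 : HasMFDerivAt 𝓘(ℝ, E) 𝓘(ℝ, F) (fun g : G => g • m) 1
      (mfderiv 𝓘(ℝ, E) 𝓘(ℝ, F) (fun g : G => g • m) 1) :=
    ((((contMDiff_smul (I := 𝓘(ℝ, E)) (I' := 𝓘(ℝ, F)) (n := ∞) (G := G)
      (M := M)).comp (contMDiff_id.prodMk contMDiff_const)).mdifferentiableAt
        (by simp)).hasMFDerivAt)
  have h2 : ∀ k : G, k = 1 → HasMFDerivAt 𝓘(ℝ, E) 𝓘(ℝ, F) (fun g : G => g • m) k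
      (mfderiv 𝓘(ℝ, E) 𝓘(ℝ, F) (fun g : G => g • m) 1 : E →L[ℝ] F) := by
    rintro k rfl; exact h1
  have h3 := HasMFDerivAt.comp (f := γ) (0 : ℝ) (h2 _ (IsOneParameterSubgroup.map_zero (E := E) (X := (X : E)) hγ))
    (IsOneParameterSubgroup.hasMFDerivAt_zero (E := E) (X := (X : E)) hγ)
  have h4 : HasMFDerivAt 𝓘(ℝ, ℝ) 𝓘(ℝ, F) (fun s => γ s • m) 0 (0 : ℝ →L[ℝ] F) := by
    have h5 : (fun s => γ s • m) = fun _ => m := funext h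
    rw [h5]
    exact hasMFDerivAt_const m 0
  have h6 : ∀ A B : ℝ →L[ℝ] F, A = B → A 1 = B 1 := by rintro A _ rfl; rfl
  have h7 := h6 _ _ (hasMFDerivAt_unique h3 h4)
  have h8 : ∀ D : E →L[ℝ] F, D.comp ((1 : ℝ →L[ℝ] ℝ).smulRight (X : E)) 1 = 0 → -(D X) = 0 := by
    intro D hD
    have h9 : D ((1 : ℝ) • (X : E)) = 0 := hD
    rw [one_smul] at h9
    rw [h9, neg_zero]
  exact h8 _ h7

variable [IsManifold 𝓘(ℝ, F) 1 M] {L}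
  {Ω : ∀ m : M, TangentSpace 𝓘(ℝ, F) m →ₗ[ℝ] TangentSpace 𝓘(ℝ, F) m →ₗ[ℝ] ℝ}
  {Φ : M → LieDual E G}

/-- The action of a one-parameter group of stabilizers on the fibre of a prequantum line bundle. -/
theorem PrequantumConnection.isotropy_eq (C : PrequantumConnection L Ω Φ) {X : LieAlg E G}
    {γ : ℝ → G} (hγ : IsOneParameterSubgroup X γ) {m : M} (h : ∀ s, γ s • m = m) (l : L.Fiber m)
    (s : ℝ) : L.action.isotropy (h s) l = Complex.exp (s * (Complex.I * Φ m X)) • l := by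
  have hadd : ∀ a b l, L.action.isotropy (h (a + b)) l =
      L.action.isotropy (h a) (L.action.isotropy (h b) l) := fun a b l => by
    rw [← L.action.isotropy_mul (h a) (h b) (by rw [mul_smul, h b, h a])]
    exact L.action.isotropy_congr (hγ.2.1 a b) _ _ l
  have h0 : ∀ l, L.action.isotropy (h 0) l = l := fun l => by
    rw [L.action.isotropy_congr (IsOneParameterSubgroup.map_zero (E := E) (X := (X : E)) hγ) (h 0)
      (one_smul G m) l, L.action.isotropy_one]
  have hneg : ∀ a l, (L.action.isotropy (h a)).symm l = L.action.isotropy (h (-a)) l := fun a l => by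
    rw [LinearEquiv.symm_apply_eq, ← hadd]
    exact (h0 l).symm.trans (L.action.isotropy_congr (by rw [add_neg_cancel]) _ _ l)
  have hderiv : ∀ l, HasDerivAt (fun r => L.action.isotropy (h r) l)
      ((Complex.I * Φ m X) • l) 0 := by
    intro l
    obtain ⟨σ, hσ, hσl⟩ : ∃ σ : ∀ m, L.Fiber m, SmoothSectionAt F ℂ σ m ∧ σ m = l :=
      ⟨_, smoothSectionAt_symmL (F := F) (E₁ := L.Fiber) m
        ((trivializationAt ℂ L.Fiber m).continuousLinearMapAt ℝ m l),
        (trivializationAt ℂ L.Fiber m).symmL_continuousLinearMapAt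
          (mem_baseSet_trivializationAt ℂ L.Fiber m) l⟩
    have h1 := C.kostant X σ m (hσ.mdifferentiableAt (by simp))
    rw [fundamentalField_eq_zero hγ h, map_zero, sub_zero, hσl] at h1
    have h2 := (mdifferentiableAt_translate L hσ).hasMFDerivAt
    have h3 := IsOneParameterSubgroup.hasDerivAt_comp (E := E) (G := G) (X := (X : E)) hγ
      (f := fun g : G => L.translate g σ m) h2
    have h4 : HasDerivAt (fun r => L.action.isotropy (h (-r)) l)
        (-((Complex.I * Φ m X) • l)) 0 := by
      refine (h3.congr_deriv ?_).congr_of_eventuallyEq (Filter.Eventually.of_forall fun r => ?_)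
      · rw [← h1]
        exact (neg_neg _).symm
      · change L.action.isotropy (h (-r)) l = L.translate (γ r) σ m
        rw [translate_eq_isotropy_symm L (h r), hneg, hσl]
    have h5 : HasDerivAt (fun r : ℝ => -r) (-1) 0 := hasDerivAt_neg 0
    have h6 := HasDerivAt.scomp (h := fun r : ℝ => -r) (0 : ℝ) (by rw [neg_zero]; exact h4) h5
    simpa [Function.comp_def] using h6
  have hall : ∀ r, HasDerivAt (fun r => L.action.isotropy (h r) l)
      ((Complex.I * Φ m X) • L.action.isotropy (h r) l) r := by
    intro r
    have h1 : HasDerivAt (fun x => L.action.isotropy (h x) (L.action.isotropy (h r) l))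
      ((Complex.I * Φ m X) • L.action.isotropy (h r) l) (r - r) := by
      rw [sub_self]; exact hderiv _
    have h2 := HasDerivAt.comp_sub_const r r h1
    refine h2.congr_of_eventuallyEq (Filter.Eventually.of_forall fun x => ?_)
    exact (L.action.isotropy_congr (by rw [sub_add_cancel]) _ _ l).trans (hadd (x - r) r l)
  have h1 := eq_exp_smul_of_hasDerivAt hall s
  rw [h0] at h1
  exact h1

end Kostant

section RotationInvariant

variable {b : ℂ →ₗ[ℝ] ℂ →ₗ[ℝ] ℝ} {a c : ℝ}

theorem exp_mul_eq_cos_smul_add (x : ℝ) (z : ℂ) :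
    Complex.exp (Complex.I * x) * z = Real.cos x • z + Real.sin x • (Complex.I * z) := by
  rw [mul_comm Complex.I, Complex.exp_mul_I, Complex.real_smul, Complex.real_smul,
    Complex.ofReal_cos, Complex.ofReal_sin]
  ring

theorem rotation_invariant_even (h : ∀ (s : ℝ) (z w : ℂ), b (Complex.exp (Complex.I * (s * a : ℝ)) * z)
    (Complex.exp (Complex.I * (s * c : ℝ)) * w) = b z w) (s : ℝ) (z w : ℂ) :
    Real.cos (s * a) * Real.cos (s * c) * b z w +
      Real.sin (s * a) * Real.sin (s * c) * b (Complex.I * z) (Complex.I * w) = b z w := by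
  have h1 := h s z w
  have h2 := h (-s) z w
  simp only [exp_mul_eq_cos_smul_add, neg_mul, Real.cos_neg, Real.sin_neg, map_add,
    map_smul, LinearMap.add_apply, LinearMap.smul_apply, smul_eq_mul] at h1 h2
  linarith

theorem map_I_mul_I_mul (z w : ℂ) : b (Complex.I * (Complex.I * z)) (Complex.I * (Complex.I * w)) =
    b z w := by
  rw [← mul_assoc, ← mul_assoc, Complex.I_mul_I, neg_one_mul, neg_one_mul, map_neg, map_neg,
    LinearMap.neg_apply, neg_neg]

theorem map_I_mul_of_add_ne_zero (h : ∀ (s : ℝ) (z w : ℂ),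
    b (Complex.exp (Complex.I * (s * a : ℝ)) * z)
      (Complex.exp (Complex.I * (s * c : ℝ)) * w) = b z w) (hac : a + c ≠ 0) (z w : ℂ) :
    b (Complex.I * z) (Complex.I * w) = b z w := by
  have h1 := rotation_invariant_even h (Real.pi / (a + c)) z w
  have h2 := rotation_invariant_even h (Real.pi / (a + c)) (Complex.I * z) (Complex.I * w)
  rw [map_I_mul_I_mul] at h2
  have h3 := Real.cos_add (Real.pi / (a + c) * a) (Real.pi / (a + c) * c)
  rw [← mul_add, div_mul_cancel₀ _ hac, Real.cos_pi] at h3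
  linear_combination (1 / 2) * h1 - (1 / 2) * h2 + (1 / 2) *
    (b z w - b (Complex.I * z) (Complex.I * w)) * h3

theorem map_I_mul_of_sub_ne_zero (h : ∀ (s : ℝ) (z w : ℂ),
    b (Complex.exp (Complex.I * (s * a : ℝ)) * z)
      (Complex.exp (Complex.I * (s * c : ℝ)) * w) = b z w) (hac : a - c ≠ 0) (z w : ℂ) :
    b (Complex.I * z) (Complex.I * w) = -b z w := by
  have h1 := rotation_invariant_even h (Real.pi / (a - c)) z w
  have h2 := rotation_invariant_even h (Real.pi / (a - c)) (Complex.I * z) (Complex.I * w)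
  rw [map_I_mul_I_mul] at h2
  have h3 := Real.cos_sub (Real.pi / (a - c) * a) (Real.pi / (a - c) * c)
  rw [← mul_sub, div_mul_cancel₀ _ hac, Real.cos_pi] at h3
  linear_combination -(1 / 2) * h1 - (1 / 2) * h2 - (1 / 2) *
    (b z w + b (Complex.I * z) (Complex.I * w)) * h3

end RotationInvariant

/-- A symmetric form on `ℂ^N` which is invariant under a torus acting with pairwise distinct,
non-opposite weights is diagonal. -/
theorem bilin_self_eq_sum {N : ℕ} {T : Type*} [AddCommGroup T] [Module ℝ T]
    {root : Fin N → T →ₗ[ℝ] ℝ} {X₀ : T} (hneg : ∀ j, root j X₀ < 0)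
    (hinj : Function.Injective root) {B : (Fin N → ℂ) →ₗ[ℝ] (Fin N → ℂ) →ₗ[ℝ] ℝ}
    (hsymm : ∀ z w, B z w = B w z)
    (hB : ∀ (X : T) z w, B (fun j => Complex.exp (Complex.I * (root j X : ℝ)) * z j)
      (fun j => Complex.exp (Complex.I * (root j X : ℝ)) * w j) = B z w) (z : Fin N → ℂ) :
    B z z = ∑ j, ‖z j‖ ^ 2 * B (Pi.single j 1) (Pi.single j 1) := by
  classical
  let b : Fin N → Fin N → ℂ →ₗ[ℝ] ℂ →ₗ[ℝ] ℝ := fun j k =>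
    B.compl₁₂ (LinearMap.single ℝ (fun _ => ℂ) j) (LinearMap.single ℝ (fun _ => ℂ) k)
  have hb : ∀ j k z w, b j k z w = B (Pi.single j z) (Pi.single k w) := fun j k z w => rfl
  have hsingle : ∀ (X : T) j (z : ℂ), (fun i => Complex.exp (Complex.I * (root i X : ℝ)) *
      (Pi.single j z : Fin N → ℂ) i) = Pi.single j (Complex.exp (Complex.I * (root j X : ℝ)) * z) := by
    intro X j z
    funext i
    rcases eq_or_ne i j with rfl | hij
    · simp
    · simp [hij]
  have hinv : ∀ j k (X : T) (s : ℝ) (z w : ℂ),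
      b j k (Complex.exp (Complex.I * (s * root j X : ℝ)) * z)
        (Complex.exp (Complex.I * (s * root k X : ℝ)) * w) = b j k z w := by
    intro j k X s z w
    have h := hB (s • X) (Pi.single j z) (Pi.single k w)
    rw [hsingle, hsingle] at h
    rw [hb, hb, ← h]
    simp
  have hoff : ∀ j k, j ≠ k → ∀ z w, b j k z w = 0 := by
    intro j k hjk z w
    have h1 := map_I_mul_of_add_ne_zero (hinv j k X₀) (by linarith [hneg j, hneg k]) z w
    obtain ⟨X, hX⟩ : ∃ X, root j X - root k X ≠ 0 := by
      by_contra! hall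
      exact hjk (hinj (LinearMap.ext fun X => sub_eq_zero.1 (hall X)))
    have h2 := map_I_mul_of_sub_ne_zero (hinv j k X) hX z w
    linarith
  have hdiag : ∀ j z, b j j z z = ‖z‖ ^ 2 * b j j 1 1 := by
    intro j z
    have h1 := map_I_mul_of_add_ne_zero (hinv j j X₀) (by linarith [hneg j])
    have h2 : z = z.re • (1 : ℂ) + z.im • (Complex.I * 1) := by
      rw [Complex.real_smul, Complex.real_smul, mul_one, mul_one, mul_comm (z.im : ℂ), mul_comm Complex.I]
      exact (Complex.re_add_im z).symm
    have h3 := h1 1 (Complex.I * 1)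
    rw [← mul_assoc, Complex.I_mul_I, neg_one_mul, map_neg] at h3
    have h4 : b j j (Complex.I * 1) 1 = b j j 1 (Complex.I * 1) := by
      rw [hb, hb, hsymm]
    have h5 := h1 1 1
    have h6 : ‖z‖ ^ 2 = z.re * z.re + z.im * z.im := by
      rw [Complex.sq_norm, Complex.normSq_apply]
    rw [h6]
    conv_lhs => rw [h2]
    simp only [map_add, map_smul, LinearMap.add_apply, LinearMap.smul_apply, smul_eq_mul]
    rw [h5]
    linear_combination (-z.re * z.im) * h3 + (0 : ℝ) * h4
  have hz : z = ∑ j, Pi.single j (z j) := (Finset.univ_sum_single z).symm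
  conv_lhs => rw [hz]
  rw [map_sum]
  refine Finset.sum_congr rfl fun j _ => ?_
  rw [map_sum, LinearMap.sum_apply, Finset.sum_eq_single j]
  · exact hdiag j (z j)
  · intro k _ hkj
    exact hoff k j hkj _ _
  · simp

namespace TorusData

variable {E G : Type*} [NormedAddCommGroup E] [NormedSpace ℝ E] [FiniteDimensional ℝ E]
  [TopologicalSpace G] [ChartedSpace E G] [Group G] [LieGroup 𝓘(ℝ, E) ∞ G]
  {H : Subgroup G} {cartan : Submodule ℝ E} {lam : E →L[ℝ] ℝ}
  (D : TorusData H cartan lam)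

open LinearOrbit

theorem smul_base (D : TorusData H cartan lam) {t : G} (ht : t ∈ H) :
    t • LinearOrbit.mk E (coAd E G) lam 1 = LinearOrbit.mk E (coAd E G) lam 1 := by
  rw [smul_mk, mul_one, mk_eq_mk, (D.stabilizer t).2 ht, map_one]
  rfl

theorem coord_smul_base {t : G} (ht : t ∈ H) (u : OrbitModel E (coAd E G) lam) :
    D.coord 1 (smulDeriv (OrbitModel E (coAd E G) lam) t (LinearOrbit.mk E (coAd E G) lam 1) u :
      OrbitModel E (coAd E G) lam) = D.charVec t * D.coord 1 u := by
  have h := D.coord_smul t 1 u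
  rw [mul_one] at h
  refine (D.coord_mul' 1 ht _).trans ?_
  rw [one_mul]
  exact congrArg (fun z => D.charVec t * z) h

theorem charVec_expCurve (X : cartan) : D.charVec (expCurve G (X : E) 1) =
    fun j => Complex.exp (Complex.I * (D.root j X : ℝ)) := by
  funext j
  have h := isOneParameterSubgroup_expCurve (G := G) (X : E)
  rw [charVec, extend_apply _ (D.curve_mem X X.2 _ h 1)]
  have h1 := D.char_curve j X (fun s => ⟨expCurve G (X : E) s, D.curve_mem X X.2 _ h s⟩) h 1
  rw [one_mul] at h1
  exact h1

set_option maxHeartbeats 1000000 in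
/-- An invariant metric is a multiple of the standard one in each of the coordinates. -/
theorem exists_unitary_coord
    {h : RiemannianMetricOn (OrbitModel E (coAd E G) lam) (LinearOrbit E (coAd E G) lam)}
    (hinv : InvariantMetric G h) :
    ∃ z : TangentSpace 𝓘(ℝ, OrbitModel E (coAd E G) lam) (LinearOrbit.mk E (coAd E G) lam 1) →ₗ[ℝ]
      (Fin D.N → ℂ), Function.Bijective z ∧
      (∀ u, cliffordForm h (LinearOrbit.mk E (coAd E G) lam 1) u = -∑ j, ‖z u j‖ ^ 2) ∧
      ∀ t ∈ H, ∀ u, z (smulDeriv (OrbitModel E (coAd E G) lam) t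
        (LinearOrbit.mk E (coAd E G) lam 1) u : OrbitModel E (coAd E G) lam) = D.charVec t * z u := by
  obtain ⟨p, hp⟩ : ∃ p, p = LinearOrbit.mk E (coAd E G) lam 1 := ⟨_, rfl⟩
  let hI : LinearOrbit E (coAd E G) lam →
    OrbitModel E (coAd E G) lam →L[ℝ] OrbitModel E (coAd E G) lam →L[ℝ] ℝ := h.inner
  let e : OrbitModel E (coAd E G) lam ≃ₗ[ℝ] (Fin D.N → ℂ) :=
    LinearEquiv.ofBijective (D.coord 1 : OrbitModel E (coAd E G) lam →ₗ[ℝ] (Fin D.N → ℂ))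
      (D.bijective_coord 1)
  have he : ∀ u, e u = D.coord 1 u := fun u => rfl
  let B : (Fin D.N → ℂ) →ₗ[ℝ] (Fin D.N → ℂ) →ₗ[ℝ] ℝ := LinearMap.mk₂ ℝ
    (fun z w => hI (LinearOrbit.mk E (coAd E G) lam 1) (e.symm z) (e.symm w))
    (by simp) (by simp) (by simp) (by simp)
  have hBapp : ∀ u v, B (e u) (e v) = hI (LinearOrbit.mk E (coAd E G) lam 1) u v := fun u v => by
    change hI _ (e.symm (e u)) (e.symm (e v)) = _
    rw [e.symm_apply_apply, e.symm_apply_apply]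
  have hB : ∀ t ∈ H, ∀ z w, B (D.charVec t * z) (D.charVec t * w) = B z w := by
    intro t ht z w
    obtain ⟨u, rfl⟩ := e.surjective z
    obtain ⟨v, rfl⟩ := e.surjective w
    have hd : ∀ u : OrbitModel E (coAd E G) lam, ∃ u' : OrbitModel E (coAd E G) lam,
        u' = smulDeriv (OrbitModel E (coAd E G) lam) t (LinearOrbit.mk E (coAd E G) lam 1) u ∧
        e u' = D.charVec t * e u := fun u => ⟨_, rfl, D.coord_smul_base ht u⟩
    obtain ⟨u', hu', hu⟩ := hd u
    obtain ⟨v', hv', hv⟩ := hd v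
    rw [← hu, ← hv, hBapp, hBapp, hu', hv']
    refine Eq.trans ?_ (hinv t (LinearOrbit.mk E (coAd E G) lam 1) u v)
    have h1 : ∀ m, m = LinearOrbit.mk E (coAd E G) lam 1 → ∀ a b,
        hI (LinearOrbit.mk E (coAd E G) lam 1) a b = hI m a b := by
      rintro m rfl a b; rfl
    exact h1 _ (D.smul_base ht) _ _
  have hdiag := bilin_self_eq_sum (X₀ := ⟨D.elt, D.elt_mem⟩) D.root_neg D.root_injective (B := B)
    (fun z w => h.symm _ _ _) (fun X z w => by
      have h1 := hB _ (D.curve_mem X X.2 _ (isOneParameterSubgroup_expCurve (G := G) (X : E)) 1) z w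
      rw [D.charVec_expCurve] at h1
      exact h1)
  have hpos : ∀ j, 0 < B (Pi.single j 1) (Pi.single j 1) := by
    intro j
    refine h.pos _ _ fun h0 => ?_
    have h1 : e (e.symm (Pi.single j 1)) = 0 := (congrArg e h0).trans e.map_zero
    rw [e.apply_symm_apply] at h1
    have h2 := congrFun h1 j
    simp at h2
  choose r hr using fun j => (⟨Real.sqrt _, Real.sqrt_pos.2 (hpos j), Real.sq_sqrt (hpos j).le⟩ :
    ∃ r : ℝ, 0 < r ∧ r ^ 2 = B (Pi.single j 1) (Pi.single j 1))
  let R : (Fin D.N → ℂ) →ₗ[ℝ] (Fin D.N → ℂ) :=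
    { toFun := fun z j => (r j : ℂ) * z j
      map_add' := fun z w => by funext j; simp [mul_add]
      map_smul' := fun a z => by funext j; simp [mul_left_comm] }
  have hRbij : Function.Bijective R := by
    refine ⟨(injective_iff_map_eq_zero _).2 fun z hz => funext fun j => ?_, fun z => ?_⟩
    · have h1 : (r j : ℂ) * z j = 0 := congrFun hz j
      exact (mul_eq_zero.1 h1).resolve_left (Complex.ofReal_ne_zero.2 (hr j).1.ne')
    · refine ⟨fun j => (r j : ℂ)⁻¹ * z j, funext fun j => ?_⟩
      exact mul_inv_cancel_left₀ (Complex.ofReal_ne_zero.2 (hr j).1.ne') _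
  refine ⟨R ∘ₗ (e : OrbitModel E (coAd E G) lam →ₗ[ℝ] (Fin D.N → ℂ)), hRbij.comp e.bijective,
    fun u => ?_, fun t ht u => ?_⟩
  · refine congrArg Neg.neg (((hBapp u u).symm.trans (hdiag (e u))).trans ?_)
    refine Finset.sum_congr rfl fun j _ => ?_
    change _ = ‖(r j : ℂ) * e u j‖ ^ 2
    rw [norm_mul, mul_pow, Complex.norm_real, Real.norm_eq_abs, sq_abs, (hr j).2, mul_comm]
  · funext j
    have h1 := congrFun (D.coord_smul_base ht u) j
    change (r j : ℂ) * D.coord 1 _ j = D.charVec t j * ((r j : ℂ) * D.coord 1 u j)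
    refine (congrArg (fun x => (r j : ℂ) * x) h1).trans ?_
    rw [Pi.mul_apply]
    ring

end TorusData

namespace SpinorModel

variable {N : ℕ} {V : Type} [NormedAddCommGroup V] [NormedSpace ℂ V] {W U : Type*}
  [AddCommGroup W] [Module ℂ W] (S : SpinorModel N V)

theorem exists_ne_zero (S : SpinorModel N V) : ∃ v : V, v ≠ 0 := by
  by_contra! h
  have h1 : Subsingleton V := ⟨fun v w => (h v).trans (h w).symm⟩
  have h2 := S.finrank_eq
  rw [Module.finrank_zero_of_subsingleton] at h2
  exact (pow_ne_zero N (two_ne_zero (α := ℕ))) h2.symm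

theorem τ_τ_inv {u : Fin N → ℂ} (hu : ∀ j, ‖u j‖ = 1) (v : V) : S.τ u (S.τ u⁻¹ v) = v := by
  have h : u * u⁻¹ = 1 := funext fun j =>
    mul_inv_cancel₀ (norm_ne_zero_iff.1 (by rw [hu j]; exact one_ne_zero))
  have h1 := DFunLike.congr_fun (S.τ_mul u u⁻¹) v
  rw [h, S.τ_one] at h1
  exact h1.symm

theorem τ_ne_zero {u : Fin N → ℂ} (hu : ∀ j, ‖u j‖ = 1) {v : V} (hv : v ≠ 0) : S.τ u v ≠ 0 := by
  intro h
  have h1 := S.τ_τ_inv (u := u⁻¹) (by intro j; rw [Pi.inv_apply, norm_inv, hu j, inv_one]) v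
  rw [inv_inv, h, map_zero] at h1
  exact hv h1.symm

/-- A map which intertwines Clifford multiplication with its rotation by `u` is a multiple of the
action of `u`. -/
theorem exists_eq_smul_τ (T : V ≃ₗ[ℂ] W) (A : W ≃ₗ[ℂ] W) {u : Fin N → ℂ} (hu : ∀ j, ‖u j‖ = 1)
    {z : U → Fin N → ℂ} (hz : Function.Surjective z) {f : U → Module.End ℂ W}
    (hT : ∀ x v, T (S.c (z x) v) = f x (T v)) {σ : U → U} (hσ : ∀ x, z (σ x) = u * z x)
    (hA : ∀ x w, A (f x w) = f (σ x) (A w)) :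
    ∃ ψ : ℂ, ψ ≠ 0 ∧ ∀ v, A (T v) = ψ • T (S.τ u v) := by
  have hu' : ∀ j, ‖u⁻¹ j‖ = 1 := fun j => by rw [Pi.inv_apply, norm_inv, hu j, inv_one]
  have huu : ∀ w : Fin N → ℂ, u⁻¹ * (u * w) = w := fun w => funext fun j =>
    inv_mul_cancel_left₀ (norm_ne_zero_iff.1 (by rw [hu j]; exact one_ne_zero)) _
  obtain ⟨ψ, hψ⟩ := S.exists_eq_smul
    (A := S.τ u⁻¹ ∘ₗ (T.symm : W →ₗ[ℂ] V) ∘ₗ (A : W →ₗ[ℂ] W) ∘ₗ (T : V →ₗ[ℂ] W)) fun w v => by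
      obtain ⟨x, rfl⟩ := hz w
      have h1 : T.symm (f (σ x) (A (T v))) = S.c (u * z x) (T.symm (A (T v))) := by
        rw [LinearEquiv.symm_apply_eq, ← hσ, hT, LinearEquiv.apply_symm_apply]
      simp only [LinearMap.comp_apply, LinearEquiv.coe_coe]
      rw [hT, hA, h1, S.τ_c _ _ _ hu', huu]
  have h1 : ∀ v, A (T v) = ψ • T (S.τ u v) := by
    intro v
    have h2 := congrArg (S.τ u) (hψ v)
    simp only [LinearMap.comp_apply, LinearEquiv.coe_coe] at h2
    rw [S.τ_τ_inv hu, LinearEquiv.symm_apply_eq] at h2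
    rw [h2, map_smul, map_smul]
  refine ⟨ψ, fun h0 => ?_, h1⟩
  obtain ⟨v, hv⟩ := S.exists_ne_zero
  have h2 := h1 v
  rw [h0, zero_smul] at h2
  exact hv (T.injective (A.injective (by rw [h2, map_zero, map_zero])))

theorem scalar_unique (T : V ≃ₗ[ℂ] W) {u : Fin N → ℂ} (hu : ∀ j, ‖u j‖ = 1) {a b : ℂ}
    (h : ∀ v, a • T (S.τ u v) = b • T (S.τ u v)) : a = b := by
  obtain ⟨v, hv⟩ := S.exists_ne_zero
  refine smul_left_injective ℂ (m := T (S.τ u v)) ?_ (h v)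
  exact fun h0 => S.τ_ne_zero hu hv (T.map_eq_zero_iff.1 h0)

/-- The action on the determinant line in terms of the action on the spinors. -/
theorem det_scalar (T : V ≃ₗ[ℂ] W) (A : W ≃ₗ[ℂ] W) {u : Fin N → ℂ} (hu : ∀ j, ‖u j‖ = 1) {ψ β : ℂ}
    (hψ : ∀ v, A (T v) = ψ • T (S.τ u v))
    (hβ : ∀ w, β • T (S.conj (T.symm (A w))) = A (T (S.conj (T.symm w)))) :
    β * starRingEnd ℂ ψ = ψ * ∏ j, u j := by
  obtain ⟨v, hv⟩ := S.exists_ne_zero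
  have h1 := hβ (T v)
  rw [hψ, map_smul, LinearEquiv.symm_apply_apply, LinearEquiv.symm_apply_apply,
    LinearMap.map_smulₛₗ, hψ, S.τ_conj _ _ hu, map_smul, map_smul, smul_smul, smul_smul] at h1
  refine smul_left_injective ℂ (m := T (S.conj (S.τ u v))) ?_ h1
  intro h0
  exact S.τ_ne_zero hu hv (S.conj_bijective.1 ((T.map_eq_zero_iff.1 h0).trans (map_zero _).symm))

/-- The scalars of a group of maps which agree with the standard action up to scalars form a
character. -/
theorem exists_hom {K : Type*} [Group K] (T : V ≃ₗ[ℂ] W) (A : K → W ≃ₗ[ℂ] W)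
    (hA1 : ∀ w, A 1 w = w) (hA : ∀ a b w, A (a * b) w = A a (A b w)) {u : K → Fin N → ℂ}
    (hu : ∀ t j, ‖u t j‖ = 1) (hu1 : u 1 = 1) (humul : ∀ a b, u (a * b) = u a * u b)
    (hex : ∀ t, ∃ ψ : ℂ, ψ ≠ 0 ∧ ∀ v, A t (T v) = ψ • T (S.τ (u t) v)) :
    ∃ ψ : K →* ℂ, (∀ t, ψ t ≠ 0) ∧ ∀ t v, A t (T v) = ψ t • T (S.τ (u t) v) := by
  choose ψ hψ0 hψ using hex
  refine ⟨⟨⟨ψ, ?_⟩, fun a b => ?_⟩, hψ0, hψ⟩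
  · refine S.scalar_unique T (hu 1) fun v => ?_
    rw [← hψ 1 v, hA1, hu1, S.τ_one, one_smul]
    rfl
  · refine S.scalar_unique T (hu (a * b)) fun v => ?_
    refine (hψ (a * b) v).symm.trans ?_
    rw [hA, hψ, map_smul, hψ, smul_smul, mul_comm (ψ b), humul, S.τ_mul]
    rfl

end SpinorModel

section Isotropy

variable {E F G M : Type*} [NormedAddCommGroup E] [NormedSpace ℝ E]
  [TopologicalSpace G] [ChartedSpace E G] [Group G]
  [NormedAddCommGroup F] [NormedSpace ℝ F]
  [TopologicalSpace M] [ChartedSpace F M] [MulAction G M] [IsManifold 𝓘(ℝ, F) 1 M]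
  {h : RiemannianMetricOn F M} (S : EquivariantSpincBundle E G h)

theorem EquivariantSpincBundle.isotropy_clifford {t : G} {p : M} (ht : t • p = p)
    (v : F) (w : S.Fiber p) :
    S.action.isotropy ht (S.clifford p (CliffordAlgebra.ι (cliffordForm h p) v) w) =
      S.clifford p (CliffordAlgebra.ι (cliffordForm h p) (smulDeriv F t p v : F))
        (S.action.isotropy ht w) := by
  have h1 : ∀ (m : M) (hm : m = p) (v : F) (w : S.Fiber m),
      fiberCast S.Fiber hm (S.clifford m (CliffordAlgebra.ι (cliffordForm h m) v) w) =
        S.clifford p (CliffordAlgebra.ι (cliffordForm h p) v) (fiberCast S.Fiber hm w) := by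
    rintro m rfl v w; rfl
  exact (congrArg (fiberCast S.Fiber ht) (S.equivariant_clifford t p v w)).trans (h1 _ ht _ _)

theorem DetLineIso.isotropy {L : EquivariantHermitianLineBundle E F G M} (I : DetLineIso S L)
    {t : G} {p : M} (ht : t • p = p) (l : L.Fiber p) (w : S.Fiber p) :
    (I.iso p (L.action.isotropy ht l)).1 (S.action.isotropy ht w) =
      S.action.isotropy ht ((I.iso p l).1 w) := by
  have h1 : ∀ (m : M) (hm : m = p) (l : L.Fiber m) (w : S.Fiber m),
      (I.iso p (fiberCast L.Fiber hm l)).1 (fiberCast S.Fiber hm w) =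
        fiberCast S.Fiber hm ((I.iso m l).1 w) := by
    rintro m rfl l w; rfl
  exact (h1 _ ht _ _).trans (congrArg (fiberCast S.Fiber ht) (I.equivariant_iso t p l w))

/-- The stabilizer of a point acts on the spinors at this point by the standard action up to scalars,
which are related to the action on the determinant line. -/
theorem EquivariantSpincBundle.exists_scalars {L : EquivariantHermitianLineBundle E F G M}
    (I : DetLineIso S L) {H : Subgroup G} {p : M} (hst : ∀ t : H, (t : G) • p = p) {N : ℕ} {V : Type}
    [NormedAddCommGroup V] [NormedSpace ℂ V] (Sp : SpinorModel N V)
    {z : TangentSpace 𝓘(ℝ, F) p →ₗ[ℝ] (Fin N → ℂ)} (hz : Function.Bijective z)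
    {T : V ≃ₗ[ℂ] S.Fiber p}
    (hT : ∀ x v, T (Sp.c (z x) v) = S.clifford p (CliffordAlgebra.ι (cliffordForm h p) x) (T v))
    {u : H → Fin N → ℂ} (hu : ∀ t j, ‖u t j‖ = 1) (hu1 : u 1 = 1)
    (humul : ∀ a b, u (a * b) = u a * u b)
    (hzt : ∀ (t : H) x, z (smulDeriv F (t : G) p x : F) = u t * z x) :
    ∃ ψ : H →* ℂ, (∀ t, ψ t ≠ 0) ∧ ∃ l : L.Fiber p,
      ∀ (t : H) (β : ℂ), L.action.isotropy (hst t) l = β • l →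
        β * starRingEnd ℂ (ψ t) = ψ t * ∏ j, u t j := by
  obtain ⟨ψ, hψ0, hψ⟩ := Sp.exists_hom T (fun t : H => S.action.isotropy (hst t))
    (fun w => S.action.isotropy_one w)
    (fun a b w => S.action.isotropy_mul (hst a) (hst b) _ w) hu hu1 humul fun t =>
      Sp.exists_eq_smul_τ T (S.action.isotropy (hst t)) (hu t) hz.2 hT
        (hzt t) fun x w => S.isotropy_clifford (hst t) x w
  refine ⟨ψ, hψ0, ?_⟩
  let K : S.Fiber p →ₛₗ[starRingEnd ℂ] S.Fiber p :=
    ((T : V →ₗ[ℂ] S.Fiber p).comp Sp.conj).comp (T.symm : S.Fiber p →ₗ[ℂ] V)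
  have hK : K ∈ S.detFiber p :=
    commute_clifford_of_ι _ _ fun x w => by
      obtain ⟨v, rfl⟩ := T.surjective w
      change T (Sp.conj (T.symm _)) = S.clifford _ _ (T (Sp.conj (T.symm (T v))))
      rw [← hT, LinearEquiv.symm_apply_apply, LinearEquiv.symm_apply_apply, Sp.conj_c, hT]
  refine ⟨(I.iso p).symm ⟨K, hK⟩, fun t β hβ => ?_⟩
  refine Sp.det_scalar T (S.action.isotropy (hst t)) (hu t) (hψ t) fun w => ?_
  have h1 := I.isotropy S (hst t) ((I.iso p).symm ⟨K, hK⟩) w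
  rw [hβ, map_smul, LinearEquiv.apply_symm_apply] at h1
  exact h1

end Isotropy

namespace TorusData

variable {E G : Type*} [NormedAddCommGroup E] [NormedSpace ℝ E] [FiniteDimensional ℝ E]
  [TopologicalSpace G] [ChartedSpace E G] [Group G] [LieGroup 𝓘(ℝ, E) ∞ G]
  {H : Subgroup G} {cartan : Submodule ℝ E} {lam : E →L[ℝ] ℝ}
  (D : TorusData H cartan lam)

open LinearOrbit

theorem exists_scalars
    {h : RiemannianMetricOn (OrbitModel E (coAd E G) lam) (LinearOrbit E (coAd E G) lam)}
    (hinv : InvariantMetric G h) (S : EquivariantSpincBundle E G h)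
    {L : EquivariantHermitianLineBundle E (OrbitModel E (coAd E G) lam) G
      (LinearOrbit E (coAd E G) lam)} (I : DetLineIso S L) :
    ∃ ψ : H →* ℂ, (∀ t, ψ t ≠ 0) ∧ ∃ l : L.Fiber (LinearOrbit.mk E (coAd E G) lam 1),
      ∀ (t : H) (β : ℂ), L.action.isotropy (D.smul_base t.2) l = β • l →
        β * starRingEnd ℂ (ψ t) = ψ t * ∏ j, D.charVec (t : G) j := by
  obtain ⟨z, hzbij, hzQ, hzt⟩ := D.exists_unitary_coord hinv
  obtain ⟨r, ⟨Sp⟩⟩ := SpinorModel.nonempty_euclideanSpace D.N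
  obtain ⟨T, hT⟩ := Sp.exists_equiv z hzQ hzbij
    (S.clifford (LinearOrbit.mk E (coAd E G) lam 1))
    (S.bijective_clifford (LinearOrbit.mk E (coAd E G) lam 1))
  exact S.exists_scalars I (p := LinearOrbit.mk E (coAd E G) lam 1)
    (fun t : H => D.smul_base t.2) Sp hzbij hT (u := fun t => D.charVec (t : G))
    (fun t => D.norm_charVec (t : G)) D.charVec_one (fun a b => D.charVec_mul a.2 b.2)
    (fun t => hzt t t.2)

end TorusData

/-- The phases of a non-vanishing character. -/
noncomputable def unitaryPart {K : Type*} [Group K] (ψ : K →* ℂ) (hψ : ∀ t, ψ t ≠ 0) :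
    K →* Circle where
  toFun t := ⟨ψ t / ‖ψ t‖, mem_sphere_zero_iff_norm.2 (by
    rw [norm_div, Complex.norm_real, norm_norm, div_self (norm_ne_zero_iff.2 (hψ t))])⟩
  map_one' := Circle.ext (by simp)
  map_mul' a b := Circle.ext (by
    simp only [map_mul, norm_mul, Complex.ofReal_mul]
    exact mul_div_mul_comm _ _ _ _)

theorem unitaryPart_apply {K : Type*} [Group K] (ψ : K →* ℂ) (hψ : ∀ t, ψ t ≠ 0) (t : K) :
    (unitaryPart ψ hψ t : ℂ) = ψ t / ‖ψ t‖ := rfl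

theorem unitaryPart_sq_mul {K : Type*} [Group K] (ψ : K →* ℂ) (hψ : ∀ t, ψ t ≠ 0) {t : K}
    {β p : ℂ} (h : β * starRingEnd ℂ (ψ t) = ψ t * p) :
    (unitaryPart ψ hψ t : ℂ) * unitaryPart ψ hψ t * p = β := by
  have h1 : (‖ψ t‖ : ℂ) ≠ 0 := Complex.ofReal_ne_zero.2 (norm_ne_zero_iff.2 (hψ t))
  have h2 : starRingEnd ℂ (ψ t) * ψ t = ‖ψ t‖ ^ 2 := Complex.conj_mul' _
  rw [unitaryPart_apply]
  field_simp
  linear_combination (-ψ t) * h + β * h2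

namespace TorusData

variable {E G : Type*} [NormedAddCommGroup E] [NormedSpace ℝ E] [FiniteDimensional ℝ E]
  [TopologicalSpace G] [ChartedSpace E G] [Group G] [LieGroup 𝓘(ℝ, E) ∞ G]
  {H : Subgroup G} {cartan : Submodule ℝ E} {lam : LieDual E G}

theorem momentMap_base (X : LieAlg E G) :
    ((2 : ℝ) • momentMap lam (LinearOrbit.mk E (coAd E G) lam.toModel 1)) X = 2 * lam X := by
  have h : momentMap lam (LinearOrbit.mk E (coAd E G) lam.toModel 1) = lam :=
    DFunLike.congr_fun (map_one (coAd E G)) lam.toModel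
  rw [h]
  rfl

/-- The shifted weight of a prequantized orbit is the weight of a character. -/
theorem exists_isWeight (D : TorusData H cartan lam.toModel)
    (h : IsSpincPrequantized (kksForm lam) (momentMap lam)) {μ : cartan →ₗ[ℝ] ℝ}
    (hμ : ∀ X : cartan, (μ + μ + ∑ j, D.root j) X = 2 * lam.toModel X) :
    ∃ χ : H →* Circle, IsWeight χ μ := by
  obtain ⟨g, hg, S, L, ⟨I⟩, ⟨C⟩⟩ := h
  obtain ⟨ψ, hψ0, l, hψ⟩ := D.exists_scalars hg S I
  refine ⟨unitaryPart ψ hψ0, fun X γ hγ s => ?_⟩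
  have hβ := C.isotropy_eq hγ (fun s => D.smul_base (γ s).2) l (s / 2)
  have h1 := unitaryPart_sq_mul ψ hψ0 (hψ (γ (s / 2)) _ hβ)
  have hmul : γ s = γ (s / 2) * γ (s / 2) :=
    Subtype.ext ((congrArg (fun r => (γ r : G)) (add_halves s).symm).trans (hγ.2.1 (s / 2) (s / 2)))
  have hu : ∏ j, D.charVec (γ (s / 2) : G) j =
      Complex.exp (Complex.I * (s / 2 * (∑ j, D.root j) X : ℝ)) := by
    rw [LinearMap.sum_apply, Finset.mul_sum, Complex.ofReal_sum, Finset.mul_sum, Complex.exp_sum]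
    refine Finset.prod_congr rfl fun j _ => ?_
    rw [charVec, extend_apply _ (γ (s / 2)).2]
    exact D.char_curve j X γ hγ (s / 2)
  rw [hu] at h1
  have hX := hμ X
  rw [hmul, map_mul, Circle.coe_mul, eq_div_of_mul_eq (Complex.exp_ne_zero _) h1, ← Complex.exp_sub]
  have h2 : ∀ r : ℝ, r = 2 * lam.toModel (X : E) →
      (s / 2 : ℝ) * (Complex.I * (r : ℂ)) - Complex.I * (s / 2 * (∑ j, D.root j) X : ℝ) =
        Complex.I * (s * μ X : ℝ) := by
    rintro _ rfl
    rw [← hX]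
    simp only [LinearMap.add_apply]
    push_cast
    ring
  exact congrArg Complex.exp (h2 _ (momentMap_base (E := E) (X : E)))

theorem continuous_of_isWeight (D : TorusData H cartan lam.toModel) {χ : H →* Circle}
    {μ : cartan →ₗ[ℝ] ℝ} (hχ : IsWeight χ μ) : Continuous χ := by
  have : IsTopologicalGroup G := topologicalGroup_of_lieGroup 𝓘(ℝ, E) ∞
  obtain ⟨φ, ℓ, h1, -, -, h2⟩ := D.exists_smooth_extension hχ
  have h3 : Filter.Tendsto (fun g : H => (g : G)) (𝓝 1) (𝓝 1) :=
    continuous_subtype_val.tendsto (1 : H)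
  refine continuous_of_continuousAt_one χ ?_
  have hi : Topology.IsInducing (fun z : Circle => (z : ℂ)) := ⟨rfl⟩
  rw [hi.continuousAt_iff]
  refine (h1.continuousAt.comp_of_eq continuous_subtype_val.continuousAt rfl).congr
    (f := fun g : H => φ g) ?_
  filter_upwards [h3.eventually h2] with g hg
  rw [Function.comp_apply, ← hg g.2, extend_apply χ g.2]

end TorusData

section CartanWeights

open LieAlgebra

variable {E G : Type*} [NormedAddCommGroup E] [NormedSpace ℝ E] [FiniteDimensional ℝ E]
  [TopologicalSpace G] [ChartedSpace E G] [Group G] [LieGroup 𝓘(ℝ, E) ∞ G]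
  {t : LieSubalgebra ℝ (LieAlg E G)} {lam : LieDual E G}

theorem mem_weightLattice_iff
    (D : TorusData (E := E) (cartanSubgroup t) (t.toSubmodule : Submodule ℝ E) lam.toModel)
    (μ : Module.Dual ℝ t) : μ ∈ weightLattice t ↔ ∃ χ : cartanSubgroup t →* Circle,
      TorusData.IsWeight (E := E) (cartan := (t.toSubmodule : Submodule ℝ E)) χ μ :=
  ⟨fun ⟨χ, _, h⟩ => ⟨χ, h⟩, fun ⟨χ, h⟩ => ⟨χ, D.continuous_of_isWeight h, h⟩⟩

variable [IsSemisimple ℝ (LieAlg E G)] [t.IsCartanSubalgebra] [ConnectedSpace G]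

theorem isSpincPrequantized_iff (hT : IsCompact (cartanSubgroup t : Set G))
    (hlam : IsInCartanDual t lam) (hreg : IsRegularElement t lam) :
    IsSpincPrequantized (kksForm lam) (momentMap lam) ↔
      restrictCartan t lam - rhoShift t (restrictCartan t lam) ∈ weightLattice t := by
  obtain ⟨R⟩ := exists_rootData_of_compact t hT hreg
  have hμ : ∀ (μ : Module.Dual ℝ t), μ = restrictCartan t lam - rhoShift t (restrictCartan t lam) →
      ∀ X : t, (μ + μ + ∑ j, R.root j) X = 2 * lam X := by
    rintro _ rfl X
    have h : restrictCartan t lam X = lam X := rfl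
    rw [rhoShift_eq t R]
    simp only [LinearMap.add_apply, LinearMap.sub_apply, LinearMap.smul_apply, h, smul_eq_mul]
    ring
  rw [mem_weightLattice_iff (R.toTorusData t hT hlam)]
  refine ⟨fun h => ?_, fun ⟨χ, h⟩ => ?_⟩
  · exact (R.toTorusData t hT hlam).exists_isWeight h (hμ _ rfl)
  · exact (R.toTorusData t hT hlam).isSpincPrequantized h (hμ _ rfl)

end CartanWeights

section Normalizer

open LieAlgebra TensorProduct

variable {E G : Type*} [NormedAddCommGroup E] [NormedSpace ℝ E] [FiniteDimensional ℝ E]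
  [TopologicalSpace G] [ChartedSpace E G] [Group G] [LieGroup 𝓘(ℝ, E) ∞ G]
  {t : LieSubalgebra ℝ (LieAlg E G)}

theorem Ad_Ad_inv (g : G) (X : LieAlg E G) : Ad E g (Ad E g⁻¹ X) = X :=
  AdModel_apply_inv (E := E) g X

theorem Ad_inv_Ad (g : G) (X : LieAlg E G) : Ad E g⁻¹ (Ad E g X) = X := by
  simpa using Ad_Ad_inv g⁻¹ X

theorem Ad_mem_of_Ad_inv_mem {g : G} (h : ∀ X ∈ t, Ad E g⁻¹ X ∈ t) {X : LieAlg E G} (hX : X ∈ t) :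
    Ad E g X ∈ t := by
  let f : t →ₗ[ℝ] t := (Ad E g⁻¹ : LieAlg E G →ₗ[ℝ] LieAlg E G).restrict h
  have hf : Function.Injective f := by
    intro a b hab
    refine Subtype.ext ?_
    rw [← Ad_Ad_inv g (a : LieAlg E G), ← Ad_Ad_inv g (b : LieAlg E G)]
    exact congrArg (fun z : t => Ad E g z) hab
  obtain ⟨Y, hY⟩ := LinearMap.injective_iff_surjective.1 hf ⟨X, hX⟩
  have h1 : Ad E g⁻¹ (Y : LieAlg E G) = X := congrArg Subtype.val hY
  rw [← h1, Ad_Ad_inv]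
  exact Y.2

/-- The action of an element of the normalizer on the Cartan subalgebra. -/
noncomputable def normalizerEquiv {g : G} (h : ∀ X ∈ t, Ad E g⁻¹ X ∈ t) : t ≃ₗ[ℝ] t where
  toFun X := ⟨Ad E g⁻¹ X, h X X.2⟩
  invFun X := ⟨Ad E g X, Ad_mem_of_Ad_inv_mem h X.2⟩
  map_add' X Y := Subtype.ext (map_add (Ad E g⁻¹) (X : LieAlg E G) Y)
  map_smul' c X := Subtype.ext (map_smul (Ad E g⁻¹) c (X : LieAlg E G))
  left_inv _ := Subtype.ext (Ad_Ad_inv g _)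
  right_inv _ := Subtype.ext (Ad_inv_Ad g _)

variable {g : G} (h : ∀ X ∈ t, Ad E g⁻¹ X ∈ t)

theorem normalizerEquiv_apply (X : t) :
    (normalizerEquiv h X : LieAlg E G) = Ad E g⁻¹ (X : LieAlg E G) := rfl

theorem conj_mem_cartanSubgroup {g : G} (h : ∀ X ∈ t, Ad E g⁻¹ X ∈ t) {a : G}
    (ha : a ∈ cartanSubgroup t) : g⁻¹ * a * g ∈ cartanSubgroup t := by
  intro X hX
  have h1 : Ad E (g⁻¹ * a * g) X = Ad E g⁻¹ (Ad E a (Ad E g X)) := by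
    rw [Ad_mul, Ad_mul]; rfl
  rw [h1, ha _ (Ad_mem_of_Ad_inv_mem h hX), Ad_inv_Ad]

theorem IsOneParameterSubgroup.conj {X : LieAlg E G} {γ : ℝ → G} (hγ : IsOneParameterSubgroup X γ)
    (g : G) : IsOneParameterSubgroup (Ad E g X) (fun s => g * γ s * g⁻¹) := by
  have hs : ContMDiff 𝓘(ℝ, E) 𝓘(ℝ, E) ∞ (fun h : G => g * h * g⁻¹) :=
    contMDiff_mul_right.comp contMDiff_mul_left
  refine ⟨hs.comp hγ.1, fun a b => ?_, ?_⟩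
  · change g * γ (a + b) * g⁻¹ = _
    rw [hγ.2.1]
    group
  · have h1 : HasMFDerivAt 𝓘(ℝ, E) 𝓘(ℝ, E) (fun h : G => g * h * g⁻¹) (γ 0) _ :=
      (hs.mdifferentiableAt (by simp)).hasMFDerivAt
    have h2 : HasMFDerivAt 𝓘(ℝ, ℝ) 𝓘(ℝ, E) γ 0 _ := (hγ.1.mdifferentiableAt (by simp)).hasMFDerivAt
    have h3 := (h1.comp (0 : ℝ) h2).mfderiv
    have h4 : ∀ A B : ℝ →L[ℝ] E, A = B → A 1 = B 1 := by rintro A _ rfl; rfl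
    have h5 : ∀ k : G, k = 1 → (mfderiv 𝓘(ℝ, E) 𝓘(ℝ, E) (fun h : G => g * h * g⁻¹) k : E →L[ℝ] E) =
        (mfderiv 𝓘(ℝ, E) 𝓘(ℝ, E) (fun h : G => g * h * g⁻¹) 1 : E →L[ℝ] E) := by
      rintro k rfl; rfl
    have h6 : ∀ A B : E →L[ℝ] E, A = B → ∀ u v : E, u = v → A u = B v := by
      rintro A _ rfl u _ rfl; rfl
    exact (h4 _ _ h3).trans (h6 _ _ (h5 _ (IsOneParameterSubgroup.map_zero (E := E) hγ)) _ _ hγ.2.2)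

theorem comp_normalizerEquiv_mem_weightLattice {μ : Module.Dual ℝ t} (hμ : μ ∈ weightLattice t) :
    μ ∘ₗ (normalizerEquiv h : t →ₗ[ℝ] t) ∈ weightLattice t := by
  have : IsTopologicalGroup G := topologicalGroup_of_lieGroup 𝓘(ℝ, E) ∞
  obtain ⟨χ, hχ, hχμ⟩ := hμ
  let c : cartanSubgroup t →* cartanSubgroup t :=
    { toFun := fun a => ⟨g⁻¹ * a * g, conj_mem_cartanSubgroup h a.2⟩
      map_one' := Subtype.ext (by simp)
      map_mul' := fun a b => Subtype.ext (by simp [mul_assoc]) }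
  have hc : Continuous c := by
    refine Continuous.subtype_mk ?_ _
    exact (continuous_const.mul continuous_subtype_val).mul continuous_const
  refine ⟨χ.comp c, hχ.comp hc, fun X γ hγ s => ?_⟩
  refine hχμ (normalizerEquiv h X) (fun s => c (γ s)) ?_ s
  have h1 := hγ.conj g⁻¹
  rw [inv_inv] at h1
  exact h1

theorem comp_normalizerEquiv_mem_realRoots {α : Module.Dual ℝ t} (hα : α ∈ realRoots t) :
    α ∘ₗ (normalizerEquiv h : t →ₗ[ℝ] t) ∈ realRoots t := by
  obtain ⟨hα0, Z, hZ0, hZ⟩ := hα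
  let f := (AdLieEquiv E g).toLinearEquiv.toLinearMap.baseChange ℂ
  let f' := (AdLieEquiv E g⁻¹).toLinearEquiv.toLinearMap.baseChange ℂ
  have hff : ∀ Z, f' (f Z) = Z := by
    intro Z
    induction Z using TensorProduct.induction_on with
    | zero => simp
    | tmul c X => exact congrArg (fun Y => c ⊗ₜ[ℝ] Y) (Ad_inv_Ad g X)
    | add a b ha hb => rw [map_add, map_add, ha, hb]
  have hfl : ∀ (X : LieAlg E G) Z, f ⁅(1 : ℂ) ⊗ₜ[ℝ] X, Z⁆ = ⁅(1 : ℂ) ⊗ₜ[ℝ] (Ad E g X), f Z⁆ := by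
    intro X Z
    have hl0 : ∀ W : ℂ ⊗[ℝ] LieAlg E G, ⁅W, (0 : ℂ ⊗[ℝ] LieAlg E G)⁆ = 0 := fun W => lie_zero W
    have hla : ∀ W a b : ℂ ⊗[ℝ] LieAlg E G, ⁅W, a + b⁆ = ⁅W, a⁆ + ⁅W, b⁆ := fun W a b =>
      lie_add W a b
    induction Z using TensorProduct.induction_on with
    | zero => rw [hl0, map_zero, hl0]
    | tmul c Y =>
      exact congrArg (fun Y => ((1 : ℂ) * c) ⊗ₜ[ℝ] Y) (Ad_lie g X Y)
    | add a b ha hb => rw [map_add, hla, map_add, hla, ha, hb]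
  refine ⟨fun h0 => hα0 (LinearMap.ext fun X => ?_), f Z, fun h0 => hZ0 ?_, fun X => ?_⟩
  · have h1 := LinearMap.congr_fun h0 ((normalizerEquiv h).symm X)
    simpa using h1
  · rw [← hff Z, h0, map_zero]
  · have h1 := hfl (normalizerEquiv h X) Z
    rw [hZ, map_smul, normalizerEquiv_apply, Ad_Ad_inv] at h1
    exact h1.symm

theorem comp_normalizerEquiv_mem_realRoots_iff {α : Module.Dual ℝ t} :
    α ∘ₗ (normalizerEquiv h : t →ₗ[ℝ] t) ∈ realRoots t ↔ α ∈ realRoots t := by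
  refine ⟨fun hα => ?_, comp_normalizerEquiv_mem_realRoots h⟩
  have h' : ∀ X ∈ t, Ad E g⁻¹⁻¹ X ∈ t := fun X hX => by
    rw [inv_inv]; exact Ad_mem_of_Ad_inv_mem h hX
  have h1 := comp_normalizerEquiv_mem_realRoots h' hα
  convert h1 using 1
  refine LinearMap.ext fun X => congrArg α (Subtype.ext ?_)
  simp only [LinearEquiv.coe_coe, normalizerEquiv_apply]
  rw [inv_inv, Ad_inv_Ad]

variable [IsSemisimple ℝ (LieAlg E G)] [t.IsCartanSubalgebra]

theorem cartanEquivDual_symm_comp_normalizerEquiv (μ : Module.Dual ℝ t) :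
    (IsKilling.cartanEquivDual t).symm (μ ∘ₗ (normalizerEquiv h : t →ₗ[ℝ] t)) =
      (normalizerEquiv h).symm ((IsKilling.cartanEquivDual t).symm μ) := by
  rw [LinearEquiv.symm_apply_eq]
  refine LinearMap.ext fun X => ?_
  have h1 : killingForm ℝ (LieAlg E G) (Ad E g ((IsKilling.cartanEquivDual t).symm μ : t))
      (Ad E g (Ad E g⁻¹ (X : LieAlg E G))) = μ (normalizerEquiv h X) :=
    (killingForm_Ad g _ _).trans (killingForm_cartanEquivDual_symm t μ (normalizerEquiv h X))
  rw [Ad_Ad_inv] at h1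
  exact h1.symm

theorem dualForm_comp_normalizerEquiv (μ ν : Module.Dual ℝ t) :
    dualForm t (μ ∘ₗ (normalizerEquiv h : t →ₗ[ℝ] t)) (ν ∘ₗ (normalizerEquiv h : t →ₗ[ℝ] t)) =
      dualForm t μ ν := by
  unfold dualForm
  rw [cartanEquivDual_symm_comp_normalizerEquiv, cartanEquivDual_symm_comp_normalizerEquiv]
  exact congrArg Neg.neg (killingForm_Ad g _ _)

theorem rhoShift_comp_normalizerEquiv (μ : Module.Dual ℝ t) :
    rhoShift t (μ ∘ₗ (normalizerEquiv h : t →ₗ[ℝ] t)) =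
      rhoShift t μ ∘ₗ (normalizerEquiv h : t →ₗ[ℝ] t) := by
  let e : Module.Dual ℝ t ≃ₗ[ℝ] Module.Dual ℝ t := (normalizerEquiv h).dualMap
  have he : ∀ ν : Module.Dual ℝ t, e ν = ν ∘ₗ (normalizerEquiv h : t →ₗ[ℝ] t) := fun ν => rfl
  have hS : {α | α ∈ realRoots t ∧ 0 < dualForm t α (e μ)} =
      e '' {α | α ∈ realRoots t ∧ 0 < dualForm t α μ} := by
    ext β
    obtain ⟨α, rfl⟩ := e.surjective β
    rw [e.injective.mem_set_image, mem_ofPred_eq, mem_ofPred_eq, he, he,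
      comp_normalizerEquiv_mem_realRoots_iff, dualForm_comp_normalizerEquiv]
  change rhoShift t (e μ) = e (rhoShift t μ)
  unfold rhoShift
  rw [hS, finsum_mem_image e.injective.injOn, map_smul]
  refine congrArg _ (Eq.symm ?_)
  refine (e.toAddEquiv.map_finsum _).trans ?_
  exact finsum_congr fun α => e.toAddEquiv.map_finsum _

theorem cartanRep_coAd {lam lam' : LieDual E G} (hlam : IsInCartanDual t lam)
    (hlam' : IsInCartanDual t lam') {g : G} (h : coAd E G g lam.toModel = lam'.toModel) :
    (cartanRep t lam' : LieAlg E G) = Ad E g (cartanRep t lam) := by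
  rw [← sub_eq_zero]
  refine eq_zero_of_killingForm_eq_zero fun Y => ?_
  have h1 : lam' Y = lam (Ad E g⁻¹ Y) := (DFunLike.congr_fun h Y).symm
  have h2 : killingForm ℝ (LieAlg E G) (Ad E g (cartanRep t lam : t)) (Ad E g (Ad E g⁻¹ Y)) =
      lam (Ad E g⁻¹ Y) := (killingForm_Ad g _ _).trans (killingForm_cartanRep t hlam _)
  rw [Ad_Ad_inv] at h2
  rw [map_sub, LinearMap.sub_apply, killingForm_cartanRep t hlam', h1, h2, sub_self]

theorem Ad_inv_mem_of_coAd (hT : IsCompact (cartanSubgroup t : Set G)) {lam lam' : LieDual E G}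
    (hlam : IsInCartanDual t lam) (hreg : IsRegularElement t lam)
    (hlam' : IsInCartanDual t lam') {g : G} (h : coAd E G g lam.toModel = lam'.toModel)
    (X : LieAlg E G) (hX : X ∈ t) : Ad E g⁻¹ X ∈ t := by
  obtain ⟨R⟩ := exists_rootData_of_compact t hT hreg
  refine mem_cartan_of_lie_cartanRep t R hlam ?_
  have h1 := lie_eq_zero_of_mem_cartan t hX (cartanRep t lam').2
  rw [cartanRep_coAd hlam hlam' h] at h1
  have h2 := congrArg (Ad E g⁻¹) h1
  rw [Ad_lie, Ad_inv_Ad, map_zero] at h2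
  exact h2

theorem isAdmissibleOrbit_iff (hT : IsCompact (cartanSubgroup t : Set G)) {lam : LieDual E G}
    (hlam : IsInCartanDual t lam) (hreg : IsRegularElement t lam) :
    IsAdmissibleOrbit t lam ↔
      restrictCartan t lam - rhoShift t (restrictCartan t lam) ∈ weightLattice t := by
  constructor
  · intro h
    have h1 : momentMap lam (LinearOrbit.mk E (coAd E G) lam.toModel 1) = lam :=
      DFunLike.congr_fun (map_one (coAd E G)) lam.toModel
    have h2 := h (LinearOrbit.mk E (coAd E G) lam.toModel 1)
    rw [h1] at h2
    exact h2 hlam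
  · intro h y hy
    obtain ⟨g, hg⟩ := y.2
    have hn := Ad_inv_mem_of_coAd hT hlam hreg hy hg
    have h1 : restrictCartan t (momentMap lam y) =
        restrictCartan t lam ∘ₗ (normalizerEquiv hn : t →ₗ[ℝ] t) :=
      LinearMap.ext fun X => (DFunLike.congr_fun hg (X : LieAlg E G)).symm
    rw [h1, rhoShift_comp_normalizerEquiv, ← LinearMap.sub_comp]
    exact comp_normalizerEquiv_mem_weightLattice hn h

end Normalizer

theorem mainTheorem9 {E G : Type*} [NormedAddCommGroup E] [NormedSpace ℝ E]
    [FiniteDimensional ℝ E] [TopologicalSpace G] [ChartedSpace E G] [Group G]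
    [LieGroup 𝓘(ℝ, E) ∞ G] [ConnectedSpace G] [LieAlgebra.IsSemisimple ℝ (LieAlg E G)]
    [Finite (Subgroup.center G)]
    (t : LieSubalgebra ℝ (LieAlg E G)) [t.IsCartanSubalgebra]
    (hT : IsCompact (cartanSubgroup t : Set G))
    (lam : LieDual E G) (hlam : IsInCartanDual t lam) (hreg : IsRegularElement t lam) :
    (IsSpincPrequantized (kksForm lam) (momentMap lam) ↔
      restrictCartan t lam - rhoShift t (restrictCartan t lam) ∈ weightLattice t) ∧
    (IsAdmissibleOrbit t lam ↔ IsSpincPrequantized (kksForm lam) (momentMap lam)) :=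
  ⟨isSpincPrequantized_iff hT hlam hreg,
    (isAdmissibleOrbit_iff hT hlam hreg).trans (isSpincPrequantized_iff hT hlam hreg).symm⟩
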